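/- Let $k$ be a field, $V$ a finite-dimensional $k$-vector space, $N\ge 2$, $R\subseteq V^{\otimes N}$ a subspace, and let $A=\mathrm{Tens}(V)/(R)$ be the associated $N$-homogeneous algebra, graded by the images $A_m$ of $V^{\otimes m}$. Let $k$ also denote the left $A$-module on which $V$ acts by zero. Assume that - $A$ is (generalized) Koszul: for every $i\ge 3$ the graded vector space $\mathrm{Ext}^i_A(k,k)$ (equivalently $\mathrm{Tor}_i^A(k,k)$, up to the sign of the degree) is concentrated in degree $-n(i)$, where $n(2q)=qN$ and $n(2q+1)=qN+1$; - $A$ has finite left global dimension $D$; - $A$ is AS-Gorenstein: $\mathrm{Ext}^i_A(k,A)=0$ for $i\ne D$ and $\mathrm{Ext}^D_A(k,A)\cong k$ (Ext of left $A$-modules). Let $E=E(A)=\bigoplus_{i\ge 0}\mathrm{Ext}^i_A(k,k)$ be the Yoneda algebra, with product $f\bullet g=f\circ g$ (first $g$, then $f$). Then: 1. There is a unique automorphism $\nu$ of the graded $k$-algebra $E$ such that there is an isomorphism of $E$-$E$-bimodules $E_\nu\cong E^*$ mapping $E_i$ onto $(E_{D-i})^*$ for all $i$. Here $E_\nu$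 is $E$ with the usual left action and with right action twisted by $\nu$, and $(a\cdot f\cdot b)(y)=f(b\bullet y\bullet a)$ for $f\in E^*$. ($\nu$ is the Nakayama automorphism of the graded Frobenius algebra $E$.) 2. There is a unique $k$-algebra automorphism $\phi$ of $A$ which maps $V=A_1$ to itself and whose restriction $\phi_1:V\to V$ has as transpose the restriction $\nu_1$ of $\nu$ to $E_1=\mathrm{Ext}^1_A(k,k)=V^*$, i.e. $\nu_1(\alpha)=\alpha\circ\phi_1$. 3. Let $\varepsilon$ be the automorphism of $A$ which is multiplication by $(-1)^m$ on $A_m$. For an $A$-$A$-bimodule $M$ (with $k$ acting centrally) let ${}_{\varepsilon^{D+1}\phi}M$ be $M$ with the left action twisted: $a\cdot m=(\varepsilon^{D+1}\phi)(a)\,m$. Then for every such $M$ there are $k$-linear isomorphisms $$HH^i(A,M)\;\cong\; HH_{D-i}(A,\,{}_{\varepsilon^{D+1}\phi}M)\qquad\text{for all } i\in\mathbb Z,$$ where $HH^i(A,M)=\mathrm{Ext}^i_{A\otimes A^\circ}(A,M)$ and $HH_i(A,M)=\mathrm{Tor}_i^{A\otimes A^\circ}(A,M)$ are Hochschild cohomology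 and homology, which are zero for $i<0$ (so both sides vanish unless $0\le i\le D$). -/

import Mathlib

open CategoryTheory TensorProduct DirectSum MulOpposite
open scoped ModuleCat

universe u v w t

noncomputable section

/-! ## The Yoneda algebra of an object -/

section Yoneda

variable {C : Type u} [Category.{v} C] [Abelian C] [HasExt.{w} C]

/-- The group `Ext^i(X, X)`, the degree `i` component of the Yoneda algebra of `X`. -/
def SelfExt (X : C) (i : ℕ) : Type w := Abelian.Ext.{w} X X i

namespace SelfExt

instance (X : C) (i : ℕ) : AddCommGroup (SelfExt X i) :=
  inferInstanceAs (AddCommGroup (Abelian.Ext.{w} X X i))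

instance (k : Type t) [CommRing k] [Linear k C] (X : C) (i : ℕ) : Module k (SelfExt X i) :=
  inferInstanceAs (Module k (Abelian.Ext.{w} X X i))

/-- The Yoneda product `x • y` is the composition `x ∘ y` (first `y`, then `x`). Mathlib writes
compositions of `Ext` classes in diagrammatic order. -/
def mul {X : C} {i j : ℕ} (x : SelfExt X i) (y : SelfExt X j) : SelfExt X (i + j) :=
  Abelian.Ext.comp (X := X) (Y := X) (Z := X) y x (Nat.add_comm j i)

/-- The unit of the Yoneda algebra is the class of the identity. -/
def one (X : C) : SelfExt X 0 := Abelian.Ext.mk₀ (𝟙 X)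

theorem mk_comp_eq {X : C} {a b c c' : ℕ} (x : Abelian.Ext.{w} X X a)
    (y : Abelian.Ext.{w} X X b) (h : a + b = c) (h' : a + b = c') :
    GradedMonoid.mk (A := SelfExt X) c (x.comp y h) =
      GradedMonoid.mk (A := SelfExt X) c' (x.comp y h') := by
  subst h; subst h'; rfl

instance (X : C) : GradedMonoid.GMul (SelfExt X) where
  mul x y := mul x y

instance (X : C) : GradedMonoid.GOne (SelfExt X) where
  one := one X

theorem one_mul_mk {X : C} {i : ℕ} (x : SelfExt X i) :
    GradedMonoid.mk (A := SelfExt X) (0 + i) (mul (one X) x) = GradedMonoid.mk i x := by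
  refine (mk_comp_eq (X := X) x (Abelian.Ext.mk₀ (𝟙 X)) _ (Nat.add_zero i)).trans ?_
  exact congrArg (GradedMonoid.mk (A := SelfExt X) i)
    (Abelian.Ext.comp_mk₀_id (X := X) (Y := X) x)

theorem mul_one_mk {X : C} {i : ℕ} (x : SelfExt X i) :
    GradedMonoid.mk (A := SelfExt X) (i + 0) (mul x (one X)) = GradedMonoid.mk i x := by
  refine (mk_comp_eq (X := X) (Abelian.Ext.mk₀ (𝟙 X)) x _ (Nat.zero_add i)).trans ?_
  exact congrArg (GradedMonoid.mk (A := SelfExt X) i)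
    (Abelian.Ext.mk₀_id_comp (X := X) (Y := X) x)

theorem mul_assoc_mk {X : C} {i j l : ℕ} (x : SelfExt X i) (y : SelfExt X j) (z : SelfExt X l) :
    GradedMonoid.mk (A := SelfExt X) (i + j + l) (mul (mul x y) z) =
      GradedMonoid.mk (i + (j + l)) (mul x (mul y z)) := by
  have h := Abelian.Ext.comp_assoc (X := X) (Y := X) (Z := X) (T := X) (a := i + (j + l)) z y x
    (a₁₂ := j + l) (a₂₃ := i + j) (by omega) (by omega) (by omega)
  refine (mk_comp_eq (X := X) z (mul x y) _ (c' := i + (j + l)) (by omega)).trans ?_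
  exact congrArg (GradedMonoid.mk (A := SelfExt X) (i + (j + l))) h.symm

instance (X : C) : DirectSum.GRing (SelfExt X) where
  one_mul x := one_mul_mk x.2
  mul_one x := mul_one_mk x.2
  mul_assoc x y z := mul_assoc_mk x.2 y.2 z.2
  mul_zero {i j} x := Abelian.Ext.zero_comp (X := X) (Y := X) _ _ _ (Nat.add_comm j i)
  zero_mul {i j} x := Abelian.Ext.comp_zero (X := X) (Y := X) _ _ _ _ (Nat.add_comm j i)
  mul_add {i j} x y z := Abelian.Ext.add_comp (X := X) (Y := X) _ _ _ (Nat.add_comm j i)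
  add_mul {i j} x y z := Abelian.Ext.comp_add (X := X) (Y := X) _ _ _ (Nat.add_comm j i)
  natCast n := n • one X
  natCast_zero := zero_smul _ _
  natCast_succ n := succ_nsmul _ _
  intCast n := n • one X
  intCast_ofNat n := natCast_zsmul _ _
  intCast_negSucc_ofNat n := negSucc_zsmul _ _

section

variable {k : Type t} [CommRing k] [Linear k C]

theorem smul_mul {X : C} {i j : ℕ} (r : k) (x : SelfExt X i) (y : SelfExt X j) :
    mul (r • x) y = r • mul x y :=
  Abelian.Ext.comp_smul (X := X) (Y := X) (Z := X) _ _ _ _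

theorem mul_smul {X : C} {i j : ℕ} (r : k) (x : SelfExt X i) (y : SelfExt X j) :
    mul x (r • y) = r • mul x y :=
  Abelian.Ext.smul_comp (X := X) (Y := X) (Z := X) _ _ _ _

theorem mk_smul_congr {X : C} {c c' : ℕ} {x : SelfExt X c} {y : SelfExt X c'} (r : k)
    (h : GradedMonoid.mk (A := SelfExt X) c x = GradedMonoid.mk c' y) :
    GradedMonoid.mk (A := SelfExt X) c (r • x) = GradedMonoid.mk c' (r • y) := by
  cases h; rfl

end

instance (k : Type t) [CommRing k] [Linear k C] (X : C) : DirectSum.GAlgebra k (SelfExt X) where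
  toFun := AddMonoidHom.mk' (fun r => r • one X) (fun r s => add_smul r s (one X))
  map_one := one_smul k (one X)
  map_mul r s := by
    change GradedMonoid.mk (A := SelfExt X) 0 ((r * s) • one X) =
      GradedMonoid.mk (0 + 0) (mul (r • one X) (s • one X))
    rw [smul_mul, mul_smul, SemigroupAction.mul_smul]
    exact (mk_smul_congr r (mk_smul_congr s (one_mul_mk (one X)))).symm
  commutes r x := by
    change GradedMonoid.mk (A := SelfExt X) (0 + x.1) (mul (r • one X) x.2) =
      GradedMonoid.mk (x.1 + 0) (mul x.2 (r • one X))
    rw [smul_mul, mul_smul]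
    exact mk_smul_congr r ((one_mul_mk x.2).trans (mul_one_mk x.2).symm)
  smul_def r x := by
    change GradedMonoid.mk (A := SelfExt X) x.1 (r • x.2) =
      GradedMonoid.mk (0 + x.1) (mul (r • one X) x.2)
    rw [smul_mul]
    exact mk_smul_congr r (one_mul_mk x.2).symm

end SelfExt

/-- The Yoneda algebra `⨁ i, Ext^i(X, X)` of `X`. -/
abbrev YonedaAlgebra (X : C) : Type w := ⨁ i, SelfExt X i

/-- `ν` is the Nakayama automorphism of the graded Frobenius algebra `E = ⨁ i, Ext^i(X, X)` with
top degree `D`: it is an automorphism of graded algebras and the bimodule `E_ν` (right action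
twisted by `ν`) is isomorphic to the dual bimodule `E^*`, where `(a.f.b) y = f (b y a)`, by an
isomorphism which maps `E_i` to `(E_{D-i})^*`. -/
def IsNakayamaAutomorphism {k : Type t} [Field k] [Linear k C] (X : C) (D : ℕ)
    (ν : YonedaAlgebra X ≃ₐ[k] YonedaAlgebra X) : Prop :=
  (∀ (i : ℕ) (x : SelfExt X i), ∃ y : SelfExt X i,
      ν (DirectSum.of (SelfExt X) i x) = DirectSum.of (SelfExt X) i y) ∧
    ∃ θ : YonedaAlgebra X ≃ₗ[k] Module.Dual k (YonedaAlgebra X),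
      (∀ a x b y : YonedaAlgebra X, θ (a * x * ν b) y = θ x (b * y * a)) ∧
      ∀ (i j : ℕ), i + j ≠ D → ∀ (x : SelfExt X i) (y : SelfExt X j),
        θ (DirectSum.of (SelfExt X) i x) (DirectSum.of (SelfExt X) j y) = 0

end Yoneda

/-! ## Bimodules, Hochschild homology and cohomology -/

section Hochschild

variable (k : Type u) [Field k] (A : Type u) [Ring A] [Algebra k A]

/-- The enveloping algebra `A ⊗ A°`; its left modules are the `A`-`A`-bimodules on which `k` acts
centrally, via `(a ⊗ b) m = a m b`. -/
abbrev Enveloping : Type u := A ⊗[k] Aᵐᵒᵖ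

/-- `A` as a bimodule over itself, `(a ⊗ b) x = a x b`. -/
def regularBimodule : ModuleCat.{u} (Enveloping k A) :=
  letI : Module (A ⊗[k] Aᵐᵒᵖ) A := TensorProduct.Algebra.module
  ModuleCat.of (Enveloping k A) A

/-- Hochschild cohomology `HH^i(A, M) = Ext^i_{A ⊗ A°}(A, M)`. -/
abbrev HochschildCohomology (M : ModuleCat.{u} (Enveloping k A)) (i : ℕ) : Type u :=
  Abelian.Ext.{u} (regularBimodule k A) M i

variable {k A} in
/-- The subspace `[A, M]` spanned by the commutators `a m - m a`. -/
def commutatorSubspace (M : ModuleCat.{u} (Enveloping k A)) : Submodule k M :=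
  Submodule.span k {x | ∃ (a : A) (m : M),
    x = (a ⊗ₜ[k] (1 : Aᵐᵒᵖ)) • m - ((1 : A) ⊗ₜ[k] op a) • m}

theorem commutatorSubspace_le_comap {M N : ModuleCat.{u} (Enveloping k A)} (f : M ⟶ N) :
    commutatorSubspace M ≤
      (commutatorSubspace N).comap (f.hom.restrictScalars k) := by
  refine Submodule.span_le.2 ?_
  rintro _ ⟨a, m, rfl⟩
  refine Submodule.subset_span ⟨a, f.hom m, ?_⟩
  change f.hom _ = _
  rw [map_sub, map_smul, map_smul]

/-- The functor `M ↦ A ⊗_{A ⊗ A°} M = M / [A, M]` from bimodules to vector spaces. -/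
def commutatorQuotient : ModuleCat.{u} (Enveloping k A) ⥤ ModuleCat.{u} k where
  obj M := ModuleCat.of k (M ⧸ commutatorSubspace M)
  map {M N} f := ModuleCat.ofHom
    ((commutatorSubspace M).mapQ (commutatorSubspace N) (f.hom.restrictScalars k)
      (commutatorSubspace_le_comap k A f))
  map_id M := by
    ext x
    rfl
  map_comp f g := by
    ext x
    rfl

instance : (commutatorQuotient k A).Additive where
  map_add {M N f g} := by
    refine ModuleCat.hom_ext (LinearMap.ext fun x => ?_)
    obtain ⟨x, rfl⟩ := Submodule.Quotient.mk_surjective _ x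
    rfl

/-- Hochschild homology `HH_i(A, M) = Tor_i^{A ⊗ A°}(A, M)`: the left derived functors of
`M ↦ A ⊗_{A ⊗ A°} M`. -/
abbrev HochschildHomology (M : ModuleCat.{u} (Enveloping k A)) (i : ℕ) : Type u :=
  ((commutatorQuotient k A).leftDerived i).obj M

variable {k A} in
/-- The bimodule `_σ M`: the vector space `M` with actions `a . m = σ(a) m` and `m . b = m b`. -/
def leftTwist (σ : A ≃ₐ[k] A) (M : ModuleCat.{u} (Enveloping k A)) :
    ModuleCat.{u} (Enveloping k A) :=
  (ModuleCat.restrictScalars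
    (Algebra.TensorProduct.map (σ : A →ₐ[k] A) (AlgHom.id k Aᵐᵒᵖ)).toRingHom).obj M

end Hochschild

/-- The left global dimension of a ring, the supremum of the projective dimensions of the left
modules. -/
def leftGlobalDimension (A : Type u) [Ring A] : WithBot ℕ∞ :=
  ⨆ M : ModuleCat.{u} A, projectiveDimension M

/-! ## Homogeneous algebras -/

/-- The datum of an integer `N ≥ 2` and of a space of relations `R ⊆ V^{⊗N}`. -/
structure HomogeneousRelations (k V : Type u) [Field k] [AddCommGroup V] [Module k V] where
  /-- the degree of the relations -/
  N : ℕ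
  two_le : 2 ≤ N
  /-- the space of relations -/
  R : Submodule k (⨂[k]^N V)

namespace HomogeneousRelations

variable {k V : Type u} [Field k] [AddCommGroup V] [Module k V] (P : HomogeneousRelations k V)

/-- The relations `r = 0`, for `r ∈ R`, on the tensor algebra. -/
def Rel (x y : TensorAlgebra k V) : Prop :=
  (∃ r ∈ P.R, TensorPower.toTensorAlgebra r = x) ∧ y = 0

/-- The `N`-homogeneous algebra `A = Tens(V) / (R)`. -/
def Alg : Type u := RingQuot P.Rel

instance : Ring P.Alg := inferInstanceAs (Ring (RingQuot P.Rel))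

instance : Algebra k P.Alg := inferInstanceAs (Algebra k (RingQuot P.Rel))

/-- The canonical projection `Tens(V) → A`. -/
def proj : TensorAlgebra k V →ₐ[k] P.Alg := RingQuot.mkAlgHom k P.Rel

theorem proj_eq_zero {r : ⨂[k]^P.N V} (hr : r ∈ P.R) :
    P.proj (TensorPower.toTensorAlgebra r) = 0 :=
  (RingQuot.mkAlgHom_rel k ⟨⟨r, hr, rfl⟩, rfl⟩ :
    P.proj (TensorPower.toTensorAlgebra r) = P.proj 0).trans (map_zero P.proj)

/-- The canonical map `V → A`. -/
def ι : V →ₗ[k] P.Alg := P.proj.toLinearMap ∘ₗ TensorAlgebra.ι k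

theorem proj_ι (v : V) : P.proj (TensorAlgebra.ι k v) = P.ι v := rfl

/-- The universal property of `A`. -/
def lift {B : Type*} [Ring B] [Algebra k B] (f : V →ₗ[k] B)
    (h : ∀ r ∈ P.R, TensorAlgebra.lift k f (TensorPower.toTensorAlgebra r) = 0) : P.Alg →ₐ[k] B :=
  RingQuot.liftAlgHom k ⟨TensorAlgebra.lift k f, by
    rintro x y ⟨⟨r, hr, rfl⟩, rfl⟩
    rw [h r hr, map_zero]⟩

theorem lift_ι {B : Type*} [Ring B] [Algebra k B] (f : V →ₗ[k] B)
    (h : ∀ r ∈ P.R, TensorAlgebra.lift k f (TensorPower.toTensorAlgebra r) = 0) (v : V) :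
    P.lift f h (P.ι v) = f v :=
  (RingQuot.liftAlgHom_mkAlgHom_apply k _ _ _).trans (TensorAlgebra.lift_ι_apply f v)

theorem algHom_ext {B : Type*} [Ring B] [Algebra k B] {f g : P.Alg →ₐ[k] B}
    (h : ∀ v, f (P.ι v) = g (P.ι v)) : f = g := by
  refine RingQuot.ringQuot_ext' (S := k) (s := P.Rel) f g (TensorAlgebra.hom_ext ?_)
  ext v
  exact h v

/-- If all products of two elements of the image of `V` vanish, then so does the image of every
element of `V^{⊗N}`, since `N ≥ 2`. -/
theorem lift_eq_zero_of_prod {B : Type*} [Ring B] [Algebra k B] (f : V →ₗ[k] B)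
    (h : ∀ v w : V, f v * f w = 0) (r : ⨂[k]^P.N V) :
    TensorAlgebra.lift k f (TensorPower.toTensorAlgebra r) = 0 := by
  induction r using PiTensorProduct.induction_on with
  | smul_tprod c x =>
    rw [map_smul, map_smul, TensorPower.toTensorAlgebra_tprod, TensorAlgebra.tprod_apply,
      map_list_prod]
    obtain ⟨n, hn⟩ := Nat.exists_eq_add_of_le P.two_le
    have key : ∀ (m : ℕ) (hm : m = 2 + n) (x : Fin m → V),
        (List.map (TensorAlgebra.lift k f)
          (List.ofFn fun i => TensorAlgebra.ι k (x i))).prod = 0 := by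
      intro m hm x
      obtain rfl : m = n + 2 := by omega
      simp [List.ofFn_succ, ← mul_assoc, h]
    rw [key _ hn, smul_zero]
  | add x y hx hy => rw [map_add, map_add, hx, hy, add_zero]

/-- The augmentation `A → k`, which vanishes on `V`. -/
def aug : P.Alg →ₐ[k] k :=
  P.lift 0 fun r _ => P.lift_eq_zero_of_prod 0 (fun _ _ => by simp) r

theorem lift_neg_ι (r : ⨂[k]^P.N V) :
    TensorAlgebra.lift k (-P.ι) (TensorPower.toTensorAlgebra r) =
      (-1 : k) ^ P.N • P.proj (TensorPower.toTensorAlgebra r) := by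
  induction r using PiTensorProduct.induction_on with
  | smul_tprod c x =>
    rw [map_smul, map_smul, map_smul, smul_comm ((-1 : k) ^ P.N)]
    congr 1
    rw [TensorPower.toTensorAlgebra_tprod, TensorAlgebra.tprod_apply, map_list_prod, map_list_prod]
    have key : ∀ (m : ℕ) (x : Fin m → V),
        (List.map (TensorAlgebra.lift k (-P.ι))
          (List.ofFn fun i => TensorAlgebra.ι k (x i))).prod =
        (-1 : k) ^ m • (List.map P.proj (List.ofFn fun i => TensorAlgebra.ι k (x i))).prod := by
      intro m
      induction m with
      | zero => intro x; simp
      | succ m ih =>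
        intro x
        have := ih fun i => x i.succ
        simp only [List.ofFn_succ, List.map_cons, List.prod_cons]
        rw [this, TensorAlgebra.lift_ι_apply, pow_succ, proj_ι, LinearMap.neg_apply,
          mul_smul_comm, neg_mul, mul_neg_one, neg_smul, smul_neg]
    exact key _ x
  | add x y hx hy => rw [map_add, map_add, map_add, smul_add, hx, hy]

/-- The algebra endomorphism of `A` which is `-1` on `V`. -/
def signHom : P.Alg →ₐ[k] P.Alg :=
  P.lift (-P.ι) fun r hr => by rw [lift_neg_ι, P.proj_eq_zero hr, smul_zero]

theorem signHom_ι (v : V) : P.signHom (P.ι v) = -P.ι v := P.lift_ι _ _ v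

theorem signHom_comp : P.signHom.comp P.signHom = AlgHom.id k P.Alg :=
  P.algHom_ext fun v => by
    rw [AlgHom.comp_apply, signHom_ι, map_neg, signHom_ι, neg_neg, AlgHom.id_apply]

/-- The automorphism `ε` of `A`, multiplication by `(-1)^m` on `A_m`. -/
def ε : P.Alg ≃ₐ[k] P.Alg := AlgEquiv.ofAlgHom P.signHom P.signHom P.signHom_comp P.signHom_comp

/-- The homogeneous component `A_m`, the image of `V^{⊗m}` in `A`. -/
def component (m : ℕ) : Submodule k P.Alg := LinearMap.range P.ι ^ m

/-- The automorphism `ε` is multiplication by `(-1)^m` on `A_m`. -/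
theorem ε_apply_of_mem (m : ℕ) (a : P.Alg) (ha : a ∈ P.component m) :
    P.ε a = (-1 : k) ^ m • a := by
  induction m generalizing a with
  | zero =>
    rw [component, pow_zero, Submodule.mem_one] at ha
    obtain ⟨c, rfl⟩ := ha
    rw [AlgEquiv.commutes, pow_zero, one_smul]
  | succ m ih =>
    rw [component, pow_succ] at ha
    induction ha using Submodule.mul_induction_on' with
    | mem_mul_mem x hx y hy =>
      obtain ⟨v, rfl⟩ := hy
      have hv : P.ε (P.ι v) = -P.ι v := P.signHom_ι v
      rw [map_mul, ih x hx, hv, pow_succ, smul_mul_assoc, mul_neg, mul_neg_one, neg_smul, smul_neg]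
    | add x _ y _ hx hy => rw [map_add, hx, hy, smul_add]

/-! ### The Koszul property -/

/-- The jump map `n(2q) = q N`, `n(2q + 1) = q N + 1`. -/
def jump (i : ℕ) : ℕ := i / 2 * P.N + i % 2

/-- The differential, from linear forms on `A^{⊗n}` to linear forms on `A^{⊗(n+1)}`, of the complex `Hom_A(B, k)`, where `B` is the
bar resolution of the left `A`-module `k`. -/
def barDifferential {n : ℕ} (f : (Fin n → P.Alg) → k) (a : Fin (n + 1) → P.Alg) : k :=
  P.aug (a 0) * f (Fin.tail a) +
    ∑ i : Fin n, (-1) ^ ((i : ℕ) + 1) * f (Fin.contractNth i.castSucc (· * ·) a) +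
    (-1) ^ (n + 1) * (f (Fin.init a) * P.aug (a (Fin.last n)))

/-- A linear form on `A^{⊗n}` which vanishes on the homogeneous elements of internal degree
different from `j`. -/
def IsHomogeneousForm {n : ℕ} (j : ℕ) (f : (Fin n → P.Alg) → k) : Prop :=
  ∀ (m : Fin n → ℕ) (a : Fin n → P.Alg), (∀ l, a l ∈ P.component (m l)) → ∑ l, m l ≠ j → f a = 0

/-- The vanishing of the component of internal degree `-j` of the graded space `Ext_A^{n+1}(k, k)`,
computed by means of the graded bar resolution. -/
def GradedExtVanishes (n j : ℕ) : Prop :=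
  ∀ f : MultilinearMap k (fun _ : Fin (n + 1) => P.Alg) k,
    P.IsHomogeneousForm j ⇑f → P.barDifferential ⇑f = 0 →
      ∃ g : MultilinearMap k (fun _ : Fin n => P.Alg) k,
        P.IsHomogeneousForm j ⇑g ∧ P.barDifferential ⇑g = ⇑f

/-- The (generalized) Koszul property: for every `i ≥ 3`, the graded vector space `Ext_A^i(k, k)` is
concentrated in degree `-n(i)`. -/
def IsKoszul : Prop :=
  ∀ n : ℕ, 3 ≤ n + 1 → ∀ j : ℕ, j ≠ P.jump (n + 1) → P.GradedExtVanishes n j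

/-! ### The trivial module, the AS-Gorenstein property and the Yoneda algebra -/

/-- The left `A`-module `k`, on which `V` acts by zero. -/
def trivialModule : ModuleCat.{u} P.Alg :=
  (ModuleCat.restrictScalars P.aug.toRingHom).obj (ModuleCat.of k k)

/-- The AS-Gorenstein property for an algebra of global dimension `D`: `Ext_A^i(k, A)` is `0` for
`i ≠ D` and is `k` for `i = D`. -/
def IsASGorenstein (D : ℕ) : Prop :=
  (∀ i : ℕ, i ≠ D → Subsingleton (Abelian.Ext.{u} P.trivialModule (ModuleCat.of P.Alg P.Alg) i)) ∧
    Nonempty (Abelian.Ext.{u} P.trivialModule (ModuleCat.of P.Alg P.Alg) D ≃ₗ[k] k)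

/-- The Yoneda algebra `E(A) = ⨁ i, Ext_A^i(k, k)`. -/
abbrev E : Type u := YonedaAlgebra.{_, _, u} P.trivialModule

/-- The augmentation as a map of left `A`-modules. -/
def augLinear : P.Alg →ₗ[P.Alg] P.trivialModule where
  toFun a := P.aug a
  map_add' a b := map_add P.aug a b
  map_smul' a b := map_mul P.aug a b

theorem augLinear_surjective : Function.Surjective P.augLinear := fun c =>
  ⟨algebraMap k P.Alg c, P.aug.commutes c⟩

/-- The morphism of algebras `A → k[δ]`, `δ² = 0`, which maps `v ∈ V` to `α(v) δ`. -/
def dualNumberHom (α : Module.Dual k V) : P.Alg →ₐ[k] DualNumber k :=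
  P.lift (TrivSqZeroExt.inrHom k k ∘ₗ α) fun r _ =>
    P.lift_eq_zero_of_prod _ (fun v w => TrivSqZeroExt.inr_mul_inr k (α v) (α w)) r

theorem fst_dualNumberHom (α : Module.Dual k V) (a : P.Alg) :
    (P.dualNumberHom α a).fst = P.aug a := by
  have : (TrivSqZeroExt.fstHom k k k).comp (P.dualNumberHom α) = P.aug :=
    P.algHom_ext fun v => by
      rw [AlgHom.comp_apply, dualNumberHom, lift_ι, aug, lift_ι]
      rfl
  exact DFunLike.congr_fun this a

/-- The linear map from the augmentation ideal `A_+` to `k` which extends the linear form `α` on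
`V = A_1` by zero on `A_m`, `m ≥ 2`. -/
def extendForm (α : Module.Dual k V) : LinearMap.ker P.augLinear →ₗ[P.Alg] P.trivialModule where
  toFun x := (P.dualNumberHom α x.1).snd
  map_add' x y := by
    change (P.dualNumberHom α (x.1 + y.1)).snd = _
    rw [map_add, TrivSqZeroExt.snd_add]
    rfl
  map_smul' a x := by
    have hx : P.aug x.1 = 0 := x.2
    change (P.dualNumberHom α (a * x.1)).snd = P.aug a * (P.dualNumberHom α x.1).snd
    rw [map_mul, TrivSqZeroExt.snd_mul, fst_dualNumberHom, fst_dualNumberHom, hx]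
    simp

/-- The identification `V^* = Ext_A^1(k, k)`: a linear form on `V` is viewed as a linear map
`A_+ → k`, to which the connecting map of `0 → A_+ → A → k → 0` is applied. -/
def dualToExt (α : Module.Dual k V) : SelfExt.{_, _, u} P.trivialModule 1 :=
  Abelian.Ext.comp (LinearMap.shortExact_shortComplexKer P.augLinear_surjective).extClass
    (Abelian.Ext.mk₀ (ModuleCat.ofHom (P.extendForm α))) (Nat.add_zero 1)

/-- `φ` maps `V = A_1` to itself and its component `φ_1` of degree `1` is the transpose of the
component of degree `1` of `ν`, where `E(A)_1` is identified with `V^*`. -/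
def IsTransposeInDegreeOne (φ : P.Alg ≃ₐ[k] P.Alg) (ν : P.E ≃ₐ[k] P.E) : Prop :=
  ∃ φ₁ : V →ₗ[k] V, (∀ v, φ (P.ι v) = P.ι (φ₁ v)) ∧
    ∀ α : Module.Dual k V,
      ν (DirectSum.of (SelfExt P.trivialModule) 1 (P.dualToExt α)) =
        DirectSum.of (SelfExt P.trivialModule) 1 (P.dualToExt (α ∘ₗ φ₁))

end HomogeneousRelations

end

/-! The statement is a twisted Poincaré duality read off from explicit minimal resolutions. After
the choice of a basis of V, elements of M ⊗ V^{⊗n} are M-valued functions on words of length n. Let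
W_n be the intersection of the spaces V^{⊗p} ⊗ R ⊗ V^{⊗q} with p + N + q = n. The left Koszul
complex has terms A ⊗ W_{n(i)}, and its differential multiplies the first one or N - 1 letters into
A.

Koszul complex. Dimension shifting in bar cohomology turns the concentration of Ext into the
statement that the i-th syzygy has new generators in degree n(i) only; in that degree cycles are
described by words. Hence the complex resolves k (`πY_surjective`). It is minimal, so Ext^i(k,k) is
the dual of W_{n(i)} (`cls_surjective`, `cls_eq_zero_iff`), and Yoneda products are concatenations
whenever the jumps add up (`cls_comp_cls`).

Frobenius structure. Since Ext^D(k,A) is one-dimensional, W_{n(D)} is a line k·w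
(`exists_generator`) and the last differential moves one letter (`gap_of_top`). Since the other
groups Ext^i(k,A) vanish, contraction with w is nondegenerate (`contract_injective`). So f ↦ f(w) is
a Frobenius form on E, and ν is characterized by H(y ν(x)) = H(x y). In degree one this says that w
is invariant under moving its last letter to the front through φ_1 (`rotates`). Rotating N letters
and using nondegeneracy again shows that φ_1 respects R (`relation_rotate`), which gives φ.

Bimodules. The terms A^e ⊗ W_{n(i)}, where A^e = A ⊗ A°, with differentials L - R and ∑ L^p
R^{N-1-p} form a resolution of A. For the filtration by left degree the leading part of the
differential is that of the left Koszul complex, which transfers exactness (`exact_TB_succ`) and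
also the vanishing of Ext^i(k,A), giving Ext^i_{A^e}(A, Q) = 0 for i < D and Q projective
(`subsingleton_ext_projective`). In degree D the rotation formula writes the differential of w as a
sum of twisted commutators, so HH^D(A,M) is M modulo twisted commutators, which is HH_0 of the twist
of M by ε^{D+1}φ (`χ_eq_zero_iff_twistComm`).

Duality. Let Q be a projective resolution of M. Termwise HH^D(A,Q_n) is HH_0 of the twisted Q_n,
naturally, so the complex HH^D(A,Q) computes the Hochschild homology of the twisted M. Because
HH^i(A,Q_n) = 0 for i < D and HH^{D+1} = 0, dimension shifting identifies its j-th homology with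
HH^{D-j}(A,M) (`nonempty_homology_linearEquiv_ext`). -/

noncomputable section

set_option autoImplicit false
set_option linter.unusedSectionVars false

/-! ## Functions on words -/

namespace Words

section Sums

variable {ι : Type*} [Fintype ι]

/-- The sum of the values of `F` at the words of length `n`. -/
def wsum {M : Type*} [AddCommMonoid M] : ℕ → (List ι → M) → M
  | 0, F => F []
  | n + 1, F => ∑ i, wsum n fun u => F (i :: u)

variable {M M' : Type*} [AddCommMonoid M] [AddCommMonoid M']

@[simp] theorem wsum_zero (F : List ι → M) : wsum 0 F = F [] := rfl

theorem wsum_succ (n : ℕ) (F : List ι → M) :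
    wsum (n + 1) F = ∑ i, wsum n fun u => F (i :: u) := rfl

theorem wsum_congr {n : ℕ} {F G : List ι → M} (h : ∀ u, u.length = n → F u = G u) :
    wsum n F = wsum n G := by
  induction n generalizing F G with
  | zero => exact h [] rfl
  | succ n ih => exact Finset.sum_congr rfl fun i _ => ih fun u hu => h _ (by simp [hu])

@[simp] theorem wsum_const_zero (n : ℕ) : wsum n (fun _ : List ι => (0 : M)) = 0 := by
  induction n with
  | zero => rfl
  | succ n ih => simp [wsum_succ, ih]

theorem wsum_eq_zero {n : ℕ} {F : List ι → M} (h : ∀ u, u.length = n → F u = 0) :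
    wsum n F = 0 := (wsum_congr h).trans (wsum_const_zero n)

theorem wsum_add_fun (n : ℕ) (F G : List ι → M) :
    wsum n (fun u => F u + G u) = wsum n F + wsum n G := by
  induction n generalizing F G with
  | zero => rfl
  | succ n ih => simp [wsum_succ, ih, Finset.sum_add_distrib]

theorem wsum_finsum {κ : Type*} (s : Finset κ) (n : ℕ) (F : κ → List ι → M) :
    wsum n (fun u => ∑ j ∈ s, F j u) = ∑ j ∈ s, wsum n (F j) := by
  induction n generalizing F with
  | zero => rfl
  | succ n ih => simp only [wsum_succ, ih]; exact Finset.sum_comm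

theorem wsum_wsum_comm (m n : ℕ) (F : List ι → List ι → M) :
    wsum m (fun u => wsum n fun v => F u v) = wsum n fun v => wsum m fun u => F u v := by
  induction m generalizing F with
  | zero => rfl
  | succ m ih => simp only [wsum_succ, ih, wsum_finsum]

theorem wsum_append (m n : ℕ) (F : List ι → M) :
    wsum (m + n) F = wsum m fun u => wsum n fun v => F (u ++ v) := by
  induction m generalizing F with
  | zero => simp
  | succ m ih => rw [Nat.succ_add, wsum_succ]; simp only [ih]; rfl

theorem wsum_one (F : List ι → M) : wsum 1 F = ∑ i, F [i] := rfl

theorem wsum_succ_last (n : ℕ) (F : List ι → M) :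
    wsum (n + 1) F = ∑ i, wsum n fun u => F (u ++ [i]) := by
  rw [wsum_append]
  exact wsum_finsum _ _ _

theorem map_wsum {Φ : Type*} [FunLike Φ M M'] [AddMonoidHomClass Φ M M'] (f : Φ) (n : ℕ)
    (F : List ι → M) : f (wsum n F) = wsum n fun u => f (F u) := by
  induction n generalizing F with
  | zero => rfl
  | succ n ih => simp only [wsum_succ, map_sum, ih]

theorem smul_wsum {S : Type*} [DistribSMul S M] (c : S) (n : ℕ) (F : List ι → M) :
    c • wsum n F = wsum n fun u => c • F u :=
  map_wsum (DistribSMul.toAddMonoidHom M c) n F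

theorem wsum_smul {S : Type*} [Semiring S] [Module S M] (x : M) (n : ℕ) (F : List ι → S) :
    wsum n F • x = wsum n fun u => F u • x :=
  map_wsum ((smulAddHom S M).flip x) n F

theorem mul_wsum {S : Type*} [NonUnitalNonAssocSemiring S] (c : S) (n : ℕ) (F : List ι → S) :
    c * wsum n F = wsum n fun u => c * F u :=
  map_wsum (AddMonoidHom.mulLeft c) n F

theorem wsum_mul {S : Type*} [NonUnitalNonAssocSemiring S] (c : S) (n : ℕ) (F : List ι → S) :
    wsum n F * c = wsum n fun u => F u * c :=
  map_wsum (AddMonoidHom.mulRight c) n F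

theorem wsum_apply {X : Type*} (n : ℕ) (F : List ι → X → M) (x : X) :
    wsum n F x = wsum n fun u => F u x :=
  map_wsum (Pi.evalAddMonoidHom (fun _ : X => M) x) n F

theorem wsum_sub {M : Type*} [AddCommGroup M] (n : ℕ) (F G : List ι → M) :
    wsum n (fun u => F u - G u) = wsum n F - wsum n G := by
  rw [eq_sub_iff_add_eq, ← wsum_add_fun]
  simp

theorem wsum_ite [DecidableEq ι] (n : ℕ) (F : List ι → M) (v : List ι) :
    (wsum n fun u => if u = v then F u else 0) = if v.length = n then F v else 0 := by
  induction n generalizing F v with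
  | zero => cases v <;> simp
  | succ n ih =>
    cases v with
    | nil => simp [wsum_succ]
    | cons j v =>
      rw [wsum_succ, Finset.sum_eq_single j]
      · simpa using ih (fun u => F (j :: u)) v
      · intro i _ hij
        simp [hij]
      · simp

end Sums

section Tensors

variable {k : Type*} [Field k] {ι : Type*} [Fintype ι] [DecidableEq ι]
  {M : Type*} [AddCommGroup M] [Module k M]

theorem eq_wsum_single {n : ℕ} {x : List ι → k} (hx : ∀ u, u.length ≠ n → x u = 0) :
    x = wsum n fun u => x u • Pi.single u (1 : k) := by
  funext v
  rw [wsum_apply]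
  have : (fun u => (x u • (Pi.single u (1 : k) : List ι → k)) v) =
      fun u => if u = v then x u else 0 := by
    funext u
    by_cases h : u = v
    · subst h; simp
    · simp [h, Ne.symm h]
  rw [this, wsum_ite]
  split_ifs with h
  · rfl
  · exact hx v h

theorem apply_eq_wsum {n : ℕ} (f : (List ι → k) →ₗ[k] M) {x : List ι → k}
    (hx : ∀ u, u.length ≠ n → x u = 0) : f x = wsum n fun u => x u • f (Pi.single u 1) := by
  conv_lhs => rw [eq_wsum_single hx, map_wsum]
  simp only [map_smul]

variable (N : ℕ) (R : Submodule k (List ι → k))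

/-- The functionals on words which vanish on `R`. -/
def Annihilates (ρ : List ι → k) : Prop := ∀ r ∈ R, wsum N (fun v => ρ v * r v) = 0

/-- The space `M ⊗ W_n`, where `W_n` is the intersection of the spaces `V^{⊗p} ⊗ R ⊗ V^{⊗q}` for
`p + N + q = n`; its elements are viewed as `M`-valued functions on the words of length `n`. -/
def WS (S : Type*) [Semiring S] (M : Type*) [AddCommGroup M] [Module k M] [Module S M]
    [SMulCommClass k S M] (n : ℕ) : Submodule S (List ι → M) where
  -- Testing each window of N letters against the functionals that kill R makes sense for
  -- coefficients in any M, so no tensor product with M has to be formed. Over a field this loses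
  -- nothing, see `eq_sum_coef`.
  carrier := {F | (∀ u, u.length ≠ n → F u = 0) ∧ ∀ ρ : List ι → k, Annihilates N R ρ →
    ∀ u v : List ι, u.length + N + v.length = n → wsum N (fun t => ρ t • F (u ++ t ++ v)) = 0}
  add_mem' {F G} hF hG := by
    refine ⟨fun u hu => by simp [hF.1 u hu, hG.1 u hu], fun ρ hρ u v h => ?_⟩
    simp only [Pi.add_apply, smul_add, wsum_add_fun, hF.2 ρ hρ u v h, hG.2 ρ hρ u v h, add_zero]
  zero_mem' := by simp
  smul_mem' c F hF := by
    refine ⟨fun u hu => by simp [hF.1 u hu], fun ρ hρ u v h => ?_⟩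
    simp only [Pi.smul_apply, smul_comm _ c]
    rw [← smul_wsum, hF.2 ρ hρ u v h, smul_zero]

variable {N R} {S : Type*} [Semiring S] [Module S M] [SMulCommClass k S M]

/-- The test functionals have values in k, so k-linearity of the map is enough and the rings S and
S' need not be related. This is applied to projections, augmentations and coordinates that are not
A-linear. -/
theorem WS_map {n : ℕ} {F : List ι → M} (hF : F ∈ WS N R S M n)
    {S' : Type*} [Semiring S'] {M' : Type*} [AddCommGroup M'] [Module k M'] [Module S' M']
    [SMulCommClass k S' M'] (f : M →ₗ[k] M') : (fun u => f (F u)) ∈ WS N R S' M' n := by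
  refine ⟨fun u hu => (congrArg f (hF.1 u hu)).trans (map_zero f), fun ρ hρ u v h => ?_⟩
  have := congrArg f (hF.2 ρ hρ u v h)
  rw [map_wsum, map_zero] at this
  simpa using this

/-- Double annihilator: a vector outside R is separated from R by a linear form, and a form on
functions supported on words of length N is a sum over those words. -/
theorem mem_of_annihilates (hR : ∀ r ∈ R, ∀ u, u.length ≠ N → r u = 0) {x : List ι → k}
    (hx : ∀ u, u.length ≠ N → x u = 0)
    (h : ∀ ρ, Annihilates N R ρ → wsum N (fun t => ρ t * x t) = 0) : x ∈ R := by
  by_contra hxR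
  obtain ⟨f, hfx, hf⟩ := Submodule.exists_le_ker_of_notMem hxR
  refine hfx ?_
  rw [apply_eq_wsum f hx]
  refine (wsum_congr fun u _ => ?_).trans (h (fun u => f (Pi.single u 1)) fun r hr => ?_)
  · rw [smul_eq_mul, mul_comm]
  · have : f r = 0 := hf hr
    rw [apply_eq_wsum f (hR r hr)] at this
    rw [← this]
    exact wsum_congr fun u _ => by rw [smul_eq_mul, mul_comm]

theorem WS_N_eq (hR : ∀ r ∈ R, ∀ u, u.length ≠ N → r u = 0) : WS N R k k N = R := by
  ext x
  refine ⟨fun hx => mem_of_annihilates hR hx.1 fun ρ hρ => ?_, fun hx => ⟨hR x hx, ?_⟩⟩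
  · simpa using hx.2 ρ hρ [] [] (by simp)
  · intro ρ hρ u v huv
    obtain rfl : u = [] := List.length_eq_zero_iff.1 (by omega)
    obtain rfl : v = [] := List.length_eq_zero_iff.1 (by omega)
    simpa using hρ x hx

/-- Consecutive subwords of length `m` of elements of `W_n` are in `W_m`. -/
theorem WS_slice {n m : ℕ} {F : List ι → M} (hF : F ∈ WS N R S M n) (u v : List ι)
    (h : u.length + m + v.length = n) : (fun t => F (u ++ t ++ v)) ∈ WS N R S M m := by
  refine ⟨fun t ht => hF.1 _ (by simp; omega), fun ρ hρ u' v' huv => ?_⟩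
  have := hF.2 ρ hρ (u ++ u') (v' ++ v) (by simp; omega)
  simpa [List.append_assoc] using this

theorem WS_slice_left {n m : ℕ} {F : List ι → M} (hF : F ∈ WS N R S M n) (u : List ι)
    (h : u.length + m = n) : (fun t => F (u ++ t)) ∈ WS N R S M m := by
  simpa using WS_slice hF u [] (by simpa using h)

theorem WS_slice_right {n m : ℕ} {F : List ι → M} (hF : F ∈ WS N R S M n) (v : List ι)
    (h : m + v.length = n) : (fun t => F (t ++ v)) ∈ WS N R S M m := by
  simpa using WS_slice hF [] v (by simpa using h)

theorem mem_WS_of_lt {n : ℕ} (hn : n < N) {F : List ι → M} :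
    F ∈ WS N R S M n ↔ ∀ u, u.length ≠ n → F u = 0 :=
  ⟨fun h => h.1, fun h => ⟨h, fun ρ _ u v huv => by omega⟩⟩

/-- Contraction of the last `b` letters with the function `f`. -/
def contract (b : ℕ) (f : List ι → k) (F : List ι → M) : List ι → M :=
  fun u => wsum b fun v => f v • F (u ++ v)

theorem contract_mem {a b n : ℕ} (hn : a + b = n) (f : List ι → k) {F : List ι → M}
    (hF : F ∈ WS N R S M n) : contract b f F ∈ WS N R S M a := by
  refine ⟨fun t ht => wsum_eq_zero fun v hv => ?_, fun ρ hρ u v huv => ?_⟩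
  · rw [hF.1 _ (by simp; omega), smul_zero]
  · simp only [contract, smul_wsum]
    rw [wsum_wsum_comm]
    refine wsum_eq_zero fun v' hv' => ?_
    have := hF.2 ρ hρ u (v ++ v') (by simp; omega)
    rw [← smul_zero (f v'), ← this, smul_wsum]
    simp only [List.append_assoc, smul_comm (f v')]

variable (N R) in
instance finite_WS (n : ℕ) : FiniteDimensional k (WS N R k k n) := by
  let f : WS N R k k n →ₗ[k] ((Fin n → ι) → k) :=
    { toFun := fun x t => x.1 (List.ofFn t)
      map_add' := fun _ _ => rfl
      map_smul' := fun _ _ => rfl }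
  refine FiniteDimensional.of_injective f ((injective_iff_map_eq_zero f).2 fun x hx => ?_)
  ext u
  by_cases hu : u.length = n
  · subst hu
    have := congrFun hx u.get
    simpa [f] using this
  · exact x.2.1 u hu

-- The coordinate forms of a basis of W_n are extended to all functions and then written as sums
-- over words. In this shape the same formula defines coordinates of M-valued functions, see `coef`.
variable (N R) in
theorem exists_coordinates (n : ℕ) : ∃ (s : ℕ) (b c : Fin s → List ι → k),
    (∀ i, b i ∈ WS N R k k n) ∧
    (∀ x ∈ WS N R k k n, x = ∑ i, wsum n (fun u => c i u * x u) • b i) ∧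
    ∀ i j, wsum n (fun u => c i u * b j u) = if i = j then 1 else 0 := by
  let β := Module.finBasis k (WS N R k k n)
  have ext : ∀ i, ∃ f : (List ι → k) →ₗ[k] k, f.comp (WS N R k k n).subtype = β.coord i :=
    fun i => LinearMap.exists_extend _
  choose f hf using ext
  have key : ∀ i (x : WS N R k k n),
      wsum n (fun u => f i (Pi.single u 1) * x.1 u) = β.repr x i := fun i x => by
    have := LinearMap.congr_fun (hf i) x
    rw [LinearMap.comp_apply, Submodule.subtype_apply, apply_eq_wsum _ x.2.1] at this
    simpa [mul_comm] using this
  refine ⟨_, fun i => (β i).1, fun i u => f i (Pi.single u 1), fun i => (β i).2,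
    fun x hx => ?_, fun i j => ?_⟩
  · have := congrArg Subtype.val (β.sum_repr ⟨x, hx⟩)
    rw [AddSubmonoidClass.coe_finsetSum] at this
    simp only [key _ ⟨x, hx⟩]
    exact this.symm
  · rw [key, β.repr_self, Finsupp.single_apply]
    simp [eq_comm]

variable (N R) in
/-- The dimension of `W_n`. -/
def rk (n : ℕ) : ℕ := (exists_coordinates N R n).choose

variable (N R) in
/-- A basis of `W_n`. -/
def bas (n : ℕ) : Fin (rk N R n) → List ι → k := (exists_coordinates N R n).choose_spec.choose

variable (N R) in
/-- Functions which represent the coordinates with respect to the basis of `W_n`. -/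
def cof (n : ℕ) : Fin (rk N R n) → List ι → k :=
  (exists_coordinates N R n).choose_spec.choose_spec.choose

variable (N R) in
theorem bas_mem (n : ℕ) (i : Fin (rk N R n)) : bas N R n i ∈ WS N R k k n :=
  (exists_coordinates N R n).choose_spec.choose_spec.choose_spec.1 i

theorem eq_sum_bas {n : ℕ} {x : List ι → k} (hx : x ∈ WS N R k k n) :
    x = ∑ i, wsum n (fun u => cof N R n i u * x u) • bas N R n i :=
  (exists_coordinates N R n).choose_spec.choose_spec.choose_spec.2.1 x hx

variable (N R) in
/-- The coordinates of an element of `M ⊗ W_n`. -/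
def coef (n : ℕ) (i : Fin (rk N R n)) (F : List ι → M) : M :=
  wsum n fun u => cof N R n i u • F u

theorem coef_add (n : ℕ) (i : Fin (rk N R n)) (F G : List ι → M) :
    coef N R n i (F + G) = coef N R n i F + coef N R n i G := by
  simp [coef, smul_add, wsum_add_fun]

theorem coef_smul (n : ℕ) (i : Fin (rk N R n)) (c : S) (F : List ι → M) :
    coef N R n i (c • F) = c • coef N R n i F := by
  simp [coef, smul_wsum, smul_comm]

/-- Linear forms on M separate points, and composing F with such a form gives an element of W_n,
where the expansion in the basis is known. So the function-theoretic space really is M ⊗ W_n; in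
particular it is free when M is the ring. -/
theorem eq_sum_coef {n : ℕ} {F : List ι → M} (hF : F ∈ WS N R S M n) (u : List ι) :
    F u = ∑ i, bas N R n i u • coef N R n i F := by
  rw [← sub_eq_zero]
  refine (Module.forall_dual_apply_eq_zero_iff k _).1 fun f => ?_
  have h := congrFun (eq_sum_bas (WS_map (S' := k) hF f)) u
  rw [map_sub, sub_eq_zero, h]
  simp [coef, map_wsum, mul_comm]

end Tensors

section Free

variable {k : Type*} [Field k] {ι : Type*} [Fintype ι] [DecidableEq ι]
  {N : ℕ} {R : Submodule k (List ι → k)} (B : Type*) [Ring B] [Algebra k B]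
  {M : Type*} [AddCommGroup M] [Module k M] [Module B M] [IsScalarTower k B M]

/-- The element `1 ⊗ x` of `B ⊗ W_n`. -/
def incl {n : ℕ} (x : WS N R k k n) : WS N R B B n :=
  ⟨fun u => algebraMap k B (x.1 u), WS_map x.2 (Algebra.linearMap k B)⟩

/-- The `B`-linear extension to `B ⊗ W_n` of a linear map on `W_n`. -/
def extend {n : ℕ} (F : WS N R k k n →ₗ[k] M) : WS N R B B n →ₗ[B] M where
  toFun X := ∑ i, coef N R n i X.1 • F ⟨bas N R n i, bas_mem N R n i⟩
  map_add' X Y := by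
    simp only [Submodule.coe_add, coef_add, add_smul, Finset.sum_add_distrib]
  map_smul' c X := by
    simp only [Submodule.coe_smul, coef_smul (S := B), smul_assoc, Finset.smul_sum,
      RingHom.id_apply]

variable {B}

theorem extend_apply {n : ℕ} (F : WS N R k k n →ₗ[k] M) (X : WS N R B B n) :
    extend B F X = ∑ i, coef N R n i X.1 • F ⟨bas N R n i, bas_mem N R n i⟩ := rfl

theorem coef_incl {n : ℕ} (x : WS N R k k n) (i : Fin (rk N R n)) :
    coef N R n i (incl B x).1 = algebraMap k B (coef N R n i x.1) := by
  simp [coef, incl, map_wsum, Algebra.smul_def]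

theorem eq_sum_coef_bas {n : ℕ} (x : WS N R k k n) :
    x = ∑ i, coef N R n i x.1 • (⟨bas N R n i, bas_mem N R n i⟩ : WS N R k k n) := by
  refine Subtype.ext ?_
  rw [AddSubmonoidClass.coe_finsetSum]
  exact eq_sum_bas x.2

theorem extend_incl {n : ℕ} (F : WS N R k k n →ₗ[k] M) (x : WS N R k k n) :
    extend B F (incl B x) = F x := by
  conv_rhs => rw [eq_sum_coef_bas x, map_sum]
  rw [extend_apply]
  simp only [coef_incl, algebraMap_smul, map_smul]

theorem eq_sum_coef_incl {n : ℕ} (X : WS N R B B n) :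
    X = ∑ i, coef N R n i X.1 • incl B ⟨bas N R n i, bas_mem N R n i⟩ := by
  refine Subtype.ext (funext fun u => ?_)
  rw [AddSubmonoidClass.coe_finsetSum, Finset.sum_apply, eq_sum_coef X.2 u]
  refine Finset.sum_congr rfl fun i _ => ?_
  simp [incl, Algebra.smul_def, Algebra.commutes]

theorem hom_ext {n : ℕ} {M : Type*} [AddCommGroup M] [Module B M]
    {f g : WS N R B B n →ₗ[B] M} (h : ∀ x : WS N R k k n, f (incl B x) = g (incl B x)) :
    f = g := by
  refine LinearMap.ext fun X => ?_
  rw [eq_sum_coef_incl X]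
  simp only [map_sum, map_smul, h]

variable (N R B) in
instance projective_WS (n : ℕ) : Module.Projective B (WS N R B B n) := by
  let i : WS N R B B n →ₗ[B] (Fin (rk N R n) → B) :=
    { toFun := fun X s => coef N R n s X.1
      map_add' := fun X Y => funext fun s => coef_add n s _ _
      map_smul' := fun c X => funext fun s => coef_smul n s c _ }
  let s : (Fin (rk N R n) → B) →ₗ[B] WS N R B B n :=
    Fintype.linearCombination B fun s => incl B ⟨bas N R n s, bas_mem N R n s⟩
  refine Module.Projective.of_split i s (LinearMap.ext fun X => ?_)
  exact (eq_sum_coef_incl X).symm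

theorem incl_add {n : ℕ} (x y : WS N R k k n) : incl B (x + y) = incl B x + incl B y :=
  Subtype.ext (funext fun _ => map_add (algebraMap k B) _ _)

theorem incl_smul {n : ℕ} (c : k) (x : WS N R k k n) :
    incl B (c • x) = algebraMap k B c • incl B x :=
  Subtype.ext (funext fun _ => map_mul (algebraMap k B) _ _)

variable (e f : ι → B)

/-- The monomial `e_{i_1} ⋯ e_{i_m}` of a word. -/
def mon (u : List ι) : B := (u.map e).prod

@[simp] theorem mon_nil : mon e [] = 1 := rfl

@[simp] theorem mon_cons (i : ι) (u : List ι) : mon e (i :: u) = e i * mon e u := rfl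

theorem mon_append (u v : List ι) : mon e (u ++ v) = mon e u * mon e v := by
  simp [mon]

/-- Multiplication by the first letter. -/
def dL : Module.End B (List ι → B) where
  toFun F u := ∑ i, F (i :: u) * e i
  map_add' F G := by funext u; simp [add_mul, Finset.sum_add_distrib]
  map_smul' c F := by funext u; simp [Finset.mul_sum, mul_assoc]

/-- Multiplication by the last letter. -/
def dR : Module.End B (List ι → B) where
  toFun F u := ∑ i, F (u ++ [i]) * f i
  map_add' F G := by funext u; simp [add_mul, Finset.sum_add_distrib]
  map_smul' c F := by funext u; simp [Finset.mul_sum, mul_assoc]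

theorem dL_apply (F : List ι → B) (u : List ι) : dL e F u = ∑ i, F (i :: u) * e i := rfl

theorem dR_apply (F : List ι → B) (u : List ι) : dR f F u = ∑ i, F (u ++ [i]) * f i := rfl

theorem dL_pow_apply (m : ℕ) (F : List ι → B) (u : List ι) :
    (dL e ^ m) F u = wsum m fun t => F (t ++ u) * mon e t := by
  induction m generalizing F with
  | zero => simp
  | succ m ih =>
    rw [pow_succ, Module.End.mul_apply, ih, wsum_succ]
    simp only [dL_apply, Finset.sum_mul, wsum_finsum, mon_cons, List.cons_append, mul_assoc]

theorem dL_mem {n : ℕ} {F : List ι → B} (hF : F ∈ WS N R B B (n + 1)) :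
    dL e F ∈ WS N R B B n := by
  refine ⟨fun u hu => Finset.sum_eq_zero fun i _ => ?_, fun ρ hρ u v huv => ?_⟩
  · rw [hF.1 _ (by simpa using hu), zero_mul]
  · simp only [dL_apply, Finset.smul_sum, wsum_finsum]
    refine Finset.sum_eq_zero fun i _ => ?_
    have := hF.2 ρ hρ (i :: u) v (by simp; omega)
    rw [← zero_mul (e i), ← this, wsum_mul]
    simp

theorem dR_mem {n : ℕ} {F : List ι → B} (hF : F ∈ WS N R B B (n + 1)) :
    dR f F ∈ WS N R B B n := by
  refine ⟨fun u hu => Finset.sum_eq_zero fun i _ => ?_, fun ρ hρ u v huv => ?_⟩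
  · rw [hF.1 _ (by simpa using hu), zero_mul]
  · simp only [dR_apply, Finset.smul_sum, wsum_finsum]
    refine Finset.sum_eq_zero fun i _ => ?_
    have := hF.2 ρ hρ u (v ++ [i]) (by simp; omega)
    rw [← zero_mul (f i), ← this, wsum_mul]
    simp

theorem pow_mem {n : ℕ} (T : Module.End B (List ι → B))
    (hT : ∀ n, ∀ F ∈ WS N R B B (n + 1), T F ∈ WS N R B B n) (m : ℕ) {F : List ι → B}
    (hF : F ∈ WS N R B B (n + m)) : (T ^ m) F ∈ WS N R B B n := by
  induction m generalizing F with
  | zero => exact hF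
  | succ m ih =>
    rw [pow_succ, Module.End.mul_apply]
    exact ih (hT _ _ hF)

theorem dL_pow_mem {n : ℕ} (m : ℕ) {F : List ι → B} (hF : F ∈ WS N R B B (n + m)) :
    (dL e ^ m) F ∈ WS N R B B n :=
  pow_mem _ (fun _ _ h => dL_mem e h) m hF

theorem dR_pow_mem {n : ℕ} (m : ℕ) {F : List ι → B} (hF : F ∈ WS N R B B (n + m)) :
    (dR f ^ m) F ∈ WS N R B B n :=
  pow_mem _ (fun _ _ h => dR_mem f h) m hF

variable {e f} in
theorem commute_dL_dR (h : ∀ i j, e i * f j = f j * e i) : Commute (dL e) (dR f) := by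
  refine LinearMap.ext fun F => funext fun u => ?_
  simp only [Module.End.mul_apply, dL_apply, dR_apply, Finset.sum_mul, List.cons_append]
  rw [Finset.sum_comm]
  simp only [mul_assoc, h]

/-- The two operations act at opposite ends of the word. -/
theorem contract_dL (b : ℕ) (g : List ι → k) (F : List ι → B) :
    contract b g (dL e F) = dL e (contract b g F) := by
  funext u
  simp only [contract, dL_apply, Finset.smul_sum, wsum_finsum, wsum_mul, List.cons_append,
    smul_mul_assoc]

theorem contract_dL_pow (b : ℕ) (g : List ι → k) (m : ℕ) (F : List ι → B) :
    contract b g ((dL e ^ m) F) = (dL e ^ m) (contract b g F) := by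
  induction m generalizing F with
  | zero => rfl
  | succ m ih => rw [pow_succ, Module.End.mul_apply, ih, contract_dL, Module.End.mul_apply]

end Free

end Words

namespace HomogeneousRelations

open Words

variable {k V : Type u} [Field k] [AddCommGroup V] [Module k V] [FiniteDimensional k V]
  (P : HomogeneousRelations k V)

/-! ## Homogeneous algebras in terms of words -/

variable (k V) in
/-- The letters: the index set of a basis of `V`. -/
abbrev Letter : Type := Fin (Module.finrank k V)

variable (k V) in
/-- A basis of `V`. -/
def basisV : Module.Basis (Letter k V) k V := Module.finBasis k V

variable (k V) in
/-- The monomial in the tensor algebra of a word. -/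
def tmon (u : List (Letter k V)) : TensorAlgebra k V :=
  mon (fun i => TensorAlgebra.ι k (basisV k V i)) u

/-- This is the bridge from tensor powers to functions on words. Existence of coefficients suffices:
no isomorphism between the two descriptions is ever needed. -/
theorem exists_word_expansion (n : ℕ) (t : ⨂[k]^n V) :
    ∃ r : List (Letter k V) → k, (∀ u, u.length ≠ n → r u = 0) ∧
      TensorPower.toTensorAlgebra t = wsum n fun u => r u • tmon k V u := by
  induction t using PiTensorProduct.induction_on with
  | smul_tprod c x =>
    have key : ∀ (m : ℕ) (x : Fin m → V), ∃ r : List (Letter k V) → k,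
        (∀ u, u.length ≠ m → r u = 0) ∧
        (List.ofFn fun i => TensorAlgebra.ι k (x i)).prod = wsum m fun u => r u • tmon k V u := by
      intro m
      induction m with
      | zero =>
        intro x
        refine ⟨fun u => if u = [] then 1 else 0, fun u hu => ?_, by simp [tmon]⟩
        simp only [ite_eq_right_iff, one_ne_zero, imp_false]
        rintro rfl
        exact hu rfl
      | succ m ih =>
        intro x
        obtain ⟨r, hr, h⟩ := ih fun i => x i.succ
        refine ⟨fun u => match u with
          | [] => 0
          | i :: u => (basisV k V).repr (x 0) i * r u, fun u hu => ?_, ?_⟩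
        · cases u with
          | nil => rfl
          | cons i u => simp [hr u (by simpa using hu)]
        · rw [List.ofFn_succ, List.prod_cons, h, wsum_succ, mul_wsum]
          conv_lhs => rw [← (basisV k V).sum_repr (x 0)]
          rw [← wsum_finsum]
          refine wsum_congr fun u _ => ?_
          rw [map_sum, Finset.sum_mul]
          refine Finset.sum_congr rfl fun i _ => ?_
          rw [tmon, tmon, mon_cons, map_smul, smul_mul_smul_comm]
    obtain ⟨r, hr, h⟩ := key n x
    refine ⟨c • r, fun u hu => by simp [hr u hu], ?_⟩
    rw [map_smul, TensorPower.toTensorAlgebra_tprod, TensorAlgebra.tprod_apply, h, smul_wsum]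
    simp [smul_smul]
  | add x y hx hy =>
    obtain ⟨r, hr, h⟩ := hx
    obtain ⟨s, hs, h'⟩ := hy
    refine ⟨r + s, fun u hu => by simp [hr u hu, hs u hu], ?_⟩
    rw [map_add, h, h', ← wsum_add_fun]
    simp [add_smul]

/-- The space of relations, viewed as a space of functions on words. -/
def Rw : Submodule k (List (Letter k V) → k) where
  carrier := {r | (∀ u, u.length ≠ P.N → r u = 0) ∧ ∃ t ∈ P.R,
    TensorPower.toTensorAlgebra t = wsum P.N fun u => r u • tmon k V u}
  add_mem' := by
    rintro r s ⟨hr, t, ht, h⟩ ⟨hs, t', ht', h'⟩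
    refine ⟨fun u hu => by simp [hr u hu, hs u hu], t + t', add_mem ht ht', ?_⟩
    rw [map_add, h, h', ← wsum_add_fun]
    simp [add_smul]
  zero_mem' := ⟨fun _ _ => rfl, 0, zero_mem _, by simp⟩
  smul_mem' := by
    rintro c r ⟨hr, t, ht, h⟩
    refine ⟨fun u hu => by simp [hr u hu], c • t, Submodule.smul_mem _ _ ht, ?_⟩
    rw [map_smul, h, smul_wsum]
    simp [smul_smul]

theorem Rw_supp (r : List (Letter k V) → k) (hr : r ∈ P.Rw) (u : List (Letter k V))
    (hu : u.length ≠ P.N) : r u = 0 := hr.1 u hu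

/-- The generators of `A`. -/
def x (i : Letter k V) : P.Alg := P.ι (basisV k V i)

theorem proj_tmon (u : List (Letter k V)) : P.proj (tmon k V u) = mon P.x u := by
  rw [tmon, mon, mon, map_list_prod, List.map_map]
  rfl

theorem relation {r : List (Letter k V) → k} (hr : r ∈ P.Rw) :
    (wsum P.N fun u => r u • mon P.x u) = 0 := by
  obtain ⟨-, t, ht, h⟩ := hr
  have := P.proj_eq_zero ht
  rw [h, map_wsum] at this
  simpa [proj_tmon] using this

theorem exists_lift {B : Type*} [Ring B] [Algebra k B] (b : Letter k V → B)
    (h : ∀ r ∈ P.Rw, (wsum P.N fun u => r u • mon b u) = 0) :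
    ∃ f : P.Alg →ₐ[k] B, ∀ i, f (P.x i) = b i := by
  refine ⟨P.lift ((basisV k V).constr k b) fun t ht => ?_, fun i => ?_⟩
  · obtain ⟨r, hr, hrt⟩ := exists_word_expansion P.N t
    rw [hrt, map_wsum, ← h r ⟨hr, t, ht, hrt⟩]
    refine wsum_congr fun u _ => ?_
    rw [map_smul, tmon, mon, map_list_prod, List.map_map]
    congr 3
    funext i
    simp
  · rw [x, lift_ι]
    simp

theorem hom_ext_x {B : Type*} [Ring B] [Algebra k B] {f g : P.Alg →ₐ[k] B}
    (h : ∀ i, f (P.x i) = g (P.x i)) : f = g := by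
  refine P.algHom_ext fun v => ?_
  rw [← (basisV k V).sum_repr v]
  simp only [map_sum, map_smul]
  exact Finset.sum_congr rfl fun i _ => by rw [← x, h]

/-- The span is a subalgebra S. The universal property gives a morphism A → S whose composite with
the inclusion fixes the generators, hence is the identity. -/
theorem span_mon : Submodule.span k (Set.range (mon P.x)) = ⊤ := by
  have hmul : ∀ a ∈ Submodule.span k (Set.range (mon P.x)),
      ∀ b ∈ Submodule.span k (Set.range (mon P.x)),
      a * b ∈ Submodule.span k (Set.range (mon P.x)) := by
    intro a ha b hb
    refine (?_ : Submodule.span k (Set.range (mon P.x)) * Submodule.span k (Set.range (mon P.x)) ≤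
      Submodule.span k (Set.range (mon P.x))) (Submodule.mul_mem_mul ha hb)
    rw [Submodule.span_mul_span]
    refine Submodule.span_mono ?_
    rintro _ ⟨_, ⟨u, rfl⟩, _, ⟨v, rfl⟩, rfl⟩
    exact ⟨u ++ v, mon_append _ _ _⟩
  have hone : (1 : P.Alg) ∈ Submodule.span k (Set.range (mon P.x)) :=
    Submodule.subset_span ⟨[], rfl⟩
  let S : Subalgebra k P.Alg := (Submodule.span k (Set.range (mon P.x))).toSubalgebra hone
    (fun a b ha hb => hmul a ha b hb)
  obtain ⟨f, hf⟩ := P.exists_lift (B := S) (fun i => ⟨P.x i, Submodule.subset_span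
    ⟨[i], by simp⟩⟩) fun r hr => by
      refine Subtype.ext ?_
      change S.val _ = 0
      rw [map_wsum, ← P.relation hr]
      refine wsum_congr fun u _ => ?_
      rw [map_smul, mon, map_list_prod, List.map_map]
      rfl
  have hid : S.val.comp f = AlgHom.id k P.Alg := P.hom_ext_x fun i => by
    rw [AlgHom.comp_apply, hf]
    rfl
  rw [eq_top_iff]
  intro a _
  rw [← show S.val (f a) = a from DFunLike.congr_fun hid a]
  exact (f a).2

theorem linear_ext {M : Type*} [AddCommGroup M] [Module k M] {f g : P.Alg →ₗ[k] M}
    (h : ∀ u, f (mon P.x u) = g (mon P.x u)) : f = g := by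
  refine LinearMap.ext_on P.span_mon ?_
  rintro _ ⟨u, rfl⟩
  exact h u

theorem alg_induction {p : P.Alg → Prop} (hm : ∀ u, p (mon P.x u))
    (ha : ∀ a b, p a → p b → p (a + b)) (hs : ∀ (c : k) a, p a → p (c • a)) (a : P.Alg) : p a := by
  have ha' : a ∈ Submodule.span k (Set.range (mon P.x)) := by simp [P.span_mon]
  induction ha' using Submodule.span_induction with
  | mem a h => obtain ⟨u, rfl⟩ := h; exact hm u
  | zero => simpa using hs 0 1 (by simpa using hm [])
  | add a b _ _ h h' => exact ha a b h h'
  | smul c a _ h => exact hs c a h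

@[simp] theorem aug_x (i : Letter k V) : P.aug (P.x i) = 0 := by
  rw [x, aug, lift_ι]
  rfl

theorem aug_mon (u : List (Letter k V)) : P.aug (mon P.x u) = if u.length = 0 then 1 else 0 := by
  cases u <;> simp

instance : Nontrivial P.Alg := P.aug.toRingHom.domain_nontrivial

/-! ### The grading -/

/-- The relations are homogeneous of degree N, so substituting x_i X for x_i only multiplies them by
X^N. The coefficient of X^m is then the projection onto A_m, without a direct sum decomposition
being constructed. -/
theorem exists_gradingHom : ∃ γ : P.Alg →ₐ[k] Polynomial P.Alg,
    ∀ i, γ (P.x i) = Polynomial.C (P.x i) * Polynomial.X := by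
  have hmon : ∀ u : List (Letter k V), mon (fun i => Polynomial.C (P.x i) * Polynomial.X) u =
      Polynomial.C (mon P.x u) * Polynomial.X ^ u.length := by
    intro u
    induction u with
    | nil => simp
    | cons i u ih =>
      rw [mon_cons, mon_cons, ih, List.length_cons, pow_succ', Polynomial.C_mul]
      rw [mul_assoc, ← mul_assoc Polynomial.X, Polynomial.X_mul_C, mul_assoc, mul_assoc]
  refine P.exists_lift _ fun r hr => ?_
  have := congrArg (fun a => Polynomial.C a * Polynomial.X ^ P.N) (P.relation hr)
  simp only [map_zero, zero_mul] at this
  rw [← this, map_wsum, wsum_mul]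
  refine wsum_congr fun u hu => ?_
  rw [hmon, hu, ← Polynomial.smul_C, smul_mul_assoc]

/-- The algebra morphism which multiplies the elements of degree `m` by `X^m`. -/
def gradingHom : P.Alg →ₐ[k] Polynomial P.Alg := P.exists_gradingHom.choose

theorem gradingHom_x (i : Letter k V) :
    P.gradingHom (P.x i) = Polynomial.C (P.x i) * Polynomial.X :=
  P.exists_gradingHom.choose_spec i

/-- The projection of `A` onto `A_m`. -/
def pr (m : ℕ) : P.Alg →ₗ[k] P.Alg where
  toFun a := (P.gradingHom a).coeff m
  map_add' a b := by simp
  map_smul' c a := by simp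

theorem pr_apply (m : ℕ) (a : P.Alg) : P.pr m a = (P.gradingHom a).coeff m := rfl

@[simp] theorem pr_succ_mul_x (m : ℕ) (a : P.Alg) (i : Letter k V) :
    P.pr (m + 1) (a * P.x i) = P.pr m a * P.x i := by
  rw [pr_apply, map_mul, gradingHom_x, ← mul_assoc, Polynomial.coeff_mul_X,
    Polynomial.coeff_mul_C, pr_apply]

@[simp] theorem pr_zero_mul_x (a : P.Alg) (i : Letter k V) : P.pr 0 (a * P.x i) = 0 := by
  rw [pr_apply, map_mul, gradingHom_x, ← mul_assoc, Polynomial.coeff_mul_X_zero]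

@[simp] theorem pr_succ_x_mul (m : ℕ) (a : P.Alg) (i : Letter k V) :
    P.pr (m + 1) (P.x i * a) = P.x i * P.pr m a := by
  rw [pr_apply, map_mul, gradingHom_x, mul_assoc, Polynomial.X_mul, ← mul_assoc,
    Polynomial.coeff_mul_X, Polynomial.coeff_C_mul, pr_apply]

@[simp] theorem pr_zero_x_mul (a : P.Alg) (i : Letter k V) : P.pr 0 (P.x i * a) = 0 := by
  rw [pr_apply, map_mul, gradingHom_x, mul_assoc, Polynomial.X_mul, ← mul_assoc,
    Polynomial.coeff_mul_X_zero]

theorem pr_one (m : ℕ) : P.pr m 1 = if m = 0 then 1 else 0 := by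
  rw [pr_apply, map_one, Polynomial.coeff_one]

theorem pr_mon (m : ℕ) (u : List (Letter k V)) :
    P.pr m (mon P.x u) = if u.length = m then mon P.x u else 0 := by
  induction u generalizing m with
  | nil => simp [pr_one, eq_comm]
  | cons i u ih =>
    cases m with
    | zero => simp
    | succ m => simp [ih]

theorem pr_mul_mon (m : ℕ) (a : P.Alg) (u : List (Letter k V)) :
    P.pr (m + u.length) (a * mon P.x u) = P.pr m a * mon P.x u := by
  induction u generalizing a m with
  | nil => simp
  | cons i u ih =>
    rw [mon_cons, ← mul_assoc, List.length_cons, add_comm u.length, ← add_assoc, ih,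
      pr_succ_mul_x, mul_assoc]

theorem pr_mul_mon_of_lt {m : ℕ} (a : P.Alg) (u : List (Letter k V)) (h : m < u.length) :
    P.pr m (a * mon P.x u) = 0 := by
  induction u generalizing a m with
  | nil => simp at h
  | cons i u ih =>
    rw [mon_cons, ← mul_assoc]
    rcases Nat.lt_or_ge m u.length with h' | h'
    · exact ih _ h'
    · obtain rfl : m = 0 + u.length := by simp at h; omega
      rw [pr_mul_mon, pr_zero_mul_x, zero_mul]

theorem pr_pr (m n : ℕ) (a : P.Alg) : P.pr m (P.pr n a) = if m = n then P.pr n a else 0 := by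
  have : (P.pr m).comp (P.pr n) = if m = n then P.pr n else 0 := P.linear_ext fun u => by
    rw [LinearMap.comp_apply, pr_mon]
    by_cases h : u.length = n
    · by_cases h' : m = n
      · simp [h, h', pr_mon]
      · have h'' : ¬ n = m := fun e => h' e.symm
        simp [h, h', h'', pr_mon]
    · by_cases h' : m = n <;> simp [h, h', pr_mon]
  have := LinearMap.congr_fun this a
  split_ifs at this ⊢ with h
  · exact this
  · exact this

theorem pr_zero (a : P.Alg) : P.pr 0 a = algebraMap k P.Alg (P.aug a) := by
  have : P.pr 0 = (Algebra.linearMap k P.Alg).comp P.aug.toLinearMap := P.linear_ext fun u => by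
    cases u <;> simp [pr_one]
  exact LinearMap.congr_fun this a

theorem aug_pr_zero (a : P.Alg) : P.aug (P.pr 0 a) = P.aug a := by
  rw [pr_zero, AlgHom.commutes]
  rfl

theorem aug_pr_of_ne {m : ℕ} (hm : m ≠ 0) (a : P.Alg) : P.aug (P.pr m a) = 0 := by
  have h := P.pr_pr 0 m a
  rw [if_neg (Ne.symm hm), pr_zero] at h
  exact (map_eq_zero_iff _ (algebraMap k P.Alg).injective).1 h

theorem exists_sum_pr (a : P.Alg) : ∃ b, (∀ m, b ≤ m → P.pr m a = 0) ∧
    ∀ n, b ≤ n → ∑ m ∈ Finset.range n, P.pr m a = a := by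
  induction a using P.alg_induction with
  | hm u =>
    refine ⟨u.length + 1, fun m hm => ?_, fun n hn => ?_⟩
    · rw [pr_mon, if_neg (by omega)]
    · rw [Finset.sum_eq_single u.length]
      · simp [pr_mon]
      · intro m _ hm
        rw [pr_mon, if_neg (Ne.symm hm)]
      · intro h
        exact absurd (Finset.mem_range.2 (by omega)) h
  | ha a b ha hb =>
    obtain ⟨m, hm, hm'⟩ := ha
    obtain ⟨n, hn, hn'⟩ := hb
    refine ⟨max m n, fun l hl => ?_, fun l hl => ?_⟩
    · rw [map_add, hm _ (le_trans (le_max_left _ _) hl), hn _ (le_trans (le_max_right _ _) hl),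
        add_zero]
    · simp only [map_add, Finset.sum_add_distrib]
      rw [hm' _ (le_trans (le_max_left _ _) hl), hn' _ (le_trans (le_max_right _ _) hl)]
  | hs c a ha =>
    obtain ⟨m, hm, hm'⟩ := ha
    refine ⟨m, fun l hl => by rw [map_smul, hm l hl, smul_zero], fun l hl => ?_⟩
    simp only [map_smul, ← Finset.smul_sum]
    rw [hm' l hl]

theorem eq_zero_of_pr {a : P.Alg} (h : ∀ m, P.pr m a = 0) : a = 0 := by
  obtain ⟨b, -, hb⟩ := P.exists_sum_pr a
  rw [← hb b le_rfl]
  simp [h]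

theorem mon_mem_component (u : List (Letter k V)) : mon P.x u ∈ P.component u.length := by
  induction u with
  | nil => simp [component]
  | cons i u ih =>
    rw [mon_cons, List.length_cons, component, pow_succ']
    exact Submodule.mul_mem_mul ⟨_, rfl⟩ ih

theorem pr_mem_component (m : ℕ) (a : P.Alg) : P.pr m a ∈ P.component m := by
  induction a using P.alg_induction with
  | hm u =>
    rw [pr_mon]
    split_ifs with h
    · rw [← h]; exact P.mon_mem_component u
    · exact zero_mem _
  | ha a b ha hb => rw [map_add]; exact add_mem ha hb
  | hs c a ha => rw [map_smul]; exact Submodule.smul_mem _ _ ha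

theorem ι_eq_sum (v : V) : P.ι v = ∑ i, (basisV k V).repr v i • P.x i := by
  conv_lhs => rw [← (basisV k V).sum_repr v]
  simp only [map_sum, map_smul]
  rfl

theorem pr_of_mem {m : ℕ} {a : P.Alg} (ha : a ∈ P.component m) : P.pr m a = a := by
  induction m generalizing a with
  | zero =>
    rw [component, pow_zero, Submodule.mem_one] at ha
    obtain ⟨c, rfl⟩ := ha
    rw [pr_zero, AlgHom.commutes]
    rfl
  | succ m ih =>
    rw [component, pow_succ] at ha
    induction ha using Submodule.mul_induction_on' with
    | mem_mul_mem a ha b hb =>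
      obtain ⟨v, rfl⟩ := hb
      rw [ι_eq_sum]
      simp only [Finset.mul_sum, mul_smul_comm, map_sum, map_smul, pr_succ_mul_x, ih ha]
    | add a _ b _ ha hb => rw [map_add, ha, hb]

theorem component_mul_mem {m n : ℕ} {a b : P.Alg} (ha : a ∈ P.component m)
    (hb : b ∈ P.component n) : a * b ∈ P.component (m + n) := by
  rw [component, pow_add]
  exact Submodule.mul_mem_mul ha hb

theorem exists_eq_sum_mul_x (a : P.Alg) : ∃ b : Letter k V → P.Alg,
    a = algebraMap k P.Alg (P.aug a) + ∑ i, b i * P.x i := by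
  induction a using P.alg_induction with
  | hm u =>
    rcases List.eq_nil_or_concat u with rfl | ⟨v, i, rfl⟩
    · exact ⟨0, by simp⟩
    · refine ⟨Pi.single i (mon P.x v), ?_⟩
      rw [List.concat_eq_append, mon_append, map_mul, Finset.sum_eq_single i]
      · simp
      · intro j _ hj
        simp [hj]
      · simp
  | ha a b ha hb =>
    obtain ⟨c, hc⟩ := ha
    obtain ⟨d, hd⟩ := hb
    refine ⟨c + d, ?_⟩
    conv_lhs => rw [hc, hd]
    simp only [map_add, Pi.add_apply, add_mul, Finset.sum_add_distrib]
    abel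
  | hs c a ha =>
    obtain ⟨d, hd⟩ := ha
    refine ⟨c • d, ?_⟩
    conv_lhs => rw [hd]
    simp only [map_smul, smul_eq_mul, map_mul, smul_add, Finset.smul_sum, Pi.smul_apply,
      smul_mul_assoc, ← Algebra.smul_def]

theorem exists_eq_sum_x_mul (a : P.Alg) : ∃ b : Letter k V → P.Alg,
    a = algebraMap k P.Alg (P.aug a) + ∑ i, P.x i * b i := by
  induction a using P.alg_induction with
  | hm u =>
    cases u with
    | nil => exact ⟨0, by simp⟩
    | cons i v =>
      refine ⟨Pi.single i (mon P.x v), ?_⟩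
      rw [mon_cons, map_mul, Finset.sum_eq_single i]
      · simp
      · intro j _ hj
        simp [hj]
      · simp
  | ha a b ha hb =>
    obtain ⟨c, hc⟩ := ha
    obtain ⟨d, hd⟩ := hb
    refine ⟨c + d, ?_⟩
    conv_lhs => rw [hc, hd]
    simp only [map_add, Pi.add_apply, mul_add, Finset.sum_add_distrib]
    abel
  | hs c a ha =>
    obtain ⟨d, hd⟩ := ha
    refine ⟨c • d, ?_⟩
    conv_lhs => rw [hd]
    simp only [map_smul, smul_eq_mul, map_mul, smul_add, Finset.smul_sum, Pi.smul_apply,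
      mul_smul_comm, ← Algebra.smul_def]

end HomogeneousRelations

namespace HomogeneousRelations

open Words

variable {k V : Type u} [Field k] [AddCommGroup V] [Module k V] [FiniteDimensional k V]
  (P : HomogeneousRelations k V)

/-! ## The beginning of the Koszul complex -/

/-- The space `M ⊗ W_n` attached to a homogeneous algebra. -/
abbrev W (S : Type*) [Semiring S] (M : Type*) [AddCommGroup M] [Module k M] [Module S M]
    [SMulCommClass k S M] (n : ℕ) : Submodule S (List (Letter k V) → M) :=
  WS P.N P.Rw S M n

theorem mem_W_N {r : List (Letter k V) → k} : r ∈ P.W k k P.N ↔ r ∈ P.Rw := by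
  rw [W, WS_N_eq P.Rw_supp]

/-- The first N letters of an element of W_{N+n} form a relation, and relations vanish in A. -/
theorem dL_pow_N {n : ℕ} {F : List (Letter k V) → P.Alg} (hF : F ∈ P.W P.Alg P.Alg (P.N + n)) :
    (dL P.x ^ P.N) F = 0 := by
  funext u
  rw [dL_pow_apply]
  by_cases hu : u.length = n
  · have hs := WS_slice_right (m := P.N) hF u (by omega)
    have : ∀ t, F (t ++ u) * mon P.x t = ∑ i, coef P.N P.Rw P.N i (fun t => F (t ++ u)) *
        (bas P.N P.Rw P.N i t • mon P.x t) := fun t => by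
      rw [eq_sum_coef hs t, Finset.sum_mul]
      exact Finset.sum_congr rfl fun i _ => by rw [smul_mul_assoc, mul_smul_comm]
    simp only [this, wsum_finsum, ← mul_wsum]
    exact Finset.sum_eq_zero fun i _ => by
      rw [P.relation (P.mem_W_N.1 (bas_mem P.N P.Rw P.N i)), mul_zero]
  · exact wsum_eq_zero fun t ht => by
      rw [hF.1 _ (by simp; omega), zero_mul]

theorem exact_zero {F : List (Letter k V) → P.Alg} (hF : F ∈ P.W P.Alg P.Alg 0)
    (h : P.aug (F []) = 0) : ∃ G ∈ P.W P.Alg P.Alg 1, dL P.x G = F := by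
  obtain ⟨b, hb⟩ := P.exists_eq_sum_mul_x (F [])
  rw [h, map_zero, zero_add] at hb
  refine ⟨fun u => match u with | [i] => b i | _ => 0, ?_, ?_⟩
  · refine (mem_WS_of_lt (by have := P.two_le; omega)).2 fun u hu => ?_
    match u, hu with
    | [], _ => rfl
    | [i], hu => exact absurd rfl hu
    | i :: j :: u, _ => rfl
  · funext u
    rw [dL_apply]
    cases u with
    | nil => exact hb.symm
    | cons i u => simp [hF.1 (i :: u) (by simp)]

theorem eq_sum_single {n : ℕ} {F : List (Letter k V) → P.Alg} (hF : ∀ u, u.length ≠ n → F u = 0) :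
    F = wsum n fun u => F u • (Pi.single u 1 : List (Letter k V) → P.Alg) := by
  funext v
  rw [wsum_apply]
  have : (fun u => (F u • (Pi.single u 1 : List (Letter k V) → P.Alg)) v) =
      fun u => if u = v then F u else 0 := by
    funext u
    by_cases h : u = v
    · subst h; simp
    · simp [h, Ne.symm h]
  rw [this, wsum_ite]
  split_ifs with h
  · rfl
  · exact hF v h

/-- The image of `A ⊗ R` in `A ⊗ V`. -/
def relImage : Submodule P.Alg (List (Letter k V) → P.Alg) :=
  (P.W P.Alg P.Alg P.N).map (dL P.x ^ (P.N - 1))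

/-- The cokernel of `A ⊗ R → A ⊗ V`. -/
abbrev RelCoker : Type u := (List (Letter k V) → P.Alg) ⧸ P.relImage

/-- The class of a letter in the cokernel of `A ⊗ R → A ⊗ V`. -/
def letterClass (i : Letter k V) : P.RelCoker :=
  P.relImage.mkQ (Pi.single [i] 1)

/-- The action of a generator on the extension of `k` by `RelCoker`. -/
def extensionEnd (i : Letter k V) : Module.End k (P.RelCoker × k) where
  toFun q := (P.x i • q.1 + q.2 • P.letterClass i, 0)
  map_add' q q' := by
    refine Prod.ext ?_ (by simp)
    simp only [Prod.fst_add, Prod.snd_add, smul_add, add_smul]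
    abel
  map_smul' c q := by
    refine Prod.ext ?_ (by simp)
    simp only [Prod.smul_fst, Prod.smul_snd, smul_eq_mul, smul_add, mul_smul, RingHom.id_apply,
      smul_comm c (P.x i)]

theorem extensionEnd_apply (i : Letter k V) (q : P.RelCoker × k) :
    P.extensionEnd i q = (P.x i • q.1 + q.2 • P.letterClass i, 0) := rfl

theorem mon_extensionEnd (u : List (Letter k V)) (i : Letter k V) (q : P.RelCoker × k) :
    mon P.extensionEnd (u ++ [i]) q =
      (mon P.x (u ++ [i]) • q.1 + q.2 • mon P.x u • P.letterClass i, 0) := by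
  induction u with
  | nil => simp [extensionEnd_apply]
  | cons j u ih =>
    rw [List.cons_append, mon_cons, Module.End.mul_apply, ih, extensionEnd_apply]
    refine Prod.ext ?_ rfl
    simp only [mon_cons, smul_add, mul_smul, zero_smul, add_zero, smul_comm q.2]

/-- A relation acts on the first factor by zero already in A. On (0, 1) it produces the class of ∑
r(u i) x_u ⊗ x_i, which lies in the image of A ⊗ R. So the operators define an A-module extending k
by the cokernel of A ⊗ R → A ⊗ V. -/
theorem relation_extensionEnd {r : List (Letter k V) → k} (hr : r ∈ P.Rw) :
    (wsum P.N fun u => r u • mon P.extensionEnd u) = 0 := by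
  have h2 := P.two_le
  obtain ⟨n, hn⟩ : ∃ n, P.N = n + 1 := ⟨P.N - 1, by omega⟩
  refine LinearMap.ext fun q => ?_
  have h1 := P.relation hr
  have happ : ∀ (F : List (Letter k V) → Module.End k (P.RelCoker × k)) (m : ℕ),
      wsum m F q = wsum m fun u => F u q := fun F m =>
    map_wsum (LinearMap.applyₗ (R := k) q : Module.End k (P.RelCoker × k) →ₗ[k] _) m F
  rw [happ, hn, wsum_succ_last]
  rw [hn, wsum_succ_last] at h1
  simp only [LinearMap.smul_apply, mon_extensionEnd]
  have hfst : ∀ (F : List (Letter k V) → P.RelCoker × k) (m : ℕ),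
      (wsum m F).1 = wsum m fun u => (F u).1 := fun F m =>
    map_wsum (LinearMap.fst k P.RelCoker k) m F
  have hsnd : ∀ (F : List (Letter k V) → P.RelCoker × k) (m : ℕ),
      (wsum m F).2 = wsum m fun u => (F u).2 := fun F m =>
    map_wsum (LinearMap.snd k P.RelCoker k) m F
  refine Prod.ext ?_ ?_
  · rw [Prod.fst_sum]
    simp only [hfst, Prod.smul_fst, smul_add, wsum_add_fun, Finset.sum_add_distrib]
    have e1 : (∑ i, wsum n fun u => r (u ++ [i]) • mon P.x (u ++ [i]) • q.1) = 0 := by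
      have := congrArg (fun a => a • q.1) h1
      simp only [zero_smul, Finset.sum_smul, wsum_smul] at this
      rw [← this]
      simp only [smul_assoc]
    have e2 : (∑ i, wsum n fun u => r (u ++ [i]) • mon P.x u • P.letterClass i) = 0 := by
      have hmem : (dL P.x ^ n) (incl P.Alg (⟨r, P.mem_W_N.2 hr⟩ : P.W k k P.N)).1 ∈ P.relImage :=
        ⟨_, (incl P.Alg (⟨r, P.mem_W_N.2 hr⟩ : P.W k k P.N)).2,
          by rw [show P.N - 1 = n by omega]⟩
      have hz := (Submodule.Quotient.mk_eq_zero _).2 hmem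
      rw [P.eq_sum_single (n := 1) (F := (dL P.x ^ n) _) (dL_pow_mem (n := 1) P.x n
        (by rw [add_comm, ← hn]; exact (incl P.Alg (⟨r, P.mem_W_N.2 hr⟩ : P.W k k P.N)).2)).1,
        wsum_one, ← Submodule.mkQ_apply, map_sum] at hz
      rw [← hz]
      refine Finset.sum_congr rfl fun i _ => ?_
      rw [map_smul, ← letterClass, dL_pow_apply, wsum_smul]
      refine wsum_congr fun u _ => ?_
      simp only [incl]
      rw [← smul_assoc, Algebra.smul_def]
    have e3 : (∑ i, wsum n fun u => r (u ++ [i]) • q.2 • mon P.x u • P.letterClass i) = 0 := by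
      rw [← smul_zero q.2, ← e2]
      simp only [Finset.smul_sum, smul_wsum, smul_comm q.2]
    rw [e1, e3]
    simp
  · rw [Prod.snd_sum]
    simp [hsnd]

/-- Since A is known only through its universal property, exactness at A ⊗ V is tested on a module:
in the extension of k by the cokernel, ∑ F_i x_i sends (0, 1) to the class of F, so the class
vanishes when ∑ F_i x_i = 0. -/
theorem exact_one {F : List (Letter k V) → P.Alg} (hF : F ∈ P.W P.Alg P.Alg 1)
    (h : dL P.x F = 0) : ∃ G ∈ P.W P.Alg P.Alg P.N, (dL P.x ^ (P.N - 1)) G = F := by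
  obtain ⟨ρ, hρ⟩ := P.exists_lift P.extensionEnd fun r hr => P.relation_extensionEnd hr
  have h1 : ∀ (a : P.Alg) (q : P.RelCoker), ρ a (q, 0) = (a • q, 0) := by
    intro a
    induction a using P.alg_induction with
    | hm u =>
      intro q
      induction u with
      | nil => simp
      | cons i u ih =>
        rw [mon_cons, map_mul, Module.End.mul_apply, ih, hρ, extensionEnd_apply]
        simp [mul_smul]
    | ha a b ha hb => intro q; rw [map_add, LinearMap.add_apply, ha, hb]; simp [add_smul]
    | hs c a ha => intro q; rw [map_smul, LinearMap.smul_apply, ha]; simp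
  have h2 : P.relImage.mkQ F = 0 := by
    have hz : ∑ i, F [i] * P.x i = 0 := congrFun h []
    have := congrArg (fun a => (ρ a (0, 1)).1) hz
    simp only [map_sum, map_mul, LinearMap.sum_apply, Module.End.mul_apply, hρ,
      extensionEnd_apply, h1, map_zero, smul_zero, zero_add, one_smul, LinearMap.zero_apply,
      Prod.fst_sum, Prod.fst_zero] at this
    rw [P.eq_sum_single hF.1, wsum_one, map_sum, ← this]
    exact Finset.sum_congr rfl fun i _ => map_smul _ _ _
  rw [Submodule.mkQ_apply, Submodule.Quotient.mk_eq_zero] at h2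
  exact h2

/-! ### The components of degree at most `N` -/

/-- The map from functions on words of length `m` to `A`. -/
def evalWord (m : ℕ) (c : List (Letter k V) → k) : P.Alg := wsum m fun u => c u • mon P.x u

theorem incl_mem {n : ℕ} {c : List (Letter k V) → k} (hc : c ∈ P.W k k n) :
    (fun u => algebraMap k P.Alg (c u)) ∈ P.W P.Alg P.Alg n :=
  WS_map hc (Algebra.linearMap k P.Alg)

/-- Grouping the words by their last letter i writes the element as ∑ a_i x_i, so its vanishing is a
cycle condition in A ⊗ V. -/
theorem evalWord_succ_exact {m : ℕ} {c : List (Letter k V) → k}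
    (h : P.evalWord (m + 1) c = 0) : ∃ G ∈ P.W P.Alg P.Alg P.N, ∀ i,
      P.evalWord m (fun u => c (u ++ [i])) = wsum (P.N - 1) fun t => G (t ++ [i]) * mon P.x t := by
  have hF : (fun u => match u with
      | [i] => P.evalWord m (fun u => c (u ++ [i]))
      | _ => 0 : List (Letter k V) → P.Alg) ∈ P.W P.Alg P.Alg 1 := by
    refine (mem_WS_of_lt (by have := P.two_le; omega)).2 fun u hu => ?_
    match u, hu with
    | [], _ => rfl
    | [i], hu => exact absurd rfl hu
    | i :: j :: u, _ => rfl
  obtain ⟨G, hG, hGF⟩ := P.exact_one hF (by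
    funext u
    cases u with
    | nil =>
      rw [Pi.zero_apply, ← h, evalWord, wsum_succ_last, dL_apply]
      refine Finset.sum_congr rfl fun i _ => ?_
      change P.evalWord m (fun u => c (u ++ [i])) * P.x i = _
      rw [evalWord, wsum_mul]
      refine wsum_congr fun u _ => ?_
      rw [mon_append, smul_mul_assoc, mon_cons, mon_nil, mul_one]
    | cons i u => simp [dL_apply])
  refine ⟨G, hG, fun i => ?_⟩
  have := congrFun hGF [i]
  rw [dL_pow_apply] at this
  exact this.symm

theorem pr_evalWord (m : ℕ) (c : List (Letter k V) → k) :
    P.pr m (P.evalWord m c) = P.evalWord m c := by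
  rw [evalWord, map_wsum]
  refine wsum_congr fun u hu => ?_
  rw [map_smul, pr_mon, if_pos hu]

/-- There are no relations in degree below N. Words ending in a fixed letter evaluate, by exactness
at A ⊗ V, to a combination of terms a x_t with t of length N - 1; these have no component in degree
m < N - 1, and induction on m applies. -/
theorem evalWord_injective {m : ℕ} (hm : m < P.N) {c : List (Letter k V) → k}
    (h : P.evalWord m c = 0) (u : List (Letter k V)) (hu : u.length = m) : c u = 0 := by
  induction m generalizing c u with
  | zero =>
    obtain rfl := List.length_eq_zero_iff.1 hu
    simpa [evalWord] using h
  | succ m ih =>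
    obtain ⟨G, hG, hGc⟩ := P.evalWord_succ_exact h
    rcases List.eq_nil_or_concat u with rfl | ⟨v, i, rfl⟩
    · simp at hu
    · rw [List.concat_eq_append]
      refine ih (by omega) (c := fun u => c (u ++ [i])) ?_ v (by simpa using hu)
      rw [← pr_evalWord, hGc, map_wsum]
      exact wsum_eq_zero fun t ht => P.pr_mul_mon_of_lt _ _ (by omega)

/-- In degree N the kernel of evaluation is R itself: only the degree zero part of G contributes to
degree N - 1, so c is the augmentation of G, and that is a relation. -/
theorem mem_Rw_of_evalWord {c : List (Letter k V) → k} (hc : ∀ u, u.length ≠ P.N → c u = 0)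
    (h : P.evalWord P.N c = 0) : c ∈ P.Rw := by
  have h2 := P.two_le
  obtain ⟨n, hn⟩ : ∃ n, P.N = n + 1 := ⟨P.N - 1, by omega⟩
  rw [hn] at h
  obtain ⟨G, hG, hGc⟩ := P.evalWord_succ_exact h
  have hg : (fun u => P.aug (G u)) ∈ P.W k k P.N := WS_map hG P.aug.toLinearMap
  have : c = fun u => P.aug (G u) := by
    funext u
    by_cases hu : u.length = P.N
    · rcases List.eq_nil_or_concat u with rfl | ⟨v, i, rfl⟩
      · simp at hu; omega
      · rw [List.concat_eq_append]
        rw [List.concat_eq_append, hn] at hu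
        refine sub_eq_zero.1 (P.evalWord_injective (m := n) (by omega)
          (c := fun v => c (v ++ [i]) - P.aug (G (v ++ [i]))) ?_ v (by simpa using hu))
        have h3 : P.evalWord n (fun u => c (u ++ [i])) =
            wsum n fun t => P.aug (G (t ++ [i])) • mon P.x t := by
          rw [← pr_evalWord, hGc, map_wsum, hn]
          refine wsum_congr fun t ht => ?_
          have := P.pr_mul_mon 0 (G (t ++ [i])) t
          rw [zero_add, ht] at this
          rw [Nat.add_sub_cancel] at *
          rw [this, pr_zero, Algebra.smul_def]
        rw [evalWord]
        simp only [sub_smul]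
        rw [wsum_sub, ← evalWord, h3, sub_self]
    · rw [hc u hu]
      exact (hg.1 u hu).symm
  rw [this]
  exact P.mem_W_N.1 hg

theorem exists_evalWord (m : ℕ) (a : P.Alg) :
    ∃ c : List (Letter k V) → k, (∀ u, u.length ≠ m → c u = 0) ∧ P.evalWord m c = P.pr m a := by
  induction a using P.alg_induction with
  | hm u =>
    rw [pr_mon]
    split_ifs with h
    · refine ⟨Pi.single u 1, fun v hv => ?_, ?_⟩
      · rw [Pi.single_eq_of_ne]
        rintro rfl
        exact hv h
      · have : (fun v => (Pi.single u (1 : k) : List (Letter k V) → k) v • mon P.x v) =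
            fun v => if v = u then mon P.x v else 0 := by
          funext v
          by_cases h : v = u
          · subst h; simp
          · simp [h]
        rw [evalWord, this, wsum_ite, if_pos h]
    · exact ⟨0, fun _ _ => rfl, by simp [evalWord]⟩
  | ha a b ha hb =>
    obtain ⟨c, hc, h⟩ := ha
    obtain ⟨d, hd, h'⟩ := hb
    refine ⟨c + d, fun u hu => by simp [hc u hu, hd u hu], ?_⟩
    rw [map_add, ← h, ← h', evalWord, evalWord, evalWord, ← wsum_add_fun]
    simp [add_smul]
  | hs r a ha =>
    obtain ⟨c, hc, h⟩ := ha
    refine ⟨r • c, fun u hu => by simp [hc u hu], ?_⟩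
    rw [map_smul, ← h, evalWord, evalWord, smul_wsum]
    simp [smul_smul]

end HomogeneousRelations

/-! ## Bar cochains with coefficients -/

section FinSequences

variable {α : Type*} {n : ℕ}

/-- The dimension shift splits off the last algebra argument, the one next to the module; the faces
of the bar construction are rewritten accordingly. -/
theorem contractNth_castSucc (op : α → α → α) (a : Fin (n + 2) → α) (i : Fin n) :
    Fin.contractNth i.castSucc.castSucc op a =
      Fin.snoc (α := fun _ => α) (Fin.contractNth i.castSucc op (Fin.init a))
        (a (Fin.last (n + 1))) := by
  funext j
  refine Fin.lastCases ?_ (fun j => ?_) j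
  · rw [Fin.snoc_last, Fin.contractNth_apply_of_gt]
    · rfl
    · simp
  · rw [Fin.snoc_castSucc]
    simp only [Fin.contractNth, Fin.val_castSucc, Fin.init]
    rfl

theorem contractNth_last (op : α → α → α) (a : Fin (n + 2) → α) :
    Fin.contractNth (Fin.last n).castSucc op a =
      Fin.snoc (α := fun _ => α) (Fin.init (Fin.init a))
        (op (Fin.init a (Fin.last n)) (a (Fin.last (n + 1)))) := by
  funext j
  refine Fin.lastCases ?_ (fun j => ?_) j
  · rw [Fin.snoc_last, Fin.contractNth_apply_of_eq]
    · rfl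
    · simp
  · rw [Fin.snoc_castSucc, Fin.contractNth_apply_of_lt]
    · rfl
    · simp

theorem tail_eq_snoc (a : Fin (n + 2) → α) :
    Fin.tail a = Fin.snoc (α := fun _ => α) (Fin.tail (Fin.init a)) (a (Fin.last (n + 1))) := by
  funext j
  refine Fin.lastCases ?_ (fun j => ?_) j
  · rw [Fin.snoc_last]; rfl
  · rw [Fin.snoc_castSucc]; rfl

end FinSequences

namespace HomogeneousRelations

open Words

variable {k V : Type u} [Field k] [AddCommGroup V] [Module k V] [FiniteDimensional k V]
  (P : HomogeneousRelations k V)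

section Cochains

variable {M : Type*} [AddCommGroup M] [Module k M] [Module P.Alg M]

/-- The differential of the complex of `k`-valued bar cochains on a left `A`-module `M`. -/
def cobound {n : ℕ} (f : (Fin n → P.Alg) → M → k) (a : Fin (n + 1) → P.Alg) (x : M) : k :=
  P.aug (a 0) * f (Fin.tail a) x +
    ∑ i : Fin n, (-1) ^ ((i : ℕ) + 1) * f (Fin.contractNth i.castSucc (· * ·) a) x +
    (-1) ^ (n + 1) * f (Fin.init a) (a (Fin.last n) • x)

/-- The two terms in which the last algebra element meets its neighbours are isolated, ready for
currying on the right. -/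
theorem cobound_succ {n : ℕ} (f : (Fin (n + 1) → P.Alg) → M → k) (a : Fin (n + 2) → P.Alg)
    (x : M) : P.cobound f a x =
    P.aug (a 0) * f (Fin.snoc (α := fun _ => P.Alg) (Fin.tail (Fin.init a)) (a (Fin.last _))) x +
    ∑ i : Fin n, (-1) ^ ((i : ℕ) + 1) * f (Fin.snoc (α := fun _ => P.Alg)
      (Fin.contractNth i.castSucc (· * ·) (Fin.init a)) (a (Fin.last _))) x +
    (-1) ^ (n + 1) * f (Fin.snoc (α := fun _ => P.Alg) (Fin.init (Fin.init a))
      (Fin.init a (Fin.last n) * a (Fin.last _))) x +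
    (-1) ^ (n + 2) * f (Fin.init a) (a (Fin.last _) • x) := by
  rw [cobound, Fin.sum_univ_castSucc, contractNth_last, tail_eq_snoc]
  simp only [contractNth_castSucc, Fin.val_castSucc, Fin.val_last, add_assoc]

/-- A grading of a module, given by its projections. -/
structure Projections (M : Type*) [AddCommGroup M] [Module k M] [Module P.Alg M] where
  /-- the projection on the component of degree `n` -/
  p : ℕ → M →ₗ[k] M
  orth : ∀ m n x, p m (p n x) = if m = n then p n x else 0
  fin : ∀ x, ∃ b, (∀ m, b ≤ m → p m x = 0) ∧ ∑ m ∈ Finset.range b, p m x = x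
  smul : ∀ m n a x, a ∈ P.component m → p n x = x → p (m + n) (a • x) = a • x

/-- The cochains of internal degree `j`. -/
def IsHomogeneousCochain (g : P.Projections M) {n : ℕ} (j : ℕ)
    (f : (Fin n → P.Alg) → M → k) : Prop :=
  ∀ (m : Fin n → ℕ) (d : ℕ) (a : Fin n → P.Alg) (x : M), (∀ l, a l ∈ P.component (m l)) →
    g.p d x = x → ∑ l, m l + d ≠ j → f a x = 0

/-- The vanishing of the component of internal degree `j` of the bar cohomology of `M`. -/
def CochainVanishes (g : P.Projections M) (n j : ℕ) : Prop :=
  ∀ f : MultilinearMap k (fun _ : Fin (n + 1) => P.Alg) (Module.Dual k M),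
    P.IsHomogeneousCochain g j (fun a => f a) → (∀ a x, P.cobound (fun a => f a) a x = 0) →
      ∃ h : MultilinearMap k (fun _ : Fin n => P.Alg) (Module.Dual k M),
        ∀ a x, P.cobound (fun a => h a) a x = f a x

end Cochains

section Section_

variable {P} {K M : Type*} [AddCommGroup K] [Module k K] [Module P.Alg K]
  [AddCommGroup M] [Module k M] [Module P.Alg M]

/-- Any k-linear section can be made homogeneous by replacing it with the sum over n of its degree n
parts on the degree n components. -/
theorem Projections.exists_section (gK : P.Projections K) (gM : P.Projections M)
    (π : K →ₗ[k] M) (hπ : Function.Surjective π) (hp : ∀ n y, π (gK.p n y) = gM.p n (π y)) :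
    ∃ σ : M →ₗ[k] K, (∀ x, π (σ x) = x) ∧ ∀ n x, gM.p n x = x → gK.p n (σ x) = σ x := by
  obtain ⟨σ₀, hσ₀⟩ := π.exists_rightInverse_of_surjective (LinearMap.range_eq_top.2 hπ)
  have hσ₀' : ∀ x, π (σ₀ x) = x := fun x => LinearMap.congr_fun hσ₀ x
  have hfin : ∀ x, (Function.support fun n => gM.p n x).Finite := fun x => by
    obtain ⟨b, hb, -⟩ := gM.fin x
    refine (Finset.range b).finite_toSet.subset fun n hn => ?_
    by_contra h
    exact hn (hb n (by simpa using h))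
  let T : M →ₗ[k] ℕ →₀ M :=
    { toFun := fun x => Finsupp.ofSupportFinite _ (hfin x)
      map_add' := fun x y => by ext n; simp [Finsupp.ofSupportFinite_coe]
      map_smul' := fun c x => by ext n; simp [Finsupp.ofSupportFinite_coe] }
  let σ : M →ₗ[k] K := (Finsupp.lsum k fun n => gK.p n ∘ₗ σ₀) ∘ₗ T
  have hT : ∀ n x, gM.p n x = x → T x = Finsupp.single n x := fun n x hx => by
    ext m
    change gM.p m x = _
    rw [← hx, gM.orth, Finsupp.single_apply]
    simp [eq_comm]
  have hσ : ∀ n x, gM.p n x = x → σ x = gK.p n (σ₀ x) := fun n x hx => by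
    simp [σ, hT n x hx]
  refine ⟨σ, fun x => ?_, fun n x hx => ?_⟩
  · obtain ⟨b, -, hb⟩ := gM.fin x
    conv_rhs => rw [← hb]
    rw [← hb, map_sum, map_sum]
    refine Finset.sum_congr rfl fun n _ => ?_
    have h1 : gM.p n (gM.p n x) = gM.p n x := by simp [gM.orth]
    rw [hb, hσ n _ h1, hp, hσ₀', h1]
  · rw [hσ n x hx, gK.orth, if_pos rfl]

/-- The grading induced on a graded submodule. -/
def Projections.ofInjective {Z : Type*} [AddCommGroup Z] [Module k Z] [Module P.Alg Z]
    (g : P.Projections K) (i : Z →ₗ[k] K) (hi : Function.Injective i)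
    (hA : ∀ (a : P.Alg) z, i (a • z) = a • i z) (q : ℕ → Z →ₗ[k] Z)
    (hq : ∀ n z, i (q n z) = g.p n (i z)) : P.Projections Z where
  p := q
  orth m n z := hi <| by
    rw [hq, hq, g.orth]
    split_ifs
    · rw [hq]
    · rw [map_zero]
  fin z := by
    obtain ⟨b, hb, hb'⟩ := g.fin (i z)
    refine ⟨b, fun m hm => hi ?_, hi ?_⟩
    · rw [hq, hb m hm, map_zero]
    · rw [map_sum]
      simp only [hq, hb']
  smul m n a z ha hz := hi <| by
    rw [hq, hA, g.smul m n a _ ha]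
    rw [← hq, hz]

end Section_

section DimensionShift

variable {M Z : Type*} [AddCommGroup M] [Module k M] [Module P.Alg M] [IsScalarTower k P.Alg M]
  [AddCommGroup Z] [Module k Z] [Module P.Alg Z] [IsScalarTower k P.Alg Z]

/-- Bar cohomology of a free module vanishes in positive degree: with X = ∑ c_s(X) b_s, a homotopy
is obtained by inserting the coordinate c_s(X) as a last algebra argument and evaluating at b_s. The
last term of the cocycle identity then reassembles f(a)(X). -/
theorem exists_cobound_of_free {l n : ℕ}
    (f : MultilinearMap k (fun _ : Fin (n + 1) => P.Alg) (Module.Dual k (P.W P.Alg P.Alg l)))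
    (hf : ∀ a x, P.cobound (fun a => f a) a x = 0) :
    ∃ h : MultilinearMap k (fun _ : Fin n => P.Alg) (Module.Dual k (P.W P.Alg P.Alg l)),
        ∀ a x, P.cobound (fun a => h a) a x = f a x := by
  let b : Fin (rk P.N P.Rw l) → P.W P.Alg P.Alg l := fun s =>
    incl P.Alg ⟨bas P.N P.Rw l s, bas_mem P.N P.Rw l s⟩
  let c : Fin (rk P.N P.Rw l) → P.W P.Alg P.Alg l →ₗ[k] P.Alg := fun s =>
    { toFun := fun X => coef P.N P.Rw l s X.1
      map_add' := fun X Y => coef_add l s _ _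
      map_smul' := fun r X => coef_smul (S := k) l s r X.1 }
  let T : (P.Alg →ₗ[k] Module.Dual k (P.W P.Alg P.Alg l)) →ₗ[k]
      Module.Dual k (P.W P.Alg P.Alg l) :=
    { toFun := fun φ => ∑ s, (LinearMap.applyₗ (R := k) (b s) ∘ₗ φ) ∘ₗ c s
      map_add' := fun φ ψ => by
        ext X
        simp [Finset.sum_add_distrib]
      map_smul' := fun r φ => by
        ext X
        simp [Finset.mul_sum] }
  have hT : ∀ φ X, T φ X = ∑ s, φ (c s X) (b s) := fun φ X => by simp [T]
  let h₀ : MultilinearMap k (fun _ : Fin n => P.Alg) (Module.Dual k (P.W P.Alg P.Alg l)) :=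
    T.compMultilinearMap f.curryRight
  have hh : ∀ a X, h₀ a X = ∑ s, f (Fin.snoc a (c s X)) (b s) := fun a X => by
    simp only [h₀, LinearMap.compMultilinearMap_apply, hT, MultilinearMap.curryRight_apply]
  -- The term f(a)(X) appears in the cocycle identity with the sign (-1)^(n+2), so the coboundary of
  -- h₀ is -(-1)^n f.
  refine ⟨(-(-1) ^ n : k) • h₀, fun a X => ?_⟩
  have hs : ∀ s, P.cobound (fun a => f a) (Fin.snoc (α := fun _ => P.Alg) a (c s X)) (b s) = 0 :=
    fun s => hf _ _
  have hX : X = ∑ s, c s X • b s := eq_sum_coef_incl X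
  have hc : ∀ s (a : P.Alg), c s (a • X) = a * c s X := fun s a =>
    coef_smul (S := P.Alg) l s a X.1
  have hsum := Finset.sum_eq_zero fun s (_ : s ∈ Finset.univ) => hs s
  simp only [cobound_succ, Fin.init_snoc, Fin.snoc_last] at hsum
  have h0 : ∀ s, (Fin.snoc (α := fun _ => P.Alg) a (c s X) : Fin (n + 2) → P.Alg) 0 = a 0 :=
    fun s => Fin.snoc_castSucc (α := fun _ => P.Alg) (c s X) a 0
  simp only [h0, Finset.sum_add_distrib, ← Finset.mul_sum] at hsum
  rw [Finset.sum_comm] at hsum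
  simp only [← Finset.mul_sum] at hsum
  have hlast : ∑ s, f a (c s X • b s) = f a X := by
    rw [← map_sum, ← hX]
  rw [hlast] at hsum
  rw [cobound]
  simp only [_root_.smul_apply, LinearMap.smul_apply, smul_eq_mul, hh, hc]
  have e : ((-1 : k) ^ n) * (-1) ^ n = 1 := by rw [← mul_pow]; simp
  have e2 : (-1 : k) ^ (n + 2) = (-1) ^ n := by rw [pow_add]; simp
  rw [e2] at hsum
  have key : (∑ i : Fin n, (-1 : k) ^ ((i : ℕ) + 1) * (-(-1) ^ n * ∑ s,
      f (Fin.snoc (Fin.contractNth i.castSucc (· * ·) a) (c s X)) (b s))) =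
      -(-1) ^ n * ∑ i : Fin n, (-1 : k) ^ ((i : ℕ) + 1) * ∑ s,
      f (Fin.snoc (Fin.contractNth i.castSucc (· * ·) a) (c s X)) (b s) := by
    rw [Finset.mul_sum]
    exact Finset.sum_congr rfl fun i _ => by ring
  rw [key]
  linear_combination (-(-1) ^ n) * hsum + (f a X) * e

/-- The data of a short exact sequence of graded modules with free middle term. -/
structure GradedPresentation (l : ℕ) (gM : P.Projections M) (gZ : P.Projections Z) where
  gK : P.Projections (P.W P.Alg P.Alg l)
  i : Z →ₗ[P.Alg] P.W P.Alg P.Alg l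
  π : P.W P.Alg P.Alg l →ₗ[P.Alg] M
  inj : Function.Injective i
  surj : Function.Surjective π
  zero : ∀ z, π (i z) = 0
  exact : ∀ y, π y = 0 → ∃ z, i z = y
  hi : ∀ n z, i (gZ.p n z) = gK.p n (i z)
  hπ : ∀ n y, π (gK.p n y) = gM.p n (π y)

variable {P} {l : ℕ} {gM : P.Projections M} {gZ : P.Projections Z}

theorem GradedPresentation.exists_splitting (G : P.GradedPresentation l gM gZ) :
    ∃ (σ : M →ₗ[k] P.W P.Alg P.Alg l) (s : P.W P.Alg P.Alg l →ₗ[k] Z),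
      (∀ x, G.π (σ x) = x) ∧ (∀ n x, gM.p n x = x → G.gK.p n (σ x) = σ x) ∧
      (∀ z, s (G.i z) = z) ∧ ∀ y, G.π y = 0 → G.i (s y) = y := by
  obtain ⟨σ, h1, h2⟩ := G.gK.exists_section gM (G.π.restrictScalars k) G.surj G.hπ
  obtain ⟨s, hs⟩ := (G.i.restrictScalars k).exists_leftInverse_of_injective
    (LinearMap.ker_eq_bot.2 G.inj)
  have hs' : ∀ z, s (G.i z) = z := fun z => LinearMap.congr_fun hs z
  refine ⟨σ, s, h1, h2, hs', fun y hy => ?_⟩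
  obtain ⟨z, rfl⟩ := G.exact y hy
  rw [hs']

/-- This is exactness of the long exact sequence at H^n(Z). The failure of a homogeneous section σ
to be A-linear is a map κ from A × M to Z; composing f with κ gives its connecting cocycle on M, one
step higher and of the same internal degree. That cocycle is a coboundary, and its primitive
corrects the naive extension of f. -/
theorem GradedPresentation.exists_extension (G : P.GradedPresentation l gM gZ) {n j : ℕ}
    (hM : P.CochainVanishes gM n j)
    (f : MultilinearMap k (fun _ : Fin n => P.Alg) (Module.Dual k Z))
    (hfh : P.IsHomogeneousCochain gZ j (fun a => f a))
    (hf : ∀ a x, P.cobound (fun a => f a) a x = 0) :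
    ∃ h : MultilinearMap k (fun _ : Fin n => P.Alg) (Module.Dual k (P.W P.Alg P.Alg l)),
      (∀ a x, P.cobound (fun a => h a) a x = 0) ∧ ∀ a z, h a (G.i z) = f a z := by
  obtain ⟨σ, s, hσ, hσg, hs, hs'⟩ := G.exists_splitting
  let κ : P.Alg →ₗ[k] M →ₗ[k] Z :=
    LinearMap.mk₂ k (fun a x => s (a • σ x - σ (a • x)))
      (fun a b x => by rw [← map_add]; congr 1; simp only [add_smul, map_add]; abel)
      (fun c a x => by
        rw [← s.map_smul, smul_sub, ← σ.map_smul, smul_assoc, smul_assoc])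
      (fun a x y => by rw [← map_add]; congr 1; simp only [smul_add, map_add]; abel)
      (fun c a x => by
        rw [← s.map_smul, smul_sub, ← σ.map_smul, σ.map_smul c x, smul_comm a c, smul_comm a c])
  have hκ : ∀ a x, G.i (κ a x) = a • σ x - σ (a • x) := fun a x =>
    hs' _ (by rw [map_sub, G.π.map_smul, hσ, hσ, sub_self])
  have hκmul : ∀ a b x, κ (a * b) x = a • κ b x + κ a (b • x) := fun a b x => G.inj <| by
    rw [map_add, G.i.map_smul, hκ, hκ, hκ, mul_smul, mul_smul, smul_sub]
    abel
  let T : Module.Dual k Z →ₗ[k] P.Alg →ₗ[k] Module.Dual k M :=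
    { toFun := fun φ => κ.compr₂ φ
      map_add' := fun _ _ => rfl
      map_smul' := fun _ _ => rfl }
  let f' : MultilinearMap k (fun _ : Fin (n + 1) => P.Alg) (Module.Dual k M) :=
    (T.compMultilinearMap f).uncurryRight
  have hf' : ∀ a x, f' a x = f (Fin.init a) (κ (a (Fin.last n)) x) := fun a x => rfl
  obtain ⟨g, hg⟩ := hM f' (by
    intro m d a x ha hx hj
    change f' a x = 0
    rw [hf']
    refine hfh (Fin.init m) (m (Fin.last n) + d) _ _ (fun l => ha _) (G.inj ?_) ?_
    · rw [G.hi, hκ, map_sub, G.gK.smul _ _ _ _ (ha _) (hσg _ _ hx),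
        hσg _ _ (gM.smul _ _ _ _ (ha _) hx)]
    · rw [Fin.sum_univ_castSucc, add_assoc] at hj
      exact hj) (by
    intro a x
    have h0 := hf (Fin.init a) (κ (a (Fin.last _)) x)
    rw [cobound] at h0
    rw [cobound_succ]
    simp only [hf', Fin.init_snoc, Fin.snoc_last, hκmul, map_add]
    rw [← h0, pow_succ (-1 : k) (n + 1)]
    change P.aug (a 0) * _ + _ + _ + _ = P.aug (a 0) * _ + _ + _
    ring)
  -- A retraction of the inclusion of Z which is only k-linear; its defect of A-linearity is again
  -- κ, so f ∘ r fails to be a cocycle by exactly the connecting cocycle evaluated on the image in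
  -- M.
  let r : P.W P.Alg P.Alg l →ₗ[k] Z := s ∘ₗ (LinearMap.id - σ ∘ₗ G.π.restrictScalars k)
  have hr : ∀ y, G.i (r y) = y - σ (G.π y) := fun y => hs' _ (by
    simp [hσ])
  have hra : ∀ (a : P.Alg) y, r (a • y) = a • r y + κ a (G.π y) := fun a y => G.inj <| by
    rw [map_add, G.i.map_smul, hr, hr, hκ, G.π.map_smul, smul_sub]
    abel
  let h : MultilinearMap k (fun _ : Fin n => P.Alg) (Module.Dual k (P.W P.Alg P.Alg l)) :=
    (LinearMap.lcomp k k r).compMultilinearMap f -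
      ((-1) ^ (n + 1) : k) •
        (LinearMap.lcomp k k (G.π.restrictScalars k)).compMultilinearMap g
  have hh : ∀ a y, h a y = f a (r y) - (-1) ^ (n + 1) * g a (G.π y) := fun a y => by
    simp [h]
  refine ⟨h, fun a y => ?_, fun a z => ?_⟩
  · have h0 := hf a (r y)
    have h1 := hg a (G.π y)
    have e : ((-1 : k) ^ (n + 1)) * (-1) ^ (n + 1) = 1 := by rw [← mul_pow]; simp
    rw [hf'] at h1
    rw [cobound] at h0 h1 ⊢
    simp only [hh, hra, map_add, map_smul, mul_sub, Finset.sum_sub_distrib]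
    have h1' : (-1) ^ (n + 1) * (P.aug (a 0) * g (Fin.tail a) (G.π y)) +
        (∑ i : Fin n, (-1) ^ ((i : ℕ) + 1) *
          ((-1) ^ (n + 1) * g (Fin.contractNth i.castSucc (· * ·) a) (G.π y))) +
        (-1) ^ (n + 1) * ((-1) ^ (n + 1) * g (Fin.init a) (a (Fin.last n) • G.π y)) =
        (-1) ^ (n + 1) * f (Fin.init a) (κ (a (Fin.last n)) (G.π y)) := by
      rw [← h1, mul_add, mul_add, Finset.mul_sum]
      congr 2
      exact Finset.sum_congr rfl fun i _ => by ring
    linear_combination h0 - h1'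
  · rw [hh, G.zero, map_zero, mul_zero, sub_zero]
    congr 1
    exact G.inj (by rw [hr, G.zero, map_zero, sub_zero])

/-- A cocycle on Z extends to the free middle term, is a coboundary there, and the primitive is
restricted to Z. -/
theorem GradedPresentation.cochainVanishes (G : P.GradedPresentation l gM gZ) {n j : ℕ}
    (hM : P.CochainVanishes gM (n + 1) j) : P.CochainVanishes gZ n j := by
  intro f hfh hf
  obtain ⟨u, hu, huf⟩ := G.exists_extension hM f hfh hf
  obtain ⟨h, hh⟩ := P.exists_cobound_of_free u hu
  refine ⟨(LinearMap.lcomp k k (G.i.restrictScalars k)).compMultilinearMap h, fun a z => ?_⟩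
  rw [← huf, ← hh]
  simp [cobound]

/-- In cochain degree zero the cocycles are the A-linear maps to k, which is what is needed to
detect generators of Z. -/
theorem GradedPresentation.exists_extension_linear (G : P.GradedPresentation l gM gZ) {j : ℕ}
    (hM : P.CochainVanishes gM 0 j) (ψ : Module.Dual k Z)
    (hψ : ∀ d z, d ≠ j → gZ.p d z = z → ψ z = 0)
    (hlin : ∀ (a : P.Alg) z, ψ (a • z) = P.aug a * ψ z) :
    ∃ Ψ : Module.Dual k (P.W P.Alg P.Alg l), (∀ (a : P.Alg) y, Ψ (a • y) = P.aug a * Ψ y) ∧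
      ∀ z, Ψ (G.i z) = ψ z := by
  obtain ⟨h, hh, hhz⟩ := G.exists_extension hM (MultilinearMap.constOfIsEmpty k _ ψ)
    (by
      intro m d a x _ hx hd
      exact hψ d x (by simpa using hd) hx)
    (by
      intro a x
      simp [cobound, hlin])
  refine ⟨h default, fun a y => ?_, fun z => hhz default z⟩
  have := hh (fun _ => a) y
  simp only [cobound, Finset.univ_eq_empty, Finset.sum_empty, add_zero, zero_add, pow_one,
    neg_mul, one_mul] at this
  rw [Subsingleton.elim (Fin.tail _) default, Subsingleton.elim (Fin.init _) default] at this
  exact (add_neg_eq_zero.1 this).symm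

end DimensionShift

end HomogeneousRelations

namespace HomogeneousRelations

open Words

variable {k V : Type u} [Field k] [AddCommGroup V] [Module k V] [FiniteDimensional k V]
  (P : HomogeneousRelations k V)

/-! ## The Koszul complex -/

/-- The difference `n(i + 1) - n(i)`. -/
def gap (i : ℕ) : ℕ := if i % 2 = 0 then 1 else P.N - 1

theorem jump_succ (i : ℕ) : P.jump (i + 1) = P.jump i + P.gap i := by
  have h2 := P.two_le
  rcases Nat.mod_two_eq_zero_or_one i with h | h
  · have h1 : (i + 1) / 2 = i / 2 := by omega
    have h3 : (i + 1) % 2 = 1 := by omega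
    simp [jump, gap, h, h1, h3]
  · have h1 : (i + 1) / 2 = i / 2 + 1 := by omega
    have h3 : (i + 1) % 2 = 0 := by omega
    simp only [jump, gap, h, h1, h3, add_mul, one_mul]
    simp
    omega

theorem gap_add (i : ℕ) : P.gap i + P.gap (i + 1) = P.N := by
  have h2 := P.two_le
  rcases Nat.mod_two_eq_zero_or_one i with h | h
  · have h3 : (i + 1) % 2 = 1 := by omega
    simp [gap, h, h3]
    omega
  · have h3 : (i + 1) % 2 = 0 := by omega
    simp [gap, h, h3]
    omega

theorem gap_pos (i : ℕ) : 0 < P.gap i := by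
  have h2 := P.two_le
  unfold gap
  split_ifs <;> omega

theorem gap_lt (i : ℕ) : P.gap i < P.N := by
  have h := P.gap_add i
  have := P.gap_pos (i + 1)
  omega

theorem jump_zero : P.jump 0 = 0 := by simp [jump]

theorem jump_one : P.jump 1 = 1 := by simp [jump]

theorem jump_two : P.jump 2 = P.N := by simp [jump]

theorem gap_zero : P.gap 0 = 1 := by simp [gap]

theorem gap_one : P.gap 1 = P.N - 1 := by simp [gap]

theorem jump_add_two (i : ℕ) : P.jump (i + 2) = P.jump i + P.N := by
  rw [jump_succ, jump_succ, add_assoc, gap_add]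

/-- The terms `A ⊗ W_{n(i)}` of the Koszul complex. -/
abbrev KK (i : ℕ) : Type u := P.W P.Alg P.Alg (P.jump i)

/-- The differential of the Koszul complex. -/
def dK (i : ℕ) : P.KK (i + 1) →ₗ[P.Alg] P.KK i :=
  (dL P.x ^ P.gap i).restrict fun F hF => dL_pow_mem P.x (P.gap i) (by rwa [← jump_succ])

theorem dK_coe (i : ℕ) (F : P.KK (i + 1)) : (P.dK i F).1 = (dL P.x ^ P.gap i) F.1 := rfl

/-- Two consecutive differentials move N letters in total. -/
theorem dK_dK (i : ℕ) (F : P.KK (i + 2)) : P.dK i (P.dK (i + 1) F) = 0 := by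
  refine Subtype.ext ?_
  rw [dK_coe, dK_coe, ← Module.End.mul_apply, ← pow_add, gap_add]
  exact P.dL_pow_N (n := P.jump i) (by rw [add_comm, ← jump_add_two]; exact F.2)

/-- The augmentation of the Koszul complex. -/
def augK : P.KK 0 →ₗ[P.Alg] P.trivialModule where
  toFun F := P.aug (F.1 [])
  map_add' _ _ := map_add P.aug _ _
  map_smul' _ _ := map_mul P.aug _ _

theorem augK_apply (F : P.KK 0) : P.augK F = P.aug (F.1 []) := rfl

theorem augK_dK (F : P.KK 1) : P.augK (P.dK 0 F) = 0 := by
  rw [augK_apply, dK_coe, gap_zero, pow_one, dL_apply, map_sum]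
  exact Finset.sum_eq_zero fun i _ => by rw [map_mul, aug_x, mul_zero]; rfl

/-- The syzygies of the Koszul complex. -/
def Y : ℕ → ModuleCat.{u} P.Alg
  | 0 => P.trivialModule
  | 1 => ModuleCat.of P.Alg (LinearMap.ker P.augK)
  | i + 2 => ModuleCat.of P.Alg (LinearMap.ker (P.dK i))

/-- The inclusion of the syzygies. -/
def ιY : (i : ℕ) → P.Y (i + 1) →ₗ[P.Alg] P.KK i
  | 0 => (LinearMap.ker P.augK).subtype
  | i + 1 => (LinearMap.ker (P.dK i)).subtype

/-- The projection of the terms of the Koszul complex onto the syzygies. -/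
def πY : (i : ℕ) → P.KK i →ₗ[P.Alg] P.Y i
  | 0 => P.augK
  | 1 => (P.dK 0).codRestrict (LinearMap.ker P.augK) P.augK_dK
  | i + 2 => (P.dK (i + 1)).codRestrict (LinearMap.ker (P.dK i)) (P.dK_dK i)

theorem ιY_injective : ∀ i, Function.Injective (P.ιY i)
  | 0 => Subtype.val_injective
  | _ + 1 => Subtype.val_injective

theorem ιY_πY : ∀ i F, P.ιY i (P.πY (i + 1) F) = P.dK i F
  | 0, _ => rfl
  | _ + 1, _ => rfl

theorem πY_ιY : ∀ i z, P.πY i (P.ιY i z) = 0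
  | 0, z => z.2
  | 1, z => Subtype.ext z.2
  | _ + 2, z => Subtype.ext z.2

theorem exists_ιY : ∀ i F, P.πY i F = 0 → ∃ z, P.ιY i z = F
  | 0, F, h => ⟨⟨F, h⟩, rfl⟩
  | 1, F, h => ⟨⟨F, congrArg Subtype.val h⟩, rfl⟩
  | _ + 2, F, h => ⟨⟨F, congrArg Subtype.val h⟩, rfl⟩

/-! ### Gradings -/

theorem pr_dL_pow (g m : ℕ) (F : List (Letter k V) → P.Alg) (u : List (Letter k V)) :
    P.pr (m + g) ((dL P.x ^ g) F u) = (dL P.x ^ g) (fun w => P.pr m (F w)) u := by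
  rw [dL_pow_apply, dL_pow_apply, map_wsum]
  exact wsum_congr fun t ht => by rw [← ht, pr_mul_mon]

theorem pr_dL_pow_of_lt {g m : ℕ} (h : m < g) (F : List (Letter k V) → P.Alg)
    (u : List (Letter k V)) : P.pr m ((dL P.x ^ g) F u) = 0 := by
  rw [dL_pow_apply, map_wsum]
  exact wsum_eq_zero fun t ht => P.pr_mul_mon_of_lt _ _ (by omega)

/-- The projections of `A ⊗ W_l` on its components of internal degree `n`. -/
def prW (l n : ℕ) : P.W P.Alg P.Alg l →ₗ[k] P.W P.Alg P.Alg l where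
  toFun F := if l ≤ n then ⟨fun u => P.pr (n - l) (F.1 u), WS_map F.2 (P.pr (n - l))⟩ else 0
  map_add' F G := by
    split_ifs
    · exact Subtype.ext (funext fun u => map_add (P.pr (n - l)) _ _)
    · rw [add_zero]
  map_smul' c F := by
    split_ifs
    · exact Subtype.ext (funext fun u => map_smul (P.pr (n - l)) _ _)
    · rw [smul_zero]

theorem prW_apply {l n : ℕ} (h : l ≤ n) (F : P.W P.Alg P.Alg l) (u : List (Letter k V)) :
    (P.prW l n F).1 u = P.pr (n - l) (F.1 u) := by
  simp [prW, h]

theorem prW_of_lt {l n : ℕ} (h : n < l) (F : P.W P.Alg P.Alg l) : P.prW l n F = 0 := by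
  simp [prW, Nat.not_le.2 h]

/-- The grading of `A ⊗ W_l`. -/
def gradingW (l : ℕ) : P.Projections (P.W P.Alg P.Alg l) where
  p := P.prW l
  orth m n F := by
    rcases Nat.lt_or_ge n l with hn | hn
    · rw [prW_of_lt P hn, map_zero, ite_self]
    rcases Nat.lt_or_ge m l with hm | hm
    · rw [prW_of_lt P hm, if_neg (by omega)]
    refine Subtype.ext (funext fun u => ?_)
    rw [prW_apply P hm, prW_apply P hn, pr_pr]
    by_cases h : m = n
    · subst h
      rw [if_pos rfl, if_pos rfl, prW_apply P hm]
    · rw [if_neg h, if_neg (by omega)]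
      rfl
  fin F := by
    choose b hb hb' using P.exists_sum_pr
    obtain ⟨B, hB⟩ := ((List.finite_length_eq (Letter k V) l).image
      fun u => b (F.1 u)).bddAbove
    -- The summand `b 0` covers the words of the wrong length, where F vanishes.
    have hB' : ∀ u, b (F.1 u) ≤ B + b 0 := fun u => by
      by_cases hu : u.length = l
      · exact (hB ⟨u, hu, rfl⟩).trans (by omega)
      · rw [F.2.1 u hu]
        omega
    refine ⟨l + (B + b 0), fun m hm => ?_, ?_⟩
    · refine Subtype.ext (funext fun u => ?_)
      rw [prW_apply P (by omega), hb _ _ ((hB' u).trans (by omega))]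
      rfl
    · rw [Finset.sum_range_add, Finset.sum_eq_zero, zero_add]
      · refine Subtype.ext (funext fun u => ?_)
        rw [AddSubmonoidClass.coe_finsetSum, Finset.sum_apply]
        rw [← hb' (F.1 u) _ (hB' u)]
        refine Finset.sum_congr rfl fun m _ => ?_
        rw [prW_apply P (by omega), Nat.add_sub_cancel_left]
      · intro m hm
        exact prW_of_lt P (Finset.mem_range.1 hm) F
  smul m n a F ha hF := by
    rcases Nat.lt_or_ge n l with hn | hn
    · rw [← hF, prW_of_lt P hn, smul_zero, map_zero]
    refine Subtype.ext (funext fun u => ?_)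
    rw [prW_apply P (by omega)]
    refine P.pr_of_mem (a := a * F.1 u) ?_
    rw [Nat.add_sub_assoc hn]
    refine P.component_mul_mem ha ?_
    rw [← hF, prW_apply P hn]
    exact P.pr_mem_component _ _

theorem dK_prW (i n : ℕ) (F : P.KK (i + 1)) :
    P.dK i (P.prW (P.jump (i + 1)) n F) = P.prW (P.jump i) n (P.dK i F) := by
  have hj := P.jump_succ i
  refine Subtype.ext (funext fun u => ?_)
  rcases Nat.lt_or_ge n (P.jump (i + 1)) with hn | hn
  · rw [prW_of_lt P hn, map_zero]
    rcases Nat.lt_or_ge n (P.jump i) with hn' | hn'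
    · rw [prW_of_lt P hn']
    · rw [prW_apply P hn', dK_coe, pr_dL_pow_of_lt P (by omega)]
      rfl
  · rw [prW_apply P (by omega), dK_coe, dK_coe]
    rw [show n - P.jump i = n - P.jump (i + 1) + P.gap i by omega, pr_dL_pow]
    exact congrArg (fun G => (dL P.x ^ P.gap i) G u) (funext fun w => prW_apply P hn F w)

theorem augK_prW (n : ℕ) (F : P.KK 0) :
    P.augK (P.prW (P.jump 0) n F) = if n = 0 then P.augK F else 0 := by
  have h0 : (P.prW (P.jump 0) n F).1 [] = P.pr n (F.1 []) := by
    rw [prW_apply P (by rw [jump_zero]; omega)]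
    exact congrArg (fun m => P.pr m (F.1 [])) (by rw [jump_zero, Nat.sub_zero])
  split_ifs with h
  · subst h
    exact (congrArg P.aug h0).trans (P.aug_pr_zero _)
  · exact (congrArg P.aug h0).trans (P.aug_pr_of_ne h _)

/-- The trivial module is `k`. -/
def trivEquiv : P.trivialModule ≃ₗ[k] k where
  toFun c := c
  invFun c := c
  left_inv _ := rfl
  right_inv _ := rfl
  map_add' _ _ := rfl
  map_smul' c z := by
    change P.aug (algebraMap k P.Alg c) * (show k from z) = c * (show k from z)
    rw [AlgHom.commutes]
    rfl

theorem trivEquiv_smul (a : P.Alg) (z : P.trivialModule) :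
    P.trivEquiv (a • z) = P.aug a * P.trivEquiv z := rfl

/-- The grading of the trivial module. -/
def gradingTriv : P.Projections P.trivialModule where
  p n := if n = 0 then LinearMap.id else 0
  orth m n z := by
    by_cases h : n = 0 <;> by_cases h' : m = 0 <;> simp [h, h']
  fin z := by
    refine ⟨1, fun m hm => ?_, ?_⟩
    · rw [if_neg (by omega)]
      rfl
    · simp
  smul m n a z ha hz := by
    by_cases hn : n = 0
    · by_cases hm : m = 0
      · simp [hn, hm]
      · refine P.trivEquiv.injective ?_
        rw [trivEquiv_smul, ← P.pr_of_mem ha, aug_pr_of_ne P hm, zero_mul]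
        simp [hm]
    · rw [if_neg hn] at hz
      rw [← hz]
      simp

/-- Evaluation at 1 identifies cochains on the trivial module with the dual of the bar complex of k;
this is where the Koszul hypothesis enters the dimension shift. -/
theorem cochainVanishes_triv {n j : ℕ} (h : P.GradedExtVanishes n j) :
    P.CochainVanishes P.gradingTriv n j := by
  intro f hfh hf
  let one : P.trivialModule := P.trivEquiv.symm 1
  have hsm : ∀ (φ : Module.Dual k P.trivialModule) (z : P.trivialModule),
      φ z = φ one * P.trivEquiv z := fun φ z => by
    have : z = P.trivEquiv z • one := P.trivEquiv.injective (by simp [one])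
    conv_lhs => rw [this, map_smul, smul_eq_mul, mul_comm]
  let f' : MultilinearMap k (fun _ : Fin (n + 1) => P.Alg) k :=
    (LinearMap.applyₗ (R := k) one).compMultilinearMap f
  have hf' : ∀ a, f' a = f a one := fun a => rfl
  obtain ⟨g, -, hg⟩ := h f' (by
    intro m a ha hm
    exact hfh m 0 a one ha (by simp [gradingTriv]) (by simpa using hm)) (by
    funext a
    have := hf a one
    rw [cobound, hsm (f (Fin.init a)), trivEquiv_smul] at this
    simp only [barDifferential, hf']
    rw [Pi.zero_apply, ← this]
    simp [one])
  let h' : MultilinearMap k (fun _ : Fin n => P.Alg) (Module.Dual k P.trivialModule) :=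
    (LinearMap.toSpanSingleton k _ P.trivEquiv.toLinearMap).compMultilinearMap g
  have hh : ∀ a z, h' a z = g a * P.trivEquiv z := fun a z => rfl
  refine ⟨h', fun a z => ?_⟩
  have := congrFun hg a
  rw [hf'] at this
  rw [hsm, ← this, barDifferential, cobound]
  simp only [hh, trivEquiv_smul, add_mul, Finset.sum_mul]
  congr 1
  · congr 1
    · ring
    · exact Finset.sum_congr rfl fun i _ => by ring
  · ring

theorem Projections.p_succ_x_smul {P : HomogeneousRelations k V} {M : Type*} [AddCommGroup M]
    [Module k M] [Module P.Alg M] (g : P.Projections M) (s : Letter k V) (z : M) (j : ℕ) :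
    g.p (j + 1) (P.x s • z) = P.x s • g.p j z := by
  obtain ⟨b, -, hb⟩ := g.fin z
  have hx : P.x s ∈ P.component 1 := by simpa using P.mon_mem_component [s]
  have key : ∀ m, g.p (m + 1) (P.x s • g.p m z) = P.x s • g.p m z := fun m => by
    have := g.smul 1 m _ (g.p m z) hx (by simp [g.orth])
    rwa [add_comm] at this
  have key2 : ∀ m, g.p (j + 1) (P.x s • g.p m z) = P.x s • (g.p j (g.p m z)) := fun m => by
    rw [← key m, g.orth, g.orth]
    by_cases h : j = m
    · simp [h, key]
    · simp [h]
  conv_lhs => rw [← hb]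
  conv_rhs => rw [← hb]
  simp only [Finset.smul_sum, map_sum, key2]

theorem Projections.p_zero_x_smul {P : HomogeneousRelations k V} {M : Type*} [AddCommGroup M]
    [Module k M] [Module P.Alg M] (g : P.Projections M) (s : Letter k V) (z : M) : g.p 0 (P.x s • z) = 0 := by
  obtain ⟨b, -, hb⟩ := g.fin z
  have hx : P.x s ∈ P.component 1 := by simpa using P.mon_mem_component [s]
  conv_lhs => rw [← hb]
  simp only [Finset.smul_sum, map_sum]
  refine Finset.sum_eq_zero fun m _ => ?_
  rw [← g.smul 1 m _ (g.p m z) hx (by simp [g.orth]), g.orth, if_neg (by omega)]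

theorem πY_prW_eq_zero : ∀ (i n : ℕ) (F : P.KK i), P.πY i F = 0 →
    P.πY i (P.prW (P.jump i) n F) = 0
  | 0, n, F, h => by
    change P.augK F = 0 at h
    change P.augK _ = 0
    rw [augK_prW, h, ite_self]
  | i + 1, n, F, h => P.ιY_injective i <| by
    have h' := congrArg (P.ιY i) h
    rw [ιY_πY, map_zero] at h'
    rw [ιY_πY, dK_prW, h', map_zero, map_zero]

theorem exists_prY (i n : ℕ) : ∃ q : P.Y (i + 1) →ₗ[k] P.Y (i + 1),
    ∀ z, P.ιY i (q z) = P.prW (P.jump i) n (P.ιY i z) := by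
  obtain ⟨s, hs⟩ := ((P.ιY i).restrictScalars k).exists_leftInverse_of_injective
    (LinearMap.ker_eq_bot.2 (P.ιY_injective i))
  refine ⟨s ∘ₗ P.prW (P.jump i) n ∘ₗ (P.ιY i).restrictScalars k, fun z => ?_⟩
  obtain ⟨z', hz'⟩ := P.exists_ιY i _ (P.πY_prW_eq_zero i n _ (P.πY_ιY i z))
  have := LinearMap.congr_fun hs z'
  simp only [LinearMap.comp_apply, LinearMap.coe_restrictScalars, LinearMap.id_apply] at this ⊢
  rw [← hz', this]

/-- The gradings of the syzygies. -/
def gradingY : (i : ℕ) → P.Projections (P.Y i)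
  | 0 => P.gradingTriv
  | i + 1 => (P.gradingW (P.jump i)).ofInjective ((P.ιY i).restrictScalars k) (P.ιY_injective i)
      (fun a z => (P.ιY i).map_smul a z) (fun n => (P.exists_prY i n).choose)
      fun n => (P.exists_prY i n).choose_spec

theorem ιY_gradingY (i n : ℕ) (z : P.Y (i + 1)) :
    P.ιY i ((P.gradingY (i + 1)).p n z) = P.prW (P.jump i) n (P.ιY i z) :=
  (P.exists_prY i n).choose_spec z

theorem πY_prW : ∀ (i n : ℕ) (F : P.KK i),
    P.πY i (P.prW (P.jump i) n F) = (P.gradingY i).p n (P.πY i F)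
  | 0, n, F => by
    change P.augK _ = (P.gradingTriv).p n (P.augK F)
    rw [augK_prW]
    by_cases h : n = 0 <;> simp [gradingTriv, h]
  | i + 1, n, F => P.ιY_injective i <| by
    rw [ιY_gradingY, ιY_πY, ιY_πY, dK_prW]

/-- The short exact sequences of syzygies as graded presentations. -/
def presentation (i : ℕ) (h : Function.Surjective (P.πY i)) :
    P.GradedPresentation (P.jump i) (P.gradingY i) (P.gradingY (i + 1)) where
  gK := P.gradingW (P.jump i)
  i := P.ιY i
  π := P.πY i
  inj := P.ιY_injective i
  surj := h
  zero := P.πY_ιY i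
  exact := P.exists_ιY i
  hi n z := P.ιY_gradingY i n z
  hπ n F := P.πY_prW i n F

end HomogeneousRelations

namespace HomogeneousRelations

open Words

variable {k V : Type u} [Field k] [AddCommGroup V] [Module k V] [FiniteDimensional k V]
  (P : HomogeneousRelations k V)

/-! ## Exactness of the Koszul complex -/

variable {P} in
theorem mem_W_cast {m n : ℕ} (h : m = n) {F : List (Letter k V) → P.Alg}
    (hF : F ∈ P.W P.Alg P.Alg m) : F ∈ P.W P.Alg P.Alg n := h ▸ hF

variable {P} in
theorem apply_mem_Rw {n : ℕ} {c : List (Letter k V) → k} (hc : c ∈ P.W k k n)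
    (u v : List (Letter k V)) (h : u.length + P.N + v.length = n) :
    (fun t => c (u ++ t ++ v)) ∈ P.Rw :=
  P.mem_W_N.1 (WS_slice hc u v h)

variable {P} in
theorem mem_W_of_slices {n : ℕ} {c : List (Letter k V) → k} (hc : ∀ u, u.length ≠ n → c u = 0)
    (h : ∀ u v : List (Letter k V), u.length + P.N + v.length = n →
      (fun t => c (u ++ t ++ v)) ∈ P.Rw) : c ∈ P.W k k n :=
  ⟨hc, fun _ hρ u v huv => hρ _ (h u v huv)⟩

theorem wsum_mon_append {a b : ℕ} (c : List (Letter k V) → k) :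
    (wsum b fun t => P.evalWord a (fun u => c (u ++ t)) * mon P.x t) = P.evalWord (a + b) c := by
  rw [evalWord, wsum_append, wsum_wsum_comm]
  refine wsum_congr fun t _ => ?_
  rw [evalWord, wsum_mul]
  refine wsum_congr fun u _ => ?_
  rw [mon_append, smul_mul_assoc]

theorem dL_pow_evalWord {a g : ℕ} {F : List (Letter k V) → P.Alg} {c : List (Letter k V) → k}
    (hF : ∀ w, F w = P.evalWord a fun u => c (u ++ w)) (w : List (Letter k V)) :
    (dL P.x ^ g) F w = P.evalWord (a + g) fun u => c (u ++ w) := by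
  rw [dL_pow_apply, ← wsum_mon_append]
  refine wsum_congr fun t _ => ?_
  rw [hF]
  simp only [List.append_assoc]

theorem evalWord_of_relation {m : ℕ} {c : List (Letter k V) → k}
    (h : ∀ v : List (Letter k V), v.length = m → (fun u => c (u ++ v)) ∈ P.Rw) :
    P.evalWord (P.N + m) c = 0 := by
  rw [← wsum_mon_append]
  exact wsum_eq_zero fun t ht => by
    rw [evalWord, P.relation (h t ht), zero_mul]

/-- The elements of `A_m ⊗ W_n`, for `m < N`, are given by scalar valued functions. -/
theorem exists_word_coeff {m n : ℕ} (hm : m < P.N) {F : List (Letter k V) → P.Alg}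
    (hF : F ∈ P.W P.Alg P.Alg n) (hp : ∀ w, P.pr m (F w) = F w) :
    ∃ c : List (Letter k V) → k, (∀ u, u.length ≠ m + n → c u = 0) ∧
      (∀ w, F w = P.evalWord m fun u => c (u ++ w)) ∧
      ∀ u, u.length = m → (fun w => c (u ++ w)) ∈ P.W k k n := by
  choose c hc hcF using fun w => P.exists_evalWord m (F w)
  have hc' : ∀ u w, u.length = m →
      (fun u => if u.length = m + n then c (u.drop m) (u.take m) else 0) (u ++ w) =
      if w.length = n then c w u else 0 := by
    intro u w hu
    subst hu
    simp
  refine ⟨fun u => if u.length = m + n then c (u.drop m) (u.take m) else 0,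
    fun u hu => if_neg hu, fun w => ?_, fun u hu => ?_⟩
  · have : (P.evalWord m fun u => if w.length = n then c w u else 0) = F w := by
      split_ifs with h
      · rw [← hp, ← hcF]
      · rw [hF.1 w h]
        simp [evalWord]
    rw [← this]
    refine wsum_congr fun u hu => ?_
    rw [hc' u w hu]
  · refine ⟨fun w hw => ?_, fun ρ hρ a b hab => ?_⟩
    · rw [hc' u w hu, if_neg hw]
    · have key := P.evalWord_injective hm (c := fun u => wsum P.N fun t => ρ t * c (a ++ t ++ b) u)
        (by
          have := congrArg (P.pr m) (hF.2 ρ hρ a b hab)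
          rw [map_zero, map_wsum] at this
          rw [← this, evalWord]
          simp only [map_smul, ← hcF, evalWord, smul_wsum, wsum_smul]
          rw [wsum_wsum_comm]
          simp only [mul_smul]) u hu
      refine (wsum_congr fun t ht => ?_).trans key
      have := hc' u (a ++ t ++ b) hu
      rw [if_pos (by simp; omega)] at this
      exact congrArg (ρ t * ·) this

/-- Exactness at the term `A ⊗ W_N` of the Koszul complex. -/
def ExactTwo : Prop := ∀ F ∈ P.W P.Alg P.Alg P.N, (dL P.x ^ (P.N - 1)) F = 0 →
  ∃ G ∈ P.W P.Alg P.Alg (P.N + 1), dL P.x G = F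

/-- The extra condition on the relations: `(V^{⊗m} ⊗ R) ∩ (R ⊗ V^{⊗m})` is contained in `W_{N+m}`
for `m < N`. -/
theorem mem_W_of_prefix_suffix {m : ℕ} (hm : m < P.N) (hS : m ≤ 1 ∨ P.ExactTwo)
    {c : List (Letter k V) → k} (hc : ∀ u, u.length ≠ P.N + m → c u = 0)
    (h1 : ∀ v : List (Letter k V), v.length = m → (fun t => c (t ++ v)) ∈ P.Rw)
    (h2 : ∀ u : List (Letter k V), u.length = m → (fun t => c (u ++ t)) ∈ P.Rw) :
    c ∈ P.W k k (P.N + m) := by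
  induction m generalizing c with
  | zero => exact P.mem_W_N.2 (by simpa using h1 [] rfl)
  | succ m ih =>
    by_cases hm0 : m = 0
    · subst hm0
      refine mem_W_of_slices hc fun u v huv => ?_
      rcases Nat.eq_zero_or_pos u.length with hu | hu
      · obtain rfl := List.length_eq_zero_iff.1 hu
        exact h1 v (by simp at huv; omega)
      · obtain rfl := List.length_eq_zero_iff.1 (show v.length = 0 by omega)
        simpa using h2 u (by simp at huv; omega)
    have hS' : P.ExactTwo := hS.resolve_left (by omega)
    -- The first m + 1 letters are evaluated in A. By the suffix condition the result lies in
    -- A_{m+1} ⊗ W_N, and by the prefix condition it is a cycle.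
    have hF : (fun w => P.evalWord (m + 1) fun u => c (u ++ w)) ∈ P.W P.Alg P.Alg P.N := by
      refine ⟨fun w hw => wsum_eq_zero fun u hu => ?_, fun ρ hρ a b hab => ?_⟩
      · change c (u ++ w) • _ = 0
        rw [hc _ (by simp; omega), zero_smul]
      · simp only [evalWord, smul_wsum]
        rw [wsum_wsum_comm]
        refine wsum_eq_zero fun u hu => ?_
        have := (P.mem_W_N.2 (h2 u hu)).2 ρ hρ a b hab
        simp only [← smul_assoc]
        rw [← wsum_smul, this, zero_smul]
    obtain ⟨G, hG, hGF⟩ := hS' _ hF (by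
      funext w
      rw [P.dL_pow_evalWord (fun w => rfl)]
      by_cases hw : w.length = 1
      · rw [show m + 1 + (P.N - 1) = P.N + m by have := P.two_le; omega]
        refine P.evalWord_of_relation fun v hv => ?_
        simpa using h1 (v ++ w) (by simp; omega)
      · refine wsum_eq_zero fun u hu => ?_
        change c (u ++ w) • _ = 0
        rw [hc _ (by simp; omega), zero_smul])
    -- The degree m part of the primitive lifts to words, and injectivity of evaluation below degree
    -- N gives c = g. Hence c lies in V^{⊗m} ⊗ W_{N+1}, which provides one more window than assumed.
    obtain ⟨g, hg, hgG, hgW⟩ := P.exists_word_coeff (m := m) (by omega)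
      (WS_map (S' := P.Alg) hG (P.pr m)) (fun w => by rw [pr_pr, if_pos rfl])
    have hcg : ∀ u w, u.length = m + 1 → c (u ++ w) = g (u ++ w) := by
      intro u w hu
      refine sub_eq_zero.1 (P.evalWord_injective (m := m + 1) hm
        (c := fun u => c (u ++ w) - g (u ++ w)) ?_ u hu)
      have e1 := P.dL_pow_evalWord (g := 1) hgG w
      have e2 := P.pr_dL_pow 1 m G w
      rw [← e2, pow_one, hGF, pr_evalWord] at e1
      rw [evalWord]
      simp only [sub_smul]
      rw [wsum_sub]
      exact sub_eq_zero.2 e1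
    have hcg' : c = g := by
      funext u
      by_cases hu : u.length = P.N + (m + 1)
      · have := hcg (u.take (m + 1)) (u.drop (m + 1)) (by simp; omega)
        simpa using this
      · rw [hc u hu, hg u (by omega)]
    -- With the last letter fixed, the new window is a suffix condition with m in place of m + 1, so
    -- the induction hypothesis applies.
    have hlast : ∀ b, (fun t => c (t ++ [b])) ∈ P.W k k (P.N + m) := fun b => by
      refine ih (by omega) (Or.inr hS') (fun u hu => hc _ (by simp; omega)) (fun v hv => ?_)
        fun u hu => ?_
      · simpa using h1 (v ++ [b]) (by simp; omega)
      · have := apply_mem_Rw (hgW u hu) [] [b] (by simp)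
        simpa [hcg'] using this
    refine mem_W_of_slices hc fun u v huv => ?_
    rcases List.eq_nil_or_concat v with rfl | ⟨v, b, rfl⟩
    · simpa using h2 u (by simp at huv; omega)
    · have := apply_mem_Rw (hlast b) u v (by simp at huv; omega)
      simpa using this

/-- The cycles of the Koszul complex of least degree. -/
theorem exists_of_cycle_of_least_degree {m n : ℕ} (hm : m < P.N)
    (hS : m ≤ 1 ∨ P.ExactTwo) (hn : P.N ≤ n) {F : List (Letter k V) → P.Alg}
    (hF : F ∈ P.W P.Alg P.Alg n) (hp : ∀ w, P.pr m (F w) = F w)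
    (h0 : (dL P.x ^ (P.N - m)) F = 0) : ∃ G ∈ P.W P.Alg P.Alg (n + m), (dL P.x ^ m) G = F := by
  obtain ⟨c, hc, hcF, hcW⟩ := P.exists_word_coeff hm hF hp
  -- The cycle condition says that the first N letters evaluate to zero in A, and in degree N only
  -- relations do.
  have hpre : ∀ w : List (Letter k V), w.length + P.N = m + n → (fun t => c (t ++ w)) ∈ P.Rw := by
    intro w hw
    refine P.mem_Rw_of_evalWord (fun u hu => hc _ (by simp; omega)) ?_
    have := congrFun h0 w
    rwa [P.dL_pow_evalWord hcF, show m + (P.N - m) = P.N by omega] at this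
  have hW : c ∈ P.W k k (n + m) := by
    refine mem_W_of_slices (fun u hu => hc u (by omega)) fun u v huv => ?_
    -- A window starting before position m lies in the first N + m letters, where the prefix-suffix
    -- criterion applies; a later one lies entirely in the factor W_n.
    rcases Nat.lt_or_ge u.length m with hu | hu
    · obtain ⟨v₁, v₂, rfl, hv⟩ : ∃ v₁ v₂, v = v₁ ++ v₂ ∧ u.length + v₁.length = m :=
        ⟨v.take (m - u.length), v.drop (m - u.length), by simp, by simp; omega⟩
      have hwin : (fun t => c (t ++ v₂)) ∈ P.W k k (P.N + m) := by
        simp only [List.length_append] at huv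
        refine P.mem_W_of_prefix_suffix hm hS (fun u hu => hc _ (by simp; omega)) (fun v hv => ?_)
          fun u hu => ?_
        · simpa using hpre (v ++ v₂) (by simp; omega)
        · simpa using apply_mem_Rw (hcW u hu) [] v₂ (by simp; omega)
      simpa using apply_mem_Rw hwin u v₁ (by omega)
    · have := apply_mem_Rw (hcW (u.take m) (by simp; omega)) (u.drop m) v (by simp; omega)
      have h3 : ∀ t, List.take m u ++ (List.drop m u ++ t ++ v) = u ++ t ++ v := fun t => by
        simp [← List.append_assoc]
      simpa only [h3] using this
  refine ⟨_, P.incl_mem hW, funext fun w => ?_⟩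
  rw [hcF, dL_pow_apply, evalWord]
  exact wsum_congr fun u _ => by rw [Algebra.smul_def]

/-- The Koszul complex is minimal. -/
theorem aug_eq_zero_of_cycle {n g : ℕ} (hg : g < P.N) {F : List (Letter k V) → P.Alg}
    (hF : F ∈ P.W P.Alg P.Alg (n + g)) (h : (dL P.x ^ g) F = 0) (w : List (Letter k V)) :
    P.aug (F w) = 0 := by
  by_cases hw : w.length = n + g
  · have h1 := congrArg (P.pr (0 + g)) (congrFun h (w.drop g))
    rw [pr_dL_pow, dL_pow_apply, Pi.zero_apply, map_zero] at h1
    have h2 := P.evalWord_injective hg (c := fun u => P.aug (F (u ++ w.drop g))) (by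
      rw [← h1, evalWord]
      exact wsum_congr fun u _ => by rw [pr_zero, Algebra.smul_def]) (w.take g) (by simp; omega)
    simpa using h2
  · rw [hF.1 w hw, map_zero]

theorem exists_eq_sum_x_smul {l : ℕ} {F : P.W P.Alg P.Alg l} (hF : ∀ w, P.aug (F.1 w) = 0) :
    ∃ G : Letter k V → P.W P.Alg P.Alg l, F = ∑ i, P.x i • G i := by
  choose b hb using fun s => P.exists_eq_sum_x_mul (coef P.N P.Rw l s F.1)
  refine ⟨fun i => ∑ s, b s i • incl P.Alg ⟨bas P.N P.Rw l s, bas_mem P.N P.Rw l s⟩, ?_⟩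
  conv_lhs => rw [eq_sum_coef_incl F]
  simp only [Finset.smul_sum]
  rw [Finset.sum_comm]
  refine Finset.sum_congr rfl fun s _ => ?_
  have : P.aug (coef P.N P.Rw l s F.1) = 0 := by
    rw [coef, map_wsum]
    exact wsum_eq_zero fun u _ => by rw [map_smul, hF, smul_zero]
  conv_lhs => rw [hb s, this, map_zero, zero_add, Finset.sum_smul]
  simp only [mul_smul]

theorem πY_zero_surjective : Function.Surjective (P.πY 0) := fun c =>
  ⟨⟨fun u => if u.length = 0 then algebraMap k P.Alg (P.trivEquiv c) else 0,
    (mem_WS_of_lt (by rw [jump_zero]; have := P.two_le; omega)).2 fun u hu => by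
      rw [jump_zero] at hu; exact if_neg hu⟩, by
    change P.aug (algebraMap k P.Alg _) = _
    rw [AlgHom.commutes]
    rfl⟩

theorem πY_succ_surjective {i : ℕ} (h : ∀ z : P.Y (i + 1), ∃ F, P.dK i F = P.ιY i z) :
    Function.Surjective (P.πY (i + 1)) := fun z => by
  obtain ⟨F, hF⟩ := h z
  exact ⟨F, P.ιY_injective i (by rw [ιY_πY, hF])⟩

theorem πY_one_surjective : Function.Surjective (P.πY 1) :=
  P.πY_succ_surjective fun z => by
    obtain ⟨G, hG, h⟩ := P.exact_zero (F := (P.ιY 0 z).1) (mem_W_cast P.jump_zero (P.ιY 0 z).2) (P.πY_ιY 0 z)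
    refine ⟨⟨G, mem_W_cast P.jump_one.symm hG⟩, Subtype.ext ?_⟩
    rw [dK_coe, gap_zero, pow_one, h]

theorem dK_ιY (i : ℕ) (z : P.Y (i + 2)) : P.dK i (P.ιY (i + 1) z) = 0 := by
  rw [← ιY_πY, πY_ιY, map_zero]

theorem πY_two_surjective : Function.Surjective (P.πY 2) :=
  P.πY_succ_surjective fun z => by
    have h0 := congrArg Subtype.val (P.dK_ιY 0 z)
    rw [dK_coe, gap_zero, pow_one] at h0
    obtain ⟨G, hG, h⟩ := P.exact_one (F := (P.ιY 1 z).1) (mem_W_cast P.jump_one (P.ιY 1 z).2) h0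
    refine ⟨⟨G, mem_W_cast P.jump_two.symm hG⟩, Subtype.ext ?_⟩
    rw [dK_coe, gap_one, h]

theorem jump_mono {i j : ℕ} (h : i ≤ j) : P.jump i ≤ P.jump j :=
  monotone_nat_of_le_succ (fun i => by rw [jump_succ]; omega) h

/-- Outside of the degree `n(i + 2)`, the syzygies are generated in lower degrees. -/
theorem gradingY_mem_span (hK : P.IsKoszul) {i : ℕ} (hi : 1 ≤ i)
    (h : ∀ l, l ≤ i + 1 → Function.Surjective (P.πY l)) {j : ℕ} (hj : j ≠ P.jump (i + 2))
    (z : P.Y (i + 2)) : (P.gradingY (i + 2)).p j z ∈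
      Submodule.span k {y : P.Y (i + 2) | ∃ s z', y = P.x s • z'} := by
  by_contra hz
  obtain ⟨f, hfz, hf⟩ := Submodule.exists_le_ker_of_notMem hz
  have hf' : ∀ s z', f (P.x s • z') = 0 := fun s z' => hf (Submodule.subset_span ⟨s, z', rfl⟩)
  -- Shifting from k through the first i + 1 syzygies: the degree j part of Ext^{i+2}(k,k) vanishes,
  -- hence so does the corresponding part of the cohomology of each of these syzygies.
  have hCV : ∀ l, l ≤ i + 1 → ∀ n, l + n = i + 1 → P.CochainVanishes (P.gradingY l) n j := by
    intro l
    induction l with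
    | zero =>
      intro _ n hn
      exact P.cochainVanishes_triv (hK n (by omega) j (by
        rwa [show n + 1 = i + 2 by omega]))
    | succ l ih =>
      intro hl n hn
      exact (P.presentation l (h l (by omega))).cochainVanishes (ih (by omega) (n + 1) (by omega))
  have hx : ∀ s y, f ((P.gradingY (i + 2)).p j (P.x s • y)) = 0 := fun s y => by
    cases j with
    | zero => rw [Projections.p_zero_x_smul, map_zero]
    | succ j => rw [Projections.p_succ_x_smul, hf']
  obtain ⟨Ψ, hΨ, hΨz⟩ := (P.presentation (i + 1) (h _ le_rfl)).exists_extension_linear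
    (hCV (i + 1) le_rfl 0 rfl) (f ∘ₗ (P.gradingY (i + 2)).p j)
    (by
      intro d y hd hy
      rw [LinearMap.comp_apply, ← hy, (P.gradingY (i + 2)).orth, if_neg (Ne.symm hd), map_zero])
    (by
      intro a y
      obtain ⟨b, hb⟩ := P.exists_eq_sum_x_mul a
      conv_lhs => rw [hb, add_smul, map_add, algebraMap_smul, map_smul, Finset.sum_smul, map_sum]
      rw [Finset.sum_eq_zero, add_zero, smul_eq_mul]
      intro s _
      rw [mul_smul]
      exact hx s _)
  refine hfz ?_
  -- By minimality the syzygy sits in A_+ times the Koszul term, so an A-linear form to k defined on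
  -- the whole term kills it. This contradicts the choice of f.
  have h0 := P.dK_ιY i z
  obtain ⟨G, hG⟩ := P.exists_eq_sum_x_smul (F := P.ιY (i + 1) z)
    (P.aug_eq_zero_of_cycle (n := P.jump i) (P.gap_lt i) (by
      rw [← jump_succ]
      exact (P.ιY (i + 1) z).2) (congrArg Subtype.val h0))
  have h1 := hΨz z
  rw [LinearMap.comp_apply] at h1
  rw [← h1]
  change Ψ (P.ιY (i + 1) z) = 0
  rw [hG, map_sum]
  exact Finset.sum_eq_zero fun s _ => by rw [hΨ, aug_x, zero_mul]

/-- Induction on the internal degree. Outside of n(i+2) an element is a combination of x_s z', with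
z' replaceable by a component of smaller degree; in degree n(i+2) it is a cycle of least degree and
comes from W_{n(i+2)} directly. -/
theorem πY_add_two_surjective (hK : P.IsKoszul) {i : ℕ} (hi : 1 ≤ i)
    (h : ∀ l, l ≤ i + 1 → Function.Surjective (P.πY l)) (hS : i = 1 ∨ P.ExactTwo) :
    Function.Surjective (P.πY (i + 2)) := by
  have key : ∀ (j : ℕ) (z : P.Y (i + 2)),
      (P.gradingY (i + 2)).p j z ∈ LinearMap.range (P.πY (i + 2)) := by
    intro j
    induction j with
    | zero =>
      intro z
      have hmem := P.gradingY_mem_span hK hi h (j := 0) (by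
        have : P.jump (i + 2) = P.jump (i + 1) + P.gap (i + 1) := P.jump_succ (i + 1)
        have := P.gap_pos (i + 1)
        omega) z
      have : (P.gradingY (i + 2)).p 0 z = 0 := by
        have h0 := (P.gradingY (i + 2)).orth 0 0 z
        rw [if_pos rfl] at h0
        rw [← h0]
        generalize (P.gradingY (i + 2)).p 0 z = y at hmem ⊢
        clear h0
        induction hmem using Submodule.span_induction with
        | mem y hy => obtain ⟨s, z', rfl⟩ := hy; exact Projections.p_zero_x_smul _ _ _
        | zero => exact map_zero _
        | add y y' _ _ hy hy' => rw [map_add, hy, hy', add_zero]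
        | smul c y _ hy => rw [map_smul, hy, smul_zero]
      rw [this]
      exact zero_mem _
    | succ j ih =>
      intro z
      by_cases hj : j + 1 = P.jump (i + 2)
      · have hjump : P.jump (i + 2) = P.jump (i + 1) + P.gap (i + 1) := P.jump_succ (i + 1)
        have hιp : ∀ w, (P.ιY (i + 1) ((P.gradingY (i + 2)).p (j + 1) z)).1 w =
            P.pr (P.gap (i + 1)) ((P.ιY (i + 1) z).1 w) := fun w => by
          rw [ιY_gradingY, prW_apply P (by omega)]
          congr 1
          rw [hj, hjump, Nat.add_sub_cancel_left]
        have h0 := P.dK_ιY i ((P.gradingY (i + 2)).p (j + 1) z)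
        obtain ⟨G, hG, hGF⟩ := P.exists_of_cycle_of_least_degree (P.gap_lt (i + 1))
          (n := P.jump (i + 1)) (by
            refine hS.imp_left ?_
            rintro rfl
            simp [gap])
          (by
            rw [← jump_two]
            exact P.jump_mono (by omega))
          (P.ιY (i + 1) ((P.gradingY (i + 2)).p (j + 1) z)).2
          (fun w => by rw [hιp, pr_pr, if_pos rfl])
          (by
            have := P.gap_add i
            rw [show P.N - P.gap (i + 1) = P.gap i by omega]
            exact congrArg Subtype.val h0)
        refine ⟨⟨G, mem_W_cast hjump.symm hG⟩, P.ιY_injective (i + 1) ?_⟩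
        rw [ιY_πY]
        exact Subtype.ext hGF
      · have hmem := P.gradingY_mem_span hK hi h hj z
        have h0 := (P.gradingY (i + 2)).orth (j + 1) (j + 1) z
        rw [if_pos rfl] at h0
        rw [← h0]
        generalize (P.gradingY (i + 2)).p (j + 1) z = y at hmem ⊢
        clear h0
        induction hmem using Submodule.span_induction with
        | mem y hy =>
          obtain ⟨s, z', rfl⟩ := hy
          rw [Projections.p_succ_x_smul]
          exact Submodule.smul_mem _ _ (ih z')
        | zero => rw [map_zero]; exact zero_mem _
        | add y y' _ _ hy hy' => rw [map_add]; exact add_mem hy hy'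
        | smul c y _ hy =>
          rw [map_smul, ← algebraMap_smul P.Alg c]
          exact Submodule.smul_mem _ _ hy
  intro z
  obtain ⟨b, -, hb⟩ := (P.gradingY (i + 2)).fin z
  have : z ∈ LinearMap.range (P.πY (i + 2)) := by
    rw [← hb]
    exact sum_mem fun j _ => key j z
  exact this

/-- The Koszul complex of a Koszul algebra is a resolution. -/
theorem πY_surjective (hK : P.IsKoszul) (i : ℕ) : Function.Surjective (P.πY i) := by
  have h012 : ∀ l, l ≤ 2 → Function.Surjective (P.πY l) := fun l hl => by
    match l, hl with
    | 0, _ => exact P.πY_zero_surjective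
    | 1, _ => exact P.πY_one_surjective
    | 2, _ => exact P.πY_two_surjective
  -- Here only one letter is moved, so the prefix and suffix windows are all the windows and no
  -- extra condition is required. The outcome is exactness at A ⊗ W_N, which supplies the extra
  -- condition for all later steps.
  have h3 : Function.Surjective (P.πY 3) :=
    P.πY_add_two_surjective hK le_rfl h012 (Or.inl rfl)
  have hS : P.ExactTwo := by
    intro F hF h0
    have hF' : F ∈ P.W P.Alg P.Alg (P.jump 2) := mem_W_cast P.jump_two.symm hF
    obtain ⟨G, hG⟩ := h3 ⟨⟨F, hF'⟩, Subtype.ext (by rw [dK_coe, gap_one, h0]; rfl)⟩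
    refine ⟨G.1, ?_, ?_⟩
    · exact mem_W_cast (by rw [P.jump_succ 2, jump_two]; simp [gap]) G.2
    · have := congrArg (fun y => (P.ιY 2 y).1) hG
      simp only [ιY_πY, dK_coe] at this
      rw [show P.gap 2 = 1 by simp [gap], pow_one] at this
      exact this
  induction i using Nat.strong_induction_on with
  | h i ih =>
    match i, ih with
    | 0, _ => exact h012 0 (by omega)
    | 1, _ => exact h012 1 (by omega)
    | 2, _ => exact h012 2 (by omega)
    | i + 3, ih =>
      exact P.πY_add_two_surjective hK (i := i + 1) (by omega) (fun l hl => ih l (by omega))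
        (Or.inr hS)

end HomogeneousRelations

/-! ## `Ext` groups and syzygies -/

open Abelian in
/-- A resolution of the object `Y 0` by the projective objects `K i`, given as a sequence of short
exact sequences. -/
structure Syzygies (C : Type u) [Category.{v} C] [Abelian C] where
  /-- the syzygies -/
  Y : ℕ → C
  /-- the terms of the resolution -/
  K : ℕ → C
  /-- the inclusions of the syzygies -/
  i (n : ℕ) : Y (n + 1) ⟶ K n
  /-- the projections onto the syzygies -/
  π (n : ℕ) : K n ⟶ Y n
  zero (n : ℕ) : i n ≫ π n = 0
  exact (n : ℕ) : (ShortComplex.mk (i n) (π n) (zero n)).ShortExact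
  proj (n : ℕ) : Projective (K n)

namespace Syzygies

open Abelian

variable {C : Type u} [Category.{v} C] [Abelian C] [HasExt.{w} C] (S : Syzygies C)

/-- The class of the extension of `Y n` by `Y (n + 1)`. -/
def δ (n : ℕ) : Ext.{w} (S.Y n) (S.Y (n + 1)) 1 := (S.exact n).extClass

/-- The iterated extension of `Y 0` by `Y n`. -/
def Δ : (n : ℕ) → Ext.{w} (S.Y 0) (S.Y n) n
  | 0 => Ext.mk₀ (𝟙 _)
  | n + 1 => (Δ n).comp (S.δ n) rfl

/-- The class in `Ext^n (Y 0, M)` of a morphism from the syzygy `Y n` to `M`. -/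
def cl {n : ℕ} {M : C} (f : S.Y n ⟶ M) : Ext.{w} (S.Y 0) M n :=
  (S.Δ n).comp (Ext.mk₀ f) (add_zero n)

variable {M M' : C}

theorem cl_add {n : ℕ} (f g : S.Y n ⟶ M) : S.cl (f + g) = S.cl f + S.cl g := by
  rw [cl, Ext.mk₀_add, Ext.comp_add]; rfl

theorem cl_smul {R : Type t} [CommRing R] [Linear R C] {n : ℕ} (r : R) (f : S.Y n ⟶ M) :
    S.cl (r • f) = r • S.cl f := by
  rw [cl, Ext.mk₀_smul, Ext.comp_smul]; rfl

theorem cl_comp {n : ℕ} (f : S.Y n ⟶ M) (g : M ⟶ M') :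
    S.cl (f ≫ g) = (S.cl f).comp (Ext.mk₀ g) (add_zero n) := by
  rw [cl, cl, Ext.comp_assoc_of_third_deg_zero, Ext.mk₀_comp_mk₀]

theorem δ_comp_injective {m n : ℕ} (x : Ext.{w} (S.Y (m + 1)) M (n + 1))
    (h : (S.δ m).comp x (Nat.add_comm 1 (n + 1)) = 0) : x = 0 := by
  have := S.proj m
  obtain ⟨y, rfl⟩ := Ext.contravariant_sequence_exact₁ (S.exact m) M x _ h
  rw [Ext.eq_zero_of_projective y, Ext.comp_zero]

theorem exists_δ_comp {m n : ℕ} (x : Ext.{w} (S.Y m) M (n + 1)) :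
    ∃ y : Ext.{w} (S.Y (m + 1)) M n, (S.δ m).comp y (Nat.add_comm 1 n) = x := by
  have := S.proj m
  exact Ext.contravariant_sequence_exact₃ (S.exact m) M x (Ext.eq_zero_of_projective _) _

theorem Δ_comp_injective (m : ℕ) {n l : ℕ} (hl : m + (n + 1) = l)
    (x : Ext.{w} (S.Y m) M (n + 1)) (h : (S.Δ m).comp x hl = 0) : x = 0 := by
  induction m generalizing n with
  | zero =>
    obtain rfl : l = n + 1 := by omega
    rwa [Δ, Ext.mk₀_id_comp] at h
  | succ m ih =>
    rw [Δ, Ext.comp_assoc _ _ _ _ (Nat.add_comm 1 (n + 1)) (by omega)] at h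
    exact S.δ_comp_injective x (ih (n := n + 1) (by omega) _ h)

theorem exists_Δ_comp (m : ℕ) {n l : ℕ} (hl : m + n = l) (x : Ext.{w} (S.Y 0) M l) :
    ∃ y : Ext.{w} (S.Y m) M n, (S.Δ m).comp y hl = x := by
  induction m generalizing n with
  | zero =>
    obtain rfl : l = n := by omega
    exact ⟨x, by rw [Δ, Ext.mk₀_id_comp]⟩
  | succ m ih =>
    obtain ⟨y, rfl⟩ := ih (n := n + 1) (by omega)
    obtain ⟨z, rfl⟩ := S.exists_δ_comp y
    exact ⟨z, by rw [Δ, Ext.comp_assoc]; omega⟩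

theorem cl_surjective (n : ℕ) (x : Ext.{w} (S.Y 0) M n) : ∃ f : S.Y n ⟶ M, S.cl f = x := by
  obtain ⟨y, rfl⟩ := S.exists_Δ_comp n (add_zero n) x
  obtain ⟨f, rfl⟩ := (Ext.mk₀_bijective _ _).2 y
  exact ⟨f, rfl⟩

theorem cl_zero_eq_zero {f : S.Y 0 ⟶ M} (h : S.cl f = 0) : f = 0 := by
  rwa [cl, Δ, Ext.mk₀_id_comp, Ext.mk₀_eq_zero_iff] at h

/-- Composition with the first n extension classes is injective in positive degree because the terms
are projective, so only the last short exact sequence matters. -/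
theorem cl_succ_eq_zero_iff {n : ℕ} (f : S.Y (n + 1) ⟶ M) :
    S.cl f = 0 ↔ ∃ g : S.K n ⟶ M, S.i n ≫ g = f := by
  constructor
  · intro h
    rw [cl, Δ, Ext.comp_assoc _ _ _ _ (add_zero 1) (by omega)] at h
    have h' := S.Δ_comp_injective n (n := 0) rfl _ h
    obtain ⟨g, hg⟩ := Ext.contravariant_sequence_exact₁ (S.exact n) M (Ext.mk₀ f) _ h'
    obtain ⟨g, rfl⟩ := (Ext.mk₀_bijective _ _).2 g
    rw [Ext.mk₀_comp_mk₀] at hg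
    exact ⟨g, (Ext.mk₀_bijective _ _).1 hg⟩
  · rintro ⟨g, rfl⟩
    rw [cl, Δ, Ext.comp_assoc _ _ _ _ (add_zero 1) (by omega), ← Ext.mk₀_comp_mk₀]
    have := ShortComplex.ShortExact.extClass_comp_assoc (S.exact n) (Ext.mk₀ g)
      (h := add_zero 1)
    exact (congrArg (fun y => (S.Δ n).comp y _) this).trans (Ext.comp_zero _ _ _ _ _)

/-- The compatibility of iterated extensions with morphisms of resolutions. -/
theorem Δ_naturality {T : Syzygies C} (m : ℕ) (f : ∀ n, S.Y (m + n) ⟶ T.Y n)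
    (F : ∀ n, S.K (m + n) ⟶ T.K n) (l : ℕ)
    (hi : ∀ n < l, S.i (m + n) ≫ F n = f (n + 1) ≫ T.i n)
    (hπ : ∀ n < l, S.π (m + n) ≫ f n = F n ≫ T.π n) :
    ((S.Δ m).comp (Ext.mk₀ (f 0)) (add_zero m)).comp (T.Δ l) rfl =
      (S.Δ (m + l)).comp (Ext.mk₀ (f l)) (add_zero _) := by
  induction l with
  | zero =>
    rw [show T.Δ 0 = Ext.mk₀ (𝟙 _) from rfl]
    exact Ext.comp_mk₀_id _
  | succ l ih =>
    have ih := ih (fun n hn => hi n (by omega)) fun n hn => hπ n (by omega)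
    rw [show T.Δ (l + 1) = (T.Δ l).comp (T.δ l) rfl from rfl,
      ← Ext.comp_assoc _ _ _ rfl _ (by omega), ih]
    have h := ShortComplex.ShortExact.extClass_naturality (S.exact (m + l)) (T.exact l)
      ⟨f (l + 1), F l, f l, (hi l (by omega)).symm, (hπ l (by omega)).symm⟩
    rw [Ext.comp_assoc_of_second_deg_zero]
    change (S.Δ (m + l)).comp ((Ext.mk₀ (f l)).comp (T.exact l).extClass _) _ = _
    refine (congrArg (fun y => (S.Δ (m + l)).comp y rfl) h.symm).trans ?_
    rw [← Ext.comp_assoc_of_third_deg_zero]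
    rfl

/-- A Yoneda product is computed by lifting the first factor to a map from the shifted resolution to
the other one, as far as degree l. -/
theorem cl_comp_cl {T : Syzygies C} (m : ℕ) (f : ∀ n, S.Y (m + n) ⟶ T.Y n)
    (F : ∀ n, S.K (m + n) ⟶ T.K n) (l : ℕ)
    (hi : ∀ n < l, S.i (m + n) ≫ F n = f (n + 1) ≫ T.i n)
    (hπ : ∀ n < l, S.π (m + n) ≫ f n = F n ≫ T.π n) (g : T.Y l ⟶ M) :
    (S.cl (f 0)).comp (T.cl g) rfl = S.cl (f l ≫ g) := by
  rw [cl_comp, cl, cl, cl, ← S.Δ_naturality m f F l hi hπ, Ext.comp_assoc_of_third_deg_zero]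
  rfl

end Syzygies

/-! ### Contraction and concatenation of functions on words. -/

namespace Words

section Contraction

variable {k : Type*} [Field k] {ι : Type*} [Fintype ι] [DecidableEq ι]
  {M : Type*} [AddCommGroup M] [Module k M]

/-- The concatenation product of a function on words of length `m` with another function. -/
def conc (m : ℕ) (g f : List ι → k) : List ι → k := fun u => g (u.take m) * f (u.drop m)

theorem conc_append {m : ℕ} (g f : List ι → k) {s : List ι} (hs : s.length = m) (t : List ι) :
    conc m g f (s ++ t) = g s * f t := by
  subst hs
  simp [conc]

theorem contract_conc (a b : ℕ) (g f : List ι → k) (F : List ι → M) :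
    contract (a + b) (conc a g f) F = contract a g (contract b f F) := by
  funext u
  simp only [contract]
  rw [wsum_append]
  refine wsum_congr fun s hs => ?_
  rw [smul_wsum]
  refine wsum_congr fun t _ => ?_
  rw [conc_append _ _ hs, mul_smul, List.append_assoc]

theorem contract_add (b : ℕ) (f : List ι → k) (F G : List ι → M) :
    contract b f (F + G) = contract b f F + contract b f G := by
  funext u
  simp [contract, wsum_add_fun]

theorem contract_smul {S : Type*} [Semiring S] [Module S M] [SMulCommClass k S M] (b : ℕ)
    (f : List ι → k) (c : S) (F : List ι → M) : contract b f (c • F) = c • contract b f F := by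
  funext u
  simp [contract, smul_wsum, smul_comm (f _) c]

theorem contract_add_left (b : ℕ) (f g : List ι → k) (F : List ι → M) :
    contract b (f + g) F = contract b f F + contract b g F := by
  funext u
  simp [contract, add_smul, wsum_add_fun]

theorem contract_smul_left (b : ℕ) (c : k) (f : List ι → k) (F : List ι → M) :
    contract b (c • f) F = c • contract b f F := by
  funext u
  simp [contract, smul_wsum, smul_smul]

theorem map_contract {M' : Type*} [AddCommGroup M'] [Module k M'] (b : ℕ) (f : List ι → k)
    (φ : M →ₗ[k] M') (F : List ι → M) (u : List ι) :
    φ (contract b f F u) = contract b f (fun v => φ (F v)) u := by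
  simp [contract, map_wsum]

theorem contract_single {n : ℕ} (v : List ι) (hv : v.length = n) (F : List ι → M) (u : List ι) :
    contract n (Pi.single v (1 : k)) F u = F (u ++ v) := by
  have : (fun t => (Pi.single v (1 : k) : List ι → k) t • F (u ++ t)) =
      fun t => if t = v then F (u ++ t) else 0 := by
    funext t
    by_cases h : t = v
    · subst h; simp
    · simp [h]
  rw [contract, this, wsum_ite, if_pos hv]

theorem exists_contract_eq {N n : ℕ} {R : Submodule k (List ι → k)}
    (g : WS N R k k n →ₗ[k] k) : ∃ f : List ι → k, ∀ x, g x = contract n f x.1 [] := by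
  obtain ⟨g', hg'⟩ := LinearMap.exists_extend g
  refine ⟨fun u => g' (Pi.single u 1), fun x => ?_⟩
  rw [← hg', LinearMap.comp_apply, Submodule.subtype_apply, apply_eq_wsum g' x.2.1]
  exact wsum_congr fun u _ => by simp [mul_comm]

end Contraction

end Words

/-! ### Ext classes of linear maps on syzygies of modules. -/

namespace Syzygies

section Modules

variable {S : Type u} [Ring S] (T : Syzygies (ModuleCat.{u} S)) {M : ModuleCat.{u} S}

theorem exists_cl_ofHom (n : ℕ) (x : Abelian.Ext.{u} (T.Y 0) M n) :
    ∃ f : T.Y n →ₗ[S] M, T.cl (ModuleCat.ofHom f) = x := by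
  obtain ⟨f, rfl⟩ := T.cl_surjective n x
  exact ⟨f.hom, rfl⟩

theorem cl_ofHom_zero_eq_zero {f : T.Y 0 →ₗ[S] M}
    (h : T.cl (ModuleCat.ofHom f) = (0 : Abelian.Ext.{u} (T.Y 0) M 0)) : f = 0 :=
  congrArg ModuleCat.Hom.hom (T.cl_zero_eq_zero h)

theorem cl_ofHom_succ_eq_zero_iff {n : ℕ} (f : T.Y (n + 1) →ₗ[S] M) :
    T.cl (ModuleCat.ofHom f) = (0 : Abelian.Ext.{u} (T.Y 0) M (n + 1)) ↔
      ∃ g : T.K n →ₗ[S] M, ∀ y, g ((T.i n).hom y) = f y := by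
  rw [T.cl_succ_eq_zero_iff]
  constructor
  · rintro ⟨g, hg⟩
    exact ⟨g.hom, fun y => LinearMap.congr_fun (congrArg ModuleCat.Hom.hom hg) y⟩
  · rintro ⟨g, hg⟩
    refine ⟨ModuleCat.ofHom g, ?_⟩
    ext y
    exact hg y

theorem cl_ofHom_zero (n : ℕ) :
    T.cl (ModuleCat.ofHom (0 : T.Y n →ₗ[S] M)) = (0 : Abelian.Ext.{u} (T.Y 0) M n) := by
  rw [ModuleCat.ofHom_zero, cl, Abelian.Ext.mk₀_zero, Abelian.Ext.comp_zero]

end Modules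

end Syzygies

namespace HomogeneousRelations

open Words

variable {k V : Type u} [Field k] [AddCommGroup V] [Module k V] [FiniteDimensional k V]
  (P : HomogeneousRelations k V)

/-! ## The spaces `Ext_A^i(k, k)` and `Ext_A^i(k, A)` -/

/-- The Koszul resolution. -/
abbrev syz (hK : P.IsKoszul) : Syzygies (ModuleCat.{u} P.Alg) where
  Y := P.Y
  K i := ModuleCat.of P.Alg (P.KK i)
  i n := ModuleCat.ofHom (P.ιY n)
  π n := ModuleCat.ofHom (P.πY n)
  zero n := by
    ext z
    exact P.πY_ιY n z
  exact n := by
    refine ShortComplex.ShortExact.mk' ?_ ?_ ?_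
    · rw [ShortComplex.moduleCat_exact_iff]
      exact fun F hF => P.exists_ιY n F hF
    · exact (ModuleCat.mono_iff_injective _).2 (P.ιY_injective n)
    · exact (ModuleCat.epi_iff_surjective _).2 (P.πY_surjective hK n)
  proj n := (IsProjective.iff_projective _).1 (projective_WS _ _ _ _)

/-- The class of a linear map on a syzygy. -/
def clY (hK : P.IsKoszul) {i : ℕ} {M : ModuleCat.{u} P.Alg} (h : P.Y i →ₗ[P.Alg] M) :
    Abelian.Ext.{u} P.trivialModule M i := (P.syz hK).cl (n := i) (ModuleCat.ofHom h)

section Classes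

variable (hK : P.IsKoszul) {i : ℕ} {M : ModuleCat.{u} P.Alg}

theorem clY_add (h h' : P.Y i →ₗ[P.Alg] M) : P.clY hK (h + h') = P.clY hK h + P.clY hK h' :=
  (P.syz hK).cl_add (ModuleCat.ofHom h) (ModuleCat.ofHom h')

theorem clY_smul (c : k) (h h' : P.Y i →ₗ[P.Alg] M)
    (hh : ∀ y, h' y = algebraMap k P.Alg c • h y) : P.clY hK h' = c • P.clY hK h := by
  obtain rfl : h' = (c • ModuleCat.ofHom h).hom := LinearMap.ext hh
  exact (P.syz hK).cl_smul (n := i) c (ModuleCat.ofHom h)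

theorem exists_clY (x : Abelian.Ext.{u} P.trivialModule M i) :
    ∃ h : P.Y i →ₗ[P.Alg] M, P.clY hK h = x := (P.syz hK).exists_cl_ofHom i x

theorem clY_zero_eq_zero {h : P.Y 0 →ₗ[P.Alg] M} (h0 : P.clY hK h = 0) : h = 0 :=
  (P.syz hK).cl_ofHom_zero_eq_zero h0

theorem clY_zero : P.clY hK (0 : P.Y i →ₗ[P.Alg] M) = 0 := (P.syz hK).cl_ofHom_zero i

end Classes

section Maps

variable {P} {M : Type*} [AddCommGroup M] [Module P.Alg M]

theorem ιY_eq_dK (hK : P.IsKoszul) (i : ℕ) (z : P.Y (i + 1)) : ∃ F, P.dK i F = P.ιY i z := by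
  obtain ⟨F, rfl⟩ := P.πY_surjective hK (i + 1) z
  exact ⟨F, (P.ιY_πY i F).symm⟩

theorem πY_dK (i : ℕ) (F : P.KK (i + 1)) : P.πY i (P.dK i F) = 0 := by
  rw [← ιY_πY, πY_ιY]

/-- Linear maps on syzygies. -/
theorem exists_descend (hK : P.IsKoszul) {i : ℕ} (g : P.KK i →ₗ[P.Alg] M)
    (hg : ∀ F, g (P.dK i F) = 0) : ∃ h : P.Y i →ₗ[P.Alg] M, ∀ F, h (P.πY i F) = g F := by
  refine ⟨(LinearMap.ker (P.πY i)).liftQ g (fun F hF => ?_) ∘ₗ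
    ((P.πY i).quotKerEquivOfSurjective (P.πY_surjective hK i)).symm.toLinearMap, fun F => ?_⟩
  · obtain ⟨z, rfl⟩ := P.exists_ιY i F hF
    obtain ⟨G, hG⟩ := ιY_eq_dK hK i z
    rw [LinearMap.mem_ker, ← hG, hg]
  · have : ((P.πY i).quotKerEquivOfSurjective (P.πY_surjective hK i)).symm (P.πY i F) =
        (LinearMap.ker (P.πY i)).mkQ F := by
      rw [LinearEquiv.symm_apply_eq]
      rfl
    rw [LinearMap.comp_apply, LinearEquiv.coe_coe, this]
    rfl

theorem ext_πY (hK : P.IsKoszul) {i : ℕ} {g h : P.Y i →ₗ[P.Alg] M}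
    (hgh : ∀ x : P.W k k (P.jump i), g (P.πY i (incl P.Alg x)) = h (P.πY i (incl P.Alg x))) :
    g = h := by
  refine LinearMap.ext fun y => ?_
  obtain ⟨F, rfl⟩ := P.πY_surjective hK i y
  exact LinearMap.congr_fun
    (Words.hom_ext (f := g ∘ₗ P.πY i) (g := h ∘ₗ P.πY i) fun x => hgh x) F

theorem clY_succ_eq_zero_iff (hK : P.IsKoszul) {M : ModuleCat.{u} P.Alg} {i : ℕ}
    (h : P.Y (i + 1) →ₗ[P.Alg] M) : P.clY hK h = 0 ↔
      ∃ g : P.KK i →ₗ[P.Alg] M, ∀ F, h (P.πY (i + 1) F) = g (P.dK i F) := by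
  refine ((P.syz hK).cl_ofHom_succ_eq_zero_iff h).trans (exists_congr fun g => ?_)
  change (∀ y, g (P.ιY i y) = h y) ↔ _
  constructor
  · intro hg F
    rw [← hg, ιY_πY]
  · intro hg y
    obtain ⟨F, rfl⟩ := P.πY_surjective hK (i + 1) y
    rw [hg, ιY_πY]

end Maps

theorem aug_dK (i : ℕ) (F : P.KK (i + 1)) (u : List (Letter k V)) :
    P.aug ((P.dK i F).1 u) = 0 := by
  rw [dK_coe, dL_pow_apply, map_wsum]
  refine wsum_eq_zero fun t ht => ?_
  have := P.gap_pos i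
  rw [map_mul, aug_mon, if_neg (by omega), mul_zero]

/-- Contraction with a function on words, as a linear form on `A ⊗ W_n`. -/
def evA (n : ℕ) (f : List (Letter k V) → k) : P.W P.Alg P.Alg n →ₗ[P.Alg] P.Alg where
  toFun F := contract n f F.1 []
  map_add' F G := by rw [Submodule.coe_add, contract_add, Pi.add_apply]
  map_smul' c F := by rw [Submodule.coe_smul, contract_smul, Pi.smul_apply, RingHom.id_apply]

theorem evA_incl (n : ℕ) (f : List (Letter k V) → k) (x : P.W k k n) :
    P.evA n f (incl P.Alg x) = algebraMap k P.Alg (contract n f x.1 []) :=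
  (map_contract n f (Algebra.linearMap k P.Alg) x.1 []).symm

theorem aug_evA {n : ℕ} (f : List (Letter k V) → k) (F : P.W P.Alg P.Alg n) :
    P.aug (P.evA n f F) = contract n f (fun u => P.aug (F.1 u)) [] :=
  map_contract n f P.aug.toLinearMap F.1 []

theorem aug_map_dK {i : ℕ} (g : P.KK i →ₗ[P.Alg] P.Alg) (F : P.KK (i + 1)) :
    P.aug (g (P.dK i F)) = 0 := by
  obtain ⟨G, hG⟩ := P.exists_eq_sum_x_smul (P.aug_dK i F)
  rw [hG, map_sum, map_sum]
  exact Finset.sum_eq_zero fun s _ => by rw [map_smul, smul_eq_mul, map_mul, aug_x, zero_mul]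

/-- Minimality: the differential has values in A_+ times the next term, and A_+ acts on k by zero.
So the differentials of Hom_A(K, k) vanish. -/
theorem triv_map_dK {i : ℕ} (g : P.KK i →ₗ[P.Alg] P.trivialModule) (F : P.KK (i + 1)) :
    g (P.dK i F) = 0 := by
  obtain ⟨G, hG⟩ := P.exists_eq_sum_x_smul (P.aug_dK i F)
  rw [hG, map_sum]
  refine Finset.sum_eq_zero fun s _ => P.trivEquiv.injective ?_
  rw [map_smul, trivEquiv_smul, aug_x, zero_mul, map_zero]

theorem exists_formY (hK : P.IsKoszul) (i : ℕ) (f : List (Letter k V) → k) :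
    ∃ h : P.Y i →ₗ[P.Alg] P.trivialModule, ∀ F, h (P.πY i F) = P.augLinear (P.evA _ f F) :=
  exists_descend hK (P.augLinear ∘ₗ P.evA (P.jump i) f) fun F => P.triv_map_dK _ F

/-- The linear map from a syzygy to `k` given by a function on words. -/
def formY (hK : P.IsKoszul) (i : ℕ) (f : List (Letter k V) → k) :
    P.Y i →ₗ[P.Alg] P.trivialModule := (P.exists_formY hK i f).choose

theorem formY_πY (hK : P.IsKoszul) (i : ℕ) (f : List (Letter k V) → k) (F : P.KK i) :
    P.formY hK i f (P.πY i F) = P.augLinear (P.evA _ f F) :=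
  (P.exists_formY hK i f).choose_spec F

theorem formY_incl (hK : P.IsKoszul) (i : ℕ) (f : List (Letter k V) → k)
    (x : P.W k k (P.jump i)) : P.formY hK i f (P.πY i (incl P.Alg x)) =
      P.trivEquiv.symm (contract (P.jump i) f x.1 []) := by
  rw [formY_πY, evA_incl]
  exact P.aug.commutes _

/-- The class in `Ext_A^i(k, k)` of a function on words of length `n(i)`. -/
def cls (hK : P.IsKoszul) (i : ℕ) :
    (List (Letter k V) → k) →ₗ[k] SelfExt.{_, _, u} P.trivialModule i where
  toFun f := P.clY hK (P.formY hK i f)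
  map_add' f g := by
    refine Eq.trans (congrArg (P.clY hK) ?_) (P.clY_add hK _ _)
    refine ext_πY hK fun x => ?_
    rw [LinearMap.add_apply, formY_incl, formY_incl, formY_incl, contract_add_left, ← map_add]
    rfl
  map_smul' c f := by
    have key : P.formY hK i (c • f) = (c • ModuleCat.ofHom (P.formY hK i f)).hom :=
      ext_πY hK fun x => by
        rw [formY_incl, contract_smul_left]
        change _ = algebraMap k P.Alg c • P.formY hK i f _
        rw [formY_incl, algebraMap_smul, ← map_smul]
        rfl
    exact P.clY_smul hK c _ _ fun y => LinearMap.congr_fun key y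

theorem cls_apply (hK : P.IsKoszul) (i : ℕ) (f : List (Letter k V) → k) :
    P.cls hK i f = P.clY hK (P.formY hK i f) := rfl

theorem cls_surjective (hK : P.IsKoszul) (i : ℕ) : Function.Surjective (P.cls hK i) := fun x => by
  obtain ⟨h, hx⟩ := P.exists_clY hK (i := i) (M := P.trivialModule) x
  obtain ⟨f, hf⟩ := exists_contract_eq (N := P.N) (R := P.Rw) (n := P.jump i)
    { toFun := fun x => P.trivEquiv (h (P.πY i (incl P.Alg x)))
      map_add' := fun x y => by rw [incl_add, map_add, map_add, map_add]
      map_smul' := fun c x => by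
        rw [incl_smul, map_smul, map_smul, trivEquiv_smul, AlgHom.commutes]
        rfl }
  refine ⟨f, (congrArg (P.clY hK) (ext_πY hK fun x => ?_)).trans hx⟩
  rw [formY_incl, ← hf]
  exact P.trivEquiv.symm_apply_apply _

/-- By minimality there are no nonzero coboundaries, so the class vanishes only when the map to k
does, and that map is determined by its values on W_{n(i)}. -/
theorem cls_eq_zero_iff (hK : P.IsKoszul) (i : ℕ) (f : List (Letter k V) → k) :
    P.cls hK i f = 0 ↔ ∀ x ∈ P.W k k (P.jump i), contract (P.jump i) f x [] = 0 := by
  have key : P.formY hK i f = 0 ↔ ∀ x ∈ P.W k k (P.jump i), contract (P.jump i) f x [] = 0 := by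
    constructor
    · intro h x hx
      have := P.formY_incl hK i f ⟨x, hx⟩
      rw [h, LinearMap.zero_apply] at this
      exact (P.trivEquiv.symm.map_eq_zero_iff).1 this.symm
    · intro h
      refine ext_πY hK fun x => (P.formY_incl hK i f x).trans ?_
      rw [h x.1 x.2, map_zero]
      rfl
  rw [← key, cls_apply]
  constructor
  · intro h
    cases i with
    | zero => exact P.clY_zero_eq_zero hK h
    | succ i =>
      obtain ⟨g, hg⟩ := (clY_succ_eq_zero_iff hK _).1 h
      exact ext_πY hK fun x => (hg _).trans (P.triv_map_dK g _)
  · intro h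
    exact (congrArg (P.clY hK) h).trans (P.clY_zero hK)

/-! ### Products -/

/-- The difference is N - 2 when both indices are odd and 0 otherwise. It is the number of letters
which the lift of a form to the Koszul complex must additionally multiply into A. -/
theorem jump_add_le (m l : ℕ) : P.jump m + P.jump l ≤ P.jump (m + l) := by
  induction l with
  | zero => simp [jump_zero]
  | succ l ih =>
    have h2 := P.two_le
    rcases Nat.mod_two_eq_zero_or_one m with hm | hm
    · have h1 : (m + (l + 1)) / 2 = m / 2 + (l + 1) / 2 := by omega
      have h3 : (m + (l + 1)) % 2 = (l + 1) % 2 := by omega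
      simp only [jump, h1, h3, hm, add_mul]
      omega
    · rcases Nat.mod_two_eq_zero_or_one l with hl | hl
      · have h1 : (m + (l + 1)) / 2 = m / 2 + (l + 1) / 2 + 1 := by omega
        have h3 : (m + (l + 1)) % 2 = 0 := by omega
        have h4 : (l + 1) % 2 = 1 := by omega
        simp only [jump, h1, h3, hm, h4, add_mul]
        omega
      · have h1 : (m + (l + 1)) / 2 = m / 2 + (l + 1) / 2 := by omega
        have h3 : (m + (l + 1)) % 2 = 1 := by omega
        have h4 : (l + 1) % 2 = 0 := by omega
        simp only [jump, h1, h3, hm, h4, add_mul]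
        omega

/-- The lifting of a linear form to the Koszul complex. -/
def liftK (m : ℕ) (f : List (Letter k V) → k) (l : ℕ) : P.KK (m + l) →ₗ[P.Alg] P.KK l where
  toFun F := ⟨(dL P.x ^ (P.jump (m + l) - P.jump m - P.jump l)) (contract (P.jump m) f F.1),
    dL_pow_mem P.x _ (contract_mem (by have := P.jump_add_le m l; omega) f F.2)⟩
  map_add' F G := Subtype.ext <|
    (congrArg _ (contract_add _ f F.1 G.1)).trans (map_add (dL P.x ^ _) _ _)
  map_smul' c F := Subtype.ext <|
    (congrArg _ (contract_smul _ f c F.1)).trans (map_smul (dL P.x ^ _) _ _)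

/-- Contraction at the end of words commutes with multiplication at the beginning, and both sides
apply the same number of multiplications. -/
theorem dK_liftK (m : ℕ) (f : List (Letter k V) → k) (l : ℕ) (F : P.KK (m + (l + 1))) :
    P.dK l (P.liftK m f (l + 1) F) = P.liftK m f l (P.dK (m + l) F) := by
  refine Subtype.ext ?_
  rw [dK_coe]
  change (dL P.x ^ _) ((dL P.x ^ _) (contract _ f F.1)) =
    (dL P.x ^ _) (contract _ f ((dL P.x ^ P.gap (m + l)) F.1))
  rw [contract_dL_pow, ← Module.End.mul_apply, ← Module.End.mul_apply, ← pow_add, ← pow_add]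
  have h1 : P.jump (m + (l + 1)) = P.jump (m + l) + P.gap (m + l) := P.jump_succ (m + l)
  have h2 := P.jump_succ l
  have h3 := P.jump_add_le m l
  have h4 := P.jump_add_le m (l + 1)
  refine congrArg (fun n => (dL P.x ^ n) (contract (P.jump m) f F.1)) ?_
  omega

theorem exists_liftY (hK : P.IsKoszul) (m : ℕ) (f : List (Letter k V) → k) (l : ℕ) :
    ∃ h : P.Y (m + l) →ₗ[P.Alg] P.Y l, ∀ F, h (P.πY (m + l) F) = P.πY l (P.liftK m f l F) :=
  exists_descend hK (P.πY l ∘ₗ P.liftK m f l) fun F => by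
    rw [LinearMap.comp_apply, ← dK_liftK, πY_dK]

theorem clY_comp_clY (hK : P.IsKoszul) {M : ModuleCat.{u} P.Alg} (m l : ℕ)
    (f : ∀ n, P.Y (m + n) →ₗ[P.Alg] P.Y n) (F : ∀ n, P.KK (m + n) →ₗ[P.Alg] P.KK n)
    (hf : ∀ n G, f n (P.πY (m + n) G) = P.πY n (F n G))
    (hF : ∀ n G, P.dK n (F (n + 1) G) = F n (P.dK (m + n) G))
    (f0 : P.Y m →ₗ[P.Alg] P.trivialModule) (h0 : f0 = f 0) (g : P.Y l →ₗ[P.Alg] M) :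
    (P.clY hK f0).comp (P.clY hK g) rfl = P.clY hK (g ∘ₗ f l) := by
  subst h0
  refine (P.syz hK).cl_comp_cl (T := P.syz hK) m (fun n => ModuleCat.ofHom (f n))
    (fun n => ModuleCat.ofHom (F n)) l ?_ ?_ (ModuleCat.ofHom g)
  · intro n _
    refine ModuleCat.hom_ext (LinearMap.ext fun y => ?_)
    obtain ⟨G, rfl⟩ := P.πY_surjective hK (m + n + 1) y
    change F n (P.ιY (m + n) (P.πY (m + n + 1) G)) =
      P.ιY n (f (n + 1) (P.πY (m + (n + 1)) G))
    rw [hf, ιY_πY, ιY_πY, hF]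
  · intro n _
    exact ModuleCat.hom_ext (LinearMap.ext fun G => hf n G)

/-- The Yoneda product of the classes of two functions on words. -/
theorem cls_comp_cls (hK : P.IsKoszul) {m l : ℕ} (h : P.jump m + P.jump l = P.jump (m + l))
    (f g : List (Letter k V) → k) :
    Abelian.Ext.comp (P.cls hK m f) (P.cls hK l g) rfl =
      P.cls hK (m + l) (conc (P.jump l) g f) := by
  choose fY hfY using P.exists_liftY hK m f
  refine (P.clY_comp_clY hK m l fY (P.liftK m f) hfY (P.dK_liftK m f) (P.formY hK m f) ?_
    (P.formY hK l g)).trans (congrArg (P.clY hK) ?_)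
  · refine LinearMap.ext fun y => ?_
    obtain ⟨F, rfl⟩ := P.πY_surjective hK m y
    refine ((hfY 0 F).trans (Eq.trans ?_ (P.formY_πY hK m f F).symm)).symm
    change P.aug ((dL P.x ^ (P.jump m - P.jump m - P.jump 0)) (contract (P.jump m) f F.1) []) = _
    rw [jump_zero, Nat.sub_self, Nat.sub_zero, pow_zero]
    rfl
  · refine LinearMap.ext fun y => ?_
    obtain ⟨F, rfl⟩ := P.πY_surjective hK (m + l) y
    rw [LinearMap.comp_apply, hfY, formY_πY, formY_πY]
    refine congrArg P.augLinear ?_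
    change contract (P.jump l) g ((dL P.x ^ (P.jump (m + l) - P.jump m - P.jump l))
      (contract (P.jump m) f F.1)) [] = contract (P.jump (m + l)) _ F.1 []
    -- When the jumps add up no letters are left over, and the lift is a pure contraction.
    have h' : P.jump (m + l) - P.jump m - P.jump l = 0 := by omega
    rw [h', pow_zero]
    generalize F.1 = G
    rw [← h, Nat.add_comm (P.jump m), contract_conc]
    rfl

end HomogeneousRelations

namespace HomogeneousRelations

open Words

variable {k V : Type u} [Field k] [AddCommGroup V] [Module k V] [FiniteDimensional k V]
  (P : HomogeneousRelations k V)

/-! ## Consequences of the AS-Gorenstein property -/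

theorem subsingleton_ext_of_lt {A : Type u} [Ring A] {D : ℕ}
    (hdim : leftGlobalDimension A = (D : WithBot ℕ∞)) (M M' : ModuleCat.{u} A) {i : ℕ}
    (hi : D < i) : Subsingleton (Abelian.Ext.{u} M M' i) := by
  have h1 : projectiveDimension M ≤ (D : WithBot ℕ∞) := by
    rw [← hdim]
    exact le_iSup (fun M : ModuleCat.{u} A => projectiveDimension M) M
  have h2 := (projectiveDimension_le_iff M D).1 h1
  exact HasProjectiveDimensionLT.subsingleton M (D + 1) i hi M'

theorem eq_zero_of_contract {n : ℕ} {x : List (Letter k V) → k} (hx : x ∈ P.W k k n)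
    (h : ∀ f : List (Letter k V) → k, contract n f x [] = 0) : x = 0 := by
  funext u
  by_cases hu : u.length = n
  · have := h (Pi.single u 1)
    rwa [contract_single u hu] at this
  · exact hx.1 u hu

theorem W_eq_zero_of_ext (hK : P.IsKoszul) {i : ℕ}
    (h : Subsingleton (Abelian.Ext.{u} P.trivialModule P.trivialModule i))
    {x : List (Letter k V) → k} (hx : x ∈ P.W k k (P.jump i)) : x = 0 :=
  P.eq_zero_of_contract hx fun f =>
    (P.cls_eq_zero_iff hK i f).1 (Subsingleton.elim (α := Abelian.Ext.{u} _ _ i) _ _) x hx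

theorem W_eq_zero_of_forall {S : Type*} [Semiring S] {M : Type*} [AddCommGroup M] [Module k M]
    [Module S M] [SMulCommClass k S M] {n : ℕ} (h : ∀ x ∈ P.W k k n, x = 0)
    {F : List (Letter k V) → M} (hF : F ∈ P.W S M n) : F = 0 := by
  funext u
  rw [eq_sum_coef hF u]
  exact Finset.sum_eq_zero fun s _ => by
    rw [h _ (bas_mem P.N P.Rw n s), Pi.zero_apply, zero_smul]

/-- A coboundary has values in A_+ by minimality, and in degree zero there are none. This gives a
lower bound for Ext^i(k,A) after reduction modulo A_+. -/
theorem clY_eq_zero_aug (hK : P.IsKoszul) {i : ℕ} (h : P.Y i →ₗ[P.Alg] P.Alg)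
    (h0 : P.clY hK (M := ModuleCat.of P.Alg P.Alg) h = 0) (F : P.KK i) :
    P.aug (h (P.πY i F)) = 0 := by
  cases i with
  | zero =>
    have := P.clY_zero_eq_zero hK (M := ModuleCat.of P.Alg P.Alg) h0
    rw [this]
    exact map_zero P.aug
  | succ i =>
    obtain ⟨g, hg⟩ := (clY_succ_eq_zero_iff hK (M := ModuleCat.of P.Alg P.Alg) _).1 h0
    rw [hg]
    exact P.aug_map_dK g F

theorem exists_dependence (hK : P.IsKoszul) {i : ℕ} (h₁ h₂ : P.Y i →ₗ[P.Alg] P.Alg)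
    (e : Abelian.Ext.{u} P.trivialModule (ModuleCat.of P.Alg P.Alg) i ≃ₗ[k] k) :
    ∃ a b : k, (a ≠ 0 ∨ b ≠ 0) ∧
      P.clY hK (M := ModuleCat.of P.Alg P.Alg) (a • h₁ + b • h₂) = 0 := by
  have hsm : ∀ (c : k) (h : P.Y i →ₗ[P.Alg] P.Alg),
      P.clY hK (M := ModuleCat.of P.Alg P.Alg) (c • h) =
        c • P.clY hK (M := ModuleCat.of P.Alg P.Alg) h := fun c h =>
    P.clY_smul hK c (M := ModuleCat.of P.Alg P.Alg) h _ fun y => Algebra.smul_def c (h y)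
  have key : ∀ a b : k, e (P.clY hK (M := ModuleCat.of P.Alg P.Alg) (a • h₁ + b • h₂)) =
      a * e (P.clY hK (M := ModuleCat.of P.Alg P.Alg) h₁) +
      b * e (P.clY hK (M := ModuleCat.of P.Alg P.Alg) h₂) := fun a b => by
    rw [show P.clY hK (M := ModuleCat.of P.Alg P.Alg) (a • h₁ + b • h₂) = _ from
      P.clY_add hK (M := ModuleCat.of P.Alg P.Alg) _ _, hsm, hsm, map_add, map_smul, map_smul]
    rfl
  by_cases h1 : e (P.clY hK (M := ModuleCat.of P.Alg P.Alg) h₁) = 0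
  · refine ⟨1, 0, Or.inl one_ne_zero, (e.map_eq_zero_iff).1 ?_⟩
    rw [key, h1]
    simp
  · refine ⟨- e (P.clY hK (M := ModuleCat.of P.Alg P.Alg) h₂),
      e (P.clY hK (M := ModuleCat.of P.Alg P.Alg) h₁), Or.inr h1, (e.map_eq_zero_iff).1 ?_⟩
    rw [key]
    ring

theorem evalWord_one (c : List (Letter k V) → k) : P.evalWord 1 c = ∑ i, c [i] • P.x i := by
  simp [evalWord, wsum_one]

theorem x_ne_zero (j : Letter k V) : P.x j ≠ 0 := fun h => by
  have := P.evalWord_injective (m := 1) (by have := P.two_le; omega) (c := Pi.single [j] 1)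
    (by
      rw [evalWord_one, Finset.sum_eq_single j]
      · rw [h, smul_zero]
      · intro i _ hij
        rw [Pi.single_eq_of_ne (by simpa using hij), zero_smul]
      · simp) [j] rfl
  simp at this

theorem pr_one_mon_mul {t : List (Letter k V)} (ht : 2 ≤ t.length) (a : P.Alg) :
    P.pr 1 (mon P.x t * a) = 0 := by
  match t, ht with
  | i :: j :: s, _ => rw [mon_cons, mon_cons, mul_assoc, mul_assoc, pr_succ_x_mul, pr_zero_x_mul,
      mul_zero]

/-- The slice of an element of `W_n` at a prefix. -/
def slice {a n l : ℕ} (h : a + n = l) (x : P.W k k l) (t : List (Letter k V))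
    (ht : t.length = a) : P.W k k n :=
  ⟨fun u => x.1 (t ++ u), WS_slice_left x.2 t (by omega)⟩

/-- A differential that moves at least two letters puts them to the left of any value of g, so
coboundaries start in degree two. -/
theorem pr_one_map_dK {i : ℕ} (h : 2 ≤ P.gap i) (g : P.KK i →ₗ[P.Alg] P.Alg)
    (x : P.W k k (P.jump (i + 1))) : P.pr 1 (g (P.dK i (incl P.Alg x))) = 0 := by
  classical
  have hj : P.gap i + P.jump i = P.jump (i + 1) := by rw [jump_succ, add_comm]
  let s : List (Letter k V) → P.KK i := fun t =>
    if ht : t.length = P.gap i then incl P.Alg (P.slice hj x t ht) else 0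
  have hs : P.dK i (incl P.Alg x) = wsum (P.gap i) fun t => mon P.x t • s t := by
    refine Subtype.ext (funext fun u => ?_)
    rw [dK_coe, dL_pow_apply]
    have : ∀ (F : List (Letter k V) → P.KK i) n, (wsum n F).1 u = wsum n fun t => (F t).1 u :=
      fun F n => by
        rw [show (wsum n F).1 = wsum n fun t => (F t).1 from map_wsum (Submodule.subtype _) n F,
          wsum_apply]
    rw [this]
    refine wsum_congr fun t ht => ?_
    simp only [s, dif_pos ht]
    exact Algebra.commutes _ _
  rw [hs, map_wsum, map_wsum]
  refine wsum_eq_zero fun t ht => ?_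
  rw [map_smul, smul_eq_mul, pr_one_mon_mul P (by omega)]

section Gorenstein

variable {P} {D : ℕ}

theorem W_eq_zero (hK : P.IsKoszul)
    (hdim : leftGlobalDimension P.Alg = (D : WithBot ℕ∞)) {i : ℕ} (hi : D < i) {x : List (Letter k V) → k}
    (hx : x ∈ P.W k k (P.jump i)) : x = 0 :=
  P.W_eq_zero_of_ext hK (subsingleton_ext_of_lt hdim _ _ hi) hx

theorem KK_eq_zero (hK : P.IsKoszul)
    (hdim : leftGlobalDimension P.Alg = (D : WithBot ℕ∞)) {i : ℕ} (hi : D < i) (F : P.KK i) : F = 0 :=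
  Subtype.ext (P.W_eq_zero_of_forall (fun _ hx => W_eq_zero hK hdim hi hx) F.2)

theorem exists_descend_top (hK : P.IsKoszul)
    (hdim : leftGlobalDimension P.Alg = (D : WithBot ℕ∞)) {M : Type*} [AddCommGroup M] [Module P.Alg M]
    (g : P.KK D →ₗ[P.Alg] M) : ∃ h : P.Y D →ₗ[P.Alg] M, ∀ F, h (P.πY D F) = g F :=
  exists_descend hK g fun F => by
    rw [KK_eq_zero hK hdim (Nat.lt_succ_self D) F, map_zero, map_zero]

/-- The space `W_{n(D)}` is one-dimensional. -/
theorem exists_generator (hK : P.IsKoszul)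
    (hdim : leftGlobalDimension P.Alg = (D : WithBot ℕ∞))
    (hG : P.IsASGorenstein D) : ∃ w ∈ P.W k k (P.jump D), w ≠ 0 ∧
    ∀ x ∈ P.W k k (P.jump D), ∃ c : k, x = c • w := by
  obtain ⟨e⟩ := hG.2
  have hne : ∃ w ∈ P.W k k (P.jump D), w ≠ 0 := by
    by_contra! h
    have hz : ∀ y : P.Y D, y = 0 := fun y => by
      obtain ⟨F, rfl⟩ := P.πY_surjective hK D y
      rw [show F = 0 from Subtype.ext (P.W_eq_zero_of_forall h F.2), map_zero]
    obtain ⟨g, hg⟩ := P.exists_clY hK (M := ModuleCat.of P.Alg P.Alg) (e.symm 1)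
    have : g = 0 := LinearMap.ext fun y => by rw [hz y, map_zero, map_zero]
    rw [this, clY_zero] at hg
    have h1 := congrArg e hg
    rw [map_zero, LinearEquiv.apply_symm_apply] at h1
    exact zero_ne_one h1
  obtain ⟨w, hw, hw0⟩ := hne
  refine ⟨w, hw, hw0, fun x hx => ?_⟩
  obtain ⟨f₀, hf₀⟩ : ∃ f₀, contract (P.jump D) f₀ w [] ≠ 0 := by
    by_contra! h
    exact hw0 (P.eq_zero_of_contract hw h)
  by_contra! hxw
  -- The constant is chosen so that f₀ kills x - c w. Then f₀ and f₁ are triangular on w and x - c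
  -- w, with nonzero diagonal entries.
  let c := contract (P.jump D) f₀ x [] / contract (P.jump D) f₀ w []
  have hx' : x - c • w ≠ 0 := sub_ne_zero.2 (hxw c)
  obtain ⟨f₁, hf₁⟩ : ∃ f₁, contract (P.jump D) f₁ (x - c • w) [] ≠ 0 := by
    by_contra! h
    exact hx' (P.eq_zero_of_contract (sub_mem hx (Submodule.smul_mem _ _ hw)) h)
  have hf₀x : contract (P.jump D) f₀ (x - c • w) [] = 0 := by
    rw [sub_eq_add_neg, ← neg_smul, contract_add, contract_smul, Pi.add_apply, Pi.smul_apply]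
    simp only [c, smul_eq_mul]
    field_simp
    ring
  obtain ⟨h₀, hh₀⟩ := exists_descend_top hK hdim (P.evA _ f₀)
  obtain ⟨h₁, hh₁⟩ := exists_descend_top hK hdim (P.evA _ f₁)
  -- Both forms define classes in the line Ext^D(k,A), hence are dependent there; reducing the
  -- relation modulo A_+ contradicts triangularity.
  obtain ⟨a, b, hab, hcl⟩ := P.exists_dependence hK h₀ h₁ e
  have key : ∀ y : P.W k k (P.jump D),
      a * contract (P.jump D) f₀ y.1 [] + b * contract (P.jump D) f₁ y.1 [] = 0 := fun y => by
    have := P.clY_eq_zero_aug hK _ hcl (incl P.Alg y)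
    rw [LinearMap.add_apply, LinearMap.smul_apply, LinearMap.smul_apply, hh₀, hh₁, evA_incl,
      evA_incl, map_add, map_smul, map_smul, AlgHom.commutes, AlgHom.commutes] at this
    exact this
  have hb : b = 0 := by
    have := key ⟨_, sub_mem hx (Submodule.smul_mem _ c hw)⟩
    rw [hf₀x, mul_zero, zero_add] at this
    exact (mul_eq_zero.1 this).resolve_right hf₁
  have ha : a = 0 := by
    have := key ⟨w, hw⟩
    rw [hb, zero_mul, add_zero] at this
    exact (mul_eq_zero.1 this).resolve_right hf₀
  exact hab.elim (fun h => h ha) fun h => h hb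

/-- The cocycles f₀ and f₀ x_j are dependent in the line Ext^D(k,A). Reduction modulo A_+ kills the
coefficient of the first, so a nonzero multiple of f₀ x_j is a coboundary; its value at w is
homogeneous of degree one, which is impossible if the last differential moves two or more letters.
Thus D is odd or N = 2 when D > 0. -/
theorem gap_of_top (hK : P.IsKoszul)
    (hdim : leftGlobalDimension P.Alg = (D : WithBot ℕ∞))
    (hG : P.IsASGorenstein D) {d : ℕ} (hd : D = d + 1) : P.gap d = 1 := by
  obtain ⟨e⟩ := hG.2
  obtain ⟨w, hw, hw0, -⟩ := exists_generator hK hdim hG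
  obtain ⟨f₀, hf₀⟩ : ∃ f₀, contract (P.jump D) f₀ w [] ≠ 0 := by
    by_contra! h
    exact hw0 (P.eq_zero_of_contract hw h)
  subst hd
  by_contra hgap
  have hgap2 : 2 ≤ P.gap d := by
    have := P.gap_pos d
    omega
  obtain ⟨j⟩ : Nonempty (Letter k V) := by
    by_contra hj
    refine hw0 (funext fun u => ?_)
    cases u with
    | nil =>
      refine hw.1 [] ?_
      have := P.jump_succ d
      simp
      omega
    | cons i u => exact absurd ⟨i⟩ hj
  obtain ⟨h₀, hh₀⟩ := exists_descend_top hK hdim (P.evA _ f₀)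
  obtain ⟨h₁, hh₁⟩ := exists_descend_top hK hdim
    (LinearMap.toSpanSingleton P.Alg P.Alg (P.x j) ∘ₗ P.evA _ f₀)
  obtain ⟨a, b, hab, hcl⟩ := P.exists_dependence hK h₀ h₁ e
  have ha : a = 0 := by
    have := P.clY_eq_zero_aug hK _ hcl (incl P.Alg ⟨w, hw⟩)
    rw [LinearMap.add_apply, LinearMap.smul_apply, LinearMap.smul_apply, hh₀, hh₁,
      LinearMap.comp_apply, LinearMap.toSpanSingleton_apply, evA_incl, map_add, map_smul,
      map_smul, AlgHom.commutes, algebraMap_smul, map_smul, aug_x, smul_zero, smul_zero,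
      add_zero] at this
    exact (mul_eq_zero.1 this).resolve_right hf₀
  obtain ⟨g, hg⟩ := (clY_succ_eq_zero_iff hK (M := ModuleCat.of P.Alg P.Alg) _).1 hcl
  have h1 := hg (incl P.Alg ⟨w, hw⟩)
  have h2 := P.pr_one_map_dK hgap2 g ⟨w, hw⟩
  have h3 : b • contract (P.jump (d + 1)) f₀ w [] • P.x j = 0 := by
    rw [← h2, ← h1, LinearMap.add_apply, LinearMap.smul_apply, LinearMap.smul_apply, hh₀, hh₁,
      LinearMap.comp_apply, LinearMap.toSpanSingleton_apply, evA_incl, ha, zero_smul, zero_add,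
      map_smul, algebraMap_smul, map_smul]
    congr 2
    have := P.pr_mon 1 [j]
    simpa using this.symm
  rcases smul_eq_zero.1 h3 with hb | h3
  · exact hab.elim (fun h => h ha) fun h => h hb
  · rcases smul_eq_zero.1 h3 with h3 | h3
    · exact hf₀ h3
    · exact P.x_ne_zero j h3

/-- If D is odd then exactly one of the two indices is odd; if N = 2 then n is the identity. In
either case no letters are lost in products landing in degree D. -/
theorem jump_add_of_top (hK : P.IsKoszul)
    (hdim : leftGlobalDimension P.Alg = (D : WithBot ℕ∞))
    (hG : P.IsASGorenstein D) {m l : ℕ} (h : m + l = D) : P.jump m + P.jump l = P.jump D := by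
  rcases D with _ | d
  · obtain rfl : m = 0 := by omega
    obtain rfl : l = 0 := by omega
    rw [jump_zero]
  · have hgap := gap_of_top hK hdim hG rfl
    unfold gap at hgap
    have h2 := P.two_le
    by_cases hd : d % 2 = 0
    · rcases Nat.mod_two_eq_zero_or_one m with hm | hm
      · have h1 : (d + 1) / 2 = m / 2 + l / 2 := by omega
        have h3 : (d + 1) % 2 = l % 2 := by omega
        simp only [jump, h1, h3, hm, add_mul]
        omega
      · have h1 : (d + 1) / 2 = m / 2 + l / 2 := by omega
        have h3 : (d + 1) % 2 = 1 := by omega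
        have h4 : l % 2 = 0 := by omega
        simp only [jump, h1, h3, hm, h4, add_mul]
        omega
    · rw [if_neg hd] at hgap
      have hN : P.N = 2 := by omega
      simp only [jump, hN]
      omega

theorem evA_dK_incl {i : ℕ} (f : List (Letter k V) → k) (x : P.W k k (P.jump (i + 1))) :
    P.evA (P.jump i) f (P.dK i (incl P.Alg x)) =
      P.evalWord (P.gap i) (contract (P.jump i) f x.1) := by
  change wsum _ (fun v => f v • (dL P.x ^ P.gap i) (fun u => algebraMap k P.Alg (x.1 u)) v) = _
  simp only [dL_pow_apply, smul_wsum]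
  rw [wsum_wsum_comm]
  refine wsum_congr fun t _ => ?_
  rw [contract, wsum_smul]
  refine wsum_congr fun v _ => ?_
  rw [← Algebra.smul_def, smul_smul, smul_eq_mul]

/-- The nondegeneracy of the contraction with a generator of `W_{n(D)}`. -/
theorem contract_injective (hK : P.IsKoszul) (hG : P.IsASGorenstein D)
    {w : List (Letter k V) → k}
    (hw : ∀ x ∈ P.W k k (P.jump D), ∃ c : k, x = c • w) {i j : ℕ} (hij : i + j = D)
    {f : List (Letter k V) → k} (h : contract (P.jump i) f w = 0) :
    ∀ x ∈ P.W k k (P.jump i), contract (P.jump i) f x [] = 0 := by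
  induction j generalizing i f with
  | zero =>
    intro x hx
    obtain rfl : i = D := by omega
    obtain ⟨c, rfl⟩ := hw x hx
    rw [contract_smul, h, smul_zero, Pi.zero_apply]
  | succ j ih =>
    intro x hx
    have hgj : P.jump (i + 1) = P.gap i + P.jump i := by rw [jump_succ, add_comm]
    -- Contraction with f is a cocycle K_i → A: its composite with the differential has the
    -- coefficients of t f for words t, each t f also kills w, and the induction hypothesis in
    -- degree i + 1 applies to it.
    obtain ⟨g, hg⟩ := exists_descend hK (P.evA (P.jump i) f) fun F => by
      refine LinearMap.congr_fun (Words.hom_ext (f := P.evA (P.jump i) f ∘ₗ P.dK i) (g := 0)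
        fun y => ?_) F
      rw [LinearMap.comp_apply, evA_dK_incl]
      refine wsum_eq_zero fun t ht => ?_
      have := ih (i := i + 1) (by omega) (f := conc (P.gap i) (Pi.single t 1) f) (by
        rw [hgj, contract_conc, h]
        funext u
        exact wsum_eq_zero fun _ _ => smul_zero _) y.1 y.2
      generalize y.1 = y at this ⊢
      rw [hgj, contract_conc, contract_single t ht, List.nil_append] at this
      rw [this, zero_smul]
    -- As i < D, the cocycle is a coboundary and takes values in A_+; but on W_{n(i)} its values are
    -- scalars.
    have := hG.1 i (by omega)
    have h0 := P.clY_eq_zero_aug hK g (Subsingleton.elim _ _) (incl P.Alg ⟨x, hx⟩)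
    rw [hg, evA_incl, AlgHom.commutes] at h0
    exact h0

end Gorenstein

end HomogeneousRelations

/-! ## Frobenius algebras -/

section Frobenius

variable {C : Type u} [Category.{v} C] [Abelian C] [HasExt.{w} C] {k : Type t} [Field k]
  [Linear k C] {X : C} {D : ℕ}

/-- A graded Frobenius form of degree `D` on the Yoneda algebra of `X`. -/
structure FrobeniusForm (k : Type t) [Field k] [Linear k C] (X : C) (D : ℕ) where
  /-- the linear form -/
  H : YonedaAlgebra.{u, v, w} X →ₗ[k] k
  of_ne : ∀ i, i ≠ D → ∀ x : SelfExt X i, H (DirectSum.of (SelfExt X) i x) = 0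
  nondegenerate : ∀ i j, i + j = D → ∀ x : SelfExt X i,
    (∀ y : SelfExt X j, H (DirectSum.of (SelfExt X) j y * DirectSum.of (SelfExt X) i x) = 0) → x = 0
  eq_zero : ∀ i, D < i → ∀ x : SelfExt X i, x = 0
  exists_smul : ∀ H' : YonedaAlgebra.{u, v, w} X →ₗ[k] k,
    (∀ i, i ≠ D → ∀ x : SelfExt X i, H' (DirectSum.of (SelfExt X) i x) = 0) → ∃ c : k, H' = c • H
  finite : ∀ i, FiniteDimensional k (SelfExt X i)

namespace FrobeniusForm

variable (Φ : FrobeniusForm.{u, v, w, t} k X D)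

theorem H_mul_of {i j : ℕ} (h : i + j ≠ D) (x : SelfExt X i) (y : SelfExt X j) :
    Φ.H (DirectSum.of (SelfExt X) i x * DirectSum.of (SelfExt X) j y) = 0 := by
  rw [DirectSum.of_mul_of]
  exact Φ.of_ne _ h _

theorem H_of_mul {i j : ℕ} (h : i + j = D) (y : SelfExt X j) (x : YonedaAlgebra X) :
    Φ.H (DirectSum.of (SelfExt X) j y * x) =
      Φ.H (DirectSum.of (SelfExt X) j y * DirectSum.of (SelfExt X) i (x i)) := by
  induction x using DirectSum.induction_on with
  | zero => rw [DirectSum.zero_apply, map_zero]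
  | of l x =>
    by_cases hl : l = i
    · subst hl
      rw [DirectSum.of_eq_same]
    · rw [Φ.H_mul_of (by omega), DirectSum.of_eq_of_ne _ _ _ (Ne.symm hl), map_zero, mul_zero,
        map_zero]
  | add x x' hx hx' =>
    rw [mul_add, map_add, hx, hx', DirectSum.add_apply, map_add, mul_add, map_add]

theorem apply_eq_zero {i j : ℕ} (h : i + j = D) {x : YonedaAlgebra X}
    (hx : ∀ y : SelfExt X j, Φ.H (DirectSum.of (SelfExt X) j y * x) = 0) : x i = 0 :=
  Φ.nondegenerate i j h _ fun y => by rw [← Φ.H_of_mul h, hx]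

theorem eq_zero_of_mul {x : YonedaAlgebra X} (h : ∀ y, Φ.H (y * x) = 0) : x = 0 := by
  refine DirectSum.ext fun i => ?_
  rcases Nat.lt_or_ge D i with hi | hi
  · exact Φ.eq_zero i hi _
  · exact Φ.apply_eq_zero (j := D - i) (by omega) fun y => h _

theorem finiteDimensional (Φ : FrobeniusForm.{u, v, w, t} k X D) : FiniteDimensional k (YonedaAlgebra.{u, v, w} X) := by
  have := Φ.finite
  let T : ((i : Fin (D + 1)) → SelfExt X i) →ₗ[k] YonedaAlgebra.{u, v, w} X :=
    ∑ i : Fin (D + 1), (DirectSum.lof k ℕ (SelfExt X) i) ∘ₗ LinearMap.proj i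
  refine Module.Finite.of_surjective T fun x => ⟨fun i => x i, ?_⟩
  rw [LinearMap.sum_apply]
  refine DirectSum.ext fun j => ?_
  rw [DirectSum.sum_apply]
  rcases Nat.lt_or_ge D j with hj | hj
  · exact (Φ.eq_zero j hj _).trans (Φ.eq_zero j hj _).symm
  · rw [Finset.sum_eq_single ⟨j, by omega⟩]
    · exact DirectSum.of_eq_same _ _
    · intro i _ hij
      refine DirectSum.of_eq_of_ne _ _ _ fun h => hij (Fin.ext h.symm)
    · simp

/-- The isomorphism `x ↦ (y ↦ H (y x))` of a Frobenius algebra with its dual. -/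
def toDual : YonedaAlgebra.{u, v, w} X ≃ₗ[k] Module.Dual k (YonedaAlgebra.{u, v, w} X) :=
  haveI := Φ.finiteDimensional
  LinearEquiv.ofInjectiveOfFinrankEq
    ((LinearMap.mul k (YonedaAlgebra.{u, v, w} X)).flip.compr₂ Φ.H)
    ((injective_iff_map_eq_zero _).2 fun _ hx => Φ.eq_zero_of_mul fun y => LinearMap.congr_fun hx y)
    Subspace.dual_finrank_eq.symm

theorem toDual_apply (x y : YonedaAlgebra X) : Φ.toDual x y = Φ.H (y * x) := rfl

theorem eq_of_forall {x x' : YonedaAlgebra X} (h : ∀ y, Φ.H (y * x) = Φ.H (y * x')) : x = x' :=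
  Φ.toDual.injective (LinearMap.ext h)

/-- Nondegeneracy on the other side: by finite dimension every linear form on E is H(· z) for some
z. -/
theorem eq_zero_of_mul' {x : YonedaAlgebra X} (h : ∀ y, Φ.H (x * y) = 0) : x = 0 := by
  refine (Module.forall_dual_apply_eq_zero_iff k x).1 fun f => ?_
  rw [← Φ.toDual.apply_symm_apply f, toDual_apply, h]

/-- The Nakayama automorphism, as a linear map. -/
def nakLinear : YonedaAlgebra.{u, v, w} X →ₗ[k] YonedaAlgebra.{u, v, w} X :=
  Φ.toDual.symm.toLinearMap ∘ₗ (LinearMap.mul k (YonedaAlgebra.{u, v, w} X)).compr₂ Φ.H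

theorem H_nakLinear (x y : YonedaAlgebra X) : Φ.H (y * Φ.nakLinear x) = Φ.H (x * y) := by
  rw [← toDual_apply, nakLinear, LinearMap.comp_apply, LinearEquiv.coe_coe,
    LinearEquiv.apply_symm_apply]
  rfl

/-- Moving x, then y, around the form gives H(xyz) = H(yz ν(x)) = H(z ν(x) ν(y)). -/
theorem nakLinear_mul (x y : YonedaAlgebra X) :
    Φ.nakLinear (x * y) = Φ.nakLinear x * Φ.nakLinear y :=
  Φ.eq_of_forall fun z => by
    rw [H_nakLinear, ← mul_assoc, H_nakLinear, ← mul_assoc, H_nakLinear, mul_assoc]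

theorem nakLinear_one : Φ.nakLinear 1 = 1 :=
  Φ.eq_of_forall fun z => by rw [H_nakLinear, one_mul, mul_one]

/-- The Nakayama automorphism. -/
def nak : YonedaAlgebra.{u, v, w} X ≃ₐ[k] YonedaAlgebra.{u, v, w} X :=
  haveI := Φ.finiteDimensional
  AlgEquiv.ofBijective (AlgHom.ofLinearMap Φ.nakLinear Φ.nakLinear_one Φ.nakLinear_mul)
    ((fun h => ⟨h, (LinearMap.injective_iff_surjective (f := Φ.nakLinear)).1 h⟩)
      ((injective_iff_map_eq_zero Φ.nakLinear).2 fun x hx => Φ.eq_zero_of_mul' fun y => by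
        rw [← H_nakLinear, hx, mul_zero, map_zero]))

theorem H_nak (x y : YonedaAlgebra X) : Φ.H (y * Φ.nak x) = Φ.H (x * y) := Φ.H_nakLinear x y

theorem isNakayamaAutomorphism : IsNakayamaAutomorphism X D Φ.nak := by
  refine ⟨fun i x => ⟨Φ.nak (DirectSum.of (SelfExt X) i x) i, DirectSum.ext fun l => ?_⟩,
    Φ.toDual, fun a x b y => ?_, fun i j hij x y => ?_⟩
  · by_cases hl : l = i
    · subst hl
      rw [DirectSum.of_eq_same]
    · rw [DirectSum.of_eq_of_ne _ _ _ hl]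
      rcases Nat.lt_or_ge D l with hlD | hlD
      · exact Φ.eq_zero l hlD _
      · refine Φ.apply_eq_zero (j := D - l) (by omega) fun y => ?_
        rw [H_nak, Φ.H_mul_of (by omega)]
  · rw [toDual_apply, toDual_apply, ← mul_assoc, H_nak]
    simp only [mul_assoc]
  · exact Φ.H_mul_of (by omega) y x

/-- The form θ(1) is concentrated in degree D, hence is a multiple of H, and the bimodule property
of θ says that it satisfies the twisted symmetry. A zero multiple would force E = 0. So ν is
determined by H alone. -/
theorem H_of_isNakayamaAutomorphism {ν : YonedaAlgebra.{u, v, w} X ≃ₐ[k] YonedaAlgebra.{u, v, w} X}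
    (h : IsNakayamaAutomorphism X D ν) (x y : YonedaAlgebra X) :
    Φ.H (y * ν x) = Φ.H (x * y) := by
  obtain ⟨-, θ, hθ, hθ0⟩ := h
  have h1 : ∀ x y, θ x y = θ 1 (y * x) := fun x y => by
    have := hθ x 1 1 y
    rwa [mul_one, map_one, mul_one, one_mul] at this
  have h2 : ∀ b y, θ 1 (y * ν b) = θ 1 (b * y) := fun b y => by
    have := hθ 1 1 b y
    rwa [one_mul, one_mul, mul_one, h1] at this
  obtain ⟨c, hc⟩ := Φ.exists_smul (θ 1) fun i hi x => hθ0 0 i (by omega) _ x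
  by_cases hc0 : c = 0
  · have : ∀ x, θ x = 0 := fun x => LinearMap.ext fun y => by
      rw [h1, hc, hc0, zero_smul]
      rfl
    have hz : ∀ x : YonedaAlgebra X, x = 0 := fun x => θ.injective ((this x).trans (map_zero θ).symm)
    rw [hz (y * ν x), hz (x * y)]
  · have := h2 x y
    rw [hc] at this
    exact mul_left_cancel₀ hc0 this

theorem existsUnique_isNakayamaAutomorphism (Φ : FrobeniusForm.{u, v, w, t} k X D) :
    ∃! ν : YonedaAlgebra.{u, v, w} X ≃ₐ[k] YonedaAlgebra.{u, v, w} X,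
      IsNakayamaAutomorphism X D ν :=
  ⟨Φ.nak, Φ.isNakayamaAutomorphism, fun ν hν => AlgEquiv.ext fun x => Φ.eq_of_forall fun y => by
    rw [Φ.H_of_isNakayamaAutomorphism hν, H_nak]⟩

end FrobeniusForm

end Frobenius

/-- Naturality of extension classes for a map of short exact sequences which is the identity on `Y
0`. It serves to compare the connecting map of 0 → A_+ → A → k → 0 with the Koszul resolution. -/
theorem Syzygies.extClass_comp_eq_cl {C : Type u} [Category.{v} C] [Abelian C] [HasExt.{w} C]
    (S : Syzygies C) {A B M : C} {a : A ⟶ B} {b : B ⟶ S.Y 0} {zero : a ≫ b = 0}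
    (h : (ShortComplex.mk a b zero).ShortExact) (τ₁ : S.Y 1 ⟶ A) (τ₂ : S.K 0 ⟶ B)
    (h₁ : S.i 0 ≫ τ₂ = τ₁ ≫ a) (h₂ : S.π 0 = τ₂ ≫ b) (g : A ⟶ M) :
    h.extClass.comp (Abelian.Ext.mk₀ g) (add_zero 1) = S.cl (n := 1) (τ₁ ≫ g) := by
  have nat := ShortComplex.ShortExact.extClass_naturality (S.exact 0) h
    ⟨τ₁, τ₂, 𝟙 _, h₁.symm, ((Category.comp_id _).trans h₂).symm⟩
  rw [Abelian.Ext.mk₀_id_comp] at nat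
  rw [← nat, Abelian.Ext.comp_assoc_of_third_deg_zero, Abelian.Ext.mk₀_comp_mk₀, cl, Δ, Δ,
    Abelian.Ext.mk₀_id_comp]
  rfl

namespace HomogeneousRelations

open Words

variable {k V : Type u} [Field k] [AddCommGroup V] [Module k V] [FiniteDimensional k V]
  (P : HomogeneousRelations k V)

/-! ## The Frobenius form of the Yoneda algebra -/

/-- Ext^i(k,k) and a subspace of the dual of W_{n(i)} are quotients of the space of functions by the
same kernel. -/
theorem finite_selfExt (hK : P.IsKoszul) (i : ℕ) :
    FiniteDimensional k (SelfExt.{_, _, u} P.trivialModule i) := by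
  let ev : (List (Letter k V) → k) →ₗ[k] Module.Dual k (P.W k k (P.jump i)) :=
    LinearMap.mk₂ k (fun f x => contract (P.jump i) f x.1 [])
      (fun f g x => by rw [contract_add_left, Pi.add_apply])
      (fun c f x => by rw [contract_smul_left, Pi.smul_apply])
      (fun f x y => by rw [Submodule.coe_add, contract_add, Pi.add_apply])
      (fun c f x => by rw [Submodule.coe_smul, contract_smul, Pi.smul_apply])
  have hker : LinearMap.ker ev = LinearMap.ker (P.cls hK i) := by
    ext f
    rw [LinearMap.mem_ker, LinearMap.mem_ker, cls_eq_zero_iff]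
    exact ⟨fun h x hx => LinearMap.congr_fun h ⟨x, hx⟩, fun h => LinearMap.ext fun x => h x.1 x.2⟩
  have e1 := (P.cls hK i).quotKerEquivOfSurjective (P.cls_surjective hK i)
  have e2 := ev.quotKerEquivRange
  have e3 := Submodule.quotEquivOfEq _ _ hker
  exact Module.Finite.equiv (e2.symm.trans (e3.trans e1))

theorem of_cls_mul (hK : P.IsKoszul) {m l : ℕ} (h : P.jump m + P.jump l = P.jump (m + l))
    (f g : List (Letter k V) → k) :
    (DirectSum.of (SelfExt.{_, _, u} P.trivialModule) l (P.cls hK l g) *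
      DirectSum.of (SelfExt P.trivialModule) m (P.cls hK m f) : P.E) =
      DirectSum.of (SelfExt P.trivialModule) (m + l)
        (P.cls hK (m + l) (conc (P.jump l) g f)) := by
  rw [DirectSum.of_mul_of]
  refine DirectSum.of_eq_of_gradedMonoid_eq ?_
  rw [← P.cls_comp_cls hK h]
  exact SelfExt.mk_comp_eq (X := P.trivialModule) (P.cls hK m f) (P.cls hK l g)
    (Nat.add_comm m l) rfl

/-- The form is evaluation at w on Ext^D, well defined because classes are determined by their
values on W_{n(D)}. Since the jumps add up to n(D), it pairs g and f by contracting w with f and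
then g, and nondegeneracy is `contract_injective`. -/
theorem exists_frobeniusForm (hK : P.IsKoszul) {D : ℕ}
    (hdim : leftGlobalDimension P.Alg = (D : WithBot ℕ∞)) (hG : P.IsASGorenstein D)
    {w : List (Letter k V) → k} (hw : w ∈ P.W k k (P.jump D)) (hw0 : w ≠ 0)
    (hwD : ∀ x ∈ P.W k k (P.jump D), ∃ c : k, x = c • w) :
    ∃ Φ : FrobeniusForm.{_, _, u, _} k P.trivialModule D,
      ∀ m l, m + l = D → ∀ f g : List (Letter k V) → k,
        Φ.H (DirectSum.of (SelfExt.{_, _, u} P.trivialModule) l (P.cls hK l g) *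
          DirectSum.of (SelfExt P.trivialModule) m (P.cls hK m f)) =
        contract (P.jump l) g (contract (P.jump m) f w) [] := by
  obtain ⟨s, hs⟩ := (P.cls hK D).exists_rightInverse_of_surjective
    (LinearMap.range_eq_top.2 (P.cls_surjective hK D))
  have hs' : ∀ x, P.cls hK D (s x) = x := fun x => LinearMap.congr_fun hs x
  let η : SelfExt.{_, _, u} P.trivialModule D →ₗ[k] k :=
    { toFun := fun x => contract (P.jump D) (s x) w []
      map_add' := fun x y => by rw [map_add, contract_add_left, Pi.add_apply]
      map_smul' := fun c x => by rw [map_smul, contract_smul_left, Pi.smul_apply]; rfl }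
  have hη : ∀ f, η (P.cls hK D f) = contract (P.jump D) f w [] := fun f => by
    have := (P.cls_eq_zero_iff hK D (s (P.cls hK D f) + (-1 : k) • f)).1
      (by rw [map_add, map_smul, hs', neg_one_smul, add_neg_cancel]) w hw
    rw [contract_add_left, contract_smul_left, Pi.add_apply, Pi.smul_apply, neg_one_smul,
      add_neg_eq_zero] at this
    exact this
  let H : P.E →ₗ[k] k := η ∘ₗ DirectSum.component k ℕ (SelfExt P.trivialModule) D
  have hH : ∀ x, H (DirectSum.of (SelfExt P.trivialModule) D x) = η x := fun x =>
    congrArg η (DirectSum.of_eq_same D x)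
  have hHne : ∀ i, i ≠ D → ∀ x, H (DirectSum.of (SelfExt P.trivialModule) i x) = 0 :=
    fun i hi x => (congrArg η (DirectSum.of_eq_of_ne i D x hi.symm)).trans (map_zero η)
  have key : ∀ m l, m + l = D → ∀ f g : List (Letter k V) → k,
        H (DirectSum.of (SelfExt.{_, _, u} P.trivialModule) l (P.cls hK l g) *
          DirectSum.of (SelfExt P.trivialModule) m (P.cls hK m f)) =
        contract (P.jump l) g (contract (P.jump m) f w) [] := by
    intro m l hml f g
    have hj := jump_add_of_top hK hdim hG hml
    subst hml
    rw [P.of_cls_mul hK hj, hH, hη, ← hj, Nat.add_comm (P.jump m), contract_conc]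
  refine ⟨⟨H, hHne, fun i j hij x hx => ?_, fun i hi x => ?_, fun H' hH' => ?_,
    P.finite_selfExt hK⟩, key⟩
  · obtain ⟨f, rfl⟩ := P.cls_surjective hK i x
    refine (P.cls_eq_zero_iff hK i f).2 (contract_injective hK hG hwD hij ?_)
    refine P.eq_zero_of_contract (n := P.jump j) (contract_mem (n := P.jump D) ?_ f hw) fun g => ?_
    · rw [← jump_add_of_top hK hdim hG hij, add_comm]
    · rw [← key i j hij, hx]
  · obtain ⟨f, rfl⟩ := P.cls_surjective hK i x
    refine (P.cls_eq_zero_iff hK i f).2 fun x hx => ?_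
    rw [W_eq_zero hK hdim hi hx]
    exact wsum_eq_zero fun _ _ => smul_zero _
  · obtain ⟨f₀, hf₀⟩ : ∃ f₀, contract (P.jump D) f₀ w [] ≠ 0 := by
      by_contra! h
      exact hw0 (P.eq_zero_of_contract hw h)
    have hη0 : ∀ x, η x = 0 → x = 0 := fun x hx => by
      obtain ⟨f, rfl⟩ := P.cls_surjective hK D x
      refine (P.cls_eq_zero_iff hK D f).2 fun y hy => ?_
      obtain ⟨c, rfl⟩ := hwD y hy
      rw [contract_smul, Pi.smul_apply, ← hη, hx, smul_zero]
    let x₀ := P.cls hK D f₀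
    have hx₀ : η x₀ ≠ 0 := by rwa [hη]
    refine ⟨H' (DirectSum.of (SelfExt P.trivialModule) D x₀) / η x₀, ?_⟩
    refine LinearMap.ext fun x => ?_
    induction x using DirectSum.induction_on with
    | zero => rw [map_zero, map_zero]
    | add x y hx hy => rw [map_add, map_add, hx, hy]
    | of i x =>
      by_cases hi : i = D
      · subst hi
        have : x = (η x / η x₀) • x₀ := by
          rw [← sub_eq_zero]
          refine hη0 _ ?_
          rw [map_sub, map_smul, smul_eq_mul, div_mul_cancel₀ _ hx₀, sub_self]
        have h2 : DirectSum.of (SelfExt P.trivialModule) i x =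
            (η x / η x₀) • DirectSum.of (SelfExt P.trivialModule) i x₀ := by
          conv_lhs => rw [this]
          exact map_smul (DirectSum.lof k ℕ (SelfExt P.trivialModule) i) _ _
        rw [h2, map_smul, map_smul, LinearMap.smul_apply, hH]
        simp only [smul_eq_mul]
        field_simp
      · rw [hH' i hi, LinearMap.smul_apply, hHne i hi, smul_zero]

/-! ### The component of degree one -/

/-- A linear form on `V`, as a function on words of length one. -/
def wordForm (α : Module.Dual k V) : List (Letter k V) → k
  | [i] => α (basisV k V i)
  | _ => 0

theorem contract_one_wordForm {M : Type*} [AddCommGroup M] [Module k M] (α : Module.Dual k V)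
    (F : List (Letter k V) → M) (u : List (Letter k V)) :
    contract 1 (wordForm α) F u = ∑ i, α (basisV k V i) • F (u ++ [i]) := rfl

theorem snd_dualNumberHom_x (α : Module.Dual k V) (a : P.Alg) (i : Letter k V) :
    (P.dualNumberHom α (a * P.x i)).snd = P.aug a * α (basisV k V i) := by
  have h : P.dualNumberHom α (P.x i) = TrivSqZeroExt.inr (α (basisV k V i)) :=
    P.lift_ι _ _ _
  rw [map_mul, h, TrivSqZeroExt.snd_mul, TrivSqZeroExt.snd_inr, TrivSqZeroExt.fst_inr,
    fst_dualNumberHom]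
  simp

/-- The sequence 0 → A_+ → A → k → 0 is compared with the first step of the Koszul resolution by
evaluating at the empty word. -/
theorem dualToExt_eq_cls (hK : P.IsKoszul) (α : Module.Dual k V) :
    P.dualToExt α = P.cls hK 1 (wordForm α) := by
  let τ₂ : P.KK 0 →ₗ[P.Alg] P.Alg :=
    { toFun := fun F => F.1 []
      map_add' := fun _ _ => rfl
      map_smul' := fun _ _ => rfl }
  let τ₁ : P.Y 1 →ₗ[P.Alg] LinearMap.ker P.augLinear :=
    (τ₂ ∘ₗ P.ιY 0).codRestrict _ fun y => P.πY_ιY 0 y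
  let g : ModuleCat.of P.Alg (LinearMap.ker P.augLinear) ⟶ ModuleCat.of P.Alg P.trivialModule :=
    ModuleCat.ofHom (P.extendForm α)
  have hse := LinearMap.shortExact_shortComplexKer P.augLinear_surjective
  refine ((P.syz hK).extClass_comp_eq_cl (M := P.trivialModule) hse (ModuleCat.ofHom τ₁)
    (ModuleCat.ofHom τ₂) rfl rfl g).trans ?_
  have h : (ModuleCat.ofHom τ₁ ≫ g : (P.syz hK).Y 1 ⟶ _) =
      ModuleCat.ofHom (Y := P.trivialModule) (P.formY hK 1 (wordForm α)) := by
    refine ModuleCat.hom_ext (LinearMap.ext fun y => ?_)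
    obtain ⟨F, rfl⟩ := P.πY_surjective hK 1 y
    refine Eq.trans ?_ (P.formY_πY hK 1 (wordForm α) F).symm
    change (P.dualNumberHom α ((P.ιY 0 (P.πY 1 F)).1 [])).snd = P.aug _
    rw [ιY_πY, dK_coe, gap_zero, pow_one, dL_apply, map_sum, aug_evA]
    have : ∀ s : Finset (Letter k V), (∑ i ∈ s, P.dualNumberHom α (F.1 [i] * P.x i)).snd =
        ∑ i ∈ s, (P.dualNumberHom α (F.1 [i] * P.x i)).snd := fun s =>
      map_sum (TrivSqZeroExt.sndHom k k) _ _
    rw [this]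
    generalize F.1 = G
    rw [jump_one, contract_one_wordForm]
    exact Finset.sum_congr rfl fun i _ => by
      rw [snd_dualNumberHom_x, mul_comm]
      rfl
  exact congrArg (fun f => (P.syz hK).cl (n := 1) f) h

theorem wordForm_add (α β : Module.Dual k V) : wordForm (α + β) = wordForm α + wordForm β := by
  funext u
  match u with
  | [] => simp [wordForm]
  | [i] => rfl
  | i :: j :: u => simp [wordForm]

theorem wordForm_smul (c : k) (α : Module.Dual k V) : wordForm (c • α) = c • wordForm α := by
  funext u
  match u with
  | [] => simp [wordForm]
  | [i] => rfl
  | i :: j :: u => simp [wordForm]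

/-- The identification `V^* = Ext_A^1(k, k)` as a linear map. -/
def dualToExtLinear (hK : P.IsKoszul) :
    Module.Dual k V →ₗ[k] SelfExt.{_, _, u} P.trivialModule 1 where
  toFun α := P.dualToExt α
  map_add' α β := by rw [dualToExt_eq_cls P hK, dualToExt_eq_cls P hK, dualToExt_eq_cls P hK,
    wordForm_add, map_add]
  map_smul' c α := by rw [dualToExt_eq_cls P hK, dualToExt_eq_cls P hK, wordForm_smul, map_smul]; rfl

theorem dualToExtLinear_bijective (hK : P.IsKoszul) :
    Function.Bijective (P.dualToExtLinear hK) := by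
  have h2 := P.two_le
  constructor
  · refine (injective_iff_map_eq_zero _).2 fun α hα => (basisV k V).ext fun i => ?_
    change P.dualToExt α = 0 at hα
    rw [dualToExt_eq_cls P hK, cls_eq_zero_iff] at hα
    have := hα (Pi.single [i] 1) ((mem_WS_of_lt (by rw [jump_one]; omega)).2 fun u hu => by
      rw [jump_one] at hu
      refine Pi.single_eq_of_ne ?_ _
      rintro rfl
      exact hu rfl)
    rw [jump_one, contract_one_wordForm, Finset.sum_eq_single i] at this
    · simpa using this
    · intro j _ hj
      simp [hj]
    · simp
  · intro x
    obtain ⟨f, rfl⟩ := P.cls_surjective hK 1 x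
    refine ⟨(basisV k V).constr k fun i => f [i], ?_⟩
    change P.dualToExt _ = _
    rw [dualToExt_eq_cls P hK, ← sub_eq_zero, ← map_sub, cls_eq_zero_iff]
    intro y _
    rw [jump_one]
    refine wsum_eq_zero fun u hu => ?_
    obtain ⟨i, rfl⟩ := List.length_eq_one_iff.1 hu
    simp [wordForm]

end HomogeneousRelations

namespace HomogeneousRelations

open Words

variable {k V : Type u} [Field k] [AddCommGroup V] [Module k V] [FiniteDimensional k V]
  (P : HomogeneousRelations k V)

/-! ## The automorphism of the algebra -/

/-- The matrix of ν on E_1 = V^* is transposed. A form α vanishing on the image of φ_1 has ν(α) = 0,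
so surjectivity of φ_1 follows from injectivity of ν. -/
theorem exists_transpose (hK : P.IsKoszul) {D : ℕ} {ν : P.E ≃ₐ[k] P.E}
    (hν : IsNakayamaAutomorphism P.trivialModule D ν) : ∃ φ₁ : V →ₗ[k] V,
    Function.Surjective φ₁ ∧ ∀ α : Module.Dual k V,
      ν (DirectSum.of (SelfExt P.trivialModule) 1 (P.dualToExt α)) =
        DirectSum.of (SelfExt P.trivialModule) 1 (P.dualToExt (α ∘ₗ φ₁)) := by
  have h1 : ∀ i, ∃ β : Module.Dual k V,
      ν (DirectSum.of (SelfExt P.trivialModule) 1 (P.dualToExt ((basisV k V).coord i))) =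
        DirectSum.of (SelfExt P.trivialModule) 1 (P.dualToExt β) := fun i => by
    obtain ⟨y, hy⟩ := hν.1 1 (P.dualToExt ((basisV k V).coord i))
    obtain ⟨β, rfl⟩ := (P.dualToExtLinear_bijective hK).2 y
    exact ⟨β, hy⟩
  choose β hβ using h1
  let φ₁ : V →ₗ[k] V := ∑ j, (β j).smulRight (basisV k V j)
  let T : Module.Dual k V →ₗ[k] P.E :=
    DirectSum.lof k ℕ (SelfExt P.trivialModule) 1 ∘ₗ P.dualToExtLinear hK
  have key : (ν.toLinearMap ∘ₗ T) = T ∘ₗ Module.Dual.transpose φ₁ := by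
    refine (basisV k V).dualBasis.ext fun i => ?_
    refine Eq.trans ?_ ((hβ i).trans ?_)
    · rw [Module.Basis.coe_dualBasis]
      rfl
    · have : β i = Module.Dual.transpose φ₁ ((basisV k V).dualBasis i) := by
        refine LinearMap.ext fun v => ?_
        rw [Module.Basis.coe_dualBasis, Module.Dual.transpose_apply, LinearMap.comp_apply,
          Module.Basis.coord_apply, LinearMap.sum_apply, map_sum, Finset.sum_apply']
        simp [Finsupp.single_apply]
      rw [this]
      rfl
  have key' : ∀ α : Module.Dual k V,
      ν (DirectSum.of (SelfExt P.trivialModule) 1 (P.dualToExt α)) =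
        DirectSum.of (SelfExt P.trivialModule) 1 (P.dualToExt (α ∘ₗ φ₁)) := fun α =>
    LinearMap.congr_fun key α
  refine ⟨φ₁, LinearMap.range_eq_top.1 ?_, key'⟩
  by_contra hr
  obtain ⟨α, hα, hle⟩ := Submodule.exists_le_ker_of_lt_top _ (lt_top_iff_ne_top.2 hr)
  refine hα ((P.dualToExtLinear_bijective hK).1 ?_)
  have h0 : α ∘ₗ φ₁ = 0 := LinearMap.ext fun v => hle ⟨v, rfl⟩
  have h2 : P.dualToExt 0 = 0 := map_zero (P.dualToExtLinear hK)
  have := key' α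
  rw [h0, h2, map_zero, map_eq_zero_iff ν ν.injective] at this
  exact ((DirectSum.of_injective (β := SelfExt P.trivialModule) 1)
    (this.trans (map_zero _).symm)).trans h2.symm

/-- The matrix coefficients of an endomorphism of `V`. -/
def coeffV (φ₁ : V →ₗ[k] V) (j i : Letter k V) : k := (basisV k V).repr (φ₁ (basisV k V i)) j

/-- The generator of `W_{n(D)}` is invariant under twisted rotations. -/
def Rotates (w : List (Letter k V) → k) (φ₁ : V →ₗ[k] V) (n : ℕ) : Prop :=
  ∀ (j : Letter k V) (u : List (Letter k V)), u.length + 1 = n →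
    w (j :: u) = ∑ i, coeffV φ₁ j i * w (u ++ [i])

/-- This is H(y ν(x)) = H(x y) with x the j-th coordinate form on V and y the class of the indicator
of the word u. The left side contracts the last letter of w through φ_1, the right side reads its
first letter. -/
theorem rotates {D : ℕ} (hK : P.IsKoszul)
    (hdim : leftGlobalDimension P.Alg = (D : WithBot ℕ∞)) (hG : P.IsASGorenstein D)
    {w : List (Letter k V) → k} (hw : w ∈ P.W k k (P.jump D)) (hw0 : w ≠ 0)
    (hwD : ∀ x ∈ P.W k k (P.jump D), ∃ c : k, x = c • w) {ν : P.E ≃ₐ[k] P.E}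
    (hν : IsNakayamaAutomorphism P.trivialModule D ν) {φ₁ : V →ₗ[k] V}
    (hφ : ∀ α : Module.Dual k V,
      ν (DirectSum.of (SelfExt P.trivialModule) 1 (P.dualToExt α)) =
        DirectSum.of (SelfExt P.trivialModule) 1 (P.dualToExt (α ∘ₗ φ₁))) : Rotates w φ₁ (P.jump D) := by
  intro j u hu
  obtain ⟨d, rfl⟩ : ∃ d, D = d + 1 := by
    rcases D with _ | d
    · rw [jump_zero] at hu; omega
    · exact ⟨d, rfl⟩
  have hj := P.jump_succ d
  rw [gap_of_top hK hdim hG rfl] at hj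
  obtain ⟨Φ, hΦ⟩ := P.exists_frobeniusForm hK hdim hG hw hw0 hwD
  have h := Φ.H_of_isNakayamaAutomorphism hν
    (DirectSum.of (SelfExt P.trivialModule) 1 (P.dualToExt ((basisV k V).coord j)))
    (DirectSum.of (SelfExt P.trivialModule) d (P.cls hK d (Pi.single u 1)))
  rw [hφ, dualToExt_eq_cls P hK, dualToExt_eq_cls P hK, hΦ 1 d (by omega), hΦ d 1 rfl,
    contract_single u (by omega), jump_one, contract_one_wordForm, contract_one_wordForm] at h
  have h2 : ∀ i, contract (P.jump d) (Pi.single u (1 : k)) w ([] ++ [i]) = w (i :: u) :=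
    fun i => contract_single u (by omega) w _
  simp only [h2] at h
  have h3 : ∀ i, (basisV k V).coord j (basisV k V i) = if i = j then 1 else 0 := fun i => by
    rw [Module.Basis.coord_apply, Module.Basis.repr_self, Finsupp.single_apply]
  simp only [h3, ite_smul, one_smul, zero_smul, Finset.sum_ite_eq', Finset.mem_univ, if_true] at h
  exact h.symm

theorem ι_basis (φ₁ : V →ₗ[k] V) (i : Letter k V) :
    P.ι (φ₁ (basisV k V i)) = ∑ j, coeffV φ₁ j i • P.x j := P.ι_eq_sum _

/-- The last n letters are moved to the front one at a time, each of them passing through φ_1 once.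
-/
theorem wsum_mon_rotate {w : List (Letter k V) → k} {φ₁ : V →ₗ[k] V} {m : ℕ}
    (hrot : Rotates w φ₁ m) (n : ℕ) (u : List (Letter k V)) (hu : u.length + n = m) :
    (wsum n fun v => w (u ++ v) • mon (fun i => P.ι (φ₁ (basisV k V i))) v) =
      wsum n fun t => w (t ++ u) • mon P.x t := by
  induction n generalizing u with
  | zero => simp
  | succ n ih =>
    have h1 : ∀ i (v : List (Letter k V)), w (u ++ (v ++ [i])) •
        mon (fun i => P.ι (φ₁ (basisV k V i))) (v ++ [i]) =
        ∑ j, (coeffV φ₁ j i * w ((u ++ v) ++ [i])) •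
          (mon (fun i => P.ι (φ₁ (basisV k V i))) v * P.x j) := fun i v => by
      rw [mon_append, mon_cons, mon_nil, mul_one, ι_basis, Finset.mul_sum, Finset.smul_sum]
      refine Finset.sum_congr rfl fun j _ => ?_
      rw [mul_smul_comm, smul_smul, mul_comm, List.append_assoc]
    rw [wsum_succ_last, wsum_succ_last]
    simp only [h1]
    have h2 : ∀ j, (wsum n fun t => w (t ++ [j] ++ u) • mon P.x (t ++ [j])) =
        (wsum n fun v => w (j :: (u ++ v)) • mon (fun i => P.ι (φ₁ (basisV k V i))) v) * P.x j :=
      fun j => by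
        have := ih (j :: u) (by simp; omega)
        simp only [List.cons_append] at this
        rw [this, wsum_mul]
        refine wsum_congr fun t _ => ?_
        rw [mon_append, mon_cons, mon_nil, mul_one, smul_mul_assoc, List.append_assoc]
        rfl
    simp only [h2, wsum_finsum]
    rw [Finset.sum_comm]
    refine Finset.sum_congr rfl fun j _ => ?_
    rw [← wsum_finsum, wsum_mul]
    refine wsum_congr fun v hv => ?_
    rw [← Finset.sum_smul, ← hrot j (u ++ v) (by simp; omega), smul_mul_assoc]

/-- For a linear form l on A, contracting the last N letters of w with v ↦ l(φ(x_v)) gives, after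
rotation, l of the first N letters evaluated in A, which is zero because they form a relation.
Nondegeneracy in degree two then says that this function kills R. If D < 2 there are no relations.
-/
theorem relation_rotate {D : ℕ} (hK : P.IsKoszul)
    (hdim : leftGlobalDimension P.Alg = (D : WithBot ℕ∞)) (hG : P.IsASGorenstein D)
    {w : List (Letter k V) → k} (hw : w ∈ P.W k k (P.jump D))
    (hwD : ∀ x ∈ P.W k k (P.jump D), ∃ c : k, x = c • w) {φ₁ : V →ₗ[k] V}
    (hrot : Rotates w φ₁ (P.jump D)) {r : List (Letter k V) → k} (hr : r ∈ P.Rw) :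
    (wsum P.N fun v => r v • mon (fun i => P.ι (φ₁ (basisV k V i))) v) = 0 := by
  have hr2 : r ∈ P.W k k (P.jump 2) := by rw [jump_two]; exact P.mem_W_N.2 hr
  rcases Nat.lt_or_ge D 2 with hD | hD
  · rw [W_eq_zero hK hdim hD hr2]
    exact wsum_eq_zero fun _ _ => zero_smul _ _
  · obtain ⟨d, rfl⟩ : ∃ d, D = d + 2 := ⟨D - 2, by omega⟩
    refine (Module.forall_dual_apply_eq_zero_iff k _).1 fun l => ?_
    have hj := P.jump_add_two d
    have h := contract_injective hK hG hwD (i := 2) (j := d) (by omega)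
      (f := fun v => l (mon (fun i => P.ι (φ₁ (basisV k V i))) v)) ?_ r hr2
    · rw [jump_two] at h
      rw [map_wsum, ← h]
      refine wsum_congr fun v _ => ?_
      rw [map_smul, smul_eq_mul, smul_eq_mul, mul_comm]
      rfl
    · rw [jump_two]
      funext u
      by_cases hu : u.length = P.jump d
      · have h1 := congrArg l (P.wsum_mon_rotate hrot P.N u (by omega))
        rw [P.relation (by simpa using apply_mem_Rw hw [] u (by simp; omega)), map_zero,
          map_wsum] at h1
        rw [Pi.zero_apply, ← h1]
        refine wsum_congr fun v _ => ?_
        rw [map_smul, smul_eq_mul, smul_eq_mul, mul_comm]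
      · exact wsum_eq_zero fun v hv => by
          rw [hw.1 _ (by rw [List.length_append]; omega), smul_zero]

theorem finite_component (m : ℕ) : FiniteDimensional k (P.component m) :=
  Module.Finite.iff_fg.2 ((Module.Finite.iff_fg.1 (inferInstance :
    Module.Finite k (LinearMap.range P.ι))).pow m)

theorem map_component {φ : P.Alg →ₐ[k] P.Alg} {φ₁ : V →ₗ[k] V} (hφ : ∀ v, φ (P.ι v) = P.ι (φ₁ v))
    (hs : Function.Surjective φ₁) (m : ℕ) :
    (P.component m).map φ.toLinearMap = P.component m := by
  have h1 : (LinearMap.range P.ι).map φ.toLinearMap = LinearMap.range P.ι := by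
    ext a
    constructor
    · rintro ⟨_, ⟨v, rfl⟩, rfl⟩
      exact ⟨φ₁ v, (hφ v).symm⟩
    · rintro ⟨v, rfl⟩
      obtain ⟨v, rfl⟩ := hs v
      exact ⟨_, ⟨v, rfl⟩, hφ v⟩
  rw [component, Submodule.map_pow, h1]

theorem pr_map {φ : P.Alg →ₐ[k] P.Alg} (hφ : ∀ m, (P.component m).map φ.toLinearMap ≤ P.component m)
    (m : ℕ) (a : P.Alg) : P.pr m (φ a) = φ (P.pr m a) := by
  have : P.pr m ∘ₗ φ.toLinearMap = φ.toLinearMap ∘ₗ P.pr m := P.linear_ext fun u => by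
    have h : φ (mon P.x u) ∈ P.component u.length :=
      hφ _ ⟨_, P.mon_mem_component u, rfl⟩
    rw [LinearMap.comp_apply, LinearMap.comp_apply, pr_mon, AlgHom.toLinearMap_apply,
      ← P.pr_of_mem h, pr_pr, P.pr_of_mem h]
    split_ifs with h1 h2 h2
    · rfl
    · exact absurd h1.symm h2
    · exact absurd h2.symm h1
    · rw [map_zero]
  exact LinearMap.congr_fun this a

/-- Each component A_m is finite-dimensional and is mapped onto itself. -/
theorem bijective_of_surjective {φ : P.Alg →ₐ[k] P.Alg} {φ₁ : V →ₗ[k] V}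
    (hφ : ∀ v, φ (P.ι v) = P.ι (φ₁ v)) (hs : Function.Surjective φ₁) : Function.Bijective φ := by
  have hmap := P.map_component hφ hs
  constructor
  · refine (injective_iff_map_eq_zero φ).2 fun a ha => P.eq_zero_of_pr fun m => ?_
    have h1 : φ (P.pr m a) = 0 := by rw [← P.pr_map (fun m => (hmap m).le), ha, map_zero]
    have := P.finite_component m
    let ψ : P.component m →ₗ[k] P.component m :=
      φ.toLinearMap.restrict fun b hb => (hmap m).le ⟨b, hb, rfl⟩
    have hψ : Function.Surjective ψ := fun b => by
      obtain ⟨c, hc, h⟩ := (hmap m).ge b.2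
      exact ⟨⟨c, hc⟩, Subtype.ext h⟩
    have := (injective_iff_map_eq_zero ψ).1 (LinearMap.injective_iff_surjective.2 hψ)
      ⟨P.pr m a, P.pr_mem_component m a⟩ (Subtype.ext h1)
    exact congrArg Subtype.val this
  · intro a
    induction a using P.alg_induction with
    | hm u =>
      obtain ⟨b, -, h⟩ := (hmap u.length).ge (P.mon_mem_component u)
      exact ⟨b, h⟩
    | ha a b ha hb =>
      obtain ⟨a, rfl⟩ := ha
      obtain ⟨b, rfl⟩ := hb
      exact ⟨a + b, map_add φ a b⟩
    | hs c a ha =>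
      obtain ⟨a, rfl⟩ := ha
      exact ⟨c • a, map_smul φ c a⟩

theorem existsUnique_isTransposeInDegreeOne {D : ℕ} (hK : P.IsKoszul)
    (hdim : leftGlobalDimension P.Alg = (D : WithBot ℕ∞)) (hG : P.IsASGorenstein D)
    {ν : P.E ≃ₐ[k] P.E} (hν : IsNakayamaAutomorphism P.trivialModule D ν) :
    ∃! φ : P.Alg ≃ₐ[k] P.Alg, P.IsTransposeInDegreeOne φ ν := by
  obtain ⟨w, hw, hw0, hwD⟩ := exists_generator hK hdim hG
  obtain ⟨φ₁, hs, hφ₁⟩ := P.exists_transpose hK hν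
  obtain ⟨φ, hφ⟩ := P.exists_lift (fun i => P.ι (φ₁ (basisV k V i))) fun r hr =>
    P.relation_rotate hK hdim hG hw hwD (P.rotates hK hdim hG hw hw0 hwD hν hφ₁) hr
  have hφι : ∀ v, φ (P.ι v) = P.ι (φ₁ v) := LinearMap.congr_fun
    (f := φ.toLinearMap ∘ₗ P.ι) (g := P.ι ∘ₗ φ₁) ((basisV k V).ext hφ)
  refine ⟨AlgEquiv.ofBijective φ (P.bijective_of_surjective hφι hs), ⟨φ₁, hφι, hφ₁⟩, ?_⟩
  rintro ψ ⟨ψ₁, hψ, hψ₁⟩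
  have h1 : φ₁ = ψ₁ := by
    refine LinearMap.ext fun v => ?_
    rw [← sub_eq_zero]
    refine (Module.forall_dual_apply_eq_zero_iff k _).1 fun α => ?_
    have h := (P.dualToExtLinear_bijective hK).1 (DirectSum.of_injective
      (β := SelfExt P.trivialModule) 1 ((hφ₁ α).symm.trans (hψ₁ α)))
    rw [map_sub, sub_eq_zero]
    exact LinearMap.congr_fun h v
  subst h1
  have h2 : (ψ : P.Alg →ₐ[k] P.Alg) = φ := P.algHom_ext fun v => (hψ v).trans (hφι v).symm
  exact AlgEquiv.ext fun a => DFunLike.congr_fun h2 a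

end HomogeneousRelations

namespace HomogeneousRelations

open Words

variable {k V : Type u} [Field k] [AddCommGroup V] [Module k V] [FiniteDimensional k V]
  (P : HomogeneousRelations k V)

/-! ## The enveloping algebra -/

/-- The enveloping algebra of `A`. -/
abbrev Env : Type u := Enveloping k P.Alg

/-- The action of a generator on the left. -/
def eB (i : Letter k V) : P.Env := P.x i ⊗ₜ 1

/-- The action of a generator on the right. -/
def fB (i : Letter k V) : P.Env := 1 ⊗ₜ op (P.x i)

theorem commute_eB_fB (i j : Letter k V) : P.eB i * P.fB j = P.fB j * P.eB i := by
  simp [eB, fB, Algebra.TensorProduct.tmul_mul_tmul]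

theorem mon_eB (u : List (Letter k V)) : mon P.eB u = mon P.x u ⊗ₜ[k] (1 : P.Algᵐᵒᵖ) := by
  induction u with
  | nil => rfl
  | cons i u ih =>
    rw [mon_cons, mon_cons, ih, eB, Algebra.TensorProduct.tmul_mul_tmul, one_mul]

theorem mon_fB (u : List (Letter k V)) :
    mon P.fB u = (1 : P.Alg) ⊗ₜ[k] op (mon P.x u.reverse) := by
  induction u with
  | nil => rfl
  | cons i u ih =>
    rw [mon_cons, ih, fB, Algebra.TensorProduct.tmul_mul_tmul, one_mul, List.reverse_cons,
      mon_append, mon_cons, mon_nil, mul_one, op_mul]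

/-- The index set of a basis of the algebra opposite to `A`. -/
abbrev OpIndex : Type u := Module.Basis.ofVectorSpaceIndex k P.Algᵐᵒᵖ

/-- A basis of the algebra opposite to `A`. -/
def opBasis : Module.Basis P.OpIndex k P.Algᵐᵒᵖ := Module.Basis.ofVectorSpace k P.Algᵐᵒᵖ

/-- The coordinates of an element of the enveloping algebra with respect to a basis over `A`. -/
def coB (j : P.OpIndex) : P.Env →ₗ[k] P.Alg :=
  (TensorProduct.rid k P.Alg).toLinearMap ∘ₗ (P.opBasis.coord j).lTensor P.Alg

theorem coB_tmul (j : P.OpIndex) (a : P.Alg) (b : P.Algᵐᵒᵖ) :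
    P.coB j (a ⊗ₜ b) = P.opBasis.coord j b • a := rfl

/-- The enveloping algebra is a direct sum of copies of A indexed by a basis of A°, compatibly with
both multiplications by A ⊗ 1. Leading terms involve only such multiplications, so they can be
treated one coordinate at a time. -/
theorem coB_mul_tmul_one (j : P.OpIndex) (b : P.Env) (a : P.Alg) :
    P.coB j (b * a ⊗ₜ 1) = P.coB j b * a := by
  induction b using TensorProduct.induction_on with
  | zero => simp
  | add b b' hb hb' => rw [add_mul, map_add, map_add, add_mul, hb, hb']
  | tmul c d => rw [Algebra.TensorProduct.tmul_mul_tmul, coB_tmul, coB_tmul, mul_one, smul_mul_assoc]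

theorem coB_tmul_one_mul (j : P.OpIndex) (b : P.Env) (a : P.Alg) :
    P.coB j (a ⊗ₜ 1 * b) = a * P.coB j b := by
  induction b using TensorProduct.induction_on with
  | zero => simp
  | add b b' hb hb' => rw [mul_add, map_add, map_add, mul_add, hb, hb']
  | tmul c d => rw [Algebra.TensorProduct.tmul_mul_tmul, coB_tmul, coB_tmul, one_mul, mul_smul_comm]

/-- The element `a ⊗ b_j`, where `b_j` is an element of the basis. -/
def tmulB (j : P.OpIndex) : P.Alg →ₗ[k] P.Env := (TensorProduct.mk k P.Alg P.Algᵐᵒᵖ).flip (P.opBasis j)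

theorem tmulB_apply (j : P.OpIndex) (a : P.Alg) : P.tmulB j a = a ⊗ₜ P.opBasis j := rfl

theorem tmulB_mul (j : P.OpIndex) (a b : P.Alg) : P.tmulB j (a * b) = P.tmulB j a * b ⊗ₜ 1 := by
  rw [tmulB_apply, tmulB_apply, Algebra.TensorProduct.tmul_mul_tmul, mul_one]

theorem mul_tmulB (j : P.OpIndex) (a b : P.Alg) : P.tmulB j (a * b) = a ⊗ₜ 1 * P.tmulB j b := by
  rw [tmulB_apply, tmulB_apply, Algebra.TensorProduct.tmul_mul_tmul, one_mul]

theorem exists_support (b : P.Env) : ∃ s : Finset P.OpIndex, (∀ j ∉ s, P.coB j b = 0) ∧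
    ∀ t, s ⊆ t → ∑ j ∈ t, P.tmulB j (P.coB j b) = b := by
  classical
  refine ⟨(TensorProduct.equivFinsuppOfBasisRight P.opBasis b).support, ?_, ?_⟩
  · intro j hj
    have := Finsupp.notMem_support_iff.1 hj
    rwa [TensorProduct.equivFinsuppOfBasisRight_apply] at this
  · intro t ht
    have h := (TensorProduct.equivFinsuppOfBasisRight P.opBasis).symm_apply_apply b
    rw [TensorProduct.equivFinsuppOfBasisRight_symm_apply,
      Finsupp.sum_of_support_subset _ ht (fun i m => m ⊗ₜ[k] P.opBasis i)
        fun j _ => TensorProduct.zero_tmul _ _] at h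
    conv_rhs => rw [← h]
    refine Finset.sum_congr rfl fun j _ => ?_
    rw [TensorProduct.equivFinsuppOfBasisRight_apply]
    rfl

theorem eq_zero_of_coB {b : P.Env} (h : ∀ j, P.coB j b = 0) : b = 0 := by
  obtain ⟨s, -, hs⟩ := P.exists_support b
  rw [← hs s subset_rfl]
  exact Finset.sum_eq_zero fun j _ => by rw [h, map_zero]

/-! ### The grading by the left degree -/

/-- The projection of the enveloping algebra onto its component of left degree `m`. -/
def prB (m : ℕ) : P.Env →ₗ[k] P.Env := (P.pr m).rTensor P.Algᵐᵒᵖ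

theorem prB_tmul (m : ℕ) (a : P.Alg) (b : P.Algᵐᵒᵖ) : P.prB m (a ⊗ₜ b) = P.pr m a ⊗ₜ b := rfl

theorem coB_prB (j : P.OpIndex) (m : ℕ) (b : P.Env) : P.coB j (P.prB m b) = P.pr m (P.coB j b) := by
  induction b using TensorProduct.induction_on with
  | zero => simp
  | add b b' hb hb' => rw [map_add, map_add, map_add, map_add, hb, hb']
  | tmul c d => rw [prB_tmul, coB_tmul, coB_tmul, map_smul]

theorem prB_prB (m n : ℕ) (b : P.Env) : P.prB m (P.prB n b) = if m = n then P.prB n b else 0 := by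
  induction b using TensorProduct.induction_on with
  | zero => simp
  | add b b' hb hb' =>
    rw [map_add, map_add, hb, hb']
    split_ifs
    · rfl
    · rw [add_zero]
  | tmul c d =>
    rw [prB_tmul, prB_tmul, pr_pr]
    split_ifs
    · rfl
    · rw [TensorProduct.zero_tmul]

theorem exists_bound (b : P.Env) : ∃ m, ∀ n, m ≤ n → P.prB n b = 0 := by
  induction b using TensorProduct.induction_on with
  | zero => exact ⟨0, fun n _ => map_zero _⟩
  | add b b' hb hb' =>
    obtain ⟨m, hm⟩ := hb
    obtain ⟨m', hm'⟩ := hb'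
    exact ⟨max m m', fun n hn => by
      rw [map_add, hm n (le_of_max_le_left hn), hm' n (le_of_max_le_right hn), add_zero]⟩
  | tmul c d =>
    obtain ⟨m, hm, -⟩ := P.exists_sum_pr c
    exact ⟨m, fun n hn => by rw [prB_tmul, hm n hn, TensorProduct.zero_tmul]⟩

theorem eq_zero_of_prB {b : P.Env} (h : ∀ m, P.prB m b = 0) : b = 0 :=
  P.eq_zero_of_coB fun j => P.eq_zero_of_pr fun m => by rw [← coB_prB, h, map_zero]

theorem eq_sum_prB {b : P.Env} {m : ℕ} (h : ∀ n, m ≤ n → P.prB n b = 0) :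
    b = ∑ i ∈ Finset.range m, P.prB i b := by
  rw [← sub_eq_zero]
  refine P.eq_zero_of_prB fun n => ?_
  simp only [map_sub, map_sum, prB_prB, Finset.sum_ite_eq, Finset.mem_range]
  split_ifs with hn
  · exact sub_self _
  · rw [h n (Nat.le_of_not_lt hn), sub_zero]

theorem pr_mul_of_hom (g m : ℕ) (a b : P.Alg) :
    P.pr (g + m) (P.pr g a * b) = P.pr g a * P.pr m b := by
  induction a using P.alg_induction with
  | hm u =>
    rw [pr_mon]
    split_ifs with h
    · subst h
      induction u with
      | nil => simp
      | cons i u ih =>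
        rw [mon_cons, mul_assoc, List.length_cons, Nat.add_right_comm, pr_succ_x_mul, ih, mul_assoc]
    · rw [zero_mul, zero_mul, map_zero]
  | ha a a' h h' => rw [map_add, add_mul, map_add, h, h', add_mul]
  | hs c a h => rw [map_smul, smul_mul_assoc, map_smul, h, smul_mul_assoc]

theorem pr_mul_of_hom_of_lt {g m : ℕ} (h : m < g) (a b : P.Alg) : P.pr m (P.pr g a * b) = 0 := by
  induction a using P.alg_induction with
  | hm u =>
    rw [pr_mon]
    split_ifs with hu
    · induction u generalizing m g with
      | nil => simp at hu; omega
      | cons i u ih =>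
        rw [mon_cons, mul_assoc]
        cases m with
        | zero => rw [pr_zero_x_mul]
        | succ m =>
          rw [pr_succ_x_mul, ih (m := m) (g := u.length) (by simp at hu; omega) rfl, mul_zero]
    · rw [zero_mul, map_zero]
  | ha a a' h h' => rw [map_add, add_mul, map_add, h, h', add_zero]
  | hs c a h => rw [map_smul, smul_mul_assoc, map_smul, h, smul_zero]

theorem prB_mul_of_hom (g m : ℕ) (a b : P.Env) :
    P.prB (g + m) (P.prB g a * b) = P.prB g a * P.prB m b := by
  induction a using TensorProduct.induction_on with
  | zero => simp
  | add a a' h h' => rw [map_add, add_mul, map_add, h, h', add_mul]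
  | tmul a a' =>
    induction b using TensorProduct.induction_on with
    | zero => simp
    | add b b' h h' => rw [mul_add, map_add, h, h', map_add, mul_add]
    | tmul b b' =>
      rw [prB_tmul, prB_tmul, Algebra.TensorProduct.tmul_mul_tmul,
        Algebra.TensorProduct.tmul_mul_tmul, prB_tmul, pr_mul_of_hom]

theorem prB_mul_of_hom_of_lt {g m : ℕ} (h : m < g) (a b : P.Env) : P.prB m (P.prB g a * b) = 0 := by
  induction a using TensorProduct.induction_on with
  | zero => simp
  | add a a' h h' => rw [map_add, add_mul, map_add, h, h', add_zero]
  | tmul a a' =>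
    induction b using TensorProduct.induction_on with
    | zero => simp
    | add b b' h h' => rw [mul_add, map_add, h, h', add_zero]
    | tmul b b' =>
      rw [prB_tmul, Algebra.TensorProduct.tmul_mul_tmul, prB_tmul, P.pr_mul_of_hom_of_lt h,
        TensorProduct.zero_tmul]

/-- The elements of left degree less than `m`. -/
def LtDeg (m : ℕ) (b : P.Env) : Prop := ∀ n, m ≤ n → P.prB n b = 0

variable {P}

theorem LtDeg.mono {m n : ℕ} (h : m ≤ n) {b : P.Env} (hb : P.LtDeg m b) : P.LtDeg n b :=
  fun l hl => hb l (h.trans hl)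

theorem LtDeg.sub {m : ℕ} {b c : P.Env} (hb : P.LtDeg m b) (hc : P.LtDeg m c) :
    P.LtDeg m (b - c) := fun n hn => by rw [map_sub, hb n hn, hc n hn, sub_zero]

theorem LtDeg.zero (m : ℕ) : P.LtDeg m 0 := fun _ _ => map_zero _

theorem LtDeg.neg {m : ℕ} {b : P.Env} (hb : P.LtDeg m b) : P.LtDeg m (-b) := by
  rw [← zero_sub]
  exact (LtDeg.zero m).sub hb

theorem LtDeg.sum {κ : Type*} {s : Finset κ} {m : ℕ} {b : κ → P.Env}
    (hb : ∀ i ∈ s, P.LtDeg m (b i)) : P.LtDeg m (∑ i ∈ s, b i) := fun n hn => by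
  rw [map_sum]
  exact Finset.sum_eq_zero fun i hi => hb i hi n hn

theorem LtDeg.wsum {m n : ℕ} {F : List (Letter k V) → P.Env}
    (h : ∀ u, u.length = n → P.LtDeg m (F u)) : P.LtDeg m (wsum n F) := fun l hl => by
  rw [map_wsum]
  exact wsum_eq_zero fun u hu => h u hu l hl

theorem LtDeg.smul {m : ℕ} {b : P.Env} (c : k) (hb : P.LtDeg m b) : P.LtDeg m (c • b) :=
  fun n hn => by rw [map_smul, hb n hn, smul_zero]

/-- `LtDeg m` means left degree at most m - 1, so degrees of products are at most m + n - 2; hence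
the shift by one in the hypothesis. -/
theorem LtDeg.mul {m n l : ℕ} {b c : P.Env} (hb : P.LtDeg m b) (hc : P.LtDeg n c)
    (h : m + n ≤ l + 1) : P.LtDeg l (b * c) := by
  rw [P.eq_sum_prB hb, Finset.sum_mul]
  refine LtDeg.sum fun i hi q hq => ?_
  have hi' := Finset.mem_range.1 hi
  obtain ⟨q', rfl⟩ : ∃ q', q = i + q' := ⟨q - i, by omega⟩
  rw [prB_mul_of_hom, hc _ (by omega), mul_zero]

theorem LtDeg.prB {m : ℕ} (b : P.Env) (n : ℕ) (h : n < m) : P.LtDeg m (P.prB n b) :=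
  fun q hq => by rw [prB_prB, if_neg (by omega)]

theorem ltDeg_one_tmul (b : P.Algᵐᵒᵖ) : P.LtDeg 1 (1 ⊗ₜ b) := fun n hn => by
  rw [prB_tmul, pr_one, if_neg (by omega), TensorProduct.zero_tmul]

theorem ltDeg_algebraMap (c : k) : P.LtDeg 1 (algebraMap k P.Env c) := by
  rw [Algebra.algebraMap_eq_smul_one]
  exact (ltDeg_one_tmul 1).smul c

theorem ltDeg_mon_fB (u : List (Letter k V)) : P.LtDeg 1 (mon P.fB u) := by
  rw [mon_fB]
  exact ltDeg_one_tmul _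

theorem prB_mon_eB (u : List (Letter k V)) : P.prB u.length (mon P.eB u) = mon P.eB u := by
  rw [mon_eB, prB_tmul, pr_mon, if_pos rfl]

theorem prB_algebraMap (c : k) : P.prB 0 (algebraMap k P.Env c) = algebraMap k P.Env c := by
  rw [Algebra.algebraMap_eq_smul_one, map_smul, Algebra.TensorProduct.one_def, prB_tmul, pr_one,
    if_pos rfl]

theorem ltDeg_mon_eB (u : List (Letter k V)) : P.LtDeg (u.length + 1) (mon P.eB u) := by
  rw [← prB_mon_eB]
  exact LtDeg.prB _ _ (Nat.lt_succ_self _)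

theorem LtDeg.of_succ {m : ℕ} {b : P.Env} (hb : P.LtDeg (m + 1) b) : P.LtDeg m (b - P.prB m b) := by
  intro n hn
  rw [map_sub, prB_prB]
  split_ifs with h
  · rw [h, sub_self]
  · rw [hb n (by omega), sub_zero]

theorem prB_mul_mon_eB (m : ℕ) (b : P.Env) (u : List (Letter k V)) :
    P.prB (m + u.length) (b * mon P.eB u) = P.prB m b * mon P.eB u := by
  rw [mon_eB]
  induction b using TensorProduct.induction_on with
  | zero => simp
  | add b b' h h' => rw [add_mul, map_add, h, h', map_add, add_mul]
  | tmul a b => rw [Algebra.TensorProduct.tmul_mul_tmul, prB_tmul, pr_mul_mon, prB_tmul,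
      Algebra.TensorProduct.tmul_mul_tmul]

theorem prB_mul_mon_eB_of_lt {m : ℕ} (b : P.Env) (u : List (Letter k V)) (h : m < u.length) :
    P.prB m (b * mon P.eB u) = 0 := by
  rw [mon_eB]
  induction b using TensorProduct.induction_on with
  | zero => simp
  | add b b' h h' => rw [add_mul, map_add, h, h', add_zero]
  | tmul a b => rw [Algebra.TensorProduct.tmul_mul_tmul, prB_tmul, P.pr_mul_mon_of_lt _ _ h,
      TensorProduct.zero_tmul]

end HomogeneousRelations

namespace HomogeneousRelations

open Words

variable {k V : Type u} [Field k] [AddCommGroup V] [Module k V] [FiniteDimensional k V]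
  (P : HomogeneousRelations k V)

/-! ## The Koszul complex of bimodules -/

theorem commute_dL_dR_B : Commute (dL P.eB) (dR P.fB) := commute_dL_dR P.commute_eB_fB

/-- Letters leave the word starting from its end, hence the reversal; the product in A° reverses
them once more. -/
theorem dR_pow_apply (m : ℕ) (F : List (Letter k V) → P.Env) (u : List (Letter k V)) :
    (dR P.fB ^ m) F u = wsum m fun t => F (u ++ t) * mon P.fB t.reverse := by
  induction m generalizing u with
  | zero => simp
  | succ m ih =>
    rw [pow_succ', Module.End.mul_apply, dR_apply]
    simp only [ih, wsum_mul]
    rw [wsum_succ]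
    refine Finset.sum_congr rfl fun i _ => wsum_congr fun t _ => ?_
    rw [List.reverse_cons, mon_append, mon_cons, mon_nil, mul_one, mul_assoc, List.append_assoc]
    rfl

theorem wsum_mul_eq_zero {F m : List (Letter k V) → P.Env} (hF : F ∈ P.W P.Env P.Env P.N)
    (hm : ∀ r ∈ P.Rw, (wsum P.N fun t => r t • m t) = 0) : (wsum P.N fun t => F t * m t) = 0 := by
  have : ∀ t, F t * m t = ∑ i, coef P.N P.Rw P.N i F * (bas P.N P.Rw P.N i t • m t) := fun t => by
    rw [eq_sum_coef hF t, Finset.sum_mul]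
    exact Finset.sum_congr rfl fun i _ => by rw [smul_mul_assoc, mul_smul_comm]
  simp only [this, wsum_finsum, ← mul_wsum]
  exact Finset.sum_eq_zero fun i _ => by
    rw [hm _ (P.mem_W_N.1 (bas_mem P.N P.Rw P.N i)), mul_zero]

theorem dL_pow_N_B {n : ℕ} {F : List (Letter k V) → P.Env} (hF : F ∈ P.W P.Env P.Env (n + P.N)) :
    (dL P.eB ^ P.N) F = 0 := by
  funext u
  rw [dL_pow_apply]
  by_cases hu : u.length = n
  · refine P.wsum_mul_eq_zero (WS_slice_right (m := P.N) hF u (by omega)) fun r hr => ?_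
    have := congrArg (fun a => a ⊗ₜ[k] (1 : P.Algᵐᵒᵖ)) (P.relation hr)
    simp only [TensorProduct.zero_tmul] at this
    rw [← this]
    refine Eq.trans ?_ (map_wsum ((TensorProduct.mk k P.Alg P.Algᵐᵒᵖ).flip 1) P.N _).symm
    refine wsum_congr fun t _ => ?_
    rw [mon_eB]
    rfl
  · exact wsum_eq_zero fun t ht => by
      rw [hF.1 _ (by rw [List.length_append]; omega), zero_mul]

theorem dR_pow_N_B {n : ℕ} {F : List (Letter k V) → P.Env} (hF : F ∈ P.W P.Env P.Env (n + P.N)) :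
    (dR P.fB ^ P.N) F = 0 := by
  funext u
  rw [dR_pow_apply]
  by_cases hu : u.length = n
  · refine P.wsum_mul_eq_zero (WS_slice_left (m := P.N) hF u (by omega)) fun r hr => ?_
    have := congrArg (fun a => (1 : P.Alg) ⊗ₜ[k] op a) (P.relation hr)
    simp only [op_zero, TensorProduct.tmul_zero] at this
    rw [← this]
    refine Eq.trans ?_ (map_wsum ((TensorProduct.mk k P.Alg P.Algᵐᵒᵖ 1) ∘ₗ
      (opLinearEquiv k).toLinearMap) P.N _).symm
    refine wsum_congr fun t _ => ?_
    rw [mon_fB, List.reverse_reverse, map_smul]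
    rfl
  · exact wsum_eq_zero fun t ht => by
      rw [hF.1 _ (by rw [List.length_append]; omega), zero_mul]

/-- The operator which induces the differential of the Koszul complex of bimodules. -/
def TB (i : ℕ) : Module.End P.Env (List (Letter k V) → P.Env) :=
  if i % 2 = 0 then dL P.eB - dR P.fB
  else ∑ p ∈ Finset.range P.N, dL P.eB ^ p * dR P.fB ^ (P.N - 1 - p)

theorem TB_mem {i : ℕ} {F : List (Letter k V) → P.Env}
    (hF : F ∈ P.W P.Env P.Env (P.jump (i + 1))) : P.TB i F ∈ P.W P.Env P.Env (P.jump i) := by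
  rw [jump_succ] at hF
  unfold TB
  unfold gap at hF
  split_ifs with h
  · rw [if_pos h] at hF
    exact Submodule.sub_mem _ (dL_mem _ hF) (dR_mem _ hF)
  · rw [if_neg h] at hF
    rw [LinearMap.sum_apply]
    refine Submodule.sum_mem _ fun p hp => ?_
    have hp' := Finset.mem_range.1 hp
    refine dL_pow_mem P.eB p (dR_pow_mem P.fB (P.N - 1 - p) ?_)
    rwa [add_assoc, show p + (P.N - 1 - p) = P.N - 1 by omega]

/-- For the commuting operators L and R one has (L - R) ∑ L^p R^{N-1-p} = L^N - R^N, and N letters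
taken from either end form a relation. -/
theorem TB_TB {i : ℕ} {F : List (Letter k V) → P.Env}
    (hF : F ∈ P.W P.Env P.Env (P.jump (i + 2))) : P.TB i (P.TB (i + 1) F) = 0 := by
  rw [jump_add_two] at hF
  have h : P.TB i * P.TB (i + 1) = dL P.eB ^ P.N - dR P.fB ^ P.N := by
    unfold TB
    split_ifs with h1 h2 h2
    · omega
    · exact Commute.mul_geom_sum₂ (R := Module.End P.Env (List (Letter k V) → P.Env))
        P.commute_dL_dR_B P.N
    · exact Commute.geom_sum₂_mul (R := Module.End P.Env (List (Letter k V) → P.Env))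
        P.commute_dL_dR_B P.N
    · omega
  rw [← Module.End.mul_apply, h, LinearMap.sub_apply, P.dL_pow_N_B hF, P.dR_pow_N_B hF, sub_zero]

/-- Every summand other than the pure power of L contains a factor R, which does not raise the left
degree. The leading part of the differential is therefore that of the left Koszul complex with
coefficients extended by A°. -/
theorem ltDeg_TB_sub {i m : ℕ} {F : List (Letter k V) → P.Env} (hF : ∀ u, P.LtDeg m (F u))
    (u : List (Letter k V)) :
    P.LtDeg (m + P.gap i - 1) ((P.TB i F - (dL P.eB ^ P.gap i) F) u) := by
  have h2 := P.two_le
  unfold TB gap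
  split_ifs with h
  · rw [pow_one, LinearMap.sub_apply, sub_sub_cancel_left, Pi.neg_apply, dR_apply,
      Nat.add_sub_cancel]
    exact (LtDeg.sum fun i _ => (hF _).mul (ltDeg_one_tmul _) le_rfl).neg
  · obtain ⟨N, hN⟩ : ∃ N, P.N = N + 1 := ⟨P.N - 1, by omega⟩
    rw [hN, Finset.sum_range_succ, Nat.add_sub_cancel, Nat.sub_self, pow_zero, mul_one,
      LinearMap.add_apply, add_sub_cancel_right, LinearMap.sum_apply, Finset.sum_apply]
    refine LtDeg.sum fun p hp => ?_
    have hp' := Finset.mem_range.1 hp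
    rw [Module.End.mul_apply, dL_pow_apply]
    refine LtDeg.wsum fun t ht => ?_
    rw [dR_pow_apply]
    refine LtDeg.mul (m := m) (LtDeg.wsum fun s hs =>
      (hF _).mul (ltDeg_mon_fB _) le_rfl) (ltDeg_mon_eB t) (by omega)

theorem prB_dL_pow (g m : ℕ) (F : List (Letter k V) → P.Env) (u : List (Letter k V)) :
    P.prB (m + g) ((dL P.eB ^ g) F u) = (dL P.eB ^ g) (fun w => P.prB m (F w)) u := by
  rw [dL_pow_apply, dL_pow_apply, map_wsum]
  exact wsum_congr fun t ht => by rw [← ht, prB_mul_mon_eB]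

theorem prB_dL_pow_of_lt {g m : ℕ} (h : m < g) (F : List (Letter k V) → P.Env)
    (u : List (Letter k V)) : P.prB m ((dL P.eB ^ g) F u) = 0 := by
  rw [dL_pow_apply, map_wsum]
  exact wsum_eq_zero fun t ht => P.prB_mul_mon_eB_of_lt _ _ (by omega)

theorem coB_dL_pow (j : P.OpIndex) (g : ℕ) (F : List (Letter k V) → P.Env)
    (u : List (Letter k V)) :
    P.coB j ((dL P.eB ^ g) F u) = (dL P.x ^ g) (fun w => P.coB j (F w)) u := by
  rw [dL_pow_apply, dL_pow_apply, map_wsum]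
  exact wsum_congr fun t ht => by rw [mon_eB, coB_mul_tmul_one]

theorem tmulB_dL_pow (j : P.OpIndex) (g : ℕ) (F : List (Letter k V) → P.Alg)
    (u : List (Letter k V)) :
    (dL P.eB ^ g) (fun w => P.tmulB j (F w)) u = P.tmulB j ((dL P.x ^ g) F u) := by
  rw [dL_pow_apply, dL_pow_apply, map_wsum]
  exact wsum_congr fun t ht => by rw [mon_eB, tmulB_mul]

theorem exists_support_W {n : ℕ} {F : List (Letter k V) → P.Env} (hF : F ∈ P.W P.Env P.Env n) :
    ∃ s : Finset P.OpIndex, ∀ u, ∑ j ∈ s, P.tmulB j (P.coB j (F u)) = F u := by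
  classical
  choose s _ hs using fun i => P.exists_support (coef P.N P.Rw n i F)
  refine ⟨Finset.univ.biUnion s, fun u => ?_⟩
  rw [eq_sum_coef hF u]
  simp only [map_sum, map_smul]
  rw [Finset.sum_comm]
  refine Finset.sum_congr rfl fun i _ => ?_
  rw [← Finset.smul_sum, hs i _ (Finset.subset_biUnion_of_mem s (Finset.mem_univ i))]

theorem exists_ltDeg_W {n : ℕ} {F : List (Letter k V) → P.Env} (hF : F ∈ P.W P.Env P.Env n) :
    ∃ m, ∀ u, P.LtDeg m (F u) := by
  choose b hb using fun i => P.exists_bound (coef P.N P.Rw n i F)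
  refine ⟨Finset.univ.sup b, fun u => ?_⟩
  rw [eq_sum_coef hF u]
  exact LtDeg.sum fun i _ => (LtDeg.mono (Finset.le_sup (Finset.mem_univ i)) (hb i)).smul _

theorem exists_dL_pow {n g : ℕ} {F : List (Letter k V) → P.Env} (hF : F ∈ P.W P.Env P.Env n)
    (h : ∀ j, ∃ G ∈ P.W P.Alg P.Alg (n + g), (dL P.x ^ g) G = fun u => P.coB j (F u)) :
    ∃ G ∈ P.W P.Env P.Env (n + g), (dL P.eB ^ g) G = F := by
  choose G hG hGF using h
  obtain ⟨s, hs⟩ := P.exists_support_W hF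
  refine ⟨∑ j ∈ s, fun u => P.tmulB j (G j u),
    Submodule.sum_mem _ fun j _ => WS_map (hG j) (P.tmulB j), ?_⟩
  funext u
  rw [map_sum, Finset.sum_apply, ← hs u]
  exact Finset.sum_congr rfl fun j _ => by rw [tmulB_dL_pow, hGF]

/-- One step of successive approximation: the top left-degree part is removed by the image of a
homogeneous element of degree lower by the gap, and the error terms have smaller left degree. When m
is below the gap, that part is already zero. -/
theorem exists_sub_TB {i m : ℕ} {F : List (Letter k V) → P.Env}
    (hF : F ∈ P.W P.Env P.Env (P.jump i)) (hm : ∀ u, P.LtDeg (m + 1) (F u))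
    (h : ∀ j, ∃ G ∈ P.W P.Alg P.Alg (P.jump i + P.gap i), (dL P.x ^ P.gap i) G =
      fun u => P.coB j (P.prB m (F u))) :
    ∃ G ∈ P.W P.Env P.Env (P.jump (i + 1)), ∀ u, P.LtDeg m ((F - P.TB i G) u) := by
  obtain ⟨G, hG, hGF⟩ := P.exists_dL_pow (WS_map hF (P.prB m)) h
  rw [← jump_succ] at hG
  have h1 : ∀ u, P.prB m ((dL P.eB ^ P.gap i) G u) = P.prB m (F u) := fun u => by
    rw [hGF, prB_prB, if_pos rfl]
  have hgap := P.gap_pos i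
  rcases Nat.lt_or_ge m (P.gap i) with hlt | hge
  · refine ⟨0, Submodule.zero_mem _, fun u => ?_⟩
    rw [map_zero, sub_zero]
    have := (hm u).of_succ
    rwa [← h1, prB_dL_pow_of_lt P hlt, sub_zero] at this
  · obtain ⟨n, rfl⟩ : ∃ n, m = n + P.gap i := ⟨m - P.gap i, by omega⟩
    have hG' := WS_map (S' := P.Env) hG (P.prB n)
    refine ⟨_, hG', fun u => ?_⟩
    have h2 := P.ltDeg_TB_sub (i := i) (m := n + 1) (F := fun u => P.prB n (G u))
      (fun u => LtDeg.prB _ _ (Nat.lt_succ_self n)) u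
    have h3 := (hm u).of_succ.sub (h2.mono (by omega))
    rw [← h1, prB_dL_pow] at h3
    convert h3 using 1
    simp only [Pi.sub_apply]
    abel

theorem koszul_exact (hK : P.IsKoszul) (i : ℕ) {F : List (Letter k V) → P.Alg}
    (hF : F ∈ P.W P.Alg P.Alg (P.jump (i + 1))) (h : (dL P.x ^ P.gap i) F = 0) :
    ∃ G ∈ P.W P.Alg P.Alg (P.jump (i + 2)), (dL P.x ^ P.gap (i + 1)) G = F := by
  obtain ⟨z, hz⟩ := P.exists_ιY (i + 1) ⟨F, hF⟩ (P.ιY_injective i (by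
    rw [ιY_πY, map_zero]
    exact Subtype.ext h))
  obtain ⟨G, hG⟩ := ιY_eq_dK hK (i + 1) z
  exact ⟨G.1, G.2, by rw [← dK_coe, hG, hz]⟩

/-- Induction on a bound for the left degree. The top part of a cycle is, coordinatewise in A°, a
cycle of the exact left Koszul complex; after subtracting a boundary the bound drops. -/
theorem exact_TB_succ (hK : P.IsKoszul) (i : ℕ) {F : List (Letter k V) → P.Env}
    (hF : F ∈ P.W P.Env P.Env (P.jump (i + 1))) (h : P.TB i F = 0) :
    ∃ G ∈ P.W P.Env P.Env (P.jump (i + 2)), P.TB (i + 1) G = F := by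
  obtain ⟨m, hm⟩ := P.exists_ltDeg_W hF
  induction m generalizing F with
  | zero => exact ⟨0, Submodule.zero_mem _, by
      rw [map_zero]
      exact (funext fun u => P.eq_zero_of_prB fun n => hm u n (Nat.zero_le n)).symm⟩
  | succ m ih =>
    have h0 : ∀ u, (dL P.eB ^ P.gap i) (fun u => P.prB m (F u)) u = 0 := fun u => by
      have := P.ltDeg_TB_sub (i := i) hm u (m + P.gap i) (by omega)
      rw [h, zero_sub, Pi.neg_apply, map_neg, neg_eq_zero, prB_dL_pow] at this
      exact this
    obtain ⟨G, hG, hGm⟩ := P.exists_sub_TB hF hm fun j => by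
      rw [← jump_succ]
      refine P.koszul_exact hK i (WS_map (WS_map (S' := P.Env) hF (P.prB m)) (P.coB j)) ?_
      funext u
      rw [← coB_dL_pow, h0, map_zero, Pi.zero_apply]
    obtain ⟨G', hG', h'⟩ := ih (F := F - P.TB (i + 1) G) (Submodule.sub_mem _ hF (P.TB_mem hG))
      (by rw [map_sub, h, P.TB_TB hG, sub_zero]) hGm
    exact ⟨G' + G, Submodule.add_mem _ hG' hG, by rw [map_add, h', sub_add_cancel]⟩

/-- The multiplication map of `A`. -/
def mulB : P.Env →ₗ[k] P.Alg :=
  LinearMap.mul' k P.Alg ∘ₗ (opLinearEquiv k).symm.toLinearMap.lTensor P.Alg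

theorem mulB_tmul (a : P.Alg) (b : P.Algᵐᵒᵖ) : P.mulB (a ⊗ₜ b) = a * b.unop := rfl

theorem mulB_TB_zero (G : List (Letter k V) → P.Env) : P.mulB (P.TB 0 G []) = 0 := by
  have h : ∀ b i, P.mulB (b * P.eB i - b * P.fB i) = 0 := fun b i => by
    induction b using TensorProduct.induction_on with
    | zero => simp
    | add b b' h h' => rw [add_mul, add_mul, add_sub_add_comm, map_add, h, h', add_zero]
    | tmul a b =>
      rw [eB, fB, Algebra.TensorProduct.tmul_mul_tmul, Algebra.TensorProduct.tmul_mul_tmul,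
        map_sub, mulB_tmul, mulB_tmul, mul_one, mul_one, unop_mul, unop_op, mul_assoc, sub_self]
  rw [TB, if_pos rfl, LinearMap.sub_apply, Pi.sub_apply, dL_apply, dR_apply,
    ← Finset.sum_sub_distrib, map_sum]
  exact Finset.sum_eq_zero fun i _ => h _ i

theorem prB_zero_eq (b : P.Env) : ∃ c, P.prB 0 b = 1 ⊗ₜ c := by
  induction b using TensorProduct.induction_on with
  | zero => exact ⟨0, by rw [map_zero, TensorProduct.tmul_zero]⟩
  | add b b' h h' =>
    obtain ⟨c, hc⟩ := h
    obtain ⟨c', hc'⟩ := h'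
    exact ⟨c + c', by rw [map_add, hc, hc', TensorProduct.tmul_add]⟩
  | tmul a b =>
    exact ⟨P.aug a • b, by
      rw [prB_tmul, pr_zero, Algebra.algebraMap_eq_smul_one, TensorProduct.smul_tmul]⟩

/-- In positive left degree the top part is a combination of elements a x_i and can be removed. What
remains is 1 ⊗ c, on which the multiplication map is injective. -/
theorem exact_TB_zero {F : List (Letter k V) → P.Env}
    (hF : F ∈ P.W P.Env P.Env (P.jump 0)) (h : P.mulB (F []) = 0) :
    ∃ G ∈ P.W P.Env P.Env (P.jump 1), P.TB 0 G = F := by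
  have h1 : ∀ {F : List (Letter k V) → P.Env}, F ∈ P.W P.Env P.Env (P.jump 0) → ∀ u, u ≠ [] →
      F u = 0 := fun hF u hu => hF.1 u (by rwa [jump_zero, Ne, List.length_eq_zero_iff])
  obtain ⟨m, hm⟩ := P.exists_ltDeg_W hF
  -- The bound is raised by one so that the base case of the induction is left degree zero, which
  -- needs its own argument.
  have hm' := fun u => (hm u).mono (Nat.le_succ m)
  clear hm
  induction m generalizing F with
  | zero =>
    refine ⟨0, Submodule.zero_mem _, ?_⟩
    rw [map_zero]
    refine (funext fun u => ?_).symm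
    by_cases hu : u = []
    · subst hu
      obtain ⟨c, hc⟩ := P.prB_zero_eq (F [])
      have h2 := P.eq_sum_prB (hm' [])
      rw [Finset.sum_range_one, hc] at h2
      rw [h2, mulB_tmul, one_mul, unop_eq_zero_iff] at h
      rw [h2, h, TensorProduct.tmul_zero]
      rfl
    · exact h1 hF u hu
  | succ m ih =>
    obtain ⟨G, hG, hGm⟩ := P.exists_sub_TB hF hm' fun j => by
      obtain ⟨G, hG, h'⟩ := P.exact_zero (F := fun u => P.coB j (P.prB (m + 1) (F u)))
        (mem_W_cast P.jump_zero (WS_map (WS_map (S' := P.Env) hF (P.prB (m + 1))) (P.coB j)))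
        (by rw [coB_prB, P.aug_pr_of_ne (Nat.succ_ne_zero m)])
      refine ⟨G, mem_W_cast (by rw [jump_zero, gap_zero]) hG, ?_⟩
      rw [gap_zero, pow_one, h']
    obtain ⟨G', hG', h'⟩ := ih (F := F - P.TB 0 G) (Submodule.sub_mem _ hF (P.TB_mem hG))
      (by rw [Pi.sub_apply, map_sub, h, mulB_TB_zero, sub_zero]) hGm
    exact ⟨G' + G, Submodule.add_mem _ hG' hG, by rw [map_add, h', sub_add_cancel]⟩

end HomogeneousRelations

/-! ### Projective resolutions of modules and Ext criteria. -/

section Modules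

namespace Syzygies

variable {S : Type u} [Ring S] (T : Syzygies (ModuleCat.{u} S))

theorem π_surjective (n : ℕ) : Function.Surjective (T.π n).hom := (T.exact n).moduleCat_surjective_g

theorem π_i (n : ℕ) (y : T.Y (n + 1)) : (T.π n).hom ((T.i n).hom y) = 0 :=
  LinearMap.congr_fun (congrArg ModuleCat.Hom.hom (T.zero n)) y

theorem exists_i {n : ℕ} {z : T.K n} (h : (T.π n).hom z = 0) : ∃ y, (T.i n).hom y = z :=
  (ShortComplex.moduleCat_exact_iff _).1 (T.exact n).exact z h

/-- The differential of the resolution. -/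
def d (n : ℕ) : T.K (n + 1) →ₗ[S] T.K n := (T.i n).hom ∘ₗ (T.π (n + 1)).hom

theorem exists_descend {n : ℕ} {M : Type*} [AddCommGroup M] [Module S M] (g : T.K n →ₗ[S] M)
    (hg : ∀ F, g (T.d n F) = 0) : ∃ h : T.Y n →ₗ[S] M, ∀ F, h ((T.π n).hom F) = g F := by
  refine ⟨(LinearMap.ker (T.π n).hom).liftQ g (fun F hF => ?_) ∘ₗ
    ((T.π n).hom.quotKerEquivOfSurjective (T.π_surjective n)).symm.toLinearMap, fun F => ?_⟩
  · obtain ⟨z, rfl⟩ := T.exists_i hF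
    obtain ⟨G, rfl⟩ := T.π_surjective (n + 1) z
    exact hg G
  · have : ((T.π n).hom.quotKerEquivOfSurjective (T.π_surjective n)).symm ((T.π n).hom F) =
        (LinearMap.ker (T.π n).hom).mkQ F := by
      rw [LinearEquiv.symm_apply_eq]
      rfl
    rw [LinearMap.comp_apply, LinearEquiv.coe_coe, this]
    rfl

variable {T} {M : ModuleCat.{u} S}

theorem subsingleton_ext_zero (h : ∀ g : T.K 0 →ₗ[S] M, (∀ F, g (T.d 0 F) = 0) → g = 0) :
    Subsingleton (Abelian.Ext.{u} (T.Y 0) M 0) := by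
  refine subsingleton_of_forall_eq 0 fun x => ?_
  obtain ⟨f, rfl⟩ := T.exists_cl_ofHom 0 x
  have h0 := h (f ∘ₗ (T.π 0).hom) fun F => by
    change f ((T.π 0).hom ((T.i 0).hom _)) = 0
    rw [π_i, map_zero]
  have : f = 0 := LinearMap.ext fun y => by
    obtain ⟨F, rfl⟩ := T.π_surjective 0 y
    exact LinearMap.congr_fun h0 F
  rw [this, cl_ofHom_zero]

theorem subsingleton_ext_succ {n : ℕ} (h : ∀ g : T.K (n + 1) →ₗ[S] M,
    (∀ F, g (T.d (n + 1) F) = 0) → ∃ g' : T.K n →ₗ[S] M, ∀ F, g F = g' (T.d n F)) :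
    Subsingleton (Abelian.Ext.{u} (T.Y 0) M (n + 1)) := by
  refine subsingleton_of_forall_eq 0 fun x => ?_
  obtain ⟨f, rfl⟩ := T.exists_cl_ofHom (n + 1) x
  obtain ⟨g', hg'⟩ := h (f ∘ₗ (T.π (n + 1)).hom) fun F => by
    change f ((T.π (n + 1)).hom ((T.i (n + 1)).hom _)) = 0
    rw [π_i, map_zero]
  refine (T.cl_ofHom_succ_eq_zero_iff f).2 ⟨g', fun y => ?_⟩
  obtain ⟨F, rfl⟩ := T.π_surjective (n + 1) y
  exact (hg' F).symm

theorem exists_of_subsingleton_succ {n : ℕ} (h : Subsingleton (Abelian.Ext.{u} (T.Y 0) M (n + 1)))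
    (g : T.K (n + 1) →ₗ[S] M) (hg : ∀ F, g (T.d (n + 1) F) = 0) :
    ∃ g' : T.K n →ₗ[S] M, ∀ F, g F = g' (T.d n F) := by
  obtain ⟨f, hf⟩ := T.exists_descend g hg
  obtain ⟨g', hg'⟩ := (T.cl_ofHom_succ_eq_zero_iff f).1 (Subsingleton.elim _ _)
  exact ⟨g', fun F => by rw [← hf, ← hg']; rfl⟩

theorem eq_zero_of_subsingleton_zero (h : Subsingleton (Abelian.Ext.{u} (T.Y 0) M 0))
    (g : T.K 0 →ₗ[S] M) (hg : ∀ F, g (T.d 0 F) = 0) : g = 0 := by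
  obtain ⟨f, hf⟩ := T.exists_descend g hg
  have := T.cl_ofHom_zero_eq_zero (f := f) (Subsingleton.elim _ _)
  exact LinearMap.ext fun F => by rw [← hf, this]; rfl

end Syzygies

/-- A projective resolution of a module. -/
structure ModuleResolution {S : Type u} [Ring S] (X : ModuleCat.{u} S) where
  /-- the terms -/
  K : ℕ → ModuleCat.{u} S
  /-- the differential -/
  d (n : ℕ) : K (n + 1) →ₗ[S] K n
  /-- the augmentation -/
  aug : K 0 →ₗ[S] X
  surjective : Function.Surjective aug
  aug_d (z : K 1) : aug (d 0 z) = 0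
  d_d (n : ℕ) (z : K (n + 2)) : d n (d (n + 1) z) = 0
  exact_zero (z : K 0) : aug z = 0 → ∃ y, d 0 y = z
  exact_succ (n : ℕ) (z : K (n + 1)) : d n z = 0 → ∃ y, d (n + 1) y = z
  projective (n : ℕ) : Projective (K n)

namespace ModuleResolution

variable {S : Type u} [Ring S] {X : ModuleCat.{u} S} (Q : ModuleResolution X)

/-- The syzygies of a resolution. -/
def Y : ℕ → ModuleCat.{u} S
  | 0 => X
  | 1 => ModuleCat.of S (LinearMap.ker Q.aug)
  | n + 2 => ModuleCat.of S (LinearMap.ker (Q.d n))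

/-- The inclusion of a syzygy. -/
def ι : (n : ℕ) → Q.Y (n + 1) →ₗ[S] Q.K n
  | 0 => (LinearMap.ker Q.aug).subtype
  | n + 1 => (LinearMap.ker (Q.d n)).subtype

/-- The projection onto a syzygy. -/
def π : (n : ℕ) → Q.K n →ₗ[S] Q.Y n
  | 0 => Q.aug
  | 1 => (Q.d 0).codRestrict (LinearMap.ker Q.aug) Q.aug_d
  | n + 2 => (Q.d (n + 1)).codRestrict (LinearMap.ker (Q.d n)) (Q.d_d n)

theorem ι_injective : ∀ n, Function.Injective (Q.ι n)
  | 0 => Subtype.val_injective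
  | _ + 1 => Subtype.val_injective

theorem ι_π : ∀ n z, Q.ι n (Q.π (n + 1) z) = Q.d n z
  | 0, _ => rfl
  | _ + 1, _ => rfl

theorem π_ι : ∀ n z, Q.π n (Q.ι n z) = 0
  | 0, z => z.2
  | 1, z => Subtype.ext z.2
  | _ + 2, z => Subtype.ext z.2

theorem exists_ι : ∀ n z, Q.π n z = 0 → ∃ y, Q.ι n y = z
  | 0, z, h => ⟨⟨z, h⟩, rfl⟩
  | 1, z, h => ⟨⟨z, congrArg Subtype.val h⟩, rfl⟩
  | _ + 2, z, h => ⟨⟨z, congrArg Subtype.val h⟩, rfl⟩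

theorem π_surjective : ∀ n, Function.Surjective (Q.π n)
  | 0 => Q.surjective
  | 1 => fun z => (Q.exact_zero _ z.2).imp fun _ h => Subtype.ext h
  | n + 2 => fun z => (Q.exact_succ n _ z.2).imp fun _ h => Subtype.ext h

/-- The short exact sequences given by a resolution. -/
abbrev syzygies : Syzygies (ModuleCat.{u} S) where
  Y := Q.Y
  K := Q.K
  i n := ModuleCat.ofHom (Q.ι n)
  π n := ModuleCat.ofHom (Q.π n)
  zero n := by
    ext z
    exact Q.π_ι n z
  exact n := by
    refine ShortComplex.ShortExact.mk' ?_ ?_ ?_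
    · rw [ShortComplex.moduleCat_exact_iff]
      exact fun z hz => Q.exists_ι n z hz
    · exact (ModuleCat.mono_iff_injective _).2 (Q.ι_injective n)
    · exact (ModuleCat.epi_iff_surjective _).2 (Q.π_surjective n)
  proj := Q.projective

theorem syzygies_d (n : ℕ) : Q.syzygies.d n = Q.d n := LinearMap.ext fun z => Q.ι_π n z

end ModuleResolution

end Modules

/-! ### The Koszul resolution of A by bimodules. -/

namespace HomogeneousRelations

open Words

variable {k V : Type u} [Field k] [AddCommGroup V] [Module k V] [FiniteDimensional k V]
  (P : HomogeneousRelations k V)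

/-- The terms of the Koszul complex of bimodules. -/
abbrev KB (i : ℕ) : Type u := P.W P.Env P.Env (P.jump i)

/-- The differential of the Koszul complex of bimodules. -/
def dKB (i : ℕ) : P.KB (i + 1) →ₗ[P.Env] P.KB i := (P.TB i).restrict fun _ hF => P.TB_mem hF

theorem dKB_coe (i : ℕ) (F : P.KB (i + 1)) : (P.dKB i F).1 = P.TB i F.1 := rfl

theorem tmul_smul_regularBimodule (a : P.Alg) (b : P.Algᵐᵒᵖ) (c : P.Alg) :
    (a ⊗ₜ[k] b : P.Env) • (show regularBimodule k P.Alg from c) = (a * (c * b.unop) : P.Alg) := rfl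

theorem mulB_mul (b c : P.Env) : P.mulB (b * c) = b • (show regularBimodule k P.Alg from P.mulB c) := by
  induction b using TensorProduct.induction_on with
  | zero => exact (congrArg P.mulB (zero_mul c)).trans ((map_zero _).trans (zero_smul P.Env
      (A := regularBimodule k P.Alg) _).symm)
  | add b b' h h' =>
    rw [add_mul, map_add, h, h']
    exact (add_smul (M := regularBimodule k P.Alg) b b' _).symm
  | tmul a a' =>
    induction c using TensorProduct.induction_on with
    | zero =>
      rw [mul_zero, map_zero]
      exact (smul_zero (A := regularBimodule k P.Alg) _).symm
    | add b b' h h' =>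
      rw [mul_add, map_add, h, h', map_add]
      exact (smul_add (A := regularBimodule k P.Alg) _ _ _).symm
    | tmul c c' =>
      rw [tmul_smul_regularBimodule, Algebra.TensorProduct.tmul_mul_tmul, mulB_tmul, unop_mul,
        mul_assoc]
      change _ = a * (c * c'.unop * a'.unop)
      rw [mul_assoc c]

/-- The augmentation of the Koszul complex of bimodules. -/
def augKB : P.KB 0 →ₗ[P.Env] regularBimodule k P.Alg where
  toFun F := P.mulB (F.1 [])
  map_add' _ _ := map_add P.mulB _ _
  map_smul' b _ := P.mulB_mul b _

/-- The Koszul resolution of `A` by bimodules. -/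
def koszulResolution (hK : P.IsKoszul) : ModuleResolution (regularBimodule k P.Alg) where
  K i := ModuleCat.of P.Env (P.KB i)
  d := P.dKB
  aug := P.augKB
  surjective a := ⟨⟨fun u => if u.length = 0 then (a : P.Alg) ⊗ₜ 1 else 0,
    (mem_WS_of_lt (by rw [jump_zero]; have := P.two_le; omega)).2 fun u hu => by
      rw [jump_zero] at hu; exact if_neg hu⟩, mul_one (M := P.Alg) a⟩
  aug_d z := P.mulB_TB_zero z.1
  d_d n z := Subtype.ext (P.TB_TB z.2)
  exact_zero z h := by
    obtain ⟨G, hG, h'⟩ := P.exact_TB_zero z.2 h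
    exact ⟨⟨G, hG⟩, Subtype.ext h'⟩
  exact_succ n z h := by
    obtain ⟨G, hG, h'⟩ := P.exact_TB_succ hK n z.2 (congrArg Subtype.val h)
    exact ⟨⟨G, hG⟩, Subtype.ext h'⟩
  projective n := (IsProjective.iff_projective _).1 (projective_WS _ _ _ _)

end HomogeneousRelations

namespace HomogeneousRelations

open Words

variable {k V : Type u} [Field k] [AddCommGroup V] [Module k V] [FiniteDimensional k V]
  (P : HomogeneousRelations k V)

/-! ## Cohomology with coefficients in the enveloping algebra -/

section Coefficients

variable {n : ℕ}

theorem ltDeg_coef {m : ℕ} {F : List (Letter k V) → P.Env} (hF : ∀ u, P.LtDeg m (F u))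
    (s : Fin (rk P.N P.Rw n)) : P.LtDeg m (coef P.N P.Rw n s F) :=
  LtDeg.wsum fun u _ => (hF u).smul _

theorem prB_coef {m : ℕ} {F : List (Letter k V) → P.Env} (hF : ∀ u, P.prB m (F u) = F u)
    (s : Fin (rk P.N P.Rw n)) : P.prB m (coef P.N P.Rw n s F) = coef P.N P.Rw n s F := by
  rw [coef, map_wsum]
  exact wsum_congr fun u _ => by rw [map_smul, hF]

theorem map_eq_sum_coef (h : P.W P.Env P.Env n →ₗ[P.Env] P.Env) (F : P.W P.Env P.Env n) :
    h F = ∑ s, coef P.N P.Rw n s F.1 * h (incl P.Env ⟨bas P.N P.Rw n s, bas_mem P.N P.Rw n s⟩) := by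
  conv_lhs => rw [eq_sum_coef_incl F, map_sum]
  exact Finset.sum_congr rfl fun s _ => map_smul h _ _

/-- The linear maps of left degree less than `m`. -/
def LtDegHom (m : ℕ) (h : P.W P.Env P.Env n →ₗ[P.Env] P.Env) : Prop :=
  ∀ x : P.W k k n, P.LtDeg m (h (incl P.Env x))

variable {P}

theorem LtDegHom.apply {m p l : ℕ} {h : P.W P.Env P.Env n →ₗ[P.Env] P.Env} (hh : P.LtDegHom m h)
    {F : P.W P.Env P.Env n} (hF : ∀ u, P.LtDeg p (F.1 u)) (hl : p + m ≤ l + 1) :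
    P.LtDeg l (h F) := by
  rw [map_eq_sum_coef]
  exact LtDeg.sum fun s _ => (P.ltDeg_coef hF s).mul (hh _) hl

variable (P) in
theorem exists_ltDegHom (h : P.W P.Env P.Env n →ₗ[P.Env] P.Env) : ∃ m, P.LtDegHom m h := by
  choose b hb using fun s : Fin (rk P.N P.Rw n) =>
    P.exists_bound (h (incl P.Env ⟨bas P.N P.Rw n s, bas_mem P.N P.Rw n s⟩))
  refine ⟨Finset.univ.sup b, fun x => ?_⟩
  rw [map_eq_sum_coef]
  refine LtDeg.sum fun s _ => LtDeg.mul (m := 1) (n := Finset.univ.sup b) ?_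
    (LtDeg.mono (Finset.le_sup (Finset.mem_univ s)) (hb s)) (by omega)
  exact P.ltDeg_coef (fun u => ltDeg_algebraMap _) s

theorem LtDegHom.eq_zero {h : P.W P.Env P.Env n →ₗ[P.Env] P.Env} (hh : P.LtDegHom 0 h) : h = 0 :=
  Words.hom_ext fun x => P.eq_zero_of_prB fun m => hh x m (Nat.zero_le m)

variable (P) in
/-- The component of left degree `m` of a linear map. -/
def symbol (m : ℕ) (h : P.W P.Env P.Env n →ₗ[P.Env] P.Env) : P.W k k n →ₗ[k] P.Env where
  toFun x := P.prB m (h (incl P.Env x))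
  map_add' x y := by rw [incl_add, map_add, map_add]
  map_smul' c x := by
    rw [incl_smul, map_smul, smul_eq_mul, ← Algebra.smul_def, map_smul, RingHom.id_apply]

theorem symbol_apply (m : ℕ) (h : P.W P.Env P.Env n →ₗ[P.Env] P.Env) (x : P.W k k n) :
    P.symbol m h x = P.prB m (h (incl P.Env x)) := rfl

theorem prB_map {g : ℕ} (m : ℕ) (h : P.W P.Env P.Env n →ₗ[P.Env] P.Env) {F : P.W P.Env P.Env n}
    (hF : ∀ u, P.prB g (F.1 u) = F.1 u) :
    P.prB (g + m) (h F) = extend P.Env (P.symbol m h) F := by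
  rw [map_eq_sum_coef, map_sum, extend_apply]
  exact Finset.sum_congr rfl fun s _ => by
    rw [← P.prB_coef hF, prB_mul_of_hom, prB_coef P hF]
    rfl

theorem prB_map_of_lt {g m : ℕ} (hm : m < g) (h : P.W P.Env P.Env n →ₗ[P.Env] P.Env)
    {F : P.W P.Env P.Env n} (hF : ∀ u, P.prB g (F.1 u) = F.1 u) : P.prB m (h F) = 0 := by
  rw [map_eq_sum_coef, map_sum]
  exact Finset.sum_eq_zero fun s _ => by rw [← P.prB_coef hF, P.prB_mul_of_hom_of_lt hm]

end Coefficients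

/-- The leading term of the differential. -/
def lead (i : ℕ) : P.KB (i + 1) →ₗ[P.Env] P.KB i :=
  (dL P.eB ^ P.gap i).restrict fun F hF => dL_pow_mem P.eB (P.gap i) (by rwa [← jump_succ])

theorem lead_coe (i : ℕ) (F : P.KB (i + 1)) : (P.lead i F).1 = (dL P.eB ^ P.gap i) F.1 := rfl

theorem lead_incl (i : ℕ) (y : P.W k k (P.jump (i + 1))) (u : List (Letter k V)) :
    (P.lead i (incl P.Env y)).1 u = (P.dK i (incl P.Alg y)).1 u ⊗ₜ[k] (1 : P.Algᵐᵒᵖ) := by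
  rw [lead_coe, dK_coe, dL_pow_apply, dL_pow_apply]
  refine Eq.trans ?_ (map_wsum ((TensorProduct.mk k P.Alg P.Algᵐᵒᵖ).flip 1) _ _).symm
  refine wsum_congr fun t _ => ?_
  rw [mon_eB]
  change algebraMap k P.Env _ * _ = (algebraMap k P.Alg _ * _) ⊗ₜ[k] (1 : P.Algᵐᵒᵖ)
  rw [← Algebra.smul_def, ← Algebra.smul_def, TensorProduct.smul_tmul']

theorem prB_lead_incl (i : ℕ) (y : P.W k k (P.jump (i + 1))) (u : List (Letter k V)) :
    P.prB (P.gap i) ((P.lead i (incl P.Env y)).1 u) = (P.lead i (incl P.Env y)).1 u := by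
  have h := P.prB_dL_pow (P.gap i) 0 (incl P.Env y).1 u
  rw [Nat.zero_add] at h
  exact h.trans (congrFun (congrArg _ (funext fun w => P.prB_algebraMap _)) u)

theorem ltDeg_sub_lead (i : ℕ) (y : P.W k k (P.jump (i + 1))) (u : List (Letter k V)) :
    P.LtDeg (P.gap i) ((P.dKB i (incl P.Env y) - P.lead i (incl P.Env y)).1 u) := by
  have := P.ltDeg_TB_sub (i := i) (m := 1) (F := (incl P.Env y).1) (fun u => ltDeg_algebraMap _) u
  rwa [Nat.add_sub_cancel_left] at this

theorem coef_lead_incl (i : ℕ) (y : P.W k k (P.jump (i + 1)))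
    (s : Fin (rk P.N P.Rw (P.jump i))) :
    coef P.N P.Rw (P.jump i) s (P.lead i (incl P.Env y)).1 =
      coef P.N P.Rw (P.jump i) s (P.dK i (incl P.Alg y)).1 ⊗ₜ[k] (1 : P.Algᵐᵒᵖ) := by
  refine Eq.trans ?_ (map_wsum ((TensorProduct.mk k P.Alg P.Algᵐᵒᵖ).flip 1) _ _).symm
  refine wsum_congr fun u _ => ?_
  rw [lead_incl, TensorProduct.smul_tmul']
  rfl

theorem coB_extend_lead (i : ℕ) (j : P.OpIndex) (s : P.W k k (P.jump i) →ₗ[k] P.Env)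
    (y : P.W k k (P.jump (i + 1))) :
    P.coB j (extend P.Env s (P.lead i (incl P.Env y))) =
      extend P.Alg (P.coB j ∘ₗ s) (P.dK i (incl P.Alg y)) := by
  rw [extend_apply, extend_apply, map_sum]
  exact Finset.sum_congr rfl fun l _ => by
    rw [coef_lead_incl, smul_eq_mul, coB_tmul_one_mul]
    rfl

theorem extend_tmulB_lead (i : ℕ) (j : P.OpIndex) (s : P.W k k (P.jump i) →ₗ[k] P.Alg)
    (y : P.W k k (P.jump (i + 1))) :
    extend P.Env (P.tmulB j ∘ₗ s) (P.lead i (incl P.Env y)) =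
      P.tmulB j (extend P.Alg s (P.dK i (incl P.Alg y))) := by
  rw [extend_apply, extend_apply, map_sum]
  exact Finset.sum_congr rfl fun l _ => by
    rw [coef_lead_incl, smul_eq_mul, smul_eq_mul, mul_tmulB]
    rfl

section Gorenstein

variable {P} {D : ℕ}

theorem eq_zero_of_gorenstein (hK : P.IsKoszul) (hG : P.IsASGorenstein D) (hD : 0 < D)
    (g : P.KK 0 →ₗ[P.Alg] P.Alg) (hg : ∀ F, g (P.dK 0 F) = 0) : g = 0 := by
  obtain ⟨f, hf⟩ := exists_descend hK g hg
  have := hG.1 0 (by omega)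
  have h0 : f = 0 := P.clY_zero_eq_zero hK (M := ModuleCat.of P.Alg P.Alg) (Subsingleton.elim _ _)
  exact LinearMap.ext fun F => by rw [← hf, h0]; rfl

theorem exists_of_gorenstein (hK : P.IsKoszul) (hG : P.IsASGorenstein D) {i : ℕ} (hi : i + 1 < D)
    (g : P.KK (i + 1) →ₗ[P.Alg] P.Alg) (hg : ∀ F, g (P.dK (i + 1) F) = 0) :
    ∃ g' : P.KK i →ₗ[P.Alg] P.Alg, ∀ F, g F = g' (P.dK i F) := by
  obtain ⟨f, hf⟩ := exists_descend hK g hg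
  have := hG.1 (i + 1) (by omega)
  obtain ⟨g', hg'⟩ := (clY_succ_eq_zero_iff hK (M := ModuleCat.of P.Alg P.Alg) f).1
    (Subsingleton.elim _ _)
  exact ⟨g', fun F => by rw [← hf, hg']⟩

/-- The component of h ∘ d in the highest possible left degree is the symbol of h composed with the
leading part of d; it vanishes for a cocycle. -/
theorem extend_symbol_lead {i m : ℕ} {h : P.KB i →ₗ[P.Env] P.Env} (hm : P.LtDegHom (m + 1) h)
    (hh : ∀ F, h (P.dKB i F) = 0) (y : P.W k k (P.jump (i + 1))) :
    extend P.Env (P.symbol m h) (P.lead i (incl P.Env y)) = 0 := by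
  rw [← prB_map m h (P.prB_lead_incl i y)]
  have h1 := hm.apply (P.ltDeg_sub_lead i y) (l := P.gap i + m) (by omega) (P.gap i + m) le_rfl
  have h2 : h (P.dKB i (incl P.Env y) - P.lead i (incl P.Env y)) =
      h (P.dKB i (incl P.Env y)) - h (P.lead i (incl P.Env y)) := map_sub h _ _
  rwa [h2, hh, zero_sub, map_neg, neg_eq_zero] at h1

theorem coB_symbol_dK {i m : ℕ} {h : P.KB i →ₗ[P.Env] P.Env} (hm : P.LtDegHom (m + 1) h)
    (hh : ∀ F, h (P.dKB i F) = 0) (j : P.OpIndex) (F : P.KK (i + 1)) :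
    extend P.Alg (P.coB j ∘ₗ P.symbol m h) (P.dK i F) = 0 :=
  LinearMap.congr_fun (Words.hom_ext (f := extend P.Alg (P.coB j ∘ₗ P.symbol m h) ∘ₗ P.dK i)
    (g := 0) fun y => by
      rw [LinearMap.comp_apply, ← coB_extend_lead, extend_symbol_lead hm hh, map_zero]
      rfl) F

/-- Each A°-coordinate of the symbol is a cocycle of Hom_A(K, A) in degree 0, hence zero because
Ext^0(k,A) = 0. So the bound on the left degree drops until nothing is left. -/
theorem eq_zero_of_dKB_zero (hK : P.IsKoszul) (hG : P.IsASGorenstein D) (hD : 0 < D)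
    (h : P.KB 0 →ₗ[P.Env] P.Env) (hh : ∀ F, h (P.dKB 0 F) = 0) : h = 0 := by
  obtain ⟨m, hm⟩ := P.exists_ltDegHom h
  induction m with
  | zero => exact hm.eq_zero
  | succ m ih =>
    refine ih fun x => ?_
    have h0 : P.symbol m h x = 0 := P.eq_zero_of_coB fun j => by
      have := LinearMap.congr_fun (eq_zero_of_gorenstein hK hG hD _ (coB_symbol_dK hm hh j))
        (incl P.Alg x)
      rwa [extend_incl] at this
    have := (hm x).of_succ
    rwa [← symbol_apply, h0, sub_zero] at this

theorem exists_support_symbol {n : ℕ} (s : P.W k k n →ₗ[k] P.Env) :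
    ∃ t : Finset P.OpIndex, ∀ x, ∑ j ∈ t, P.tmulB j (P.coB j (s x)) = s x := by
  classical
  choose t _ ht using fun l : Fin (rk P.N P.Rw n) =>
    P.exists_support (s ⟨bas P.N P.Rw n l, bas_mem P.N P.Rw n l⟩)
  refine ⟨Finset.univ.biUnion t, fun x => ?_⟩
  rw [eq_sum_coef_bas x]
  simp only [map_sum, map_smul]
  rw [Finset.sum_comm]
  refine Finset.sum_congr rfl fun i _ => ?_
  rw [← Finset.smul_sum, ht i _ (Finset.subset_biUnion_of_mem t (Finset.mem_univ i))]

/-- The A°-coordinates of the symbol are cocycles of Hom_A(K, A) in a degree where Ext(k,A)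
vanishes. Their primitives are reassembled; only finitely many coordinates occur because W_{n(i+1)}
is finite-dimensional. -/
theorem exists_lead_eq_symbol (hK : P.IsKoszul) (hG : P.IsASGorenstein D) {i m : ℕ}
    (hi : i + 1 < D) {h : P.KB (i + 1) →ₗ[P.Env] P.Env} (hm : P.LtDegHom (m + 1) h)
    (hh : ∀ F, h (P.dKB (i + 1) F) = 0) : ∃ h' : P.KB i →ₗ[P.Env] P.Env,
    ∀ y, h' (P.lead i (incl P.Env y)) = P.symbol m h y := by
  choose g' hg' using fun j => exists_of_gorenstein hK hG hi _ (coB_symbol_dK hm hh j)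
  obtain ⟨t, ht⟩ := exists_support_symbol (P.symbol m h)
  let r : P.OpIndex → P.W k k (P.jump i) →ₗ[k] P.Alg := fun j =>
    { toFun := fun x => g' j (incl P.Alg x)
      map_add' := fun x y => by rw [incl_add, map_add]
      map_smul' := fun c x => by
        rw [incl_smul, map_smul, smul_eq_mul, ← Algebra.smul_def, RingHom.id_apply] }
  have hr : ∀ j, extend P.Alg (r j) = g' j := fun j => Words.hom_ext fun x => extend_incl _ _
  refine ⟨∑ j ∈ t, extend P.Env (P.tmulB j ∘ₗ r j), fun y => ?_⟩
  rw [LinearMap.sum_apply, ← ht y]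
  exact Finset.sum_congr rfl fun j _ => by
    rw [extend_tmulB_lead, hr, ← hg', extend_incl, LinearMap.comp_apply]

/-- Of the primitive of the symbol only the part of left degree m minus the gap is kept. Its
composite with the true differential differs from the symbol by terms of left degree below m. If m
is below the gap, the symbol itself is zero. -/
theorem exists_sub_dKB {i m : ℕ} {h : P.KB (i + 1) →ₗ[P.Env] P.Env} (hm : P.LtDegHom (m + 1) h)
    {h' : P.KB i →ₗ[P.Env] P.Env} (hh' : ∀ y, h' (P.lead i (incl P.Env y)) = P.symbol m h y) :
    ∃ h'' : P.KB i →ₗ[P.Env] P.Env, P.LtDegHom m (h - h'' ∘ₗ P.dKB i) := by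
  have h1 : ∀ y, P.prB m (P.symbol m h y) = P.symbol m h y := fun y => by
    rw [symbol_apply, prB_prB, if_pos rfl]
  have h2 : ∀ y, P.LtDeg m (h (incl P.Env y) - P.symbol m h y) := fun y => (hm y).of_succ
  rcases Nat.lt_or_ge m (P.gap i) with hlt | hge
  · refine ⟨0, fun y => ?_⟩
    have := h2 y
    rw [← h1, ← hh', prB_map_of_lt hlt h' (P.prB_lead_incl i y), sub_zero] at this
    simpa using this
  · obtain ⟨q, rfl⟩ : ∃ q, m = P.gap i + q := ⟨m - P.gap i, by omega⟩
    refine ⟨extend P.Env (P.symbol q h'), fun y => ?_⟩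
    have h3 : P.LtDegHom (q + 1) (extend P.Env (P.symbol q h')) := fun x => by
      rw [extend_incl]
      exact LtDeg.prB _ _ (Nat.lt_succ_self q)
    have h4 := h3.apply (P.ltDeg_sub_lead i y) (l := P.gap i + q) (by omega)
    have h5 : h (incl P.Env y) - P.symbol (P.gap i + q) h y - extend P.Env (P.symbol q h')
        (P.dKB i (incl P.Env y) - P.lead i (incl P.Env y)) =
        (h - extend P.Env (P.symbol q h') ∘ₗ P.dKB i) (incl P.Env y) := by
      have h6 : extend P.Env (P.symbol q h') (P.dKB i (incl P.Env y) - P.lead i (incl P.Env y)) =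
        extend P.Env (P.symbol q h') (P.dKB i (incl P.Env y)) -
          extend P.Env (P.symbol q h') (P.lead i (incl P.Env y)) :=
        map_sub (extend P.Env (P.symbol q h')) (P.dKB i (incl P.Env y)) _
      rw [h6, ← prB_map q h' (P.prB_lead_incl i y), hh', h1, LinearMap.sub_apply,
        LinearMap.comp_apply]
      abel
    rw [← h5]
    exact (h2 y).sub h4

theorem exists_of_dKB_succ (hK : P.IsKoszul) (hG : P.IsASGorenstein D) {i : ℕ} (hi : i + 1 < D)
    (h : P.KB (i + 1) →ₗ[P.Env] P.Env) (hh : ∀ F, h (P.dKB (i + 1) F) = 0) :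
    ∃ h' : P.KB i →ₗ[P.Env] P.Env, ∀ F, h F = h' (P.dKB i F) := by
  obtain ⟨m, hm⟩ := P.exists_ltDegHom h
  induction m generalizing h with
  | zero => exact ⟨0, fun F => by rw [hm.eq_zero]; rfl⟩
  | succ m ih =>
    obtain ⟨h₁, hh₁⟩ := exists_lead_eq_symbol hK hG hi hm hh
    obtain ⟨h₂, hh₂⟩ := exists_sub_dKB hm hh₁
    obtain ⟨h₃, hh₃⟩ := ih (h - h₂ ∘ₗ P.dKB i) (fun F => by
      rw [LinearMap.sub_apply, hh, LinearMap.comp_apply,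
        show P.dKB i (P.dKB (i + 1) F) = 0 from Subtype.ext (P.TB_TB F.2), map_zero, sub_zero]) hh₂
    exact ⟨h₃ + h₂, fun F => by
      have := hh₃ F
      rw [LinearMap.sub_apply, LinearMap.comp_apply, sub_eq_iff_eq_add] at this
      rw [this, LinearMap.add_apply]⟩

theorem subsingleton_ext_env (hK : P.IsKoszul) (hG : P.IsASGorenstein D) {i : ℕ} (hi : i < D) :
    Subsingleton (Abelian.Ext.{u} (regularBimodule k P.Alg) (ModuleCat.of P.Env P.Env) i) := by
  cases i with
  | zero =>
    refine Syzygies.subsingleton_ext_zero (T := (P.koszulResolution hK).syzygies) fun g hg =>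
      eq_zero_of_dKB_zero hK hG hi g fun F => ?_
    rw [ModuleResolution.syzygies_d] at hg
    exact hg F
  | succ i =>
    refine Syzygies.subsingleton_ext_succ (T := (P.koszulResolution hK).syzygies) fun g hg => ?_
    simp only [ModuleResolution.syzygies_d] at hg ⊢
    exact exists_of_dKB_succ hK hG hi g hg

end Gorenstein

end HomogeneousRelations

namespace HomogeneousRelations

open Words

variable {k V : Type u} [Field k] [AddCommGroup V] [Module k V] [FiniteDimensional k V]
  (P : HomogeneousRelations k V)

/-! ## Hochschild cohomology in the top degree -/

section Vanishing

variable {P} {D : ℕ}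

theorem KB_eq_zero (hK : P.IsKoszul) (hdim : leftGlobalDimension P.Alg = (D : WithBot ℕ∞)) {i : ℕ}
    (hi : D < i) (F : P.KB i) : F = 0 :=
  Subtype.ext (P.W_eq_zero_of_forall (fun _ hx => W_eq_zero hK hdim hi hx) F.2)

theorem subsingleton_hochschildCohomology (hK : P.IsKoszul)
    (hdim : leftGlobalDimension P.Alg = (D : WithBot ℕ∞)) {i : ℕ} (hi : D < i)
    (M : ModuleCat.{u} P.Env) : Subsingleton (HochschildCohomology k P.Alg M i) := by
  obtain ⟨i, rfl⟩ : ∃ j, i = j + 1 := ⟨i - 1, by omega⟩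
  refine Syzygies.subsingleton_ext_succ (T := (P.koszulResolution hK).syzygies) fun g hg =>
    ⟨0, fun F => ?_⟩
  rw [show F = 0 from KB_eq_zero hK hdim hi F, map_zero]
  rfl

theorem exists_finsupp_support {n : ℕ} {X : Type*} (g : P.W P.Env P.Env n →ₗ[P.Env] X →₀ P.Env) :
    ∃ s : Finset X, ∀ F, ∀ x ∉ s, g F x = 0 := by
  classical
  refine ⟨Finset.univ.biUnion fun l =>
    (g (incl P.Env ⟨bas P.N P.Rw n l, bas_mem P.N P.Rw n l⟩)).support, fun F x hx => ?_⟩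
  rw [eq_sum_coef_incl F, map_sum, Finset.sum_apply']
  refine Finset.sum_eq_zero fun l _ => ?_
  rw [map_smul, Finsupp.smul_apply]
  have : x ∉ (g (incl P.Env ⟨bas P.N P.Rw n l, bas_mem P.N P.Rw n l⟩)).support := fun h =>
    hx (Finset.mem_biUnion.2 ⟨l, Finset.mem_univ l, h⟩)
  rw [Finsupp.notMem_support_iff.1 this, smul_zero]

/-- Terms of the Koszul resolution are finitely generated, so a map into a free module meets only
finitely many coordinates, and primitives can be chosen for each of them. -/
theorem subsingleton_ext_free (hK : P.IsKoszul) (hG : P.IsASGorenstein D) {i : ℕ} (hi : i < D)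
    (X : Type u) : Subsingleton (Abelian.Ext.{u} (regularBimodule k P.Alg)
      (ModuleCat.of P.Env (X →₀ P.Env)) i) := by
  classical
  have h0 := subsingleton_ext_env hK hG hi
  have hsum : ∀ {s : Finset X} {f : X →₀ P.Env}, (∀ x ∉ s, f x = 0) →
      f = ∑ x ∈ s, Finsupp.single x (f x) := fun {s f} h => by
    conv_lhs => rw [← Finsupp.sum_single f]
    refine Finsupp.sum_of_support_subset _ (fun x hx => ?_) _ fun x _ => Finsupp.single_zero x
    by_contra hxs
    exact Finsupp.mem_support_iff.1 hx (h x hxs)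
  cases i with
  | zero =>
    refine Syzygies.subsingleton_ext_zero (T := (P.koszulResolution hK).syzygies) fun g hg =>
      LinearMap.ext fun F => Finsupp.ext fun x => ?_
    exact LinearMap.congr_fun (Syzygies.eq_zero_of_subsingleton_zero
      (T := (P.koszulResolution hK).syzygies) h0 (Finsupp.lapply x ∘ₗ g) fun F => by
        rw [LinearMap.comp_apply, hg, map_zero]) F
  | succ i =>
    refine Syzygies.subsingleton_ext_succ (T := (P.koszulResolution hK).syzygies) fun g hg => ?_
    have h1 := fun x => Syzygies.exists_of_subsingleton_succ
      (T := (P.koszulResolution hK).syzygies) h0 (Finsupp.lapply x ∘ₗ g) fun F => by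
        rw [LinearMap.comp_apply, hg, map_zero]
    choose g' hg' using h1
    obtain ⟨s, hs⟩ := exists_finsupp_support (P := P) (n := P.jump (i + 1)) g
    refine ⟨∑ x ∈ s, Finsupp.lsingle x ∘ₗ g' x, fun F => ?_⟩
    refine (hsum (hs F)).trans ?_
    rw [LinearMap.sum_apply]
    exact Finset.sum_congr rfl fun x _ => by
      rw [LinearMap.comp_apply, ← hg']
      rfl

/-- A projective module is a retract of the free module on its elements, so its identity factors
through a module whose Ext vanishes. -/
theorem subsingleton_ext_projective (hK : P.IsKoszul) (hG : P.IsASGorenstein D) {i : ℕ}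
    (hi : i < D) (M : ModuleCat.{u} P.Env) [hM : Projective M] :
    Subsingleton (HochschildCohomology k P.Alg M i) := by
  have := subsingleton_ext_free hK hG hi M
  obtain ⟨s, hs⟩ := Module.projective_def'.1 ((IsProjective.iff_projective M).2 hM)
  let f : M ⟶ ModuleCat.of P.Env (M →₀ P.Env) := ModuleCat.ofHom s
  let g : ModuleCat.of P.Env (M →₀ P.Env) ⟶ M := ModuleCat.ofHom (Finsupp.linearCombination P.Env id)
  have hfg : f ≫ g = 𝟙 M := ModuleCat.hom_ext hs
  refine subsingleton_of_forall_eq 0 fun x => ?_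
  rw [← Abelian.Ext.comp_mk₀_id x, ← hfg, ← Abelian.Ext.mk₀_comp_mk₀,
    ← Abelian.Ext.comp_assoc_of_third_deg_zero,
    Subsingleton.elim (x.comp (Abelian.Ext.mk₀ f) (add_zero i)) 0, Abelian.Ext.zero_comp]

end Vanishing

/-! ### The class of an element -/

section TopHom

variable {P} {D : ℕ} {w : P.W k k (P.jump D)} {cw : P.W k k (P.jump D) →ₗ[k] k}

theorem exists_topForm (hw0 : w ≠ 0) (hwD : ∀ x ∈ P.W k k (P.jump D), ∃ c : k, x = c • w.1) :
    ∃ cw : P.W k k (P.jump D) →ₗ[k] k, cw w = 1 ∧ ∀ x, x = cw x • w := by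
  obtain ⟨u, hu⟩ : ∃ u, w.1 u ≠ 0 := by
    by_contra! h
    exact hw0 (Subtype.ext (funext h))
  refine ⟨(w.1 u)⁻¹ • (LinearMap.proj u ∘ₗ Submodule.subtype _), inv_mul_cancel₀ hu, fun x => ?_⟩
  obtain ⟨c, hc⟩ := hwD x x.2
  refine Subtype.ext (hc.trans ?_)
  change c • w.1 = ((w.1 u)⁻¹ * x.1 u) • w.1
  rw [hc, Pi.smul_apply, smul_eq_mul, mul_comm c, inv_mul_cancel_left₀ hu]

variable {M : Type*} [AddCommGroup M] [Module k M] [Module P.Env M] [IsScalarTower k P.Env M]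

/-- The linear map on the last term of the Koszul complex with a given value at the generator. -/
def topHom (cw : P.W k k (P.jump D) →ₗ[k] k) (m : M) : P.KB D →ₗ[P.Env] M :=
  extend P.Env (cw.smulRight m)

theorem topHom_incl (h1 : cw w = 1) (m : M) : topHom cw m (incl P.Env w) = m := by
  rw [topHom, extend_incl, LinearMap.smulRight_apply, h1, one_smul]

theorem ext_top (hx : ∀ x, x = cw x • w) {g h : P.KB D →ₗ[P.Env] M}
    (hgh : g (incl P.Env w) = h (incl P.Env w)) : g = h :=
  Words.hom_ext fun x => by rw [hx x, incl_smul, map_smul, map_smul, hgh]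

end TopHom

variable {P}

/-- The data needed to describe the Hochschild cohomology in the top degree. -/
structure TopData (P : HomogeneousRelations k V) (D : ℕ) where
  koszul : P.IsKoszul
  dim : leftGlobalDimension P.Alg = (D : WithBot ℕ∞)
  /-- a generator of `W_{n(D)}` -/
  w : P.W k k (P.jump D)
  /-- the coordinate with respect to the generator -/
  cw : P.W k k (P.jump D) →ₗ[k] k
  cw_w : cw w = 1
  eq_smul : ∀ x, x = cw x • w

namespace TopData

variable {D : ℕ} (t : TopData P D) {M M' : ModuleCat.{u} P.Env}

/-- The short exact sequences given by the Koszul resolution. -/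
abbrev T : Syzygies (ModuleCat.{u} P.Env) := (P.koszulResolution t.koszul).syzygies

/-- The projection onto the last syzygy. -/
def π : P.KB D →ₗ[P.Env] t.T.Y D := (P.koszulResolution t.koszul).π D

theorem π_surjective : Function.Surjective t.π := (P.koszulResolution t.koszul).π_surjective D

theorem ext_π {g h : t.T.Y D →ₗ[P.Env] M}
    (hgh : g (t.π (incl P.Env t.w)) = h (t.π (incl P.Env t.w))) : g = h := by
  refine LinearMap.ext fun y => ?_
  obtain ⟨F, rfl⟩ := t.π_surjective y
  exact LinearMap.congr_fun (ext_top t.eq_smul (g := g ∘ₗ t.π) (h := h ∘ₗ t.π) hgh) F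

theorem exists_topY (m : M) : ∃ h : t.T.Y D →ₗ[P.Env] M, h (t.π (incl P.Env t.w)) = m := by
  obtain ⟨h, hh⟩ := t.T.exists_descend (n := D) (topHom t.cw m) fun F => by
    rw [show t.T.d D F = 0 from (congrArg (t.T.d D) (show F = 0 from
      KB_eq_zero t.koszul t.dim (Nat.lt_succ_self D) F)).trans (map_zero _)]
    exact map_zero (topHom t.cw m)
  exact ⟨h, (hh _).trans (topHom_incl t.cw_w m)⟩

/-- The linear map on the last syzygy with a given value. -/
def topY (m : M) : t.T.Y D →ₗ[P.Env] M := (t.exists_topY m).choose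

theorem topY_w (m : M) : t.topY m (t.π (incl P.Env t.w)) = m := (t.exists_topY m).choose_spec

/-- The class in `HH^D(A, M)` of an element of `M`. -/
def χ (m : M) : HochschildCohomology k P.Alg M D := t.T.cl (n := D) (ModuleCat.ofHom (t.topY m))

theorem χ_add (m m' : M) : t.χ (m + m') = t.χ m + t.χ m' := by
  refine Eq.trans ?_ (t.T.cl_add (n := D) (ModuleCat.ofHom (t.topY m)) (ModuleCat.ofHom (t.topY m')))
  refine congrArg (t.T.cl (n := D)) (ModuleCat.hom_ext (t.ext_π ?_))
  exact (t.topY_w _).trans (congrArg₂ (· + ·) (t.topY_w m) (t.topY_w m')).symm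

theorem χ_smul (c : k) (m : M) : t.χ (algebraMap k P.Env c • m) = c • t.χ m := by
  refine Eq.trans ?_ (t.T.cl_smul (n := D) c (ModuleCat.ofHom (t.topY m)))
  refine congrArg (t.T.cl (n := D)) (ModuleCat.hom_ext (t.ext_π ?_))
  exact (t.topY_w _).trans (congrArg (algebraMap k P.Env c • ·) (t.topY_w m)).symm

theorem χ_surjective (x : HochschildCohomology k P.Alg M D) : ∃ m, t.χ m = x := by
  obtain ⟨f, rfl⟩ := t.T.exists_cl_ofHom D x
  exact ⟨f (t.π (incl P.Env t.w)), congrArg (fun f => t.T.cl (n := D) (ModuleCat.ofHom f))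
    (t.ext_π (t.topY_w (f (t.π (incl P.Env t.w)))))⟩

theorem χ_comp (f : M ⟶ M') (m : M) :
    (t.χ m).comp (Abelian.Ext.mk₀ f) (add_zero D) = t.χ (f.hom m) := by
  refine (t.T.cl_comp (n := D) (ModuleCat.ofHom (t.topY m)) f).symm.trans ?_
  refine congrArg (t.T.cl (n := D)) (ModuleCat.hom_ext (t.ext_π ?_))
  exact (congrArg f.hom (t.topY_w m)).trans (t.topY_w _).symm

theorem χ_eq_zero_iff_of_zero (hD : D = 0) (m : M) : t.χ m = 0 ↔ m = 0 := by
  subst hD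
  constructor
  · intro h
    have h0 := t.T.cl_ofHom_zero_eq_zero (f := t.topY m) h
    rw [← t.topY_w m, h0]
    rfl
  · rintro rfl
    have h := t.χ_smul 0 (0 : M)
    rwa [smul_zero, zero_smul] at h

end TopData

theorem TopData.χ_eq_zero_iff {d : ℕ} (t : TopData P (d + 1)) {M : ModuleCat.{u} P.Env} (m : M) :
    t.χ m = 0 ↔ ∃ g : P.KB d →ₗ[P.Env] M, g (P.dKB d (incl P.Env t.w)) = m := by
  refine (t.T.cl_ofHom_succ_eq_zero_iff (t.topY m)).trans ?_
  constructor
  · rintro ⟨g, hg⟩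
    refine ⟨g, ?_⟩
    rw [← t.topY_w m, ← hg]
    exact congrArg g ((P.koszulResolution t.koszul).ι_π d _).symm
  · rintro ⟨g, hg⟩
    refine ⟨g, fun y => ?_⟩
    have h : g ∘ₗ (P.koszulResolution t.koszul).ι d = t.topY m := t.ext_π (by
      rw [t.topY_w, ← hg]
      exact congrArg g ((P.koszulResolution t.koszul).ι_π d _))
    exact LinearMap.congr_fun h y

end HomogeneousRelations

namespace HomogeneousRelations

open Words

variable {k V : Type u} [Field k] [AddCommGroup V] [Module k V] [FiniteDimensional k V]
  {P : HomogeneousRelations k V} {D : ℕ}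

/-! ## Commutators -/

/-- The commutator of a generator of `A` and an element of a bimodule, twisted by `σ`. -/
def twistComm (σ : P.Alg → P.Alg) {M : Type*} [AddCommGroup M] [Module P.Env M] (i : Letter k V)
    (m : M) : M := (σ (P.x i) ⊗ₜ[k] (1 : P.Algᵐᵒᵖ) : P.Env) • m - P.fB i • m

/-- The identity [ab, m] = [a, bm] + [b, ma] reduces commutators with words to commutators with
letters. -/
theorem mem_commutatorSubspace_iff (Z : ModuleCat.{u} P.Env) (z : Z) :
    z ∈ commutatorSubspace Z ↔ ∃ m : Letter k V → Z, z = ∑ i, twistComm (P := P) (fun a => a) i (m i) := by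
  have hx : ∀ i (m : Z), twistComm (P := P) (fun a => a) i m ∈ commutatorSubspace Z := fun i m =>
    Submodule.subset_span ⟨P.x i, m, rfl⟩
  constructor
  · let S : AddSubgroup Z :=
      { carrier := {z | ∃ m : Letter k V → Z, z = ∑ i, twistComm (P := P) (fun a => a) i (m i)}
        zero_mem' := ⟨0, by simp [twistComm]⟩
        add_mem' := by
          rintro _ _ ⟨m, rfl⟩ ⟨m', rfl⟩
          refine ⟨m + m', ?_⟩
          rw [← Finset.sum_add_distrib]
          exact Finset.sum_congr rfl fun i _ => by
            simp only [twistComm, Pi.add_apply, smul_add]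
            abel
        neg_mem' := by
          rintro _ ⟨m, rfl⟩
          refine ⟨-m, ?_⟩
          rw [← Finset.sum_neg_distrib]
          exact Finset.sum_congr rfl fun i _ => by
            simp only [twistComm, Pi.neg_apply, smul_neg]
            abel }
    have hgen : ∀ i m, twistComm (P := P) (fun a => a) i m ∈ S := fun i m => by
      classical
      refine ⟨Pi.single i m, ?_⟩
      rw [Finset.sum_eq_single i, Pi.single_eq_same]
      · intro j _ hj
        rw [Pi.single_eq_of_ne hj]
        simp [twistComm]
      · simp
    have hc : ∀ (c : k) (m : Z), c • m = algebraMap k P.Env c • m := fun c m =>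
      (algebraMap_smul P.Env c m).symm
    have hS : ∀ (c : k) z, z ∈ S → c • z ∈ S := by
      rintro c _ ⟨m, rfl⟩
      refine ⟨fun i => c • m i, ?_⟩
      rw [Finset.smul_sum]
      exact Finset.sum_congr rfl fun i _ => by
        rw [twistComm, twistComm, smul_sub, smul_comm c, smul_comm c]
    have key : ∀ (a : P.Alg) (m : Z), (a ⊗ₜ[k] (1 : P.Algᵐᵒᵖ) : P.Env) • m -
        ((1 : P.Alg) ⊗ₜ[k] op a : P.Env) • m ∈ S := by
      intro a
      induction a using P.alg_induction with
      | hm u =>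
        induction u with
        | nil =>
          intro m
          rw [mon_nil, op_one, sub_self]
          exact S.zero_mem
        | cons i u ih =>
          intro m
          have h1 : (mon P.x (i :: u) ⊗ₜ[k] (1 : P.Algᵐᵒᵖ) : P.Env) =
              (P.x i ⊗ₜ 1) * (mon P.x u ⊗ₜ 1) := by
            rw [Algebra.TensorProduct.tmul_mul_tmul, mon_cons, one_mul]
          have h2 : ((1 : P.Alg) ⊗ₜ[k] op (mon P.x (i :: u)) : P.Env) =
              (1 ⊗ₜ op (mon P.x u)) * (1 ⊗ₜ op (P.x i)) := by
            rw [Algebra.TensorProduct.tmul_mul_tmul, mon_cons, one_mul, op_mul]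
          have h3 : (P.fB i : P.Env) * (mon P.x u ⊗ₜ 1) = (mon P.x u ⊗ₜ 1) * (1 ⊗ₜ op (P.x i)) := by
            rw [fB, Algebra.TensorProduct.tmul_mul_tmul, Algebra.TensorProduct.tmul_mul_tmul,
              one_mul, mul_one, one_mul, mul_one]
          have h4 := S.add_mem (hgen i ((mon P.x u ⊗ₜ[k] (1 : P.Algᵐᵒᵖ) : P.Env) • m))
            (ih (P.fB i • m))
          rw [h1, h2, mul_smul, mul_smul]
          rw [twistComm, ← mul_smul (P.fB i), h3, mul_smul] at h4
          convert h4 using 1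
          rw [fB]
          abel
      | ha a b ha hb =>
        intro m
        rw [TensorProduct.add_tmul, MulOpposite.op_add, TensorProduct.tmul_add, add_smul, add_smul,
          add_sub_add_comm]
        exact S.add_mem (ha m) (hb m)
      | hs c a ha =>
        intro m
        rw [op_smul, TensorProduct.tmul_smul, ← TensorProduct.smul_tmul', smul_assoc, smul_assoc,
          ← smul_sub]
        exact hS c _ (ha m)
    intro hz
    change z ∈ S
    induction hz using Submodule.span_induction with
    | mem z h =>
      obtain ⟨a, m, rfl⟩ := h
      exact key a m
    | zero => exact S.zero_mem
    | add z z' _ _ h h' => exact S.add_mem h h'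
    | smul c z _ h => exact hS c z h
  · rintro ⟨m, rfl⟩
    exact Submodule.sum_mem _ fun i _ => hx i _

/-- The gap is 1 when d is even, where the operator is L - R, or when N = 2, where for d odd the sum
is L + R. This is the source of the sign that ε^(D+1) absorbs. -/
theorem TB_of_gap {d : ℕ} (h : P.gap d = 1) : P.TB d = dL P.eB - (-1 : k) ^ d • dR P.fB := by
  unfold TB
  unfold gap at h
  rcases Nat.mod_two_eq_zero_or_one d with hd | hd
  · rw [if_pos hd, (Nat.even_iff.2 hd).neg_one_pow, one_smul]
  · rw [if_neg (by omega)] at h ⊢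
    have hN : P.N = 2 := by have := P.two_le; omega
    have h1 : (-1 : k) • dR P.fB = -dR P.fB :=
      LinearMap.ext fun F => by
        rw [LinearMap.smul_apply, LinearMap.neg_apply]
        exact neg_one_smul k (dR P.fB F)
    rw [hN, (Nat.odd_iff.2 hd).neg_one_pow, h1]
    refine Eq.trans ?_ (sub_neg_eq_add (dL P.eB) (dR P.fB)).symm
    rw [Finset.sum_range_succ, Finset.sum_range_one]
    simp [add_comm]

theorem ε_pow_ι (n : ℕ) (v : V) : (P.ε ^ n) (P.ι v) = (-1 : k) ^ n • P.ι v := by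
  have h1 : ∀ v, P.ε (P.ι v) = -P.ι v := P.signHom_ι
  induction n with
  | zero => rw [pow_zero, pow_zero, one_smul]; rfl
  | succ n ih =>
    rw [pow_succ', AlgEquiv.mul_apply, ih, map_smul, h1, pow_succ, mul_neg_one, neg_smul, smul_neg]

/-- The image under the differential of the generator. -/
theorem dKB_top {d : ℕ} (h : P.gap d = 1) (w : P.W k k (P.jump (d + 1))) {φ₁ : V →ₗ[k] V}
    (hrot : Rotates w.1 φ₁ (P.jump (d + 1))) {φ : P.Alg ≃ₐ[k] P.Alg}
    (hφ : ∀ v, φ (P.ι v) = P.ι (φ₁ v)) (S : Letter k V → P.W k k (P.jump d))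
    (hS : ∀ i u, (S i).1 u = w.1 (u ++ [i])) :
    P.dKB d (incl P.Env w) = (-1 : k) ^ d •
      ∑ i, twistComm ⇑(P.ε ^ (d + 1 + 1) * φ) i (incl P.Env (S i)) := by
  have hj := P.jump_succ d
  rw [h] at hj
  -- With D = d + 1 the power of ε contributes (-1)^(d+2) = (-1)^d on generators. The global factor
  -- (-1)^d cancels it on the left action and leaves it on the right action, as in the formula for
  -- the differential.
  have hε : ∀ i, (P.ε ^ (d + 1 + 1) * φ) (P.x i) = (-1 : k) ^ d • ∑ j, coeffV φ₁ j i • P.x j := by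
    intro i
    rw [AlgEquiv.mul_apply, x, hφ, ε_pow_ι, ι_basis, pow_add, pow_add]
    simp
  refine Subtype.ext (funext fun u => ?_)
  rw [dKB_coe, TB_of_gap h, LinearMap.sub_apply, LinearMap.smul_apply, Pi.sub_apply, Pi.smul_apply,
    dL_apply, dR_apply]
  have hR : ∀ i, (incl P.Env w).1 (u ++ [i]) * P.fB i =
      P.fB i * algebraMap k P.Env ((S i).1 u) := fun i => by
    rw [hS, ← Algebra.commutes]
    rfl
  have hL : ∀ i, (incl P.Env w).1 (i :: u) * P.eB i =
      ∑ j, (coeffV φ₁ i j • P.eB i) * algebraMap k P.Env ((S j).1 u) := fun i => by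
    change algebraMap k P.Env (w.1 (i :: u)) * _ = _
    -- Rotation invariance expresses the first letter of w through φ_1 and its last letter, so that
    -- left and right terms involve the same slices of w. For words of the wrong length both sides
    -- vanish.
    have h1 : w.1 (i :: u) = ∑ j, coeffV φ₁ i j * w.1 (u ++ [j]) := by
      by_cases hu : u.length + 1 = P.jump (d + 1)
      · exact hrot i u hu
      · rw [w.2.1 _ (by rwa [List.length_cons])]
        exact (Finset.sum_eq_zero fun j _ => by
          rw [w.2.1 _ (by rwa [List.length_append]), mul_zero]).symm
    rw [h1, map_sum, Finset.sum_mul]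
    exact Finset.sum_congr rfl fun j _ => by
      rw [hS, map_mul, mul_assoc, Algebra.commutes (w.1 _), ← Algebra.smul_def, smul_mul_assoc]
  simp only [hR, hL]
  rw [Finset.sum_comm]
  change _ = (-1 : k) ^ d • (∑ i, twistComm ⇑(P.ε ^ (d + 1 + 1) * φ) i (incl P.Env (S i))).1 u
  rw [AddSubmonoidClass.coe_finsetSum, Finset.sum_apply, Finset.smul_sum, Finset.smul_sum,
    ← Finset.sum_sub_distrib]
  refine Finset.sum_congr rfl fun i _ => ?_
  change _ = (-1 : k) ^ d • (((P.ε ^ (d + 1 + 1) * φ) (P.x i) ⊗ₜ[k] (1 : P.Algᵐᵒᵖ) : P.Env) *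
    algebraMap k P.Env ((S i).1 u) - P.fB i * algebraMap k P.Env ((S i).1 u))
  rw [hε, smul_sub, ← TensorProduct.smul_tmul', smul_mul_assoc, smul_smul, ← mul_pow, neg_one_mul, neg_neg, one_pow, one_smul, TensorProduct.sum_tmul, Finset.sum_mul]
  rfl

end HomogeneousRelations

/-! ### Hochschild cohomology in degree D as a quotient by twisted commutators. -/

namespace HomogeneousRelations

open Words

variable {k V : Type u} [Field k] [AddCommGroup V] [Module k V] [FiniteDimensional k V]
  {P : HomogeneousRelations k V} {D : ℕ}

/-- The contraction of the last letter. -/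
def contractLast {n m : ℕ} (hn : n + 1 = m) (w : P.W k k m) : Module.Dual k V →ₗ[k] P.W k k n where
  toFun α := ⟨contract 1 (wordForm α) w.1, contract_mem hn _ w.2⟩
  map_add' α β := Subtype.ext (funext fun u => by
    change contract 1 (wordForm (α + β)) w.1 u =
      contract 1 (wordForm α) w.1 u + contract 1 (wordForm β) w.1 u
    simp only [contract_one_wordForm, ← Finset.sum_add_distrib, ← add_smul]
    rfl)
  map_smul' c α := Subtype.ext (funext fun u => by
    change contract 1 (wordForm (c • α)) w.1 u = c • contract 1 (wordForm α) w.1 u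
    simp only [contract_one_wordForm, Finset.smul_sum, ← smul_assoc]
    rfl)

/-- Nondegeneracy of contraction with w in degree one, together with V^* = Ext^1(k,k). -/
theorem contractLast_injective {d : ℕ} (hK : P.IsKoszul) (hG : P.IsASGorenstein (d + 1))
    (w : P.W k k (P.jump (d + 1))) (hw : ∀ x ∈ P.W k k (P.jump (d + 1)), ∃ c : k, x = c • w.1)
    (hn : P.jump d + 1 = P.jump (d + 1)) : Function.Injective (contractLast hn w) := by
  refine (injective_iff_map_eq_zero _).2 fun α hα => (P.dualToExtLinear_bijective hK).1 ?_
  rw [map_zero]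
  change P.dualToExt α = 0
  rw [dualToExt_eq_cls P hK, cls_eq_zero_iff]
  refine contract_injective hK hG hw (j := d) (add_comm 1 d) ?_
  rw [jump_one]
  exact congrArg Subtype.val hα

theorem contractLast_coord {n m : ℕ} (hn : n + 1 = m) (w : P.W k k m) (i : Letter k V)
    (u : List (Letter k V)) :
    (contractLast hn w ((basisV k V).coord i)).1 u = w.1 (u ++ [i]) := by
  change contract 1 (wordForm _) w.1 u = _
  have h3 : ∀ j, (basisV k V).coord i (basisV k V j) = if j = i then 1 else 0 := fun j => by
    rw [Module.Basis.coord_apply, Module.Basis.repr_self, Finsupp.single_apply]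
  simp only [contract_one_wordForm, h3, ite_smul, one_smul, zero_smul, Finset.sum_ite_eq',
    Finset.mem_univ, if_true]

/-- W_1 is all of V, and W_{n(i)} vanishes for i above the global dimension. -/
theorem isEmpty_letter (hK : P.IsKoszul) (hdim : leftGlobalDimension P.Alg = ((0 : ℕ) : WithBot ℕ∞)) :
    IsEmpty (Letter k V) := by
  have h2 := P.two_le
  refine ⟨fun i => ?_⟩
  have h := W_eq_zero hK hdim zero_lt_one (x := Pi.single [i] (1 : k))
    ((mem_WS_of_lt (by rw [jump_one]; omega)).2 fun u hu => by
      rw [jump_one] at hu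
      refine Pi.single_eq_of_ne ?_ _
      rintro rfl
      exact hu rfl)
  have := congrFun h [i]
  rw [Pi.single_eq_same] at this
  exact one_ne_zero this

theorem twistComm_smul (σ : P.Alg → P.Alg) {M : Type*} [AddCommGroup M] [Module k M]
    [Module P.Env M] [IsScalarTower k P.Env M] (i : Letter k V) (c : k) (m : M) :
    twistComm (P := P) σ i (c • m) = c • twistComm (P := P) σ i m := by
  rw [twistComm, twistComm, smul_sub, ← algebraMap_smul P.Env c m, ← algebraMap_smul P.Env c,
    ← algebraMap_smul P.Env c, ← mul_smul, ← mul_smul, ← mul_smul, ← mul_smul,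
    ← Algebra.commutes c (P.fB i), ← Algebra.commutes c]

/-- Coboundaries are the values g(d w), that is, sums of twisted commutators with the elements
g(w_i), where the w_i are the slices of w by its last letter. The slices are linearly independent,
so the elements g(w_i) can be prescribed arbitrarily. If D = 0 then V = 0 and both conditions say m
= 0. -/
theorem TopData.χ_eq_zero_iff_twistComm (t : TopData P D) (hG : P.IsASGorenstein D)
    {φ₁ : V →ₗ[k] V} (hrot : Rotates t.w.1 φ₁ (P.jump D)) {φ : P.Alg ≃ₐ[k] P.Alg}
    (hφ : ∀ v, φ (P.ι v) = P.ι (φ₁ v)) {M : ModuleCat.{u} P.Env} (m : M) :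
    t.χ m = 0 ↔
      ∃ z : Letter k V → M, m = ∑ i, twistComm (P := P) ⇑(P.ε ^ (D + 1) * φ) i (z i) := by
  rcases D with _ | d
  · rw [t.χ_eq_zero_iff_of_zero rfl]
    have := isEmpty_letter t.koszul t.dim
    simp
  · have hgap := gap_of_top t.koszul t.dim hG rfl
    have hn : P.jump d + 1 = P.jump (d + 1) := by rw [P.jump_succ d, hgap]
    have htop := dKB_top hgap t.w hrot hφ (fun i => contractLast hn t.w ((basisV k V).coord i))
      (contractLast_coord hn t.w)
    have hsq : (-1 : k) ^ d * (-1) ^ d = 1 := by rw [← mul_pow, neg_one_mul, neg_neg, one_pow]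
    have hg : ∀ (g : P.KB d →ₗ[P.Env] M) (c : k) F, g (c • F) = c • g F := fun g c F => by
      rw [← algebraMap_smul P.Env c F, map_smul, algebraMap_smul]
    have hgt : ∀ (g : P.KB d →ₗ[P.Env] M) i F,
        g (twistComm (P := P) ⇑(P.ε ^ (d + 1 + 1) * φ) i F) =
          twistComm (P := P) ⇑(P.ε ^ (d + 1 + 1) * φ) i (g F) := fun g i F => by
      rw [twistComm, twistComm, map_sub, map_smul, map_smul]
    rw [t.χ_eq_zero_iff]
    constructor
    · rintro ⟨g, rfl⟩
      refine ⟨fun i => (-1 : k) ^ d •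
        g (incl P.Env (contractLast hn t.w ((basisV k V).coord i))), ?_⟩
      rw [htop, hg, map_sum, Finset.smul_sum]
      exact Finset.sum_congr rfl fun i _ => by rw [hgt, twistComm_smul]
    · rintro ⟨z, rfl⟩
      obtain ⟨ρ, hρ⟩ := LinearMap.exists_leftInverse_of_injective (contractLast hn t.w)
        (LinearMap.ker_eq_bot.2 (contractLast_injective t.koszul hG t.w
          (fun x hx => ⟨t.cw ⟨x, hx⟩, congrArg Subtype.val (t.eq_smul ⟨x, hx⟩)⟩) hn))
      let s : P.W k k (P.jump d) →ₗ[k] M :=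
        ∑ j, (LinearMap.applyₗ (basisV k V j) ∘ₗ ρ).smulRight ((-1 : k) ^ d • z j)
      have hs : ∀ i, s (contractLast hn t.w ((basisV k V).coord i)) = (-1 : k) ^ d • z i := by
        intro i
        have h1 : ρ (contractLast hn t.w ((basisV k V).coord i)) = (basisV k V).coord i :=
          LinearMap.congr_fun hρ _
        rw [LinearMap.sum_apply]
        simp only [LinearMap.smulRight_apply, LinearMap.comp_apply, h1, LinearMap.applyₗ_apply_apply,
          Module.Basis.coord_apply, Module.Basis.repr_self, Finsupp.single_apply, ite_smul,
          one_smul, zero_smul, Finset.sum_ite_eq', Finset.mem_univ, if_true]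
      refine ⟨extend P.Env s, ?_⟩
      rw [htop, hg, map_sum, Finset.smul_sum]
      exact Finset.sum_congr rfl fun i _ => by
        rw [hgt, extend_incl, hs, twistComm_smul, smul_smul, hsq, one_smul]

end HomogeneousRelations

/-! ### Homology of the complex obtained by applying Ext^D to a resolution. -/

open Abelian

/-- The map β has the boundaries as kernel, and the cycles are the preimage under β of the image of
A, which is contained in the range of β. Hence cycles modulo boundaries are A. -/
theorem CategoryTheory.ShortComplex.nonempty_homology_linearEquiv {R : Type u} [Ring R]
    (S : ShortComplex (ModuleCat.{u} R)) {A B : Type u} [AddCommGroup A] [Module R A]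
    [AddCommGroup B] [Module R B] (β : S.X₂ →ₗ[R] B) (e : A →ₗ[R] B) (he : Function.Injective e)
    (hg : ∀ x, S.g.hom x = 0 ↔ ∃ a, e a = β x) (hβ : ∀ a, ∃ x, β x = e a)
    (hf : ∀ x, β x = 0 ↔ ∃ y, S.f.hom y = x) : Nonempty (S.homology ≃ₗ[R] A) := by
  let γ : LinearMap.ker S.g.hom →ₗ[R] A := (LinearEquiv.ofInjective e he).symm.toLinearMap ∘ₗ
    (β ∘ₗ Submodule.subtype _).codRestrict (LinearMap.range e) fun x => (hg x.1).1 x.2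
  have hγ : ∀ x, e (γ x) = β x.1 := fun x =>
    congrArg Subtype.val ((LinearEquiv.ofInjective e he).apply_symm_apply _)
  have hsurj : Function.Surjective γ := fun a => by
    obtain ⟨x, hx⟩ := hβ a
    exact ⟨⟨x, (hg x).2 ⟨a, hx.symm⟩⟩, he ((hγ _).trans hx)⟩
  have hker : LinearMap.range S.moduleCatToCycles = LinearMap.ker γ := by
    ext x
    rw [LinearMap.mem_ker, LinearMap.mem_range, ← map_eq_zero_iff e he, hγ, hf]
    exact ⟨fun ⟨y, hy⟩ => ⟨y, congrArg Subtype.val hy⟩, fun ⟨y, hy⟩ => ⟨y, Subtype.ext hy⟩⟩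
  exact ⟨S.moduleCatHomologyIso.toLinearEquiv.trans
    ((Submodule.quotEquivOfEq _ _ hker).trans (γ.quotKerEquivOfSurjective hsurj))⟩

theorem ChainComplex.nonempty_homology_zero_linearEquiv {R : Type u} [Ring R]
    (G : ChainComplex (ModuleCat.{u} R) ℕ) {A : Type u} [AddCommGroup A] [Module R A]
    (β : G.X 0 →ₗ[R] A) (hβ : Function.Surjective β)
    (hf : ∀ x, β x = 0 ↔ ∃ y, (G.d 1 0).hom y = x) : Nonempty (G.homology 0 ≃ₗ[R] A) := by
  have hd : G.d 0 ((ComplexShape.down ℕ).next 0) = 0 := G.shape _ _ (by simp)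
  obtain ⟨e⟩ := (G.sc' 1 0 ((ComplexShape.down ℕ).next 0)).nonempty_homology_linearEquiv
    β LinearMap.id Function.injective_id (fun x => ⟨fun _ => ⟨_, rfl⟩, fun _ => by
      change (G.d 0 _).hom x = 0
      rw [hd]
      rfl⟩) hβ hf
  exact ⟨(ShortComplex.homologyMapIso (G.isoSc' 1 0 _ (by simp) rfl)).toLinearEquiv.trans e⟩

theorem ChainComplex.nonempty_homology_succ_linearEquiv {R : Type u} [Ring R]
    (G : ChainComplex (ModuleCat.{u} R) ℕ) (n : ℕ) {A B : Type u} [AddCommGroup A] [Module R A]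
    [AddCommGroup B] [Module R B] (β : G.X (n + 1) →ₗ[R] B) (e : A →ₗ[R] B)
    (he : Function.Injective e) (hg : ∀ x, (G.d (n + 1) n).hom x = 0 ↔ ∃ a, e a = β x)
    (hβ : ∀ a, ∃ x, β x = e a) (hf : ∀ x, β x = 0 ↔ ∃ y, (G.d (n + 2) (n + 1)).hom y = x) :
    Nonempty (G.homology (n + 1) ≃ₗ[R] A) := by
  obtain ⟨e⟩ := (G.sc' (n + 2) (n + 1) n).nonempty_homology_linearEquiv β e he hg hβ hf
  exact ⟨(ShortComplex.homologyMapIso (G.isoSc' (n + 2) (n + 1) n (by simp)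
    (by simp))).toLinearEquiv.trans e⟩

namespace Syzygies

variable {C : Type u} [Category.{v} C] [Abelian C] [HasExt.{w} C] (T : Syzygies C)
  {k : Type t} [CommRing k] [Linear k C] (X : C)

/-- The composition with a morphism as a linear map on `Ext`. -/
def postcomp {Y Z : C} (f : Y ⟶ Z) (i : ℕ) : Ext.{w} X Y i →ₗ[k] Ext.{w} X Z i where
  toFun x := x.comp (Ext.mk₀ f) (add_zero i)
  map_add' _ _ := Ext.add_comp _ _ _ _
  map_smul' _ _ := Ext.smul_comp _ _ _ _

theorem postcomp_postcomp {Y Z W : C} (f : Y ⟶ Z) (g : Z ⟶ W) (i : ℕ) (x : Ext.{w} X Y i) :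
    postcomp (k := k) X g i (postcomp (k := k) X f i x) = postcomp (k := k) X (f ≫ g) i x := by
  change (x.comp (Ext.mk₀ f) (add_zero i)).comp (Ext.mk₀ g) (add_zero i) =
    x.comp (Ext.mk₀ (f ≫ g)) (add_zero i)
  rw [Ext.comp_assoc_of_third_deg_zero, Ext.mk₀_comp_mk₀]

/-- The connecting homomorphism. -/
def connecting (n i : ℕ) : Ext.{w} X (T.Y n) i →ₗ[k] Ext.{w} X (T.Y (n + 1)) (i + 1) where
  toFun x := x.comp (T.δ n) rfl
  map_add' _ _ := Ext.add_comp _ _ _ _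
  map_smul' _ _ := Ext.smul_comp _ _ _ _

variable {T X}

theorem connecting_injective {n i : ℕ} (h : Subsingleton (Ext.{w} X (T.K n) i)) :
    Function.Injective (T.connecting (k := k) X n i) := by
  refine (injective_iff_map_eq_zero _).2 fun x hx => ?_
  obtain ⟨y, rfl⟩ := Ext.covariant_sequence_exact₃ X (T.exact n) x rfl hx
  rw [Subsingleton.elim y 0, Ext.zero_comp]

theorem postcomp_i_eq_zero_iff {n i : ℕ} (x : Ext.{w} X (T.Y (n + 1)) (i + 1)) :
    postcomp (k := k) X (T.i n) (i + 1) x = 0 ↔ ∃ y, T.connecting (k := k) X n i y = x := by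
  constructor
  · intro h
    exact Ext.covariant_sequence_exact₁ X (T.exact n) x h rfl
  · rintro ⟨y, rfl⟩
    change (y.comp (T.exact n).extClass (rfl : i + 1 = i + 1)).comp (Ext.mk₀ (T.i n))
      (add_zero (i + 1)) = 0
    rw [Ext.comp_assoc_of_third_deg_zero, ShortComplex.ShortExact.extClass_comp, Ext.comp_zero]

theorem postcomp_π_eq_zero_iff {n i : ℕ} (x : Ext.{w} X (T.K n) i) :
    postcomp (k := k) X (T.π n) i x = 0 ↔ ∃ y, postcomp (k := k) X (T.i n) i y = x := by
  constructor
  · intro h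
    exact Ext.covariant_sequence_exact₂ X (T.exact n) x h
  · rintro ⟨y, rfl⟩
    rw [postcomp_postcomp, T.zero]
    change y.comp (Ext.mk₀ 0) (add_zero i) = 0
    rw [Ext.mk₀_zero, Ext.comp_zero]

theorem postcomp_π_surjective {n i : ℕ} (h : Subsingleton (Ext.{w} X (T.Y (n + 1)) (i + 1))) :
    Function.Surjective (postcomp (k := k) X (T.π n) i) := fun x =>
  Ext.covariant_sequence_exact₃ X (T.exact n) x rfl (Subsingleton.elim _ _)

theorem postcomp_i_injective_zero (n : ℕ) :
    Function.Injective (postcomp (k := k) X (T.i n) 0) := by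
  have : Mono (T.i n) := (T.exact n).mono_f
  exact Ext.postcomp_mk₀_injective_of_mono X (T.i n)

/-- Dimension shifting in the second variable: each connecting map lies between two groups Ext(X, K)
of degree less than D, which vanish. -/
theorem nonempty_ext_linearEquiv {D : ℕ}
    (h : ∀ i < D, ∀ n, Subsingleton (Ext.{w} X (T.K n) i)) (i m n : ℕ) (hin : i + n < D) :
    Nonempty (Ext.{w} X (T.Y m) i ≃ₗ[k] Ext.{w} X (T.Y (m + n)) (i + n)) := by
  induction n with
  | zero => exact ⟨LinearEquiv.refl _ _⟩
  | succ n ih =>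
    obtain ⟨e⟩ := ih (by omega)
    refine ⟨e.trans (LinearEquiv.ofBijective (T.connecting X (m + n) (i + n))
      ⟨connecting_injective (h _ (by omega) _), fun x => ?_⟩)⟩
    have := h (i + n + 1) (by omega) (m + n)
    exact (postcomp_i_eq_zero_iff (k := k) x).1 (Subsingleton.elim _ _)

end Syzygies

open Abelian

namespace Syzygies

variable {C : Type w} [Category.{v} C] [Abelian C] [HasExt.{u} C] {T : Syzygies C}
  {k : Type u} [CommRing k] [Linear k C] {X : C} {D : ℕ} {G : ChainComplex (ModuleCat.{u} k) ℕ}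

/-- The homology of the complex `Ext^D(X, K)`, where `K` is the resolution. -/
theorem nonempty_homology_linearEquiv_ext
    (h : ∀ i < D, ∀ n, Subsingleton (Ext.{u} X (T.K n) i))
    (h' : ∀ n, Subsingleton (Ext.{u} X (T.Y n) (D + 1)))
    (ψ : ∀ n, G.X n ≃ₗ[k] Ext.{u} X (T.K n) D)
    (hψ : ∀ n x, ψ n ((G.d (n + 1) n).hom x) =
      postcomp (k := k) X (T.π (n + 1) ≫ T.i n) D (ψ (n + 1) x)) :
    (∀ i j, i + j = D → Nonempty (G.homology j ≃ₗ[k] Ext.{u} X (T.Y 0) i)) ∧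
      ∀ j, D < j → Subsingleton (G.homology j) := by
  let β : ∀ n, G.X n →ₗ[k] Ext.{u} X (T.Y n) D := fun n =>
    postcomp (k := k) X (T.π n) D ∘ₗ (ψ n).toLinearMap
  have hβ : ∀ n, Function.Surjective (β n) := fun n =>
    (postcomp_π_surjective (k := k) (h' (n + 1))).comp (ψ n).surjective
  have hd : ∀ n x, ψ n ((G.d (n + 1) n).hom x) =
      postcomp (k := k) X (T.i n) D (β (n + 1) x) := fun n x => by
    rw [hψ, ← postcomp_postcomp]
    rfl
  have hf : ∀ n x, β n x = 0 ↔ ∃ y, (G.d (n + 1) n).hom y = x := fun n x => by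
    refine (postcomp_π_eq_zero_iff (k := k) (ψ n x)).trans ⟨?_, ?_⟩
    · rintro ⟨y, hy⟩
      obtain ⟨z, rfl⟩ := hβ (n + 1) y
      exact ⟨z, (ψ n).injective ((hd n z).trans hy)⟩
    · rintro ⟨y, rfl⟩
      exact ⟨β (n + 1) y, (hd n y).symm⟩
  have hg : ∀ n x, (G.d (n + 1) n).hom x = 0 ↔
      postcomp (k := k) X (T.i n) D (β (n + 1) x) = 0 := fun n x => by
    rw [← hd, LinearEquiv.map_eq_zero_iff]
  rcases D with _ | d
  · have hsub : ∀ n, Subsingleton (G.homology (n + 1)) := fun n => by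
      obtain ⟨e⟩ := G.nonempty_homology_succ_linearEquiv n (β (n + 1))
        (0 : PUnit.{u + 1} →ₗ[k] _) (Function.injective_of_subsingleton _) (fun x => by
          rw [hg, map_eq_zero_iff _ (postcomp_i_injective_zero n)]
          exact ⟨fun hx => ⟨0, hx.symm⟩, fun ⟨_, ha⟩ => ha.symm⟩)
        (fun _ => ⟨0, map_zero _⟩) (hf (n + 1))
      exact e.toEquiv.subsingleton
    refine ⟨fun i j hij => ?_, fun j hj => ?_⟩
    · obtain ⟨rfl, rfl⟩ : i = 0 ∧ j = 0 := by omega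
      exact G.nonempty_homology_zero_linearEquiv (β 0) (hβ 0) (hf 0)
    · obtain ⟨n, rfl⟩ : ∃ n, j = n + 1 := ⟨j - 1, by omega⟩
      exact hsub n
  -- The group Ext^D(X, Y_n) is the cokernel of the incoming differential. The kernel of its map to
  -- Ext^D(X, K_{n-1}) is the image of the connecting map from degree D - 1, which is injective.
  · have hs : ∀ n, Nonempty (G.homology (n + 1) ≃ₗ[k] Ext.{u} X (T.Y n) d) := fun n =>
      G.nonempty_homology_succ_linearEquiv n (β (n + 1)) (T.connecting (k := k) X n d)
        (connecting_injective (h d (Nat.lt_succ_self d) n))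
        (fun x => (hg n x).trans (postcomp_i_eq_zero_iff (k := k) _))
        (fun a => hβ (n + 1) _) (hf (n + 1))
    refine ⟨fun i j hij => ?_, fun j hj => ?_⟩
    · rcases j with _ | j
      · obtain rfl : i = d + 1 := by omega
        exact G.nonempty_homology_zero_linearEquiv (β 0) (hβ 0) (hf 0)
      · obtain ⟨e⟩ := hs j
        obtain rfl : d = i + j := by omega
        obtain ⟨e'⟩ := nonempty_ext_linearEquiv (T := T) (k := k) h i 0 j (by omega)
        have hj : T.Y (0 + j) = T.Y j := by rw [zero_add]
        rw [hj] at e'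
        exact ⟨e.trans e'.symm⟩
    -- Shifting all the way down reaches Ext^0(X, Y_{n+1}), which embeds into Ext^0(X, K_n) = 0. The
    -- index n + 1 guarantees that there is a term to embed into.
    · obtain ⟨n, rfl⟩ : ∃ n, j = n + 1 + d + 1 := ⟨j - (d + 2), by omega⟩
      obtain ⟨e⟩ := hs (n + 1 + d)
      obtain ⟨e'⟩ := nonempty_ext_linearEquiv (T := T) (k := k) h 0 (n + 1) d (by omega)
      rw [zero_add d] at e'
      have := h 0 (Nat.succ_pos d) n
      have := (postcomp_i_injective_zero (T := T) (k := k) (X := X) n).subsingleton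
      exact (e.trans e'.symm).toEquiv.subsingleton

end Syzygies

/-- A projective resolution of a module. -/
def CategoryTheory.ProjectiveResolution.toModuleResolution {S : Type u} [Ring S]
    {M : ModuleCat.{u} S} (R : ProjectiveResolution M) : ModuleResolution M where
  K n := R.complex.X n
  d n := (R.complex.d (n + 1) n).hom
  aug := (R.π.f 0).hom
  surjective := (ModuleCat.epi_iff_surjective (R.π.f 0)).1 inferInstance
  aug_d z := LinearMap.congr_fun (congrArg ModuleCat.Hom.hom R.complex_d_comp_π_f_zero) z
  d_d n z := LinearMap.congr_fun
    (congrArg ModuleCat.Hom.hom (R.complex.d_comp_d (n + 2) (n + 1) n)) z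
  exact_zero z h := (ShortComplex.moduleCat_exact_iff _).1 R.exact₀ z h
  exact_succ n z h := (ShortComplex.moduleCat_exact_iff _).1 (R.exact_succ n) z h
  projective n := R.projective n

/-! ## Duality -/

section Twist

variable {k A : Type u} [Field k] [Ring A] [Algebra k A] (σ : A ≃ₐ[k] A)

/-- The functor `M ↦ _σ M`. -/
abbrev leftTwistFunctor : ModuleCat.{u} (Enveloping k A) ⥤ ModuleCat.{u} (Enveloping k A) :=
  ModuleCat.restrictScalars
    (Algebra.TensorProduct.map (σ : A →ₐ[k] A) (AlgHom.id k Aᵐᵒᵖ)).toRingHom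

/-- Restriction along the automorphism σ ⊗ id. Being an equivalence, it carries a projective
resolution of M to one of the twisted M, and this computes the Hochschild homology. -/
instance : (leftTwistFunctor σ).IsEquivalence :=
  ModuleCat.restrictScalars_isEquivalence_of_ringEquiv
    (Algebra.TensorProduct.congr σ (AlgEquiv.refl : Aᵐᵒᵖ ≃ₐ[k] Aᵐᵒᵖ)).toRingEquiv

end Twist

namespace HomogeneousRelations

open Words Abelian

variable {k V : Type u} [Field k] [AddCommGroup V] [Module k V] [FiniteDimensional k V]
  {P : HomogeneousRelations k V} {D : ℕ}

namespace TopData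

variable (t : TopData P D) (σ : P.Alg ≃ₐ[k] P.Alg) (Z : ModuleCat.{u} P.Env)

/-- The map `χ` as a linear map on the twisted bimodule. -/
def χTwist : leftTwist σ Z →ₗ[k] HochschildCohomology k P.Alg Z D where
  toFun m := t.χ (M := Z) m
  map_add' m m' := t.χ_add (M := Z) m m'
  map_smul' c m := by
    refine Eq.trans (congrArg (t.χ (M := Z)) ?_) (t.χ_smul (M := Z) c m)
    change (Algebra.TensorProduct.map (σ : P.Alg →ₐ[k] P.Alg) (AlgHom.id k P.Algᵐᵒᵖ)
      (algebraMap k P.Env c)) • (show Z from m) = _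
    rw [AlgHom.commutes]

theorem ker_χTwist (h : ∀ m : Z, t.χ m = 0 ↔
      ∃ z : Letter k V → Z, m = ∑ i, twistComm (P := P) ⇑σ i (z i)) :
    commutatorSubspace (leftTwist σ Z) = LinearMap.ker (t.χTwist σ Z) := by
  ext m
  rw [mem_commutatorSubspace_iff]
  refine Iff.trans ?_ (h m).symm
  have key : ∀ i (z : Z), twistComm (P := P) (fun a => a) i (show leftTwist σ Z from z) =
      twistComm (P := P) ⇑σ i z := fun i z => by
    change (Algebra.TensorProduct.map (σ : P.Alg →ₐ[k] P.Alg) (AlgHom.id k P.Algᵐᵒᵖ)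
      (P.x i ⊗ₜ 1)) • z - (Algebra.TensorProduct.map (σ : P.Alg →ₐ[k] P.Alg)
      (AlgHom.id k P.Algᵐᵒᵖ) (P.fB i)) • z = _
    rw [fB, Algebra.TensorProduct.map_tmul, Algebra.TensorProduct.map_tmul, map_one, map_one]
    rfl
  constructor
  · rintro ⟨z, hz⟩
    exact ⟨z, hz.trans (Finset.sum_congr rfl fun i _ => key i (z i))⟩
  · rintro ⟨z, hz⟩
    exact ⟨z, hz.trans (Finset.sum_congr rfl fun i _ => (key i (z i)).symm)⟩

/-- The duality in the top degree. -/
def dual (h : ∀ m : Z, t.χ m = 0 ↔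
      ∃ z : Letter k V → Z, m = ∑ i, twistComm (P := P) ⇑σ i (z i)) :
    (commutatorQuotient k P.Alg).obj (leftTwist σ Z) ≃ₗ[k] HochschildCohomology k P.Alg Z D :=
  (Submodule.quotEquivOfEq _ _ (t.ker_χTwist σ Z h)).trans
    ((t.χTwist σ Z).quotKerEquivOfSurjective fun x => t.χ_surjective x)

end TopData

/-- For a projective resolution Q of M, the classes χ identify HH_0 of the twisted Q_n with HH^D(A,
Q_n), compatibly with the differentials by `χ_comp`. The homology of the first complex is the
Hochschild homology of the twisted M; that of the second is found by dimension shifting. -/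
theorem hochschild_duality (hK : P.IsKoszul) (hdim : leftGlobalDimension P.Alg = (D : WithBot ℕ∞))
    (hG : P.IsASGorenstein D) {ν : P.E ≃ₐ[k] P.E} (hν : IsNakayamaAutomorphism P.trivialModule D ν)
    {φ : P.Alg ≃ₐ[k] P.Alg} (hφ : P.IsTransposeInDegreeOne φ ν) (M : ModuleCat.{u} P.Env) :
    (∀ i j : ℕ, i + j = D → Nonempty (HochschildHomology k P.Alg (leftTwist (P.ε ^ (D + 1) * φ) M) j
      ≃ₗ[k] HochschildCohomology k P.Alg M i)) ∧
    ∀ j : ℕ, D < j →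
      Subsingleton (HochschildHomology k P.Alg (leftTwist (P.ε ^ (D + 1) * φ) M) j) := by
  obtain ⟨w, hw, hw0, hwD⟩ := exists_generator hK hdim hG
  obtain ⟨φ₁, hφι, hφν⟩ := hφ
  have hrot := P.rotates hK hdim hG hw hw0 hwD hν hφν
  obtain ⟨cw, hcw, hcw'⟩ := exists_topForm (P := P) (w := ⟨w, hw⟩)
    (fun h => hw0 (congrArg Subtype.val h)) hwD
  let t : TopData P D := ⟨hK, hdim, ⟨w, hw⟩, cw, hcw, hcw'⟩
  have hχ : ∀ (Z : ModuleCat.{u} P.Env) (m : Z), t.χ m = 0 ↔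
      ∃ z : Letter k V → Z, m = ∑ i, twistComm (P := P) ⇑(P.ε ^ (D + 1) * φ) i (z i) :=
    fun Z m => t.χ_eq_zero_iff_twistComm hG hrot hφι m
  -- From here on the automorphism matters only through the twisted commutators that describe the
  -- kernel of χ.
  generalize P.ε ^ (D + 1) * φ = σ at hχ ⊢
  let R := ProjectiveResolution.of M
  let R' := (leftTwistFunctor σ).mapProjectiveResolution R
  let G := ((commutatorQuotient k P.Alg).mapHomologicalComplex _).obj R'.complex
  let T := R.toModuleResolution.syzygies
  have hT : ∀ n, T.π (n + 1) ≫ T.i n = R.complex.d (n + 1) n := fun n =>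
    ModuleCat.hom_ext (R.toModuleResolution.syzygies_d n)
  have hiso : ∀ j, HochschildHomology k P.Alg (leftTwist σ M) j ≃ₗ[k] G.homology j := fun j =>
    (R'.isoLeftDerivedObj (commutatorQuotient k P.Alg) j).toLinearEquiv
  have hhom := Syzygies.nonempty_homology_linearEquiv_ext (T := T) (G := G) (k := k)
    (X := regularBimodule k P.Alg) (D := D)
    (fun i hi n => by
      have : Projective (T.K n) := T.proj n
      exact subsingleton_ext_projective hK hG hi (T.K n))
    (fun n => subsingleton_hochschildCohomology hK hdim (Nat.lt_succ_self D) (T.Y n))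
    (fun n => t.dual σ (R.complex.X n) (hχ _)) (fun n x => by
      obtain ⟨x, rfl⟩ := Submodule.Quotient.mk_surjective _ x
      rw [hT]
      exact (t.χ_comp (R.complex.d (n + 1) n) x).symm)
  refine ⟨fun i j hij => ?_, fun j hj => ?_⟩
  · obtain ⟨e⟩ := hhom.1 i j hij
    exact ⟨(hiso j).trans e⟩
  · have := hhom.2 j hj
    exact (hiso j).toEquiv.subsingleton

end HomogeneousRelations

theorem theorem6p3 {k V : Type u} [Field k] [AddCommGroup V] [Module k V] [FiniteDimensional k V]
    (P : HomogeneousRelations k V) (D : ℕ) (hKoszul : P.IsKoszul)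
    (hdim : leftGlobalDimension P.Alg = (D : WithBot ℕ∞)) (hGor : P.IsASGorenstein D) :
    (∃! ν : P.E ≃ₐ[k] P.E, IsNakayamaAutomorphism P.trivialModule D ν) ∧
    ∀ ν : P.E ≃ₐ[k] P.E, IsNakayamaAutomorphism P.trivialModule D ν →
      (∃! φ : P.Alg ≃ₐ[k] P.Alg, P.IsTransposeInDegreeOne φ ν) ∧
      ∀ φ : P.Alg ≃ₐ[k] P.Alg, P.IsTransposeInDegreeOne φ ν →
        ∀ M : ModuleCat.{u} (Enveloping k P.Alg),
          (∀ i j : ℕ, i + j = D →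
            Nonempty (HochschildCohomology k P.Alg M i ≃ₗ[k]
              HochschildHomology k P.Alg (leftTwist (P.ε ^ (D + 1) * φ) M) j)) ∧
          (∀ i : ℕ, D < i → Subsingleton (HochschildCohomology k P.Alg M i)) ∧
          (∀ j : ℕ, D < j →
            Subsingleton (HochschildHomology k P.Alg (leftTwist (P.ε ^ (D + 1) * φ) M) j)) := by
  obtain ⟨w, hw, hw0, hwD⟩ := HomogeneousRelations.exists_generator hKoszul hdim hGor
  obtain ⟨Φ, -⟩ := P.exists_frobeniusForm hKoszul hdim hGor hw hw0 hwD
  refine ⟨Φ.existsUnique_isNakayamaAutomorphism, fun ν hν =>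
    ⟨P.existsUnique_isTransposeInDegreeOne hKoszul hdim hGor hν, fun φ hφ M => ?_⟩⟩
  have h := HomogeneousRelations.hochschild_duality hKoszul hdim hGor hν hφ M
  exact ⟨fun i j hij => (h.1 i j hij).map LinearEquiv.symm, fun i hi =>
    HomogeneousRelations.subsingleton_hochschildCohomology hKoszul hdim hi M, h.2⟩

end
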